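/- **Setting.** Let $G$ be the (first) Grigorchuk group: the group of automorphisms of the infinite binary rooted tree $\{0,1\}^*$ generated by $a,b,c,d$, where $a$ exchanges the two subtrees of the root and, recursively, $b=(a,c)$, $c=(a,d)$, $d=(1,b)$. Let $\Sigma$ be a finite symmetric generating set of $G$, i.e. a finite set of letters with a map $\Sigma\to G$ (not necessarily injective) whose image generates $G$ and is closed under inverses. A *neutral letter* is an $e\in\Sigma$ that is mapped to $1$. The *word problem* $\mathrm{WP}(G)$ asks whether a given word $w\in\Sigma^*$ satisfies $w=_G1$. A *power word* is a tuple $(u_1,x_1,\dots,u_n,x_n)$, $n\ge 0$, of words $u_i\in\Sigma^*$ and integers $x_i$, and the *power word problem* $\mathrm{PowWP}(G)$ asks whether $u_1^{x_1}\cdots u_n^{x_n}=_G1$. A power word is written as the string $u_1\,s_1\,b_1\cdots u_n\,s_n\,b_n$ over $\Sigma\sqcup\{+,-\}\sqcup\{0,1\}$, where $s_i$ is the sign of $x_i$ and $b_i$ is a binary representation of $|x_i|$, least significant bit first, possibly padded by zeros (an empty $b_i$ represents $0$). Both problems are regarded as languages over $\{0,1\}$: the letters of $\Sigma$ are encoded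 by an arbitrary injective map $\Sigma\to\{0,1\}^{\ell}$, and the letters of $\Sigma\sqcup\{+,-\}\sqcup\{0,1\}$ by an arbitrary injective map into $\{0,1\}^{k}$, with $\ell,k$ constant. A function $f:\{0,1\}^*\to\{0,1\}^*$ is $\mathsf{uAC}^0$-computable if it is computed by a family $(C_n)_{n\ge 0}$ of Boolean circuits ($C_n$ has $n$ inputs and an ordered list of output gates) of polynomial size and constant depth with *not*-gates and unbounded fan-in *and*- and *or*-gates, such that the family is DLOGTIME-uniform: the gates of $C_n$ are named by bit strings of length $O(\log n)$, and deterministic Turing machines that are given $n$ in binary compute, in time linear in the length of their input (so in time $O(\log n)$ on strings of length $O(\log n)$), the type of the gate named by a given string (or that it names no gate), whether a given gate is the $i$-th input of another given gate, and whether a given gate is the $i$-th output gate ($i$ in binary). **Theorem.** 1. If $e\in\Sigma$ is a neutral letter, then $\mathrm{PowWP}(G)$ is $\mathsf{uAC}^0$-many-one reducible to $\mathrm{WP}(G)$: there is a $\mathsf{uAC}^0$-computable function $f$ with $x\in\mathrm{PowWP}(G)\iff f(x)\in\mathrm{WP}(G)$ for all $x\in\{0,1\}^*$. Moreover, $f$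 can be chosen such that there are a function $\kappa:\mathbb N\to\mathbb N$ and a polynomial $p$ with $2^{\kappa(m)}\le p(m)$ for all $m$ and the following property: $f$ maps the encoding of any power word $(u_1,x_1,\dots,u_n,x_n)$ to the encoding of a word that arises from $u_1^{r_1}\cdots u_n^{r_n}$ by inserting copies of $e$, where $r_i\in\{0,\dots,2^{\kappa(m)}-1\}$ is the residue of $x_i$ modulo $2^{\kappa(m)}$ and $m=\max_i|u_i|$ (with $m=0$ if $n=0$). 2. $\mathrm{PowWP}(G)$ is decidable in deterministic logarithmic space (for every $\Sigma$ as above, with or without a neutral letter). -/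

import Mathlib

/-! ## The first Grigorchuk group -/

/-- Automorphisms of the infinite binary rooted tree. The vertices are the finite words over
`Bool`, the root is the empty word, and `u` is an ancestor of `v` when `u` is a prefix of `v`. -/
abbrev BinaryTreeAut : Type :=
  (fun u v : List Bool => u <+: v) ≃r (fun u v : List Bool => u <+: v)

/-- Names of the four standard generators of the first Grigorchuk group. -/
inductive GrigGen where
  | a | b | c | d

/-- Action of the generators on the tree: `a` exchanges the two subtrees of the root, and
`b = (a, c)`, `c = (a, d)`, `d = (1, b)`. -/
def GrigGen.act : GrigGen → List Bool → List Bool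
  | _, [] => []
  | .a, x :: w => (!x) :: w
  | .b, false :: w => false :: GrigGen.act .a w
  | .b, true :: w => true :: GrigGen.act .c w
  | .c, false :: w => false :: GrigGen.act .a w
  | .c, true :: w => true :: GrigGen.act .d w
  | .d, false :: w => false :: w
  | .d, true :: w => true :: GrigGen.act .b w

theorem GrigGen.act_act (g : GrigGen) (w : List Bool) : g.act (g.act w) = w := by
  induction w generalizing g with
  | nil => cases g <;> simp [GrigGen.act]
  | cons x w ih => cases g <;> cases x <;> simp [GrigGen.act, ih]

theorem GrigGen.act_prefix (g : GrigGen) (u v : List Bool) (h : u <+: v) :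
    g.act u <+: g.act v := by
  induction u generalizing g v with
  | nil => cases g <;> simp [GrigGen.act]
  | cons x u ih =>
    cases v with
    | nil => simp at h
    | cons y v =>
      obtain ⟨rfl, hv⟩ := List.cons_prefix_cons.1 h
      cases g <;> cases x <;> simp [GrigGen.act, ih _ _ hv, hv]

/-- The generators as automorphisms of the binary rooted tree. -/
def GrigGen.toAut (g : GrigGen) : BinaryTreeAut where
  toFun := g.act
  invFun := g.act
  left_inv := g.act_act
  right_inv := g.act_act
  map_rel_iff' := by
    intro u v
    refine ⟨fun h => ?_, fun h => g.act_prefix u v h⟩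
    have := g.act_prefix _ _ h
    simpa [GrigGen.act_act] using this

/-- The (first) Grigorchuk group. -/
def grigorchukGroup : Subgroup BinaryTreeAut :=
  Subgroup.closure (Set.range GrigGen.toAut)

/-! ## Words, power words, and their encodings -/

/-- The binary encoding of a word over an alphabet whose letters are encoded by blocks of
`l` bits. -/
def encodeWord {A : Type*} {l : ℕ} (enc : A → Fin l → Bool) (w : List A) : List Bool :=
  w.flatMap fun s => List.ofFn (enc s)

/-- One factor `u ^ x` of a power word: the word `u`, the sign of the exponent (`true` for a
minus sign), and the binary digits of its absolute value, least significant digit first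
(padding by zeros is allowed). -/
structure PowerFactor (S : Type*) where
  base : List S
  neg : Bool
  digits : List Bool

/-- The absolute value of the exponent of a factor. -/
def PowerFactor.absExponent {S : Type*} (q : PowerFactor S) : ℕ :=
  Nat.ofDigits 2 (q.digits.map Bool.toNat)

/-- The exponent of a factor. -/
def PowerFactor.exponent {S : Type*} (q : PowerFactor S) : ℤ :=
  if q.neg then -(q.absExponent : ℤ) else (q.absExponent : ℤ)

/-- The alphabet in which power words over `S` are written down. -/
inductive PowerSymbol (S : Type*) where
  | letter (s : S)
  | sign (neg : Bool)
  | digit (b : Bool)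

/-- A factor is written as its base word, then the sign, then the digits. -/
def PowerFactor.symbols {S : Type*} (q : PowerFactor S) : List (PowerSymbol S) :=
  q.base.map .letter ++ .sign q.neg :: q.digits.map .digit

/-- The sequence of symbols of a power word. -/
def powerWordSymbols {S : Type*} (P : List (PowerFactor S)) : List (PowerSymbol S) :=
  P.flatMap PowerFactor.symbols

/-- The group element `u₁ ^ x₁ * ⋯ * uₙ ^ xₙ` that a power word represents. -/
def powerWordValue {S G : Type*} [Group G] (val : S → G) (P : List (PowerFactor S)) : G :=
  (P.map fun q => (q.base.map val).prod ^ q.exponent).prod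

/-- The word problem, as a set of bit strings. -/
def WordProblem {S G : Type*} [Group G] (val : S → G) {l : ℕ} (enc : S → Fin l → Bool) :
    Set (List Bool) :=
  {x | ∃ w : List S, x = encodeWord enc w ∧ (w.map val).prod = 1}

/-- The power word problem, as a set of bit strings. -/
def PowerWordProblem {S G : Type*} [Group G] (val : S → G) {l : ℕ}
    (enc : PowerSymbol S → Fin l → Bool) : Set (List Bool) :=
  {x | ∃ P : List (PowerFactor S),
    x = encodeWord enc (powerWordSymbols P) ∧ powerWordValue val P = 1}

/-- The maximal length of the base words of a power word. -/
def maxBaseLength {S : Type*} (P : List (PowerFactor S)) : ℕ :=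
  (P.map fun q => q.base.length).foldr max 0

/-- The ordinary word `u₁ ^ r₁ ⋯ uₙ ^ rₙ`, where `rᵢ` with `0 ≤ rᵢ < M` is the residue of the
exponent `xᵢ` modulo `M`. -/
def reducedWord {S : Type*} (M : ℕ) (P : List (PowerFactor S)) : List S :=
  P.flatMap fun q => (List.replicate (q.exponent % (M : ℤ)).toNat q.base).flatten

/-- `IsPadding e v w`: the word `w` arises from `v` by inserting copies of the letter `e`. -/
inductive IsPadding {S : Type*} (e : S) : List S → List S → Prop
  | nil : IsPadding e [] []
  | cons (s : S) {v w : List S} : IsPadding e v w → IsPadding e (s :: v) (s :: w)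
  | pad {v w : List S} : IsPadding e v w → IsPadding e v (e :: w)

/-! ## Boolean circuits of unbounded fan-in -/

/-- The types of gates. -/
inductive GateKind where
  | input (i : ℕ)
  | not
  | and
  | or

/-- The value of a gate, given the circuit input `x` and the values at its incoming wires. -/
def GateKind.apply (x : List Bool) : GateKind → List Bool → Bool
  | .input i, _ => x.getD i false
  | .not, vs => !(vs.headD false)
  | .and, vs => vs.all id
  | .or, vs => vs.any id

/-- Boolean circuits with `n` input bits: finitely many gates, for every gate the ordered list
of the gates from which its incoming wires come, and an ordered list of output gates. The wires
form an acyclic graph. -/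
structure BoolCircuit (n : ℕ) where
  Gate : Type
  [gateFintype : Fintype Gate]
  kind : Gate → GateKind
  ins : Gate → List Gate
  outs : List Gate
  input_lt : ∀ g i, kind g = .input i → i < n
  input_ins : ∀ g i, kind g = .input i → ins g = []
  not_ins : ∀ g, kind g = .not → (ins g).length = 1
  acyclic : WellFounded fun u g => u ∈ ins g

namespace BoolCircuit

/-- The value computed at a gate on input `x`. -/
noncomputable def eval {n : ℕ} (C : BoolCircuit n) (x : List Bool) : C.Gate → Bool :=
  C.acyclic.fix fun g rec =>
    (C.kind g).apply x ((C.ins g).attach.map fun u => rec u.1 u.2)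

theorem eval_eq {n : ℕ} (C : BoolCircuit n) (x : List Bool) (g : C.Gate) :
    C.eval x g = (C.kind g).apply x ((C.ins g).map (C.eval x)) := by
  unfold eval
  rw [WellFounded.fix_eq]
  congr 1
  exact List.attach_map_val (l := C.ins g) (f := C.eval x)

/-- The output of the circuit on input `x`. -/
noncomputable def output {n : ℕ} (C : BoolCircuit n) (x : List Bool) : List Bool :=
  C.outs.map (C.eval x)

/-- The number of gates, wires and outputs. -/
def size {n : ℕ} (C : BoolCircuit n) : ℕ :=
  (letI := C.gateFintype; ∑ g : C.Gate, (1 + (C.ins g).length)) + C.outs.length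

/-- Every path in the circuit has at most `d` wires. -/
def DepthAtMost {n : ℕ} (C : BoolCircuit n) (d : ℕ) : Prop :=
  ∀ p : List C.Gate, p.IsChain (fun g u => g ∈ C.ins u) → p.length ≤ d + 1

end BoolCircuit

/-! ## DLOGTIME-uniformity and uniform AC⁰ -/

/-- A tuple of bit strings as one string over `{0, 1, #}`; every entry is followed by `#`. -/
def encodeTuple (t : List (List Bool)) : List (Option Bool) :=
  t.flatMap fun w => w.map some ++ [none]

/-- Gate types as bit strings, with the empty string for `not a gate`. -/
def GateKind.code : Option GateKind → List Bool
  | none => []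
  | some .not => [true]
  | some .and => [true, false]
  | some .or => [true, true]
  | some (.input i) => false :: i.bits

/-- `F` is computed, on tuples of bit strings, by a deterministic multi-stack Turing machine in
time linear in the length of the tuple. -/
def LinearTimeComputable (F : List (List Bool) → List Bool) : Prop :=
  ∃ M : Turing.TM2ComputableInTime encodeTuple (fun w : List Bool => w) F,
    ∃ c : ℕ, ∀ k, M.time k ≤ c * (k + 1)

/-- The decision version of `LinearTimeComputable`, for a relation on tuples. -/
def LinearTimeDecidable (R : List (List Bool) → Prop) : Prop :=
  ∃ F : List (List Bool) → List Bool, LinearTimeComputable F ∧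
    ∀ t, (R t → F t = [true]) ∧ (¬ R t → F t = [false])

/-- DLOGTIME-uniformity of a family of circuits. The gates of `C n` are named by bit strings of
length `O(log n)`, and deterministic Turing machines that are given `n` (in binary) together with
the strings in question decide the following in linear time, which is time `O(log n)` for strings
of length `O(log n)`:
* which type a string `u` has as a gate of `C n` (or that it does not name a gate);
* whether `u` is the `i`-th input gate of `v` in `C n`;
* whether `u` is the `i`-th output gate of `C n`.
The index `i` is given in binary and starts at `0`. -/
def DLogTimeUniform (C : ∀ n, BoolCircuit n) : Prop :=
  ∃ name : ∀ n, (C n).Gate → List Bool,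
    (∀ n, Function.Injective (name n)) ∧
    (∃ c : ℕ, ∀ n g, (name n g).length ≤ c * (Nat.size n + 1)) ∧
    (∃ T : List (List Bool) → Option GateKind,
      LinearTimeComputable (fun t => GateKind.code (T t)) ∧
      (∀ n g, T [n.bits, name n g] = some ((C n).kind g)) ∧
      ∀ n u, u ∉ Set.range (name n) → T [n.bits, u] = none) ∧
    LinearTimeDecidable (fun t => ∃ (n : ℕ) (g h : (C n).Gate) (i : ℕ),
      t = [n.bits, name n g, name n h, i.bits] ∧ ((C n).ins h)[i]? = some g) ∧
    LinearTimeDecidable (fun t => ∃ (n : ℕ) (g : (C n).Gate) (i : ℕ),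
      t = [n.bits, name n g, i.bits] ∧ (C n).outs[i]? = some g)

/-- `f` is computed by a DLOGTIME-uniform family of Boolean circuits of polynomial size and
constant depth, with `not`-gates and with `and`- and `or`-gates of unbounded fan-in. -/
def UniformAC0Computable (f : List Bool → List Bool) : Prop :=
  ∃ C : ∀ n, BoolCircuit n,
    DLogTimeUniform C ∧
    (∃ p : Polynomial ℕ, ∀ n, (C n).size ≤ p.eval n) ∧
    (∃ d : ℕ, ∀ n, (C n).DepthAtMost d) ∧
    ∀ x, (C x.length).output x = f x

/-- `f` is a uniform-AC⁰ many-one reduction from `L` to `K`. -/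
def IsUniformAC0Reduction (f : List Bool → List Bool) (L K : Set (List Bool)) : Prop :=
  UniformAC0Computable f ∧ ∀ x, x ∈ L ↔ f x ∈ K

/-! ## Deterministic logarithmic space -/

/-- What the input head of an off-line machine can see. -/
inductive InputSymbol where
  | leftEnd
  | bit (b : Bool)
  | rightEnd

/-- Head moves. -/
inductive HeadMove where
  | left
  | stay
  | right

/-- Deterministic Turing machines with a two-way read-only input tape, which carries a bit string
between two end markers, and finitely many two-way infinite work tapes. A transition either halts
with an answer (`Sum.inl`), or gives the new state, the move of the input head, and for each work
tape the symbol to be written and the move of its head. -/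
structure OfflineTM where
  State : Type
  Tape : Type
  Symb : Type
  [stateFinite : Finite State]
  [tapeFinite : Finite Tape]
  [symbFinite : Finite Symb]
  start : State
  blank : Symb
  trans : State → InputSymbol → (Tape → Symb) →
    Bool ⊕ (State × HeadMove × (Tape → Symb × HeadMove))

namespace OfflineTM

/-- Configurations. The input head is at a position from `0` (left end marker) to `n + 1` (right
end marker), where `n` is the length of the input. -/
structure Cfg (M : OfflineTM) where
  state : M.State
  inputPos : ℕ
  work : M.Tape → ℤ → M.Symb
  head : M.Tape → ℤ

/-- The symbol at a position of the input tape. -/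
def readInput (x : List Bool) : ℕ → InputSymbol
  | 0 => .leftEnd
  | i + 1 => match x[i]? with
    | some b => .bit b
    | none => .rightEnd

/-- The input head cannot leave the part of the tape between the end markers. -/
def moveInput (x : List Bool) (p : ℕ) : HeadMove → ℕ
  | .left => p - 1
  | .stay => p
  | .right => min (p + 1) (x.length + 1)

/-- Moves on a work tape. -/
def moveWork (p : ℤ) : HeadMove → ℤ
  | .left => p - 1
  | .stay => p
  | .right => p + 1

/-- The initial configuration: the input head is on the left end marker, the work tapes are
blank. -/
def initial (M : OfflineTM) : M.Cfg where
  state := M.start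
  inputPos := 0
  work := fun _ _ => M.blank
  head := fun _ => 0

/-- One step on input `x`: an answer, or the next configuration. -/
def step (M : OfflineTM) (x : List Bool) (c : M.Cfg) : Bool ⊕ M.Cfg :=
  match M.trans c.state (readInput x c.inputPos) (fun k => c.work k (c.head k)) with
  | .inl b => .inl b
  | .inr (q, m, a) => .inr
      { state := q
        inputPos := moveInput x c.inputPos m
        work := fun k => Function.update (c.work k) (c.head k) (a k).1
        head := fun k => moveWork (c.head k) (a k).2 }

/-- The configuration `c` occurs in the computation on input `x`. -/
def Reaches (M : OfflineTM) (x : List Bool) (c : M.Cfg) : Prop :=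
  Relation.ReflTransGen (fun c₁ c₂ => M.step x c₁ = .inr c₂) M.initial c

/-- The machine halts with answer `b` on input `x`. -/
def Answers (M : OfflineTM) (x : List Bool) (b : Bool) : Prop :=
  ∃ c, M.Reaches x c ∧ M.step x c = .inl b

/-- On input `x` all work heads stay within distance `s` of their initial position. -/
def SpaceAtMost (M : OfflineTM) (x : List Bool) (s : ℕ) : Prop :=
  ∀ c, M.Reaches x c → ∀ k, |c.head k| ≤ (s : ℤ)

end OfflineTM

/-- The language `L` is decidable in deterministic logarithmic space. -/
def InLogspace (L : Set (List Bool)) : Prop :=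
  ∃ M : OfflineTM,
    (∃ c : ℕ, ∀ x, M.SpaceAtMost x (c * (Nat.size x.length + 1))) ∧
    ∀ x, (x ∈ L → M.Answers x true) ∧ (x ∉ L → M.Answers x false)

/-! Both parts rest on two quantitative facts about $G$, each proved by passing from an element to
its sections at the two vertices of the first level.

Orders. Give the letters the weights in `Grig.genWeight`. Up to conjugacy, a nontrivial element is a
letter or a cyclic product of blocks $ay$ with $y\in\{b,c,d\}$, and each block weighs at least $6/5$
of the total weight of its two sections. If the number of blocks is even, the element fixes the
first level and its sections weigh at most $5/6$ of it. If the number is odd, the same bound holds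
for each section of its square. Thus one squaring is spent per factor $5/6$, and the order of an
element of length less than $2^i$ divides $2^{4i+1}$ (`Grig.wordPerm_pow_eq_one`).

Depth. The number of letters $a$ at least halves from a cyclic form of even length to its sections,
so an element with fewer than $2^j$ letters $a$ that fixes level $j+3$ pointwise is trivial
(`Grig.eq_one_of_level`).

For the reduction, exponents may be replaced by their residues modulo $2^\kappa$ with
$\kappa=c(\mathrm{size}(m)+1)$, which are polynomially bounded. Write $u^r=\prod_t u^{2^t}$ over the
binary digits $t$ of $r$ that are one. The output has one slot for every quadruple (sign position
$s$, digit index $t$, copy $r<2^t$, letter position $j$) in lexicographic order; a slot carries the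
letter at $j$ or the neutral letter. So the layout depends on the input length only, and the content
of a slot is a first-order property of the input (`exists_reduction`). The numerical atoms of the
formulas are relations on binary digits that synchronous finite automata recognise, together with
the number of ones of one variable. The latter gives access to $2^t$, since $m=2^t-1$ is
recognisable and has $t$ ones.

A formula unfolds into a circuit whose gates are pairs (subformula, valuation). When a gate is named
by the digits of its valuation, all questions of DLOGTIME-uniformity become automaton questions
about the names, and these are answered in linear time by an explicit multi-stack machine
(`Fml.uniformAC0Computable`).

For logarithmic space no neutral letter is needed. By the two facts, a power word is trivial if and
only if it fixes every vertex of a level of logarithmic depth. A vertex and an exponent modulo a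
power of two that kills all bases fit into logarithmically many cells, and a letter acts on a vertex
through a finite transducer. A machine that runs through all vertices and applies the power word to
each decides the problem (`PowProg.inLogspace`). -/

/-! ## Words over the standard generators -/

namespace Grig

/-- The Klein four-group of the elements `1, b, c, d`. -/
inductive K4 where
  | e | b | c | d

namespace K4

def word : K4 → List GrigGen
  | e => []
  | b => [.b]
  | c => [.c]
  | d => [.d]

def mul : K4 → K4 → K4
  | e, y => y
  | y, e => y
  | b, b => e
  | c, c => e
  | d, d => e
  | b, c => d
  | c, b => d
  | b, d => c
  | d, b => c
  | c, d => b
  | d, c => b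

/-- The section of an element at a vertex of the first level, as a word. -/
def sec : Bool → K4 → List GrigGen
  | _, e => []
  | false, b => [.a]
  | false, c => [.a]
  | false, d => []
  | true, b => [.c]
  | true, c => [.d]
  | true, d => [.b]

end K4

/-- A generator as a permutation of the vertices of the tree. -/
def genPerm (g : GrigGen) : Equiv.Perm (List Bool) := ⟨g.act, g.act, g.act_act, g.act_act⟩

/-- The permutation of the vertices given by a word. -/
def wordPerm (w : List GrigGen) : Equiv.Perm (List Bool) := (w.map genPerm).prod

@[simp] theorem wordPerm_nil : wordPerm [] = 1 := rfl

@[simp] theorem wordPerm_cons (g : GrigGen) (w : List GrigGen) :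
    wordPerm (g :: w) = genPerm g * wordPerm w := by simp [wordPerm]

theorem wordPerm_append (w w' : List GrigGen) :
    wordPerm (w ++ w') = wordPerm w * wordPerm w' := by simp [wordPerm]

theorem genPerm_apply (g : GrigGen) (v : List Bool) : genPerm g v = g.act v := rfl

theorem genPerm_mul_self (g : GrigGen) : genPerm g * genPerm g = 1 := by
  ext1 v; exact g.act_act v

theorem genPerm_inv (g : GrigGen) : (genPerm g)⁻¹ = genPerm g :=
  inv_eq_of_mul_eq_one_right (genPerm_mul_self g)

theorem wordPerm_reverse (w : List GrigGen) : wordPerm w.reverse = (wordPerm w)⁻¹ := by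
  induction w with
  | nil => simp
  | cons g w ih => simp [wordPerm_append, ih, genPerm_inv]

theorem length_act (g : GrigGen) (v : List Bool) : (g.act v).length = v.length := by
  induction v generalizing g with
  | nil => cases g <;> rfl
  | cons x v ih => cases g <;> cases x <;> simp [GrigGen.act, ih]

theorem length_wordPerm (w : List GrigGen) (v : List Bool) :
    (wordPerm w v).length = v.length := by
  induction w with
  | nil => rfl
  | cons g w ih => simp [genPerm_apply, length_act, ih]

theorem wordPerm_apply_nil (w : List GrigGen) : wordPerm w [] = [] := by
  simpa using length_wordPerm w []

/-- The six relations are proved together: the sections of each of them at the two children are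
relations $aa=1$, trivial identities, or relations of the same list. -/
theorem act_bcd (v : List Bool) :
    GrigGen.act .b (GrigGen.act .c v) = GrigGen.act .d v ∧
    GrigGen.act .c (GrigGen.act .d v) = GrigGen.act .b v ∧
    GrigGen.act .d (GrigGen.act .b v) = GrigGen.act .c v ∧
    GrigGen.act .c (GrigGen.act .b v) = GrigGen.act .d v ∧
    GrigGen.act .d (GrigGen.act .c v) = GrigGen.act .b v ∧
    GrigGen.act .b (GrigGen.act .d v) = GrigGen.act .c v := by
  induction v with
  | nil => simp [GrigGen.act]
  | cons x v ih => cases x <;> simp [GrigGen.act, ih, GrigGen.act_act]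

theorem wordPerm_mul (x y : K4) :
    wordPerm (x.mul y).word = wordPerm x.word * wordPerm y.word := by
  ext1 v
  have := act_bcd v
  cases x <;> cases y <;>
    simp [K4.mul, K4.word, genPerm_apply, GrigGen.act_act, this]

/-- The product of the elements `a * y` for `y` in a list. -/
def cyc (ys : List K4) : List GrigGen := ys.flatMap fun y => .a :: y.word

@[simp] theorem cyc_nil : cyc [] = [] := rfl

theorem cyc_cons (y : K4) (ys : List K4) : cyc (y :: ys) = .a :: (y.word ++ cyc ys) := by
  simp [cyc]

theorem cyc_append (ys zs : List K4) : cyc (ys ++ zs) = cyc ys ++ cyc zs := by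
  simp [cyc]

/-! ### Weights -/

/-- The values are tuned to two requirements. Each of $b,c,d$ weighs at most the sum of the other
two, so multiplication in the Klein group does not increase weight. The blocks $ab$, $ac$, $ad$ have
weights 107, 89, 74 and section weights 89, 74, 57, and $6\cdot 89\le 5\cdot 107$, $6\cdot 74\le
5\cdot 89$, $6\cdot 57\le 5\cdot 74$. -/
def genWeight : GrigGen → ℕ
  | .a => 50
  | .b => 57
  | .c => 39
  | .d => 24

def weight (w : List GrigGen) : ℕ := (w.map genWeight).sum

@[simp] theorem weight_nil : weight [] = 0 := rfl
@[simp] theorem weight_cons (g : GrigGen) (w : List GrigGen) :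
    weight (g :: w) = genWeight g + weight w := by simp [weight]
@[simp] theorem weight_append (w w' : List GrigGen) :
    weight (w ++ w') = weight w + weight w' := by simp [weight]

theorem weight_le (w : List GrigGen) : weight w ≤ 57 * w.length := by
  induction w with
  | nil => simp
  | cons g w ih =>
    have : genWeight g ≤ 57 := by cases g <;> simp [genWeight]
    simp; omega

theorem weight_mul (x y : K4) : weight (x.mul y).word ≤ weight x.word + weight y.word := by
  cases x <;> cases y <;> simp [K4.mul, K4.word, genWeight]

/-- The number of occurrences of `a` in a word. -/
def countA (w : List GrigGen) : ℕ :=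
  (w.map fun g => match g with
    | .a => 1
    | _ => 0).sum

@[simp] theorem countA_nil : countA [] = 0 := rfl
@[simp] theorem countA_cons (g : GrigGen) (w : List GrigGen) :
    countA (g :: w) = (match g with
      | .a => 1
      | _ => 0) + countA w := by simp [countA]
@[simp] theorem countA_append (w w' : List GrigGen) :
    countA (w ++ w') = countA w + countA w' := by simp [countA]

theorem countA_le (w : List GrigGen) : countA w ≤ w.length := by
  induction w with
  | nil => simp
  | cons g w ih => cases g <;> simp <;> omega

/-! ### Cyclic normal forms -/

/-- Conjugacy by an element of the group. -/
def ConjWord (g h : Equiv.Perm (List Bool)) : Prop :=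
  ∃ u, wordPerm u * g * (wordPerm u)⁻¹ = h

theorem ConjWord.refl (g : Equiv.Perm (List Bool)) : ConjWord g g := ⟨[], by simp⟩

theorem ConjWord.trans {g h k : Equiv.Perm (List Bool)} (h₁ : ConjWord g h)
    (h₂ : ConjWord h k) : ConjWord g k := by
  obtain ⟨u, rfl⟩ := h₁
  obtain ⟨v, rfl⟩ := h₂
  exact ⟨v ++ u, by simp [wordPerm_append, mul_assoc]⟩

theorem conjWord_swap (u v : List GrigGen) :
    ConjWord (wordPerm (u ++ v)) (wordPerm (v ++ u)) :=
  ⟨v, by simp [wordPerm_append, mul_assoc]⟩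

/-- Up to conjugation, an element is a letter or the product of a non-empty list of elements
`a * y` with `y ∈ {b, c, d}`. -/
def HasCycForm (g : Equiv.Perm (List Bool)) (A W : ℕ) : Prop :=
  ConjWord g (genPerm .a) ∨ (∃ y : K4, ConjWord g (wordPerm y.word)) ∨
    ∃ ys : List K4, ConjWord g (wordPerm (cyc ys)) ∧ ys ≠ [] ∧ (∀ y ∈ ys, y ≠ .e) ∧
      ys.length ≤ A ∧ weight (cyc ys) ≤ W

theorem HasCycForm.of_conj {g h : Equiv.Perm (List Bool)} {A A' W W' : ℕ} (hA : A ≤ A')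
    (hW : W ≤ W') (hc : ConjWord g h) (hh : HasCycForm h A W) : HasCycForm g A' W' := by
  rcases hh with h | ⟨y, h⟩ | ⟨ys, h, h1, h2, h3, h4⟩
  · exact .inl (hc.trans h)
  · exact .inr (.inl ⟨y, hc.trans h⟩)
  · exact .inr (.inr ⟨ys, hc.trans h, h1, h2, h3.trans hA, h4.trans hW⟩)

/-- A cyclic rotation carries the leading `y₀` to the end, where it is absorbed by the last block.
-/
theorem conjWord_merge (ys : List K4) (y y₀ : K4) :
    ConjWord (wordPerm (y₀.word ++ cyc (ys ++ [y]))) (wordPerm (cyc (ys ++ [y.mul y₀]))) := by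
  convert conjWord_swap y₀.word (cyc (ys ++ [y])) using 1
  simp [cyc_append, cyc_cons, wordPerm_append, wordPerm_mul]

/-- Cyclic reduction. A trivial entry makes two letters `a` cyclically adjacent; they cancel, and
the two neighbouring entries merge. Two blocks become superfluous, so induction on the number of
blocks applies. -/
theorem hasCycForm_cyc (n : ℕ) (ys : List K4) (hn : ys.length = n) (hne : ys ≠ []) :
    HasCycForm (wordPerm (cyc ys)) ys.length (weight (cyc ys)) := by
  induction n using Nat.strong_induction_on generalizing ys with
  | _ n ih =>
  by_cases hall : ∀ y ∈ ys, y ≠ .e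
  · exact .inr (.inr ⟨ys, .refl _, hne, hall, le_rfl, le_rfl⟩)
  push Not at hall
  obtain ⟨y, hy, rfl⟩ := hall
  obtain ⟨l, r, rfl⟩ := List.append_of_mem hy
  -- The trivial entry is rotated to the last place, so that the word ends with a bare `a`.
  have h1 : ConjWord (wordPerm (cyc (l ++ .e :: r))) (wordPerm (cyc ((r ++ l) ++ [.e]))) := by
    have := conjWord_swap (cyc (l ++ [.e])) (cyc r)
    rw [← cyc_append, ← cyc_append] at this
    simpa using this
  have hw : weight (cyc (l ++ .e :: r)) = weight (cyc (r ++ l)) + 50 := by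
    simp [cyc_append, cyc_cons, K4.word, genWeight]; omega
  have hl : (l ++ .e :: r).length = (r ++ l).length + 1 := by simp; omega
  rw [hw, hl]
  generalize r ++ l = zs at *
  rcases zs with _ | ⟨z, zs⟩
  · exact .inl (by simpa [cyc, K4.word] using h1)
  -- Conjugation by `a` cancels the first letter against the final one.
  have h2 : ConjWord (wordPerm (cyc ((z :: zs) ++ [.e]))) (wordPerm (z.word ++ cyc zs)) := by
    refine ⟨[.a], ?_⟩
    have := genPerm_mul_self .a
    have he : K4.e.word = [] := rfl
    simp only [cyc_append, cyc_cons, cyc_nil, wordPerm_append, wordPerm_cons, wordPerm_nil, he,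
      List.append_nil, mul_one, genPerm_inv]
    rw [← mul_assoc, ← mul_assoc, ← mul_assoc, this, one_mul, mul_assoc, this, mul_one]
  rcases List.eq_nil_or_concat zs with rfl | ⟨zs, z', rfl⟩
  · exact .inr (.inl ⟨z, by simpa [cyc] using h1.trans h2⟩)
  rw [List.concat_eq_append] at *
  refine .of_conj ?_ ?_ ((h1.trans h2).trans (conjWord_merge zs z' z))
    (ih (zs ++ [z'.mul z]).length ?_ _ rfl (by simp))
  · simp
  · have := weight_mul z' z
    simp [cyc_append, cyc_cons, genWeight] at *; omega
  · simp at *; omega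

/-- Adjacent letters of the Klein group are multiplied, which leaves `y₀` followed by blocks $ay$,
one for each letter `a`. The leading `y₀` is then merged cyclically and the result is reduced. -/
theorem hasCycForm (w : List GrigGen) : HasCycForm (wordPerm w) (countA w) (weight w) := by
  have key : ∃ y₀ : K4, ∃ ys, wordPerm w = wordPerm (y₀.word ++ cyc ys) ∧
      ys.length = countA w ∧ weight (y₀.word ++ cyc ys) ≤ weight w := by
    induction w with
    | nil => exact ⟨.e, [], by simp [K4.word, cyc]⟩
    | cons g w ih =>
      obtain ⟨y₀, ys, h1, h2, h3⟩ := ih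
      have step : ∀ x : K4, x.word = [g] → countA (g :: w) = countA w →
          ∃ y₀ : K4, ∃ ys, wordPerm (g :: w) = wordPerm (y₀.word ++ cyc ys) ∧
          ys.length = countA (g :: w) ∧ weight (y₀.word ++ cyc ys) ≤ weight (g :: w) := by
        intro x hx hg
        refine ⟨x.mul y₀, ys, ?_, by omega, ?_⟩
        · simp [wordPerm_append, wordPerm_mul, hx, h1, mul_assoc]
        · have := weight_mul x y₀
          simp [hx] at *; omega
      cases g with
      | a =>
        refine ⟨.e, y₀ :: ys, ?_, ?_, ?_⟩
        · simp [K4.word, cyc_cons, h1]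
        · simp [h2]; omega
        · simp [K4.word, cyc_cons] at *; omega
      | b => exact step .b rfl (by simp)
      | c => exact step .c rfl (by simp)
      | d => exact step .d rfl (by simp)
  obtain ⟨y₀, ys, h1, h2, h3⟩ := key
  rw [h1]
  rcases List.eq_nil_or_concat ys with rfl | ⟨zs, z, rfl⟩
  · exact .inr (.inl ⟨y₀, by simpa [cyc] using .refl _⟩)
  rw [List.concat_eq_append] at *
  refine .of_conj ?_ ?_ (conjWord_merge zs z y₀) (hasCycForm_cyc _ _ rfl (by simp))
  · simp at *; omega
  · have := weight_mul z y₀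
    simp [cyc_append, cyc_cons] at *; omega

/-! ### Sections -/

theorem word_apply (y : K4) (x : Bool) (v : List Bool) :
    wordPerm y.word (x :: v) = x :: wordPerm (y.sec x) v := by
  cases y <;> cases x <;> simp [K4.word, K4.sec, genPerm_apply, GrigGen.act]

/-- The section of `cyc ys` at the vertex that is mapped to `[o]`. -/
def secs : Bool → List K4 → List GrigGen
  | _, [] => []
  | o, y :: ys => y.sec (!o) ++ secs (!o) ys

/-- Each block flips the first coordinate exactly once, through its `a`. Indexing sections by the
image coordinate `o` allows blocks to be peeled off from the left, although the rightmost letter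
acts first. -/
theorem cyc_apply (ys : List K4) (o : Bool) (v : List Bool) :
    wordPerm (cyc ys) ((o ^^ decide (ys.length % 2 = 1)) :: v) = o :: wordPerm (secs o ys) v := by
  induction ys generalizing o with
  | nil => simp [cyc, secs]
  | cons y ys ih =>
    have h : (o ^^ decide ((y :: ys).length % 2 = 1)) =
        ((!o) ^^ decide (ys.length % 2 = 1)) := by
      rcases Nat.mod_two_eq_zero_or_one ys.length with h | h <;>
        simp [h, Nat.add_mod]
    rw [h, cyc_cons, wordPerm_cons, wordPerm_append, Equiv.Perm.mul_apply, Equiv.Perm.mul_apply,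
      ih, word_apply, genPerm_apply]
    simp [GrigGen.act, secs, wordPerm_append]

/-- The block inequalities behind `genWeight` add up: each block contributes one of its two sections
to `secs o` and the other to `secs (!o)`. -/
theorem weight_secs (ys : List K4) (hys : ∀ y ∈ ys, y ≠ .e) (o : Bool) :
    6 * (weight (secs o ys) + weight (secs (!o) ys)) ≤ 5 * weight (cyc ys) := by
  induction ys generalizing o with
  | nil => simp [secs]
  | cons y ys ih =>
    have h1 := ih (fun z hz => hys z (by simp [hz])) o
    have h2 := hys y (by simp)
    have h3 : 6 * (weight (y.sec o) + weight (y.sec (!o))) ≤ 5 * (50 + weight y.word) := by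
      cases y <;> cases o <;> simp [K4.sec, K4.word, genWeight] at *
    simp only [secs, weight_append, cyc_cons, weight_cons, Bool.not_not, genWeight]
    omega

theorem secs_append (ys zs : List K4) (o : Bool) :
    secs o (ys ++ zs) = secs o ys ++ secs (o ^^ decide (ys.length % 2 = 1)) zs := by
  induction ys generalizing o with
  | nil => simp [secs]
  | cons y ys ih =>
    have h : (o ^^ decide ((y :: ys).length % 2 = 1)) =
        ((!o) ^^ decide (ys.length % 2 = 1)) := by
      rcases Nat.mod_two_eq_zero_or_one ys.length with h | h <;>
        simp [h, Nat.add_mod]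
    simp only [List.cons_append, secs, ih, h, List.append_assoc]

/-- The letter `a` occurs only in sections at the vertex `false`, and successive blocks contribute
alternately to the two words. The word `secs true` receives the `false`-section of the first block,
hence the extra one. -/
theorem countA_secs (ys : List K4) :
    2 * countA (secs true ys) ≤ ys.length + 1 ∧ 2 * countA (secs false ys) ≤ ys.length := by
  induction ys with
  | nil => simp [secs]
  | cons y ys ih =>
    have h1 : countA (y.sec false) ≤ 1 := by cases y <;> simp [K4.sec]
    have h2 : countA (y.sec true) = 0 := by cases y <;> simp [K4.sec]
    simp only [secs, countA_append, Bool.not_true, Bool.not_false, List.length_cons, h2]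
    omega

/-! ### Orders of elements. -/

theorem eq_one_of_sections {g : Equiv.Perm (List Bool)} {G : Bool → Equiv.Perm (List Bool)}
    (h0 : g [] = []) (hg : ∀ o v, g (o :: v) = o :: G o v) (n : ℕ) (hG : ∀ o, G o ^ n = 1) :
    g ^ n = 1 := by
  have h : ∀ n o v, (g ^ n) (o :: v) = o :: (G o ^ n) v := by
    intro n
    induction n with
    | zero => simp
    | succ n ih => intro o v; rw [pow_succ', pow_succ', Equiv.Perm.mul_apply, ih, hg]; rfl
  ext1 v
  cases v with
  | nil =>
    clear h hG
    induction n with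
    | zero => rfl
    | succ n ih => rw [pow_succ', Equiv.Perm.mul_apply, ih]; exact h0
  | cons o v => rw [h, hG]; rfl

theorem ConjWord.pow_eq_one {g h : Equiv.Perm (List Bool)} (hc : ConjWord g h) {n : ℕ}
    (hn : h ^ n = 1) : g ^ n = 1 := by
  obtain ⟨u, rfl⟩ := hc
  rw [conj_pow] at hn
  have := congrArg (fun x => (wordPerm u)⁻¹ * x * wordPerm u) hn
  simpa [mul_assoc] using this

/-- Every factor $5/6$ of weight costs one squaring. The bound 74 for $j=0$ is the weight of $ad$,
the lightest block, so below it only single letters remain, and these are involutions or trivial. -/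
theorem pow_eq_one_of_weight (j : ℕ) (w : List GrigGen) (hw : weight w * 5 ^ j < 74 * 6 ^ j) :
    wordPerm w ^ 2 ^ (j + 1) = 1 := by
  induction j generalizing w with
  | zero =>
    rcases hasCycForm w with h | ⟨y, h⟩ | ⟨ys, h, h1, h2, h3, h4⟩
    · refine h.pow_eq_one ?_
      simp [pow_two, genPerm_mul_self]
    · refine h.pow_eq_one ?_
      cases y <;> simp [pow_two, K4.word, genPerm_mul_self]
    -- A form with at least one block weighs at least 74, which is excluded.
    · obtain ⟨y, ys, rfl⟩ := List.exists_cons_of_ne_nil h1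
      have h5 := h2 y (by simp)
      cases y <;> simp [cyc_cons, K4.word, genWeight] at * <;> omega
  | succ j ih =>
    rcases hasCycForm w with h | ⟨y, h⟩ | ⟨ys, h, h1, h2, h3, h4⟩
    · refine h.pow_eq_one ?_
      rw [pow_succ', pow_mul, pow_two, genPerm_mul_self, one_pow]
    · refine h.pow_eq_one ?_
      rw [pow_succ', pow_mul, pow_two]
      cases y <;> simp [K4.word, genPerm_mul_self]
    have hsec : ∀ u, 6 * weight u ≤ 5 * weight (cyc ys) → wordPerm u ^ 2 ^ (j + 1) = 1 := by
      intro u hu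
      apply ih
      have h5 : 6 * weight u * 5 ^ j ≤ 5 * weight w * 5 ^ j :=
        Nat.mul_le_mul_right _ (hu.trans (by omega))
      have h6 : 5 * weight w * 5 ^ j = weight w * 5 ^ (j + 1) := by ring
      have h7 : 74 * 6 ^ (j + 1) = 6 * (74 * 6 ^ j) := by ring
      have h8 : 6 * weight u * 5 ^ j = 6 * (weight u * 5 ^ j) := by ring
      omega
    refine h.pow_eq_one ?_
    rcases Nat.mod_two_eq_zero_or_one ys.length with hp | hp
    -- Even number of blocks: the element fixes the first level, and both sections have at most
    -- $5/6$ of its weight.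
    · rw [pow_succ, pow_mul]
      have : wordPerm (cyc ys) ^ 2 ^ (j + 1) = 1 := by
        refine eq_one_of_sections (wordPerm_apply_nil _) (G := fun o => wordPerm (secs o ys))
          (fun o v => ?_) _ fun o => hsec _ ?_
        · have := cyc_apply ys o v
          simpa [hp] using this
        · have := weight_secs ys h2 o
          omega
      rw [this, one_pow]
    -- Odd number of blocks: the square fixes the first level, and each of its sections is a product
    -- of the two words `secs false ys` and `secs true ys`, whose total weight is still at most
    -- $5/6$ of that of `cyc ys`. Here the extra squaring is used.
    · rw [pow_succ', pow_mul, pow_two, ← wordPerm_append, ← cyc_append]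
      refine eq_one_of_sections (wordPerm_apply_nil _)
        (G := fun o => wordPerm (secs o (ys ++ ys))) (fun o v => ?_) _ fun o => hsec _ ?_
      · have := cyc_apply (ys ++ ys) o v
        have h0 : (ys.length + ys.length) % 2 = 0 := by omega
        simpa [h0] using this
      · have := weight_secs ys h2 o
        simpa [secs_append, hp] using this

/-- Four levels halve the weight, since $2\cdot 5^4=1250\le 1296=6^4$; moreover $57<74$. -/
theorem wordPerm_pow_eq_one (i : ℕ) (w : List GrigGen) (hw : w.length < 2 ^ i) :
    wordPerm w ^ 2 ^ (4 * i + 1) = 1 := by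
  apply pow_eq_one_of_weight
  have h1 : 2 ^ i * 5 ^ (4 * i) ≤ 6 ^ (4 * i) := by
    rw [pow_mul, pow_mul, ← mul_pow]
    exact Nat.pow_le_pow_left (by norm_num) _
  have h2 := weight_le w
  have h3 : weight w ≤ 57 * 2 ^ i := by omega
  have h4 := Nat.mul_le_mul_right (5 ^ (4 * i)) h3
  have h5 : 57 * 2 ^ i * 5 ^ (4 * i) = 57 * (2 ^ i * 5 ^ (4 * i)) := by ring
  have h6 : 0 < 6 ^ (4 * i) := by positivity
  omega

/-! ### Triviality is detected at logarithmic depth. -/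

/-- Fixing a whole level is invariant under conjugation, so the cyclic form may be examined. If it
has an even number of blocks, its sections have at most half as many letters `a` and fix the level
above, and induction applies. -/
theorem eq_one_of_level (j : ℕ) (w : List GrigGen) (hw : countA w < 2 ^ j)
    (h : ∀ v : List Bool, v.length = 3 + j → wordPerm w v = v) : wordPerm w = 1 := by
  have conj : ∀ {w : List GrigGen} {n : ℕ} {g}, (∀ v : List Bool, v.length = n → wordPerm w v = v) →
      ConjWord (wordPerm w) g → ∀ v : List Bool, v.length = n → g v = v := by
    rintro w n _ h ⟨u, rfl⟩ v hv
    have : ((wordPerm u)⁻¹ v).length = n := by rw [← wordPerm_reverse, length_wordPerm, hv]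
    rw [Equiv.Perm.mul_apply, Equiv.Perm.mul_apply, h _ this]
    exact (wordPerm u).apply_symm_apply v
  have back : ∀ {g : Equiv.Perm (List Bool)}, ConjWord (wordPerm w) g → g = 1 →
      wordPerm w = 1 := by
    intro g hc h1
    have := hc.pow_eq_one (n := 1) (by simpa using h1)
    simpa using this
  induction j generalizing w with
  | zero =>
    rcases hasCycForm w with hc | ⟨y, hc⟩ | ⟨ys, hc, h1, h2, h3, h4⟩
    · have := conj h hc [false, false, false] rfl
      simp [genPerm_apply, GrigGen.act] at this
    · refine back hc ?_
      -- The elements $b$ and $c$ move 000, and $d$ sends 100 to $1\,b(00)=10\,a(0)=101$. Level 3 is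
      -- needed to see $d$.
      have t1 := conj h hc [false, false, false] rfl
      have t2 := conj h hc [true, false, false] rfl
      cases y <;> simp [K4.word, genPerm_apply, GrigGen.act] at *
    · have := List.length_pos_of_ne_nil h1
      omega
  | succ j ih =>
    rcases hasCycForm w with hc | ⟨y, hc⟩ | ⟨ys, hc, h1, h2, h3, h4⟩
    · have := conj h hc (false :: List.replicate (3 + j) false) (by simp; omega)
      simp [genPerm_apply, GrigGen.act] at this
    · refine back hc ?_
      have t1 := conj h hc (false :: false :: List.replicate (2 + j) false) (by simp; omega)
      have t2 := conj h hc (true :: false :: false :: List.replicate (1 + j) false)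
        (by simp; omega)
      cases y <;> simp [K4.word, genPerm_apply, GrigGen.act] at *
    refine back hc ?_
    have t := conj h hc
    rcases Nat.mod_two_eq_zero_or_one ys.length with hp | hp
    · have hap : ∀ o v, wordPerm (cyc ys) (o :: v) = o :: wordPerm (secs o ys) v := fun o v => by
        have := cyc_apply ys o v
        simpa [hp] using this
      have : wordPerm (cyc ys) ^ 1 = 1 := by
        refine eq_one_of_sections (wordPerm_apply_nil _) hap 1 fun o => ?_
        rw [pow_one]
        refine ih _ ?_ ?_ ?_
        · have := countA_secs ys
          cases o <;> omega
        · intro v hv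
          have := t (o :: v) (by simp [hv]; omega)
          rw [hap] at this
          simpa using this
        · intro g hc h1
          have := hc.pow_eq_one (n := 1) (by simpa using h1)
          simpa using this
      simpa using this
    -- An odd number of blocks exchanges the two subtrees of the root.
    · have := cyc_apply ys false (List.replicate (3 + j) false)
      rw [t _ (by simp; omega)] at this
      simp [hp] at this

/-! ### The group -/

theorem coe_prod_toAut (w : List GrigGen) (v : List Bool) :
    ((w.map GrigGen.toAut).prod : BinaryTreeAut) v = wordPerm w v := by
  induction w with
  | nil => rfl
  | cons g w ih => simp only [List.map_cons, List.prod_cons, wordPerm_cons, RelIso.mul_apply,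
      Equiv.Perm.mul_apply, ih]; rfl

theorem prod_toAut_eq_iff (w w' : List GrigGen) :
    (w.map GrigGen.toAut).prod = (w'.map GrigGen.toAut).prod ↔ wordPerm w = wordPerm w' := by
  constructor
  · intro h
    ext1 v
    rw [← coe_prod_toAut, h, coe_prod_toAut]
  · intro h
    ext v : 1
    rw [coe_prod_toAut, h, coe_prod_toAut]

/-- Inverses need no extra letters, because the generators are involutions. -/
theorem exists_word (g : grigorchukGroup) :
    ∃ w : List GrigGen, (g : BinaryTreeAut) = (w.map GrigGen.toAut).prod := by
  obtain ⟨g, hg⟩ := g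
  refine Subgroup.closure_induction (p := fun x _ => ∃ w : List GrigGen,
    x = (w.map GrigGen.toAut).prod) ?_ ⟨[], rfl⟩ ?_ ?_ hg
  · rintro _ ⟨g, rfl⟩
    exact ⟨[g], by simp⟩
  · rintro x y _ _ ⟨u, rfl⟩ ⟨v, rfl⟩
    exact ⟨u ++ v, by simp⟩
  · rintro x _ ⟨u, rfl⟩
    refine ⟨u.reverse, ?_⟩
    rw [inv_eq_iff_mul_eq_one, ← List.prod_append, ← List.map_append]
    refine (prod_toAut_eq_iff _ []).2 ?_
    simp [wordPerm_append, wordPerm_reverse]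

end Grig

/-! ## Stack machines

A machine model that is convenient for programming: in every step the machine sees the tops of all
its stacks. -/

/-- A machine with an input stack, with further stacks of bits indexed by `ι`, and with control
states `Q`. A step depends on the state and the tops of all stacks. The machine halts, or it
changes the state, possibly pops the input stack, and for every other stack possibly pops it and
then puts a list on top of it. -/
structure StackMachine (ι Q : Type) where
  start : Q
  step : Q → Option (Option Bool) → (ι → Option Bool) →
    Option (Q × Bool × (ι → Bool × List Bool))

namespace StackMachine

variable {ι Q : Type}

@[ext]
structure Cfg (ι Q : Type) where
  state : Q
  inp : List (Option Bool)
  stk : ι → List Bool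

def next (M : StackMachine ι Q) (c : Cfg ι Q) : Option (Cfg ι Q) :=
  (M.step c.state c.inp.head? fun j => (c.stk j).head?).map fun r =>
    { state := r.1
      inp := if r.2.1 then c.inp.tail else c.inp
      stk := fun j => (r.2.2 j).2 ++ if (r.2.2 j).1 then (c.stk j).tail else c.stk j }

/-- The machine gets from one configuration to another in exactly `n` steps. -/
def RunsIn (M : StackMachine ι Q) (n : ℕ) (c c' : Cfg ι Q) : Prop :=
  (flip bind M.next)^[n] (some c) = some c'

theorem RunsIn.refl (M : StackMachine ι Q) (c : Cfg ι Q) : M.RunsIn 0 c c := rfl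

theorem RunsIn.trans {M : StackMachine ι Q} {m n : ℕ} {c c' c'' : Cfg ι Q}
    (h : M.RunsIn m c c') (h' : M.RunsIn n c' c'') : M.RunsIn (m + n) c c'' := by
  unfold RunsIn at *
  rw [add_comm, Function.iterate_add_apply, h, h']

theorem RunsIn.head {M : StackMachine ι Q} {n : ℕ} {c c' c'' : Cfg ι Q}
    (h : M.next c = some c') (h' : M.RunsIn n c' c'') : M.RunsIn (n + 1) c c'' := by
  unfold RunsIn at *
  rw [Function.iterate_succ_apply]
  simpa [flip, h] using h'

/-- On every input the machine stops within the given number of steps with the given output on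
the stack `o`, and with all other stacks empty. -/
def Outputs (M : StackMachine ι Q) [DecidableEq ι] (o : ι) (x : List (Option Bool))
    (y : List Bool) (m : ℕ) : Prop :=
  ∃ n ≤ m, ∃ q, M.RunsIn n ⟨M.start, x, fun _ => []⟩ ⟨q, [], fun j => if j = o then y else []⟩ ∧
    M.step q none (fun j => if j = o then y.head? else none) = none

/-! ### Compilation of stack machines to multi-stack Turing machines. -/

section compile

open Turing TM2

variable [DecidableEq ι]

/-- The alphabets of the stacks: `none` is the input stack. -/
abbrev Alph (ι : Type) : Option ι → Type
  | none => Option Bool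
  | some _ => Bool

/-- The local variables: the state, and the tops of the stacks. -/
abbrev Var (ι Q : Type) : Type := Q × Option (Option Bool) × (ι → Option Bool)

abbrev TMStmt (ι Q : Type) : Type := Stmt (Alph ι) Unit (Var ι Q)

def peekAll : List ι → TMStmt ι Q → TMStmt ι Q
  | [], q => q
  | j :: l, q => .peek (some j) (fun v a => (v.1, v.2.1, Function.update v.2.2 j a)) (peekAll l q)

/-- A statement is fixed text, whereas the list to be pushed is known only at run time. Hence one
conditional push is provided for every index below a uniform bound, starting with the last index. -/
def pushList (j : ι) (f : Var ι Q → List Bool) : ℕ → TMStmt ι Q → TMStmt ι Q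
  | 0, q => q
  | i + 1, q => .branch (fun v => decide (i < (f v).length))
      (.push (some j) (fun v => (f v).getD i false) (pushList j f i q)) (pushList j f i q)

def actAll (B : ℕ) (f : Var ι Q → ι → Bool × List Bool) : List ι → TMStmt ι Q → TMStmt ι Q
  | [], q => q
  | j :: l, q => .branch (fun v => (f v j).1)
      (.pop (some j) (fun v _ => v) (pushList j (fun v => (f v j).2) B (actAll B f l q)))
      (pushList j (fun v => (f v j).2) B (actAll B f l q))

theorem stepAux_peekAll (l : List ι) (q : TMStmt ι Q) (v : Var ι Q) (S : ∀ k, List (Alph ι k)) :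
    stepAux (peekAll l q) v S = stepAux q
      (v.1, v.2.1, fun j => if j ∈ l then (S (some j)).head? else v.2.2 j) S := by
  induction l generalizing v with
  | nil => simp [peekAll]
  | cons i l ih =>
    simp only [peekAll, stepAux, ih]
    congr 3
    funext j
    by_cases hj : j = i
    · subst hj; simp
    · simp [hj]

theorem stepAux_pushList (j : ι) (f : Var ι Q → List Bool) (n : ℕ) (q : TMStmt ι Q)
    (v : Var ι Q) (S : ∀ k, List (Alph ι k)) :
    stepAux (pushList j f n q) v S =
      stepAux q v (Function.update S (some j) ((f v).take n ++ S (some j))) := by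
  induction n generalizing S with
  | zero => simp [pushList]
  | succ n ih =>
    simp only [pushList, stepAux]
    by_cases h : n < (f v).length
    · simp only [h, decide_true, cond_true, ih, Function.update_self, Function.update_idem]
      congr 2
      rw [List.take_succ_eq_append_getElem h, List.getD_eq_getElem _ _ h]
      simp only [List.append_assoc, List.singleton_append]
    · simp only [h, decide_false, cond_false, ih]
      rw [List.take_of_length_le (by omega), List.take_of_length_le (by omega)]

theorem stepAux_actAll (B : ℕ) (f : Var ι Q → ι → Bool × List Bool)
    (hB : ∀ v j, (f v j).2.length ≤ B) (l : List ι) (hl : l.Nodup) (q : TMStmt ι Q)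
    (v : Var ι Q) (S S' : ∀ k, List (Alph ι k)) (hn : S' none = S none)
    (hS : ∀ j, S' (some j) = if j ∈ l then
      (f v j).2 ++ (if (f v j).1 then (S (some j)).tail else S (some j)) else S (some j)) :
    stepAux (actAll B f l q) v S = stepAux q v S' := by
  induction l generalizing S with
  | nil =>
    simp only [actAll]
    congr 1
    funext k
    cases k with
    | none => exact hn.symm
    | some j => simp [hS]
  | cons i l ih =>
    obtain ⟨hi, hl⟩ := List.nodup_cons.1 hl
    simp only [actAll, stepAux]
    have key : ∀ T : List Bool, T = (if (f v i).1 then (S (some i)).tail else S (some i)) →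
        stepAux (actAll B f l q) v
          (Function.update S (some i) ((f v i).2.take B ++ T)) = stepAux q v S' := by
      intro T hT
      apply ih hl
      · simp [hn]
      · intro j
        rw [hS]
        by_cases hj : j = i
        · subst hj
          simp only [hi, List.mem_cons, true_or, if_true, if_false, Function.update_self, hT]
          rw [List.take_of_length_le (hB v j)]
        · have : (some j : Option ι) ≠ some i := by simpa using hj
          simp [hj, this]
    cases h : (f v i).1
    · simp only [cond_false, stepAux_pushList]
      exact key _ (by simp [h])
    · simp only [cond_true, stepAux_pushList]
      rw [Function.update_idem, Function.update_self]
      exact key _ (by simp [h])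

variable [Fintype ι] (M : StackMachine ι Q)

/-- What the machine does next, with an arbitrary value where it halts. -/
def action (v : Var ι Q) : Q × Bool × (ι → Bool × List Bool) :=
  (M.step v.1 v.2.1 v.2.2).getD (M.start, false, fun _ => (false, []))

/-- The only statement of the compiled machine: it performs one step. -/
noncomputable def stmt (B : ℕ) : TMStmt ι Q :=
  .peek none (fun v a => (v.1, a, v.2.2)) <| peekAll Finset.univ.toList <|
    .branch (fun v => (M.step v.1 v.2.1 v.2.2).isNone)
      -- A halting `FinTM2` must have its initial local state, so the variables are reset first.
      (.load (fun _ => (M.start, none, fun _ => none)) .halt)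
      (.branch (fun v => (M.action v).2.1)
        (.pop none (fun v _ => v) (actAll B (fun v => (M.action v).2.2) Finset.univ.toList
          (.load (fun v => ((M.action v).1, none, fun _ => none)) (.goto fun _ => ()))))
        (actAll B (fun v => (M.action v).2.2) Finset.univ.toList
          (.load (fun v => ((M.action v).1, none, fun _ => none)) (.goto fun _ => ()))))

/-- The stacks of the compiled machine. -/
def allStk (c : Cfg ι Q) : ∀ k, List (Alph ι k)
  | none => c.inp
  | some j => c.stk j

/-- A configuration as a configuration of the compiled machine. -/
def toTM (c : Cfg ι Q) : Turing.TM2.Cfg (Alph ι) Unit (Var ι Q) :=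
  ⟨some (), (c.state, none, fun _ => none), allStk c⟩

/-- A step of the multi-stack machine executes a whole statement up to the next jump, so steps
correspond one to one and linear time is preserved exactly. -/
theorem step_toTM {B : ℕ} (hB : ∀ v j, ((M.action v).2.2 j).2.length ≤ B) (c : Cfg ι Q) :
    TM2.step (fun _ => M.stmt B) (toTM c) = some (match M.next c with
      | some c' => toTM c'
      | none => ⟨none, (M.start, none, fun _ => none), allStk c⟩) := by
  have hnd := (Finset.univ : Finset ι).nodup_toList
  change some (stepAux (M.stmt B) (c.state, none, fun _ => none) (allStk c)) = _
  simp only [stmt, stepAux, stepAux_peekAll, Finset.mem_toList, Finset.mem_univ,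
    if_true, Option.some.injEq]
  cases h : M.step c.state c.inp.head? (fun j => (c.stk j).head?) with
  | none =>
    have h' : M.next c = none := by simp [next, h]
    simp only [allStk, h, h', Option.isNone_none, cond_true]
  | some r =>
    have h' : M.next c = some ⟨r.1, if r.2.1 then c.inp.tail else c.inp,
      fun j => (r.2.2 j).2 ++ if (r.2.2 j).1 then (c.stk j).tail else c.stk j⟩ := by
      simp [next, h]
    have ha : M.action (c.state, c.inp.head?, fun j => (c.stk j).head?) = r := by
      simp [action, h]
    simp only [allStk, h, h', Option.isNone_some, cond_false, ha]
    cases hp : r.2.1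
    · rw [cond_false, stepAux_actAll B _ hB _ hnd _ _ _ (allStk _)]
      · simp only [stepAux, ha]; rfl
      · simp [allStk]
      · intro j; simp [allStk, ha]
    · rw [cond_true, stepAux_actAll B _ hB _ hnd _ _ _ (allStk _)]
      · simp only [stepAux, ha]; rfl
      · simp [allStk]
      · intro j; simp [allStk, ha]

/-- The compiled machine. -/
noncomputable def toFinTM2 [Fintype Q] (B : ℕ) (o : ι) : FinTM2 where
  K := Option ι
  k₀ := none
  k₁ := some o
  Γ := Alph ι
  Λ := Unit
  main := ()
  σ := Var ι Q
  initialState := (M.start, none, fun _ => none)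
  Γk₀Fin := inferInstanceAs (Fintype (Option Bool))
  m := fun _ => M.stmt B

/-- The bound `B` on the pushed lists exists because states and visible stack tops are finitely
many. Halting costs one additional step. -/
theorem linearTimeComputable [Finite Q] (o : ι) (F : List (List Bool) → List Bool) (c : ℕ)
    (hF : ∀ t, M.Outputs o (encodeTuple t) (F t) (c * ((encodeTuple t).length + 1))) :
    LinearTimeComputable F := by
  have := Fintype.ofFinite Q
  obtain ⟨B, hB⟩ : ∃ B, ∀ v j, ((M.action v).2.2 j).2.length ≤ B :=
    ⟨Finset.univ.sup fun p : Var ι Q × ι => ((M.action p.1).2.2 p.2).2.length, fun v j =>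
      Finset.le_sup (f := fun p : Var ι Q × ι => ((M.action p.1).2.2 p.2).2.length)
        (Finset.mem_univ (v, j))⟩
  have runs : ∀ n c c', M.RunsIn n c c' →
      (flip bind (TM2.step fun _ => M.stmt B))^[n] (some (toTM c)) = some (toTM c') := by
    intro n
    induction n with
    | zero => intro c c' h; cases h; rfl
    | succ n ih =>
      intro c c' h
      unfold RunsIn at h
      rw [Function.iterate_succ_apply] at h ⊢
      have h0 : flip bind M.next (some c) = M.next c := rfl
      have h1 : flip bind (TM2.step fun _ => M.stmt B) (some (toTM c)) =
        TM2.step (fun _ => M.stmt B) (toTM c) := rfl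
      rw [h0] at h
      rw [h1, M.step_toTM hB]
      cases hc : M.next c with
      | none =>
        rw [hc] at h
        have : ∀ n, (flip bind M.next)^[n] (none : Option (Cfg ι Q)) = none := by
          intro n; induction n with
          | zero => rfl
          | succ n ih => rw [Function.iterate_succ_apply]; exact ih
        rw [this] at h
        cases h
      | some c₁ =>
        rw [hc] at h
        exact ih _ _ h
  choose n hn q hr hq using hF
  refine ⟨⟨⟨M.toFinTM2 B o, Equiv.refl _, Equiv.refl _⟩, fun k => c * (k + 1) + 1, fun t =>
    ⟨⟨n t + 1, ?_⟩, Nat.add_le_add_right (hn t) 1⟩⟩, c + 1, fun k => ?_⟩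
  · have e1 : initList (M.toFinTM2 B o) (List.map (Equiv.refl _).invFun (encodeTuple t)) =
        toTM (⟨M.start, encodeTuple t, fun _ => []⟩ : Cfg ι Q) := by
      have h2 : List.map (Equiv.refl (Option Bool)).invFun (encodeTuple t) = encodeTuple t :=
        List.map_id _
      unfold initList toTM
      congr 1
      funext k
      cases k with
      | none => exact h2
      | some j => rfl
    have e2 : haltList (M.toFinTM2 B o) (List.map (Equiv.refl _).invFun (F t)) =
        (⟨none, (M.start, none, fun _ => none),
          allStk (⟨q t, [], fun j => if j = o then F t else []⟩ : Cfg ι Q)⟩ :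
            Turing.TM2.Cfg (Alph ι) Unit (Var ι Q)) := by
      have h2 : List.map (Equiv.refl Bool).invFun (F t) = F t := List.map_id _
      unfold haltList
      congr 1
      funext k
      cases k with
      | none => rfl
      | some j =>
        by_cases hj : j = o
        · subst hj
          simp only [allStk, if_true]
          exact (dif_pos rfl).trans h2
        · have : ¬ (some j = some o) := by simpa using hj
          simp only [allStk, hj, if_false]
          exact dif_neg this
    refine Eq.trans (congrArg _ (congrArg some e1)) (Eq.trans ?_ (congrArg some e2).symm)
    rw [Function.iterate_succ_apply']
    have h3 := runs _ _ _ (hr t)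
    refine (congrArg (flip bind (TM2.step fun _ => M.stmt B)) h3).trans ?_
    refine (M.step_toTM hB _).trans ?_
    have : M.next (⟨q t, [], fun j => if j = o then F t else []⟩ : Cfg ι Q) = none := by
      have h5 := hq t
      have : (fun j => (if j = o then F t else []).head?) =
          fun j => if j = o then (F t).head? else none := by
        funext j; split <;> rfl
      simp only [next, List.head?_nil, this, h5, Option.map_none]
    rw [this]
    rfl
  · show c * (k + 1) + 1 ≤ (c + 1) * (k + 1)
    nlinarith

end compile

end StackMachine

/-! ## Synchronous automata on tuples of bit strings -/

/-- The number with the given binary digits, least significant digit first. -/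
def bitsNum (l : List Bool) : ℕ := Nat.ofDigits 2 (l.map Bool.toNat)

@[simp] theorem bitsNum_nil : bitsNum [] = 0 := rfl

@[simp] theorem bitsNum_cons (b : Bool) (l : List Bool) :
    bitsNum (b :: l) = b.toNat + 2 * bitsNum l := by
  simp [bitsNum, Nat.ofDigits_cons]

/-- The state of an automaton that reads a tuple of strings column by column. -/
def runColumns {ι Q : Type} (st : Q → (ι → Option Bool) → Q) : ℕ → Q → (ι → List Bool) → Q
  | 0, q, _ => q
  | N + 1, q, T => runColumns st N (st q fun j => (T j).head?) fun j => (T j).tail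

/-- The function `R` of a tuple of strings is computed by a finite automaton that reads the strings
synchronously, whatever the number of blank columns that follow the strings. -/
def Recog {ι : Type} {α : Type*} (R : (ι → List Bool) → α) : Prop :=
  ∃ (Q : Type) (_ : Finite Q) (st : Q → (ι → Option Bool) → Q) (q₀ : Q) (out : Q → α),
    ∀ (T : ι → List Bool) (N : ℕ), (∀ j, (T j).length ≤ N) → out (runColumns st N q₀ T) = R T

namespace Recog

variable {ι κ : Type} {α β γ : Type*}

/-- It is enough to give an interpretation of all states that is compatible with the steps. -/
theorem of_val {R : (ι → List Bool) → α} {Q : Type} [Finite Q] (st : Q → (ι → Option Bool) → Q)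
    (q₀ : Q) (val : Q → (ι → List Bool) → α) (h0 : ∀ T, val q₀ T = R T)
    (hs : ∀ q T, val (st q fun j => (T j).head?) (fun j => (T j).tail) = val q T) :
    Recog R := by
  refine ⟨Q, inferInstance, st, q₀, fun q => val q fun _ => [], fun T N hN => ?_⟩
  rw [← h0]
  generalize q₀ = q
  induction N generalizing q T with
  | zero =>
    have : T = fun _ => [] := funext fun j => List.length_eq_zero_iff.1 (Nat.le_zero.1 (hN j))
    rw [this]; rfl
  | succ N ih =>
    rw [← hs, runColumns]
    exact ih _ (fun j => by have := hN j; simp; omega) _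

theorem const (a : α) : Recog fun _ : ι → List Bool => a :=
  ⟨Unit, inferInstance, fun q _ => q, (), fun _ => a, fun _ _ _ => rfl⟩

theorem map (g : α → β) {R : (ι → List Bool) → α} (h : Recog R) : Recog fun T => g (R T) := by
  obtain ⟨Q, hQ, st, q₀, out, h⟩ := h
  exact ⟨Q, hQ, st, q₀, g ∘ out, fun T N hN => congrArg g (h T N hN)⟩

theorem comap {R : (ι → List Bool) → α} (h : Recog R) (f : ι → κ) :
    Recog fun T : κ → List Bool => R fun j => T (f j) := by
  obtain ⟨Q, hQ, st, q₀, out, h⟩ := h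
  refine ⟨Q, hQ, fun q c => st q fun j => c (f j), q₀, out, fun T N hN => ?_⟩
  dsimp only
  rw [← h _ N fun j => hN (f j)]
  congr 1
  clear h hN
  generalize q₀ = q
  induction N generalizing q T with
  | zero => rfl
  | succ N ih => exact ih (fun j => (T j).tail) _

theorem pi {κ : Type} [Finite κ] {R : κ → (ι → List Bool) → α} (h : ∀ k, Recog (R k)) :
    Recog fun T k => R k T := by
  choose Q hQ st q₀ out h using h
  refine ⟨∀ k, Q k, inferInstance, fun q c k => st k (q k) c, q₀, fun q k => out k (q k),
    fun T N hN => ?_⟩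
  funext k
  dsimp only
  rw [← h k T N hN]
  congr 1
  clear h hN
  generalize q₀ = q
  induction N generalizing q T with
  | zero => rfl
  | succ N ih => exact ih (fun j => (T j).tail) _

theorem map₂ (g : α → β → γ) {R : (ι → List Bool) → α} {R' : (ι → List Bool) → β} (h : Recog R)
    (h' : Recog R') : Recog fun T => g (R T) (R' T) := by
  obtain ⟨Q, hQ, st, q₀, out, h⟩ := h
  obtain ⟨Q', hQ', st', q₀', out', h'⟩ := h'
  refine ⟨Q × Q', inferInstance, fun q c => (st q.1 c, st' q.2 c), (q₀, q₀'),
    fun q => g (out q.1) (out' q.2), fun T N hN => ?_⟩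
  dsimp only
  rw [← h T N hN, ← h' T N hN]
  have : runColumns (fun (q : Q × Q') c => (st q.1 c, st' q.2 c)) N (q₀, q₀') T =
      (runColumns st N q₀ T, runColumns st' N q₀' T) := by
    clear h h' hN
    generalize q₀ = q, q₀' = q'
    induction N generalizing q q' T with
    | zero => rfl
    | succ N ih => exact ih (fun j => (T j).tail) _ _
  rw [this]

theorem and {p q : (ι → List Bool) → Prop} (hp : Recog p) (hq : Recog q) :
    Recog fun T => p T ∧ q T := map₂ _ hp hq

theorem or {p q : (ι → List Bool) → Prop} (hp : Recog p) (hq : Recog q) :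
    Recog fun T => p T ∨ q T := map₂ _ hp hq

theorem imp {p q : (ι → List Bool) → Prop} (hp : Recog p) (hq : Recog q) :
    Recog fun T => p T → q T := map₂ (fun a b : Prop => a → b) hp hq

theorem all {κ : Type} [Finite κ] {p : κ → (ι → List Bool) → Prop} (h : ∀ k, Recog (p k)) :
    Recog fun T => ∀ k, p k T := map (fun f : κ → Prop => ∀ k, f k) (pi h)

theorem ex {κ : Type} [Finite κ] {p : κ → (ι → List Bool) → Prop} (h : ∀ k, Recog (p k)) :
    Recog fun T => ∃ k, p k T := map (fun f : κ → Prop => ∃ k, f k) (pi h)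

theorem congr {R R' : (ι → List Bool) → α} (h : Recog R) (e : ∀ T, R T = R' T) : Recog R' :=
  (funext e : R = R') ▸ h

theorem bitsNum_head_tail (l : List Bool) :
    bitsNum l = (if l.head? = some true then 1 else 0) + 2 * bitsNum l.tail := by
  cases l with
  | nil => simp
  | cons b l => cases b <;> simp

/-- Linear inequalities are recognised. -/
theorem linear_le [Fintype ι] (a : ι → ℤ) (D : ℤ) :
    Recog fun T : ι → List Bool => ∑ j, a j * (bitsNum (T j) : ℤ) ≤ D := by
  -- The state is the current right-hand side. With $x_j=\beta_j+2x_j'$, the inequality $\sum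
  -- a_jx_j\le q$ is equivalent to $\sum a_jx_j'\le\lfloor(q-\sum a_j\beta_j)/2\rfloor$, and this
  -- update maps the interval $[-M,M]$ to itself.
  set M : ℤ := |D| + ∑ j, |a j| with hM
  have hS : 0 ≤ ∑ j, |a j| := Finset.sum_nonneg fun j _ => abs_nonneg _
  have hb : ∀ c : ι → Option Bool,
      |∑ j, a j * (if c j = some true then 1 else 0)| ≤ ∑ j, |a j| := fun c => by
    refine (Finset.abs_sum_le_sum_abs _ _).trans (Finset.sum_le_sum fun j _ => ?_)
    split <;> simp
  have hD := abs_nonneg D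
  refine of_val (Q := Set.Icc (-M) M)
    (fun q c => ⟨(q.1 - ∑ j, a j * (if c j = some true then 1 else 0)) / 2, ?_⟩)
    ⟨D, ?_⟩ (fun q T => ∑ j, a j * (bitsNum (T j) : ℤ) ≤ q.1) (fun T => rfl) fun q T => ?_
  · have h1 := abs_le.1 (hb c)
    have h2 := q.2.1
    have h3 := q.2.2
    constructor <;> omega
  · have h1 := abs_le.1 (le_refl |D|)
    constructor <;> omega
  · have : ∑ j, a j * (bitsNum (T j) : ℤ) =
        ∑ j, a j * (if (T j).head? = some true then 1 else 0) +
          2 * ∑ j, a j * (bitsNum (T j).tail : ℤ) := by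
      rw [Finset.mul_sum, ← Finset.sum_add_distrib]
      refine Finset.sum_congr rfl fun j _ => ?_
      conv_lhs => rw [bitsNum_head_tail]
      push_cast
      split <;> ring
    simp only [this, eq_iff_iff]
    omega

theorem length_eq (i j : ι) : Recog fun T : ι → List Bool => (T i).length = (T j).length := by
  refine of_val (Q := Bool) (fun q c => q && ((c i).isSome == (c j).isSome)) true
    (fun q T => q = true ∧ (T i).length = (T j).length) (by simp) fun q T => ?_
  cases q
  · simp
  · dsimp only
    generalize T i = x, T j = y
    cases x <;> cases y <;> simp

/-- `Nat.bits` produces exactly the digit strings without a leading zero, and the leading digit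
stands last here. -/
theorem bits_bitsNum_iff (l : List Bool) : (bitsNum l).bits = l ↔ l.getLast? ≠ some false := by
  induction l with
  | nil => simp
  | cons b l ih =>
    have h1 : bitsNum (b :: l) = Nat.bit b (bitsNum l) := by
      cases b <;> simp [Nat.bit_val] <;> ring
    rw [h1]
    by_cases h : bitsNum l = 0 → b = true
    · rw [Nat.bits_append_bit _ _ h, List.cons.injEq, ih]
      rcases l with _ | ⟨x, l⟩
      · simp_all
      · simp
    · push Not at h
      obtain ⟨h2, rfl⟩ := (by simpa using h : bitsNum l = 0 ∧ b = false)
      rw [h2]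
      simp only [Nat.bit_false, mul_zero, Nat.zero_bits, reduceCtorEq, false_iff, not_not]
      rw [h2, Nat.zero_bits] at ih
      rcases l with _ | ⟨x, l⟩
      · rfl
      · simp at ih
        simp [ih]

/-- The automaton remembers the last digit that it has read; blank columns leave it unchanged, and
the empty string counts as ending in `true`. -/
theorem canonical (j : ι) : Recog fun T : ι → List Bool => (bitsNum (T j)).bits = T j := by
  refine of_val (Q := Bool) (fun q c => (c j).getD q) true
    (fun q T => (T j = [] → q = true) ∧ (T j ≠ [] → (T j).getLast? ≠ some false))
    (fun T => ?_) fun q T => ?_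
  · rw [bits_bitsNum_iff]
    by_cases h : T j = [] <;> simp [h]
  · dsimp only
    generalize T j = x
    rcases x with _ | ⟨b, _ | ⟨b', l⟩⟩ <;> simp

/-- The digit string consists of ones followed by zeros. The states are: only ones so far, zeros
have begun, failure. This is what makes powers of two available to the formulas. -/
theorem isOnes (j : ι) : Recog fun T : ι → List Bool => ∃ t, bitsNum (T j) + 1 = 2 ^ t := by
  refine of_val (Q := Option Bool)
    (fun q c => match q, decide (c j = some true) with
      | none, _ => none
      | some true, b => some b
      | some false, b => if b then none else some false) (some true)
    (fun q T => match q with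
      | none => False
      | some true => ∃ t, bitsNum (T j) + 1 = 2 ^ t
      | some false => bitsNum (T j) = 0) (fun T => rfl) fun q T => ?_
  have h := bitsNum_head_tail (T j)
  generalize bitsNum (T j) = m, bitsNum (T j).tail = m' at h
  by_cases hb : (T j).head? = some true
  · rw [if_pos hb] at h
    rcases q with _ | _ | _
    · simp
    · simp [hb]; omega
    · simp only [hb, decide_true, eq_iff_iff]
      constructor
      · rintro ⟨t, ht⟩
        exact ⟨t + 1, by rw [pow_succ]; omega⟩
      · rintro ⟨t, ht⟩
        cases t with
        | zero => simp at ht; omega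
        | succ t => exact ⟨t, by rw [pow_succ] at ht; omega⟩
  · rw [if_neg hb] at h
    rcases q with _ | _ | _
    · simp
    · simp [hb]; omega
    · simp only [hb, decide_false, eq_iff_iff]
      constructor
      · rintro h0
        exact ⟨0, by omega⟩
      · rintro ⟨t, ht⟩
        cases t with
        | zero => simp at ht; omega
        | succ t => rw [pow_succ] at ht; omega

end Recog

/-! ## A machine that prepares its input for an automaton -/

/-- A finite-state transducer that splits its input into strings indexed by `ι`, and that marks
some of the positions of its input. -/
structure Splitter (ι Q : Type) where
  tr : Q → Option Bool → Q
  emit : Q → Option Bool → ι → List Bool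
  mark : Q → Option Bool → Bool

namespace Splitter

variable {ι Q : Type} (S : Splitter ι Q)

def final : Q → List (Option Bool) → Q
  | q, [] => q
  | q, a :: W => final (S.tr q a) W

def tracks : Q → List (Option Bool) → ι → List Bool
  | _, [], _ => []
  | q, a :: W, j => S.emit q a j ++ tracks (S.tr q a) W j

def marks : Q → List (Option Bool) → ℕ
  | _, [] => 0
  | q, a :: W => (S.mark q a).toNat + marks (S.tr q a) W

theorem marks_le (q : Q) (W : List (Option Bool)) : S.marks q W ≤ W.length := by
  induction W generalizing q with
  | nil => simp [marks]
  | cons a W ih =>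
    have := ih (S.tr q a)
    have := Bool.toNat_le (S.mark q a)
    simp [marks]; omega

theorem length_tracks_le {E : ℕ} (hE : ∀ q a j, (S.emit q a j).length ≤ E) (q : Q)
    (W : List (Option Bool)) (j : ι) : (S.tracks q W j).length ≤ E * W.length := by
  induction W generalizing q with
  | nil => simp [tracks]
  | cons a W ih =>
    have := ih (S.tr q a)
    have := hE q a j
    simp [tracks, Nat.mul_add]; omega

/-- The strings into which the input is split, together with the number of marks in binary. -/
def allTracks (q : Q) (W : List (Option Bool)) : Option ι → List Bool
  | none => (S.marks q W).bits
  | some j => S.tracks q W j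

end Splitter

namespace SplitMachine

inductive Phase where
  | start | even | odd | back | pour | run | fin

instance : Finite Phase :=
  Finite.of_surjective (fun i : Fin 7 => match i with
    | 0 => .start
    | 1 => .even
    | 2 => .odd
    | 3 => .back
    | 4 => .pour
    | 5 => .run
    | 6 => .fin) fun p => by
      cases p
      exacts [⟨0, rfl⟩, ⟨1, rfl⟩, ⟨2, rfl⟩, ⟨3, rfl⟩, ⟨4, rfl⟩, ⟨5, rfl⟩, ⟨6, rfl⟩]

/-- Names of the stacks: two stacks for every string, two auxiliary stacks, and the output. -/
abbrev Stk (ι : Type) : Type := (Option ι ⊕ Option ι) ⊕ Fin 3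

def stk {ι : Type} (A B : Option ι → List Bool) (x y z : List Bool) : Stk ι → List Bool
  | .inl (.inl j) => A j
  | .inl (.inr j) => B j
  | .inr 0 => x
  | .inr 1 => y
  | .inr 2 => z

variable {ι Q₁ Q₂ : Type} [Fintype ι] [DecidableEq ι]

abbrev Ctl (Q₁ Q₂ : Type) : Type := Q₁ ⊕ (Phase × Q₂) ⊕ Unit

/-- The actions on the stacks, in the order of `stk`. -/
def acts (A B : Option ι → Bool × List Bool) (x y z : Bool × List Bool) :
    Stk ι → Bool × List Bool
  | .inl (.inl j) => A j
  | .inl (.inr j) => B j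
  | .inr 0 => x
  | .inr 1 => y
  | .inr 2 => z

abbrev nop : Bool × List Bool := (false, [])

/-- The machine splits the input, computes the binary representation of the number of marks by
repeated halving, reverses all strings, runs the automaton, and outputs the string that belongs to
its final state, followed possibly by the string of index `o`. -/
def machine (S : Splitter ι Q₁) (q₁ : Q₁) (init : Q₁ → Q₂)
    (st : Q₂ → (Option ι → Option Bool) → Q₂) (out : Q₂ → List Bool × Bool) (o : ι) :
    StackMachine (Stk ι) (Ctl Q₁ Q₂) where
  start := .inl q₁
  step s a t := match s with
    | .inl q => match a with
      | some x => some (.inl (S.tr q x), true, acts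
          (fun j => match j with
            | some j => (false, (S.emit q x j).reverse)
            | none => nop) (fun _ => nop) (false, if S.mark q x then [true] else []) nop nop)
      | none => some (.inr (.inl (.start, init q)), false, fun _ => nop)
    | .inr (.inl (.start, q)) => match t (.inr 0) with
      | none => some (.inr (.inl (.pour, q)), false, fun _ => nop)
      | some _ => some (.inr (.inl (.odd, q)), false,
          acts (fun _ => nop) (fun _ => nop) (true, []) nop nop)
    | .inr (.inl (.even, q)) => match t (.inr 0) with
      | none => some (.inr (.inl (.back, q)), false,
          acts (fun j => (false, if j = none then [false] else [])) (fun _ => nop) nop nop nop)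
      | some _ => some (.inr (.inl (.odd, q)), false,
          acts (fun _ => nop) (fun _ => nop) (true, []) nop nop)
    | .inr (.inl (.odd, q)) => match t (.inr 0) with
      | none => some (.inr (.inl (.back, q)), false,
          acts (fun j => (false, if j = none then [true] else [])) (fun _ => nop) nop nop nop)
      | some _ => some (.inr (.inl (.even, q)), false,
          acts (fun _ => nop) (fun _ => nop) (true, []) (false, [true]) nop)
    | .inr (.inl (.back, q)) => match t (.inr 1) with
      | none => some (.inr (.inl (.start, q)), false, fun _ => nop)
      | some _ => some (.inr (.inl (.back, q)), false,
          acts (fun _ => nop) (fun _ => nop) (false, [true]) (true, []) nop)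
    | .inr (.inl (.pour, q)) =>
      if ∀ j, t (.inl (.inl j)) = none then some (.inr (.inl (.run, q)), false, fun _ => nop)
      else some (.inr (.inl (.pour, q)), false,
        acts (fun _ => (true, [])) (fun j => (false, (t (.inl (.inl j))).toList)) nop nop nop)
    | .inr (.inl (.run, q)) =>
      if ∀ j, t (.inl (.inr j)) = none then some (.inr (.inl (.fin, q)), false, fun _ => nop)
      else some (.inr (.inl (.run, st q fun j => t (.inl (.inr j)))), false,
        acts (fun j => (false, if j = some o then (t (.inl (.inr j))).toList else []))
          (fun _ => (true, [])) nop nop nop)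
    | .inr (.inl (.fin, q)) => match t (.inl (.inl (some o))) with
      | none => some (.inr (.inr ()), false,
          acts (fun _ => nop) (fun _ => nop) nop nop (false, (out q).1))
      | some b => some (.inr (.inl (.fin, q)), false,
          acts (fun _ => (true, [])) (fun _ => nop) nop nop (false, if (out q).2 then [b] else []))
    | .inr (.inr ()) => none

variable (S : Splitter ι Q₁) (q₁ : Q₁) (init : Q₁ → Q₂)
    (st : Q₂ → (Option ι → Option Bool) → Q₂) (out : Q₂ → List Bool × Bool) (o : ι)

local notation "MM" => machine S q₁ init st out o

abbrev cfg (s : Ctl Q₁ Q₂) (W : List (Option Bool)) (A B : Option ι → List Bool)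
    (x y z : List Bool) : StackMachine.Cfg (Stk ι) (Ctl Q₁ Q₂) := ⟨s, W, stk A B x y z⟩

theorem next_eq {s s' : Ctl Q₁ Q₂} {W W' : List (Option Bool)} {A A' B B' : Option ι → List Bool}
    {x x' y y' z z' : List Bool} {p : Bool} {aA aB : Option ι → Bool × List Bool}
    {ax ay az : Bool × List Bool}
    (hs : (MM).step s W.head? (fun j => (stk A B x y z j).head?) =
      some (s', p, acts aA aB ax ay az)) (hW : W' = if p then W.tail else W)
    (hA : ∀ j, A' j = (aA j).2 ++ if (aA j).1 then (A j).tail else A j)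
    (hB : ∀ j, B' j = (aB j).2 ++ if (aB j).1 then (B j).tail else B j)
    (hx : x' = ax.2 ++ if ax.1 then x.tail else x) (hy : y' = ay.2 ++ if ay.1 then y.tail else y)
    (hz : z' = az.2 ++ if az.1 then z.tail else z) :
    (MM).next (cfg s W A B x y z) = some (cfg s' W' A' B' x' y' z') := by
  simp only [StackMachine.next, hs, Option.map_some, ← hW]
  congr 2
  funext k
  rcases k with (k | k) | k
  · exact (hA k).symm
  · exact (hB k).symm
  · fin_cases k
    · exact hx.symm
    · exact hy.symm
    · exact hz.symm

theorem runsIn_zero {s : Ctl Q₁ Q₂} {W : List (Option Bool)} {A A' B B' : Option ι → List Bool}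
    {x x' y y' z z' : List Bool} (hA : ∀ j, A j = A' j) (hB : B = B') (hx : x = x') (hy : y = y')
    (hz : z = z') : (MM).RunsIn 0 (cfg s W A B x y z) (cfg s W A' B' x' y' z') := by
  rw [funext hA, hB, hx, hy, hz]
  exact .refl _ _

omit [Fintype ι] [DecidableEq ι] in
theorem nop_eq : (fun _ => nop : Stk ι → Bool × List Bool) =
    acts (fun _ => nop) (fun _ => nop) nop nop nop := by
  funext k
  rcases k with (k | k) | k
  · rfl
  · rfl
  · fin_cases k <;> rfl

theorem next_nop {s s' : Ctl Q₁ Q₂} {W : List (Option Bool)} {A B : Option ι → List Bool}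
    {x y z : List Bool}
    (hs : (MM).step s W.head? (fun j => (stk A B x y z j).head?) = some (s', false, fun _ => nop)) :
    (MM).next (cfg s W A B x y z) = some (cfg s' W A B x y z) :=
  next_eq S q₁ init st out o (p := false) (by rw [hs, nop_eq]) rfl (fun _ => rfl) (fun _ => rfl)
    rfl rfl rfl

theorem runs_scan (W : List (Option Bool)) (q : Q₁) (A B : Option ι → List Bool) (c : ℕ) :
    (MM).RunsIn (W.length + 1) (cfg (.inl q) W A B (List.replicate c true) [] [])
      (cfg (.inr (.inl (.start, init (S.final q W)))) []
        (fun j => match j with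
          | some j => (S.tracks q W j).reverse ++ A (some j)
          | none => A none) B (List.replicate (c + S.marks q W) true) [] []) := by
  induction W generalizing q A c with
  | nil =>
    exact .head (next_nop S q₁ init st out o rfl) (runsIn_zero S q₁ init st out o
        (fun j => by cases j <;> simp [Splitter.tracks]) rfl rfl rfl rfl)
  | cons a W ih =>
    have h := ih (S.tr q a) (fun j => match j with
      | some j => (S.emit q a j).reverse ++ A (some j)
      | none => A none) (c + (S.mark q a).toNat)
    have e : ∀ j : Option ι, (match j with
        | some j => (S.tracks q (a :: W) j).reverse ++ A (some j)
        | none => A none) = (match j with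
        | some j => (S.tracks (S.tr q a) W j).reverse ++ ((S.emit q a j).reverse ++ A (some j))
        | none => A none) := by
      intro j
      cases j <;> simp [Splitter.tracks]
    rw [funext e, Splitter.marks, ← add_assoc]
    refine .head (next_eq S q₁ init st out o (p := true) rfl rfl ?_ (fun _ => rfl) ?_ rfl rfl) h
    · intro j
      cases j <;> simp
    · cases S.mark q a <;> simp [List.replicate_succ]

/-- One halving of a unary number: every second removed mark is recorded on the other stack, and the
parity is remembered in the control state and becomes the next binary digit. -/
theorem runs_pass (q : Q₂) (A B : Option ι → List Bool) (c d : ℕ) :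
    (MM).RunsIn (c + 1)
      (cfg (.inr (.inl (.even, q))) [] A B (List.replicate c true) (List.replicate d true) [])
      (cfg (.inr (.inl (.back, q))) [] (fun j => if j = none then c.bodd :: A none else A j) B []
        (List.replicate (d + c / 2) true) []) ∧
    (MM).RunsIn (c + 1)
      (cfg (.inr (.inl (.odd, q))) [] A B (List.replicate c true) (List.replicate d true) [])
      (cfg (.inr (.inl (.back, q))) []
        (fun j => if j = none then (c + 1).bodd :: A none else A j) B []
        (List.replicate (d + (c + 1) / 2) true) []) := by
  induction c generalizing d with
  | zero =>
    constructor <;>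
    · exact .head (next_eq S q₁ init st out o (p := false) rfl rfl
        (fun _ => rfl) (fun _ => rfl) rfl rfl rfl) (runsIn_zero S q₁ init st out o
          (fun j => by cases j <;> simp) rfl rfl (by simp) rfl)
  | succ c ih =>
    constructor
    · exact .head (next_eq S q₁ init st out o (p := false) rfl rfl
        (fun _ => rfl) (fun _ => rfl) rfl rfl rfl) (ih d).2
    · have h := (ih (d + 1)).1
      have e1 : (c + 1 + 1).bodd = c.bodd := by simp
      have e2 : d + (c + 1 + 1) / 2 = d + 1 + c / 2 := by omega
      rw [e1, e2]
      exact .head (next_eq S q₁ init st out o (p := false) rfl rfl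
        (fun _ => rfl) (fun _ => rfl) rfl rfl rfl) h

theorem runs_back (q : Q₂) (A B : Option ι → List Bool) (c d : ℕ) :
    (MM).RunsIn (d + 1)
      (cfg (.inr (.inl (.back, q))) [] A B (List.replicate c true) (List.replicate d true) [])
      (cfg (.inr (.inl (.start, q))) [] A B (List.replicate (d + c) true) [] []) := by
  induction d generalizing c with
  | zero =>
    exact .head (next_nop S q₁ init st out o rfl)
      (runsIn_zero S q₁ init st out o (fun _ => rfl) rfl (by rw [zero_add]) rfl rfl)
  | succ d ih =>
    have h := ih (c + 1)
    have e : d + (c + 1) = d + 1 + c := by omega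
    rw [e] at h
    exact .head (next_eq S q₁ init st out o (p := false) rfl rfl
      (fun _ => rfl) (fun _ => rfl) rfl rfl rfl) h

/-- The pass that starts with `c` marks takes time proportional to `c`, and the next one starts with
`c / 2`. The geometric series keeps the total linear. -/
theorem runs_halve (c : ℕ) (q : Q₂) (A B : Option ι → List Bool) :
    ∃ n ≤ 7 * c + 1, (MM).RunsIn n
      (cfg (.inr (.inl (.start, q))) [] A B (List.replicate c true) [] [])
      (cfg (.inr (.inl (.pour, q))) []
        (fun j => if j = none then c.bits.reverse ++ A none else A j) B [] [] []) := by
  induction c using Nat.strong_induction_on generalizing A with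
  | _ c ih =>
  cases c with
  | zero =>
    refine ⟨1, by omega, .head (next_nop S q₁ init st out o rfl)
      (runsIn_zero S q₁ init st out o (fun j => by cases j <;> simp) rfl rfl rfl rfl)⟩
  | succ c =>
    obtain ⟨n, hn, h⟩ := ih ((c + 1) / 2) (by omega)
      fun j => if j = none then (c + 1).bodd :: A none else A j
    have h1 := (runs_pass S q₁ init st out o q A B c 0).2
    have h2 := runs_back S q₁ init st out o q
      (fun j => if j = none then (c + 1).bodd :: A none else A j) B 0 ((c + 1) / 2)
    rw [zero_add] at h1
    have hb : (c + 1).bits = (c + 1).bodd :: ((c + 1) / 2).bits := by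
      conv_lhs => rw [← Nat.bit_bodd_div2 (c + 1)]
      rw [Nat.bits_append_bit, Nat.div2_val]
      intro h0
      rw [Nat.div2_val] at h0
      have : c = 0 := by omega
      subst this
      rfl
    have e : ∀ j : Option ι, (if j = none then (c + 1).bits.reverse ++ A none else A j) =
        if j = none then ((c + 1) / 2).bits.reverse ++
          (if (none : Option ι) = none then (c + 1).bodd :: A none else A none)
        else if j = none then (c + 1).bodd :: A none else A j := by
      intro j
      cases j <;> simp [hb]
    rw [funext e]
    exact ⟨_, by omega, .head (next_eq S q₁ init st out o (p := false) rfl rfl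
      (fun _ => rfl) (fun _ => rfl) rfl rfl rfl) ((h1.trans h2).trans h)⟩

/-- The scanned strings lie on their stacks upside down; pouring them over brings the least
significant digits to the top. -/
theorem runs_pour (N : ℕ) (q : Q₂) (A B : Option ι → List Bool) (hA : ∀ j, (A j).length ≤ N) :
    ∃ n ≤ N + 1, (MM).RunsIn n (cfg (.inr (.inl (.pour, q))) [] A B [] [] [])
      (cfg (.inr (.inl (.run, q))) [] (fun _ => []) (fun j => (A j).reverse ++ B j) [] [] []) := by
  induction N generalizing A B with
  | zero =>
    have : A = fun _ => [] := funext fun j => List.length_eq_zero_iff.1 (Nat.le_zero.1 (hA j))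
    subst this
    refine ⟨1, by omega, .head (next_nop S q₁ init st out o (if_pos fun _ => rfl)) (.refl _ _)⟩
  | succ N ih =>
    by_cases h : ∀ j, (A j).head? = none
    · have : A = fun _ => [] := funext fun j => by simpa using h j
      subst this
      exact ⟨1, by omega, .head (next_nop S q₁ init st out o (if_pos fun _ => rfl)) (.refl _ _)⟩
    · obtain ⟨n, hn, hr⟩ := ih (fun j => (A j).tail) (fun j => (A j).head?.toList ++ B j)
        fun j => by have := hA j; simp; omega
      refine ⟨n + 1, by omega, .head (next_eq S q₁ init st out o (p := false)
        (if_neg h) rfl (fun _ => rfl) (fun _ => rfl) rfl rfl rfl) ?_⟩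
      have e : ∀ j, (A j).reverse ++ B j =
          (A j).tail.reverse ++ ((A j).head?.toList ++ B j) := by
        intro j
        cases A j <;> simp
      rw [funext e]
      exact hr

/-- The number `N'` of columns need not be known, since the result of the automaton is insensitive
to blank columns. The track `o` is saved for a possible output. -/
theorem runs_run (N : ℕ) (q : Q₂) (T : Option ι → List Bool) (r : List Bool)
    (hT : ∀ j, (T j).length ≤ N) :
    ∃ N', (∀ j, (T j).length ≤ N') ∧ ∃ n ≤ N + 1, (MM).RunsIn n
      (cfg (.inr (.inl (.run, q))) [] (fun j => if j = some o then r else []) T [] [] [])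
      (cfg (.inr (.inl (.fin, runColumns st N' q T))) []
        (fun j => if j = some o then (T j).reverse ++ r else []) (fun _ => []) [] [] []) := by
  induction N generalizing q T r with
  | zero =>
    have : T = fun _ => [] := funext fun j => List.length_eq_zero_iff.1 (Nat.le_zero.1 (hT j))
    subst this
    refine ⟨0, by simp, 1, by omega, .head (next_nop S q₁ init st out o (if_pos fun _ => rfl)) (.refl _ _)⟩
  | succ N ih =>
    by_cases h : ∀ j, (T j).head? = none
    · have : T = fun _ => [] := funext fun j => by simpa using h j
      subst this
      exact ⟨0, by simp, 1, by omega, .head (next_nop S q₁ init st out o (if_pos fun _ => rfl)) (.refl _ _)⟩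
    · obtain ⟨N', hN', n, hn, hr⟩ := ih (st q fun j => (T j).head?) (fun j => (T j).tail)
        ((T (some o)).head?.toList ++ r) fun j => by have := hT j; simp; omega
      refine ⟨N' + 1, fun j => by have := hN' j; simp at this; omega, n + 1, by omega,
        .head (next_eq S q₁ init st out o (p := false)
        (if_neg h) rfl (A' := fun j => if j = some o then (T (some o)).head?.toList ++ r else [])
        (fun j => ?_) (fun _ => rfl) rfl rfl rfl) ?_⟩
      · by_cases hj : j = some o
        · subst hj; simp [stk]
        · simp [hj]
      · have e : ∀ j, (if j = some o then (T j).reverse ++ r else []) =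
            if j = some o then (T j).tail.reverse ++ ((T (some o)).head?.toList ++ r) else [] := by
          intro j
          by_cases hj : j = some o
          · subst hj
            cases T (some o) <;> simp
          · simp [hj]
        rw [funext e]
        exact hr

theorem runs_fin (q : Q₂) (l z : List Bool) :
    (MM).RunsIn (l.length + 1)
      (cfg (.inr (.inl (.fin, q))) [] (fun j => if j = some o then l else []) (fun _ => []) [] [] z)
      (cfg (.inr (.inr ())) [] (fun _ => []) (fun _ => []) [] []
        ((out q).1 ++ ((if (out q).2 then l.reverse else []) ++ z))) := by
  induction l generalizing z with
  | nil =>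
    refine .head (next_eq S q₁ init st out o (p := false) (s' := .inr (.inr ()))
      (aA := fun _ => nop) (aB := fun _ => nop) (ax := nop) (ay := nop) (az := (false, (out q).1))
      ?_ rfl (A' := fun _ => []) (fun j => by simp) (fun _ => rfl) rfl rfl rfl) ?_
    · simp [machine, stk]
    · simp [StackMachine.RunsIn.refl]
  | cons b l ih =>
    refine .head (next_eq S q₁ init st out o (p := false) (s' := .inr (.inl (.fin, q)))
      (aA := fun _ => (true, [])) (aB := fun _ => nop) (ax := nop) (ay := nop)
      (az := (false, if (out q).2 then [b] else []))
      ?_ rfl (A' := fun j => if j = some o then l else []) (fun j => ?_) (fun _ => rfl)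
      rfl rfl rfl) ?_
    · simp [machine, stk]
    · by_cases hj : j = some o <;> simp [hj]
    · have e : (if (out q).2 then (b :: l).reverse else []) ++ z = (if (out q).2 then l.reverse
          else []) ++ ((if (out q).2 then [b] else []) ++ z) := by
        cases (out q).2 <;> simp
      rw [e]
      exact ih _

end SplitMachine

/-- Splitting, halving, pouring and running are linear in the length of the code. The automata for
all final states of the splitter run in parallel, and the final state, carried along unchanged,
selects the answer. -/
theorem linearTimeComputable_of_splitter {ι Q : Type} [Finite ι] [Finite Q] (S : Splitter ι Q)
    (q₀ : Q) (R : Q → (Option ι → List Bool) → List Bool × Bool) (hR : ∀ q, Recog (R q)) (o : ι)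
    (F : List (List Bool) → List Bool)
    (hF : ∀ t, F t =
      (R (S.final q₀ (encodeTuple t)) (S.allTracks q₀ (encodeTuple t))).1 ++
      if (R (S.final q₀ (encodeTuple t)) (S.allTracks q₀ (encodeTuple t))).2
      then S.tracks q₀ (encodeTuple t) o else []) :
    LinearTimeComputable F := by
  classical
  have := Fintype.ofFinite ι
  have := Fintype.ofFinite Q
  obtain ⟨Q₂, hQ₂, st, q₂, out, h⟩ := Recog.pi hR
  obtain ⟨E, hE⟩ : ∃ E, ∀ q a j, (S.emit q a j).length ≤ E :=
    ⟨Finset.univ.sup fun p : Q × Option Bool × ι => (S.emit p.1 p.2.1 p.2.2).length,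
      fun q a j => Finset.le_sup
        (f := fun p : Q × Option Bool × ι => (S.emit p.1 p.2.1 p.2.2).length)
        (Finset.mem_univ (q, a, j))⟩
  let st' : Q × Q₂ → (Option ι → Option Bool) → Q × Q₂ := fun q c => (q.1, st q.2 c)
  let out' : Q × Q₂ → List Bool × Bool := fun q => out q.2 q.1
  let init : Q → Q × Q₂ := fun q => (q, q₂)
  refine StackMachine.linearTimeComputable (SplitMachine.machine S q₀ init st' out' o) (.inr 2) F
    (4 * E + 14) fun t => ?_
  specialize hF t
  generalize encodeTuple t = W at hF
  have hrun : ∀ N (q : Q × Q₂) T, runColumns st' N q T = (q.1, runColumns st N q.2 T) := by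
    intro N
    induction N with
    | zero => intros; rfl
    | succ N ih => intro q T; exact ih _ _
  set m := S.marks q₀ W with hm
  set T := S.allTracks q₀ W with hT
  have hm' : m ≤ W.length := S.marks_le q₀ W
  have hlen : ∀ j, (T j).length ≤ (E + 1) * W.length := by
    rintro (_ | j)
    · have h1 : m.bits.length ≤ m := by
        rw [Nat.size_eq_bits_len, Nat.size_le]
        exact Nat.lt_two_pow_self
      simp only [hT, Splitter.allTracks, ← hm]
      nlinarith
    · have := S.length_tracks_le hE q₀ W j
      simp only [hT, Splitter.allTracks]
      nlinarith
  have h1 := SplitMachine.runs_scan S q₀ init st' out' o W q₀ (fun _ => []) (fun _ => []) 0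
  rw [zero_add, ← hm] at h1
  obtain ⟨n2, hn2, h2⟩ := SplitMachine.runs_halve S q₀ init st' out' o m (init (S.final q₀ W))
    (fun j => match j with
      | some j => (S.tracks q₀ W j).reverse ++ []
      | none => []) (fun _ => [])
  have e2 : (fun j : Option ι => if j = none then m.bits.reverse ++ [] else
      (match j with
      | some j => (S.tracks q₀ W j).reverse ++ []
      | none => [])) = fun j => (T j).reverse := by
    funext j
    cases j <;> simp [hT, Splitter.allTracks, hm]
  rw [e2] at h2
  obtain ⟨n3, hn3, h3⟩ := SplitMachine.runs_pour S q₀ init st' out' o ((E + 1) * W.length)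
    (init (S.final q₀ W)) (fun j => (T j).reverse) (fun _ => []) (by simpa using hlen)
  have e3 : (fun j : Option ι => (T j).reverse.reverse ++ []) = T := by
    funext j; simp
  rw [e3] at h3
  obtain ⟨N, hN, n4, hn4, h4⟩ := SplitMachine.runs_run S q₀ init st' out' o ((E + 1) * W.length)
    (init (S.final q₀ W)) T [] hlen
  have e4 : (fun j : Option ι => if j = some o then ([] : List Bool) else []) = fun _ => [] := by
    funext j; simp
  rw [e4] at h4
  have h5 := SplitMachine.runs_fin S q₀ init st' out' o
    (runColumns st' N (init (S.final q₀ W)) T) ((T (some o)).reverse ++ []) []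
  have e5 : (fun j : Option ι => if j = some o then (T j).reverse ++ [] else []) =
      fun j => if j = some o then (T (some o)).reverse ++ [] else [] := by
    funext j
    split
    · next hj => rw [hj]
    · rfl
  rw [e5] at h4
  have hout : out' (runColumns st' N (init (S.final q₀ W)) T) = R (S.final q₀ W) T := by
    rw [hrun]
    exact congrFun (h T N hN) (S.final q₀ W)
  rw [hout] at h5
  have h6 := (((h1.trans h2).trans h3).trans h4).trans h5
  have es : (fun _ => []) = SplitMachine.stk (ι := ι) (fun _ => []) (fun _ => []) [] [] [] := by
    funext k
    rcases k with (k | k) | k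
    · rfl
    · rfl
    · fin_cases k <;> rfl
  have ee : (fun j => if j = Sum.inr 2 then F t else []) =
      SplitMachine.stk (ι := ι) (fun _ => []) (fun _ => []) [] [] ((R (S.final q₀ W) T).1 ++
        ((if (R (S.final q₀ W) T).2 then ((T (some o)).reverse ++ []).reverse else []) ++ [])) := by
    rw [hF]
    funext k
    rcases k with (k | k) | k
    · rfl
    · rfl
    · fin_cases k
      · rfl
      · rfl
      · simp [SplitMachine.stk, hT, Splitter.allTracks]
  rw [SplitMachine.cfg, SplitMachine.cfg, List.replicate_zero, ← es, ← ee] at h6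
  refine ⟨_, ?_, .inr (.inr ()), h6, rfl⟩
  have := hlen (some o)
  simp only [List.length_append, List.length_reverse, List.length_nil]
  nlinarith

/-! ## Tuples of names

A name is a sequence of blocks of bits. In a name every bit of a block is preceded by the bit
`false`, and every block is followed by two bits `true`. -/

/-- A block of a name. -/
def packBlock (l : List Bool) : List Bool := (l.flatMap fun b => [false, b]) ++ [true, true]

/-- The name with the `m` blocks of indices `a + m - 1, …, a`. -/
def packFrom (a : ℕ) : ℕ → (ℕ → List Bool) → List Bool
  | 0, _ => []
  | m + 1, T => packBlock (T (a + m)) ++ packFrom a m T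

theorem packFrom_congr {a m : ℕ} {T T' : ℕ → List Bool} (h : ∀ i < m, T (a + i) = T' (a + i)) :
    packFrom a m T = packFrom a m T' := by
  induction m with
  | zero => rfl
  | succ m ih =>
    rw [packFrom, packFrom, h m (by omega), ih fun i hi => h i (by omega)]

theorem packFrom_shift (a m : ℕ) (T : ℕ → List Bool) :
    packFrom a m T = packFrom 0 m fun i => T (a + i) := by
  induction m with
  | zero => rfl
  | succ m ih => rw [packFrom, packFrom, ih, zero_add]

/-- The blocks form a prefix code: the first bit of each pair tells whether the pair carries a digit
or ends the block. -/
theorem packBlock_append_inj {l l' r r' : List Bool} (h : packBlock l ++ r = packBlock l' ++ r') :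
    l = l' ∧ r = r' := by
  induction l generalizing l' with
  | nil =>
    cases l' with
    | nil => simpa [packBlock] using h
    | cons b l' => simp [packBlock] at h
  | cons b l ih =>
    cases l' with
    | nil => simp [packBlock] at h
    | cons b' l' =>
      have h' : b = b' ∧ packBlock l ++ r = packBlock l' ++ r' := by
        simpa [packBlock] using h
      obtain ⟨h1, h2⟩ := ih h'.2
      exact ⟨by rw [h'.1, h1], h2⟩

theorem packFrom_inj {a m : ℕ} {T T' : ℕ → List Bool} (h : packFrom a m T = packFrom a m T') :
    ∀ i < m, T (a + i) = T' (a + i) := by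
  induction m with
  | zero => simp
  | succ m ih =>
    obtain ⟨h1, h2⟩ := packBlock_append_inj h
    intro i hi
    rcases Nat.lt_succ_iff_lt_or_eq.1 hi with hi | rfl
    · exact ih h2 i hi
    · exact h1

theorem length_packFrom_le {a m L : ℕ} {T : ℕ → List Bool} (h : ∀ i < m, (T (a + i)).length ≤ L) :
    (packFrom a m T).length ≤ m * (2 * L + 2) := by
  induction m with
  | zero => simp [packFrom]
  | succ m ih =>
    have h1 := ih fun i hi => h i (by omega)
    have h2 := h m (by omega)
    have h3 : (packBlock (T (a + m))).length = (T (a + m)).length * 2 + 2 := by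
      simp [packBlock, List.length_flatMap]
    rw [packFrom, List.length_append, h3, Nat.succ_mul]
    omega

theorem encodeTuple_nil : encodeTuple [] = [] := rfl

theorem encodeTuple_cons (w : List Bool) (t : List (List Bool)) :
    encodeTuple (w :: t) = w.map some ++ none :: encodeTuple t := by
  simp [encodeTuple]

theorem encodeTuple_injective : Function.Injective encodeTuple := by
  intro t
  induction t with
  | nil =>
    intro t' h
    cases t' with
    | nil => rfl
    | cons w t' => rw [encodeTuple_cons, encodeTuple_nil] at h; simp at h
  | cons w t ih =>
    intro t' h
    cases t' with
    | nil => rw [encodeTuple_cons, encodeTuple_nil] at h; simp at h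
    | cons w' t' =>
      rw [encodeTuple_cons, encodeTuple_cons] at h
      have : w = w' ∧ encodeTuple t = encodeTuple t' := by
        clear ih
        induction w generalizing w' with
        | nil =>
          cases w' with
          | nil => simpa using h
          | cons b w' => simp at h
        | cons b w ihw =>
          cases w' with
          | nil => simp at h
          | cons b' w' =>
            simp only [List.map_cons, List.cons_append, List.cons.injEq, Option.some.injEq] at h
            obtain ⟨h1, h2⟩ := ihw w' h.2
            exact ⟨by rw [h.1, h1], h2⟩
      rw [this.1, ih this.2]

/-- The kinds of pieces of which the code of a tuple consists: an entry of the tuple, a block of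
a name, and the end of a name. -/
inductive PieceKind where
  | raw | inner | closing

def PieceKind.code : PieceKind → List Bool → List (Option Bool)
  | raw, l => l.map some ++ [none]
  | inner, l => (packBlock l).map some
  | closing, _ => [none]

/-- The code that consists of the pieces of indices `r - 1, …, 0`. -/
def renderPieces (sh : ℕ → PieceKind) : ℕ → (ℕ → List Bool) → List (Option Bool)
  | 0, _ => []
  | r + 1, T => (sh r).code (T r) ++ renderPieces sh r T

theorem renderPieces_congr (sh : ℕ → PieceKind) {r : ℕ} {T T' : ℕ → List Bool}
    (h : ∀ i < r, T i = T' i) : renderPieces sh r T = renderPieces sh r T' := by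
  induction r with
  | zero => rfl
  | succ r ih =>
    rw [renderPieces, renderPieces, h r (by omega), ih fun i hi => h i (by omega)]

theorem renderPieces_name (sh : ℕ → PieceKind) (a m : ℕ) (T : ℕ → List Bool)
    (h : ∀ i < m, sh (a + i) = .inner) :
    renderPieces sh (a + m) T = (packFrom a m T).map some ++ renderPieces sh a T := by
  induction m with
  | zero => rfl
  | succ m ih =>
    rw [← add_assoc, renderPieces, ih fun i hi => h i (by omega), h m (by omega), packFrom,
      List.map_append, List.append_assoc]
    rfl

/-- The state of the splitter: the number of the remaining pieces, and the first bit of a pair. -/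
abbrev PieceState (P : ℕ) : Type := Option (Fin (P + 1) × Option Bool)

namespace PieceState

variable {P : ℕ} (sh : ℕ → PieceKind)

def pred (r : Fin (P + 1)) : Fin (P + 1) := ⟨r.1 - 1, by omega⟩

/-- The value `none` is a rejecting sink. A code has the prescribed shape exactly if the run ends in
`some (0, none)`. Pieces are counted downwards, so the first piece of the code has the largest
index. -/
def tr : PieceState P → Option Bool → PieceState P
  | none, _ => none
  | some (r, h), a => if r.1 = 0 then none else
    match sh (r.1 - 1), h, a with
    | .raw, _, some _ => some (r, none)
    | .raw, _, none => some (pred r, none)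
    | .inner, none, some f => some (r, some f)
    | .inner, some false, some _ => some (r, none)
    | .inner, some true, some true => some (pred r, none)
    | .closing, _, none => some (pred r, none)
    | _, _, _ => none

/-- The bit that is read, with the index of its piece. -/
def data : PieceState P → Option Bool → Option (ℕ × Bool)
  | some (r, h), some b =>
    match sh (r.1 - 1), h with
    | .raw, _ => some (r.1 - 1, b)
    | .inner, some false => some (r.1 - 1, b)
    | _, _ => none
  | _, _ => none

/-- The splitter. Besides the pieces it produces a string of `C` times as many bits as the first
piece has letters, and the concatenation of the pieces selected by `wh`. -/
def splitter (P : ℕ) (C g : ℕ) (wh : ℕ → Bool) : Splitter (Fin P ⊕ Bool) (PieceState P) where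
  tr := tr sh
  emit q a j := match j with
    | .inl j => match data sh q a with
      | some (i, b) => if i = j.1 then [b] else []
      | none => []
    | .inr false => match data sh q a with
      | some (i, b) => if wh i then [b] else []
      | none => []
    | .inr true => match q with
      | some (r, _) => if r.1 = P then List.replicate C true else []
      | none => []
  mark q a := match data sh q a with
    | some (i, b) => decide (i = g) && b
    | none => false

end PieceState

namespace Splitter

variable {ι Q : Type} (S : Splitter ι Q)

theorem final_append (q : Q) (W W' : List (Option Bool)) :
    S.final q (W ++ W') = S.final (S.final q W) W' := by
  induction W generalizing q with
  | nil => rfl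
  | cons a W ih => exact ih _

theorem tracks_append (q : Q) (W W' : List (Option Bool)) (j : ι) :
    S.tracks q (W ++ W') j = S.tracks q W j ++ S.tracks (S.final q W) W' j := by
  induction W generalizing q with
  | nil => rfl
  | cons a W ih => simp [tracks, final, ih]

theorem marks_append (q : Q) (W W' : List (Option Bool)) :
    S.marks q (W ++ W') = S.marks q W + S.marks (S.final q W) W' := by
  induction W generalizing q with
  | nil => simp [marks, final]
  | cons a W ih => simp [marks, final, ih, add_assoc]

end Splitter

namespace PieceState

variable {P : ℕ} (sh : ℕ → PieceKind) (C g : ℕ) (wh : ℕ → Bool)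

local notation "SS" => splitter sh P C g wh

/-- What the splitter does with a piece. -/
theorem split_code {r : ℕ} (hr : r + 1 < P + 1) {l : List Bool} (hl : sh r = .closing → l = []) :
    (SS).final (some (⟨r + 1, hr⟩, none)) ((sh r).code l) = some (⟨r, by omega⟩, none) ∧
    (∀ j : Fin P, (SS).tracks (some (⟨r + 1, hr⟩, none)) ((sh r).code l) (.inl j) =
      if r = j.1 then l else []) ∧
    (SS).tracks (some (⟨r + 1, hr⟩, none)) ((sh r).code l) (.inr false) =
      (if wh r then l else []) ∧
    (SS).tracks (some (⟨r + 1, hr⟩, none)) ((sh r).code l) (.inr true) =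
      (if r + 1 = P then List.replicate (C * ((sh r).code l).length) true else []) ∧
    (SS).marks (some (⟨r + 1, hr⟩, none)) ((sh r).code l) =
      if r = g then l.count true else 0 := by
  have hpred : pred (⟨r + 1, hr⟩ : Fin (P + 1)) = ⟨r, by omega⟩ := rfl
  cases h : sh r with
  | raw =>
    clear hl
    simp only [PieceKind.code]
    induction l with
    | nil =>
      simp [Splitter.final, Splitter.tracks, Splitter.marks, splitter, tr, data, h, hpred]
    | cons b l ih =>
      obtain ⟨h1, h2, h3, h4, h5⟩ := ih
      have e : (SS).tr (some (⟨r + 1, hr⟩, none)) (some b) = some (⟨r + 1, hr⟩, none) := by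
        simp [splitter, tr, h]
      simp only [List.map_cons, List.cons_append, Splitter.final, Splitter.tracks, Splitter.marks,
        e, h1, h2, h3, h4, h5]
      refine ⟨trivial, fun j => ?_, ?_, ?_, ?_⟩
      · simp only [splitter, data, h, Nat.add_sub_cancel]
        split <;> rfl
      · simp only [splitter, data, h, Nat.add_sub_cancel]
        split <;> rfl
      · simp only [splitter]
        split
        · simp only [← List.replicate_add, List.length_cons]
          congr 1; ring
        · rfl
      · simp only [splitter, data, h, Nat.add_sub_cancel]
        by_cases hg : r = g <;> cases b <;> simp [hg, add_comm]
  | inner =>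
    clear hl
    simp only [PieceKind.code]
    induction l with
    | nil =>
      simp [Splitter.final, Splitter.tracks, Splitter.marks, splitter, tr, data, h, hpred,
        packBlock]
      split
      · rw [← List.replicate_add, mul_two]
      · rfl
    | cons b l ih =>
      obtain ⟨h1, h2, h3, h4, h5⟩ := ih
      have e1 : (SS).tr (some (⟨r + 1, hr⟩, none)) (some false) =
          some (⟨r + 1, hr⟩, some false) := by
        simp [splitter, tr, h]
      have e2 : (SS).tr (some (⟨r + 1, hr⟩, some false)) (some b) = some (⟨r + 1, hr⟩, none) := by
        simp [splitter, tr, h]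
      have ep : (packBlock (b :: l)).map some = some false :: some b :: (packBlock l).map some := by
        simp [packBlock]
      simp only [ep, Splitter.final, Splitter.tracks, Splitter.marks, e1, e2, h1, h2, h3, h4, h5]
      refine ⟨trivial, fun j => ?_, ?_, ?_, ?_⟩
      · simp only [splitter, data, h, Nat.add_sub_cancel]
        split <;> rfl
      · simp only [splitter, data, h, Nat.add_sub_cancel]
        split <;> rfl
      · simp only [splitter]
        split
        · simp only [← List.replicate_add, List.length_cons]
          congr 1; ring
        · rfl
      · simp only [splitter, data, h, Nat.add_sub_cancel]
        by_cases hg : r = g <;> cases b <;> simp [hg, add_comm]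
  | closing =>
    rw [hl h]
    simp [PieceKind.code, Splitter.final, Splitter.tracks, Splitter.marks, splitter, tr, data, h,
      hpred]

/-- The concatenation of the selected pieces of index less than `r`. -/
def selected (wh : ℕ → Bool) : ℕ → (ℕ → List Bool) → List Bool
  | 0, _ => []
  | r + 1, T => (if wh r then T r else []) ++ selected wh r T

theorem split_render {r : ℕ} (hr : r < P + 1) {T : ℕ → List Bool}
    (hT : ∀ i, sh i = .closing → T i = []) :
    (SS).final (some (⟨r, hr⟩, none)) (renderPieces sh r T) = some (0, none) ∧
    (∀ j : Fin P, (SS).tracks (some (⟨r, hr⟩, none)) (renderPieces sh r T) (.inl j) =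
      if j < r then T j else []) ∧
    (SS).tracks (some (⟨r, hr⟩, none)) (renderPieces sh r T) (.inr false) = selected wh r T ∧
    (r < P → (SS).tracks (some (⟨r, hr⟩, none)) (renderPieces sh r T) (.inr true) = []) ∧
    (SS).marks (some (⟨r, hr⟩, none)) (renderPieces sh r T) =
      if g < r then (T g).count true else 0 := by
  induction r with
  | zero => simp [renderPieces, Splitter.final, Splitter.tracks, Splitter.marks, selected]
  | succ r ih =>
    obtain ⟨h1, h2, h3, h4, h5⟩ := ih (by omega)
    obtain ⟨k1, k2, k3, k4, k5⟩ := split_code sh C g wh hr (hT r)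
    simp only [renderPieces, Splitter.final_append, Splitter.tracks_append,
      Splitter.marks_append, k1, k2, k3, k4, k5, h1, h2, h3, h5]
    refine ⟨trivial, fun j => ?_, rfl, fun hP => ?_, ?_⟩
    · rcases lt_trichotomy j.1 r with h | h | h
      · simp [h, h.ne', h.trans (Nat.lt_succ_self r)]
      · simp [h]
      · simp [h.ne, h.not_gt, show ¬ j.1 < r + 1 by omega]
    · rw [h4 (by omega), if_neg (by omega)]; rfl
    · rcases lt_trichotomy g r with h | h | h
      · simp [h, h.ne', h.trans (Nat.lt_succ_self r)]
      · simp [h]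
      · simp [h.ne, h.not_gt, show ¬ g < r + 1 by omega]

theorem final_none (W : List (Option Bool)) : (SS).final none W = none := by
  induction W with
  | nil => rfl
  | cons a W ih => exact ih

theorem exists_code {r : ℕ} (hr : r + 1 < P + 1) (n : ℕ) (W : List (Option Bool))
    (hn : W.length ≤ n) (hW : (SS).final (some (⟨r + 1, hr⟩, none)) W = some (0, none)) :
    ∃ l W', (sh r = .closing → l = []) ∧ W = (sh r).code l ++ W' ∧
      (SS).final (some (⟨r, by omega⟩, none)) W' = some (0, none) := by
  induction n generalizing W with
  | zero =>
    rw [List.length_eq_zero_iff.1 (Nat.le_zero.1 hn)] at hW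
    simp [Splitter.final] at hW
  | succ n ih =>
    have hpred : pred (⟨r + 1, hr⟩ : Fin (P + 1)) = ⟨r, by omega⟩ := rfl
    rcases W with _ | ⟨a, W⟩
    · simp [Splitter.final] at hW
    rw [Splitter.final] at hW
    simp only [List.length_cons] at hn
    cases h : sh r with
    | raw =>
      rcases a with _ | b
      · have e : (SS).tr (some (⟨r + 1, hr⟩, none)) none = some (⟨r, by omega⟩, none) := by
          simp [splitter, tr, h, hpred]
        rw [e] at hW
        exact ⟨[], W, by simp, by simp [PieceKind.code], hW⟩
      · have e : (SS).tr (some (⟨r + 1, hr⟩, none)) (some b) = some (⟨r + 1, hr⟩, none) := by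
          simp [splitter, tr, h]
        rw [e] at hW
        obtain ⟨l, W', -, rfl, h2⟩ := ih W (by omega) hW
        exact ⟨b :: l, W', by simp, by simp [PieceKind.code, h], h2⟩
    | closing =>
      rcases a with _ | b
      · have e : (SS).tr (some (⟨r + 1, hr⟩, none)) none = some (⟨r, by omega⟩, none) := by
          simp [splitter, tr, h, hpred]
        rw [e] at hW
        exact ⟨[], W, by simp, by simp [PieceKind.code], hW⟩
      · have e : (SS).tr (some (⟨r + 1, hr⟩, none)) (some b) = none := by
          simp [splitter, tr, h]
        rw [e, final_none] at hW
        cases hW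
    | inner =>
      rcases a with _ | f
      · have e : (SS).tr (some (⟨r + 1, hr⟩, none)) none = none := by
          simp [splitter, tr, h]
        rw [e, final_none] at hW
        cases hW
      have e : (SS).tr (some (⟨r + 1, hr⟩, none)) (some f) = some (⟨r + 1, hr⟩, some f) := by
        simp [splitter, tr, h]
      rw [e] at hW
      rcases W with _ | ⟨a, W⟩
      · simp [Splitter.final] at hW
      rw [Splitter.final] at hW
      simp only [List.length_cons] at hn
      rcases a with _ | b
      · have e : (SS).tr (some (⟨r + 1, hr⟩, some f)) none = none := by
          cases f <;> simp [splitter, tr, h]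
        rw [e, final_none] at hW
        cases hW
      cases f with
      | false =>
        have e : (SS).tr (some (⟨r + 1, hr⟩, some false)) (some b) =
            some (⟨r + 1, hr⟩, none) := by
          simp [splitter, tr, h]
        rw [e] at hW
        obtain ⟨l, W', -, rfl, h2⟩ := ih W (by omega) hW
        exact ⟨b :: l, W', by simp, by simp [PieceKind.code, h, packBlock], h2⟩
      | true =>
        cases b with
        | true =>
          have e : (SS).tr (some (⟨r + 1, hr⟩, some true)) (some true) =
              some (⟨r, by omega⟩, none) := by
            simp [splitter, tr, h, hpred]
          rw [e] at hW
          exact ⟨[], W, by simp, by simp [PieceKind.code, packBlock], hW⟩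
        | false =>
          have e : (SS).tr (some (⟨r + 1, hr⟩, some true)) (some false) = none := by
            simp [splitter, tr, h]
          rw [e, final_none] at hW
          cases hW

/-- Converse to `split_render`: acceptance forces the shape. Tuples of any other shape can therefore
be given a constant answer. -/
theorem exists_render {r : ℕ} (hr : r < P + 1) (W : List (Option Bool))
    (hW : (SS).final (some (⟨r, hr⟩, none)) W = some (0, none)) :
    ∃ T, (∀ i, sh i = .closing → T i = []) ∧ W = renderPieces sh r T := by
  induction r generalizing W with
  | zero =>
    rcases W with _ | ⟨a, W⟩
    · exact ⟨fun _ => [], by simp, rfl⟩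
    · rw [Splitter.final] at hW
      have e : (SS).tr (some (⟨0, hr⟩, none)) a = none := by simp [splitter, tr]
      rw [e, final_none] at hW
      cases hW
  | succ r ih =>
    obtain ⟨l, W', hl, rfl, h⟩ := exists_code sh C g wh hr W.length W le_rfl hW
    obtain ⟨T, hT, rfl⟩ := ih (by omega) W' h
    refine ⟨Function.update T r l, fun i hi => ?_, ?_⟩
    · by_cases h : i = r
      · subst h; simpa using hl hi
      · simpa [h] using hT i hi
    · rw [renderPieces, Function.update_self]
      congr 1
      exact renderPieces_congr sh fun i hi => by simp [hi.ne]

/-- The strings that the splitter extracts from the code of a tuple. -/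
def split (P C g : ℕ) (wh : ℕ → Bool) (T : ℕ → List Bool) : Option (Fin P ⊕ Bool) → List Bool
  | none => ((T g).count true).bits
  | some (.inl j) => T j
  | some (.inr true) => List.replicate (C * ((T (P - 1)).length + 1)) true
  | some (.inr false) => selected wh P T

end PieceState

open PieceState in
/-- A function on tuples of a fixed shape is computable in linear time if it is computed by a
finite automaton on the strings that are extracted from the tuple. -/
theorem linearTimeComputable_of_pieces (sh : ℕ → PieceKind) (P C g : ℕ) (wh : ℕ → Bool)
    (hP : 0 < P) (hg : g < P) (hraw : sh (P - 1) = .raw)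
    (R : (Option (Fin P ⊕ Bool) → List Bool) → List Bool × Bool) (hR : Recog R) (o : Fin P)
    (enc : (ℕ → List Bool) → List (List Bool))
    (henc : ∀ T, encodeTuple (enc T) = renderPieces sh P T)
    (F : List (List Bool) → List Bool) (bad : List Bool)
    (hF : ∀ T, (∀ i, sh i = .closing → T i = []) → F (enc T) =
      (R (split P C g wh T)).1 ++ if (R (split P C g wh T)).2 then T o else [])
    (hbad : ∀ t, (¬ ∃ T, (∀ i, sh i = .closing → T i = []) ∧ t = enc T) → F t = bad) :
    LinearTimeComputable F := by
  refine linearTimeComputable_of_splitter (splitter sh P C g wh) (some (⟨P, by omega⟩, none))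
    (fun q T => if q = some (0, none) then R T else (bad, false)) (fun q => ?_) (.inl o) F
    fun t => ?_
  · by_cases h : q = some (0, none)
    · simpa [h] using hR
    · simpa [h] using Recog.const _
  · by_cases h : ∃ T, (∀ i, sh i = .closing → T i = []) ∧ t = enc T
    · obtain ⟨T, hT, rfl⟩ := h
      obtain ⟨h1, h2, h3, h4, h5⟩ := split_render sh C g wh (Nat.lt_succ_self P) hT
      have e : (splitter sh P C g wh).allTracks (some (⟨P, by omega⟩, none))
          (encodeTuple (enc T)) = split P C g wh T := by
        rw [henc]
        funext j
        rcases j with _ | j | _ | _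
        · simp only [Splitter.allTracks, h5, split, if_pos hg]
        · simp only [Splitter.allTracks, h2, split, if_pos j.2]
        · simp only [Splitter.allTracks, h3, split]
        · obtain ⟨P, rfl⟩ : ∃ P', P = P' + 1 := ⟨P - 1, by omega⟩
          obtain ⟨k1, k2, k3, k4, k5⟩ := split_code sh C g wh (Nat.lt_succ_self (P + 1)) (hT P)
          obtain ⟨-, -, -, h4, -⟩ := split_render sh C g wh (P := P + 1) (r := P) (by omega) hT
          simp only [Splitter.allTracks, split, renderPieces, Splitter.tracks_append, k1, k4,
            h4 (Nat.lt_succ_self P), Nat.add_sub_cancel, if_true, List.append_nil]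
          rw [Nat.add_sub_cancel] at hraw
          simp [hraw, PieceKind.code]
      rw [hF T hT, e, henc, h1, if_pos rfl, h2, if_pos o.2]
    · rw [hbad t h, if_neg]
      · simp
      · intro h0
        obtain ⟨T, hT, hW⟩ := exists_render sh C g wh (Nat.lt_succ_self P) _ h0
        exact h ⟨T, hT, encodeTuple_injective (by rw [henc, hW])⟩

/-! ## Circuits for formulas -/

/-- The numbers that a numerical atom may use: the length of the input, the number of ones in the
binary representation of a fixed variable, and the variables. -/
inductive Src (w : ℕ) where
  | n
  | pop
  | var (v : Fin w)

/-- First-order formulas with variables `0, …, w - 1`. -/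
inductive Fml (w : ℕ) : Type where
  | num (P : (Src w → ℕ) → Prop)
  | inp (v : Fin w)
  | not (φ : Fml w)
  | and (φ ψ : Fml w)
  | ex (v : Fin w) (φ : Fml w)

/-- The number of ones in the binary representation. -/
def popcount (m : ℕ) : ℕ := m.bits.count true

namespace Fml

variable {w : ℕ}

def env (g : Fin w) (n : ℕ) (val : Fin w → ℕ) : Src w → ℕ
  | .n => n
  | .pop => popcount (val g)
  | .var v => val v

/-- Truth of a formula about the input `x` of length `n`. Quantifiers range over the numbers below
`B`. -/
def Holds (g : Fin w) (B n : ℕ) (x : List Bool) : Fml w → (Fin w → ℕ) → Prop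
  | num P, val => P (env g n val)
  | inp v, val => x.getD (val v) false = true
  | not φ, val => ¬ Holds g B n x φ val
  | and φ ψ, val => Holds g B n x φ val ∧ Holds g B n x ψ val
  | ex v φ, val => ∃ i < B, Holds g B n x φ (Function.update val v i)

/-- All numerical atoms of the formula are recognised by finite automata. -/
def Auto : Fml w → Prop
  | num P => Recog fun T : Src w → List Bool => P fun s => bitsNum (T s)
  | inp _ => True
  | not φ => Auto φ
  | and φ ψ => Auto φ ∧ Auto ψ
  | ex _ φ => Auto φ

def subs : Fml w → List (Fml w)
  | num P => [num P]
  | inp v => [inp v]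
  | not φ => not φ :: subs φ
  | and φ ψ => and φ ψ :: (subs φ ++ subs ψ)
  | ex v φ => ex v φ :: subs φ

theorem self_mem_subs (φ : Fml w) : φ ∈ subs φ := by cases φ <;> simp [subs]

theorem mem_subs_trans {φ ψ χ : Fml w} (h : φ ∈ subs ψ) (h' : ψ ∈ subs χ) : φ ∈ subs χ := by
  induction χ with
  | num P => simp [subs] at h'; subst h'; exact h
  | inp v => simp [subs] at h'; subst h'; exact h
  | not χ ih =>
    rcases List.mem_cons.1 h' with rfl | h'
    · exact h
    · exact List.mem_cons_of_mem _ (ih h')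
  | and χ χ' ih ih' =>
    rcases List.mem_cons.1 h' with rfl | h'
    · exact h
    · rcases List.mem_append.1 h' with h' | h'
      · exact List.mem_cons_of_mem _ (List.mem_append_left _ (ih h'))
      · exact List.mem_cons_of_mem _ (List.mem_append_right _ (ih' h'))
  | ex v χ ih =>
    rcases List.mem_cons.1 h' with rfl | h'
    · exact h
    · exact List.mem_cons_of_mem _ (ih h')

theorem auto_of_mem_subs {φ χ : Fml w} (h : φ ∈ subs χ) (hχ : Auto χ) : Auto φ := by
  induction χ with
  | num P => simp [subs] at h; subst h; exact hχ
  | inp v => simp [subs] at h; subst h; exact hχ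
  | not χ ih =>
    rcases List.mem_cons.1 h with rfl | h
    · exact hχ
    · exact ih h hχ
  | and χ χ' ih ih' =>
    rcases List.mem_cons.1 h with rfl | h
    · exact hχ
    · rcases List.mem_append.1 h with h | h
      · exact ih h hχ.1
      · exact ih' h hχ.2
  | ex v χ ih =>
    rcases List.mem_cons.1 h with rfl | h
    · exact hχ
    · exact ih h hχ

/-- Strictly decreasing along wires, with the input gates below at rank 0. It witnesses acyclicity
and bounds the depth independently of the input length. -/
def rank : Fml w → ℕ
  | num _ => 1
  | inp _ => 1
  | not φ => rank φ + 1
  | and φ ψ => rank φ + rank ψ + 1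
  | ex _ φ => rank φ + 1

end Fml

/-! ### Lists of valuations -/

/-- The valuations of the variables `0, …, r - 1` by numbers below `B`, in lexicographic order. -/
def vals (B : ℕ) : ℕ → List (ℕ → ℕ)
  | 0 => [fun _ => 0]
  | r + 1 => (vals B r).flatMap fun v => (List.range B).map fun d => Function.update v r d

/-- The position of a valuation in the list of valuations. -/
def valIndex (B : ℕ) : ℕ → (ℕ → ℕ) → ℕ
  | 0, _ => 0
  | r + 1, v => v r + B * valIndex B r v

theorem valIndex_congr {B r : ℕ} {v v' : ℕ → ℕ} (h : ∀ i < r, v i = v' i) :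
    valIndex B r v = valIndex B r v' := by
  induction r with
  | zero => rfl
  | succ r ih => rw [valIndex, valIndex, h r (by omega), ih fun i hi => h i (by omega)]

theorem length_vals (B r : ℕ) : (vals B r).length = B ^ r := by
  induction r with
  | zero => rfl
  | succ r ih => simp [vals, List.length_flatMap, ih, pow_succ]

theorem getElem?_flatMap_const {α β : Type*} {B : ℕ} (hB : 0 < B) (f : α → List β)
    (hf : ∀ a, (f a).length = B) (l : List α) (i : ℕ) :
    (l.flatMap f)[i]? = l[i / B]?.bind fun a => (f a)[i % B]? := by
  induction l generalizing i with
  | nil => simp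
  | cons a l ih =>
    rw [List.flatMap_cons]
    by_cases h : i < B
    · rw [List.getElem?_append_left (by rw [hf]; exact h), Nat.div_eq_of_lt h, Nat.mod_eq_of_lt h]
      rfl
    · push Not at h
      rw [List.getElem?_append_right (by rw [hf]; exact h), hf, ih]
      obtain ⟨k, rfl⟩ := Nat.exists_eq_add_of_le h
      rw [Nat.add_sub_cancel_left, Nat.add_mod_left, Nat.add_div_left _ hB]
      rfl

/-- Valuations are numerals in base `B`, with variable 0 as the most significant digit. The
induction splits off the last variable by division with remainder. -/
theorem getElem?_vals {B : ℕ} (hB : 0 < B) (r Y : ℕ) (v : ℕ → ℕ) :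
    (vals B r)[Y]? = some v ↔
      (∀ i < r, v i < B) ∧ (∀ i, r ≤ i → v i = 0) ∧ valIndex B r v = Y := by
  induction r generalizing Y v with
  | zero =>
    cases Y with
    | zero =>
      simp only [vals, valIndex]
      constructor
      · intro h
        cases h
        simp
      · rintro ⟨-, h, -⟩
        have : v = fun _ => 0 := funext fun i => h i (by omega)
        rw [this]; rfl
    | succ Y => simp [vals, valIndex]
  | succ r ih =>
    rw [vals, getElem?_flatMap_const hB _ (by simp)]
    have hm : Y % B < B := Nat.mod_lt _ hB
    have e : ∀ u : ℕ → ℕ, ((List.range B).map fun d => Function.update u r d)[Y % B]? =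
        some (Function.update u r (Y % B)) := by
      intro u; simp [hm]
    simp only [e, Option.bind_eq_some_iff, Option.some.injEq]
    have hd := Nat.div_add_mod Y B
    constructor
    · rintro ⟨u, hu, rfl⟩
      obtain ⟨h1, h2, h3⟩ := (ih _ _).1 hu
      refine ⟨fun i hi => ?_, fun i hi => ?_, ?_⟩
      · by_cases h : i = r
        · subst h; simpa using hm
        · simpa [h] using h1 i (by omega)
      · have : i ≠ r := by omega
        simpa [this] using h2 i (by omega)
      · rw [valIndex, Function.update_self,
          valIndex_congr (v' := u) fun i hi => by simp [hi.ne], h3]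
        omega
    · rintro ⟨h1, h2, h3⟩
      rw [valIndex] at h3
      have h4 := h1 r (by omega)
      have h5 : Y % B = v r := by
        rw [← h3, Nat.add_mul_mod_self_left, Nat.mod_eq_of_lt h4]
      have h6 : Y / B = valIndex B r v := by
        rw [← h3, Nat.add_mul_div_left _ _ hB, Nat.div_eq_of_lt h4, zero_add]
      refine ⟨Function.update v r 0, (ih _ _).2 ⟨fun i hi => ?_, fun i hi => ?_, ?_⟩, ?_⟩
      · simpa [hi.ne] using h1 i (by omega)
      · by_cases h : i = r
        · subst h; simp
        · simpa [h] using h2 i (by omega)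
      · rw [h6]
        exact valIndex_congr fun i hi => by simp [hi.ne]
      · rw [Function.update_idem, h5, Function.update_eq_self]

/-! ### The circuits -/

/-- The number of bits of a variable. -/
def varBits (C n : ℕ) : ℕ := C * (Nat.size n + 1)

/-- For $n>0$ one has $2^{\mathrm{size}(n)-1}\le n$, so $2^{\mathrm{size}(n)+1}\le 4n$; the summand
2 covers $n=0$. This makes the circuits polynomial in size. -/
theorem two_pow_varBits_le (C n : ℕ) : 2 ^ varBits C n ≤ (4 * n + 2) ^ C := by
  rw [varBits, mul_comm, pow_mul]
  refine Nat.pow_le_pow_left ?_ C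
  rcases Nat.eq_zero_or_pos n with rfl | hn
  · simp
  · have h1 : 0 < Nat.size n := Nat.size_pos.2 hn
    have h2 : 2 ^ (Nat.size n - 1) ≤ n := Nat.lt_size.1 (by omega)
    obtain ⟨s, hs⟩ : ∃ s, Nat.size n = s + 1 := ⟨Nat.size n - 1, by omega⟩
    rw [hs] at h2 ⊢
    simp only [Nat.add_sub_cancel] at h2
    rw [pow_succ, pow_succ]
    omega

namespace FmlCircuit

variable {w l : ℕ} (C : ℕ) (g : Fin w) (ρ : Fin l → Fml w)

abbrev Node : Type := {φ : Fml w // ∃ β, φ ∈ (ρ β).subs}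

instance : Finite (Node ρ) := by
  have : {φ : Fml w | ∃ β, φ ∈ (ρ β).subs} = ⋃ β, {φ | φ ∈ (ρ β).subs} := by ext; simp
  have h : {φ : Fml w | ∃ β, φ ∈ (ρ β).subs}.Finite := by
    rw [this]
    exact Set.finite_iUnion fun β => List.finite_toSet _
  exact h

abbrev Val (w C n : ℕ) : Type := Fin w → Fin (2 ^ varBits C n)

abbrev Gate (n : ℕ) : Type := (Node ρ × Val w C n) ⊕ Fin n

def child {φ ψ : Fml w} (h : ∃ β, ψ ∈ (ρ β).subs) (hφ : φ ∈ ψ.subs) : Node ρ :=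
  ⟨φ, h.imp fun _ h => Fml.mem_subs_trans hφ h⟩

/-- An existential quantifier becomes a disjunction over all values of its variable. An input atom
that points beyond the input has no wire, so its empty disjunction is false, in agreement with the
default value of `getD`. -/
def ins (n : ℕ) : Gate C ρ n → List (Gate C ρ n)
  | .inr _ => []
  | .inl (⟨.num _, _⟩, _) => []
  | .inl (⟨.inp v, _⟩, val) => if h : (val v).1 < n then [.inr ⟨(val v).1, h⟩] else []
  | .inl (⟨.not φ, h⟩, val) => [.inl (child ρ h (List.mem_cons_of_mem _ φ.self_mem_subs), val)]
  | .inl (⟨.and φ ψ, h⟩, val) =>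
    [.inl (child ρ h (List.mem_cons_of_mem _ (List.mem_append_left _ φ.self_mem_subs)), val),
      .inl (child ρ h (List.mem_cons_of_mem _ (List.mem_append_right _ ψ.self_mem_subs)), val)]
  | .inl (⟨.ex v φ, h⟩, val) => List.ofFn fun i =>
    .inl (child ρ h (List.mem_cons_of_mem _ φ.self_mem_subs), Function.update val v i)

-- A numerical atom does not depend on the input bits. It becomes a constant: an empty conjunction
-- if it is true, an empty disjunction if it is false. Its evaluation is thereby shifted to the
-- machine that computes gate types.
open scoped Classical in
noncomputable def nodeKind (n : ℕ) (val : Fin w → ℕ) : Fml w → GateKind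
  | .num P => if P (Fml.env g n val) then .and else .or
  | .inp _ => .or
  | .not _ => .not
  | .and _ _ => .and
  | .ex _ _ => .or

noncomputable def kind (n : ℕ) : Gate C ρ n → GateKind
  | .inr i => .input i
  | .inl (φ, val) => nodeKind g n (fun v => val v) φ.1

def rank (n : ℕ) : Gate C ρ n → ℕ
  | .inr _ => 0
  | .inl (φ, _) => φ.1.rank

theorem rank_lt {n : ℕ} {u v : Gate C ρ n} (h : u ∈ ins C ρ n v) :
    rank C ρ n u < rank C ρ n v := by
  rcases v with ⟨⟨φ, hφ⟩, val⟩ | i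
  · cases φ with
    | num P => simp [ins] at h
    | inp v =>
      simp only [ins] at h
      split at h
      · rw [List.mem_singleton] at h
        subst h
        simp [rank, Fml.rank]
      · simp at h
    | not φ =>
      simp only [ins, List.mem_singleton] at h
      subst h
      simp [rank, Fml.rank, child]
    | and φ ψ =>
      simp only [ins, List.mem_cons, List.not_mem_nil, or_false] at h
      rcases h with rfl | rfl <;> simp [rank, Fml.rank, child]
    | ex v φ =>
      simp only [ins, List.mem_ofFn] at h
      obtain ⟨i, rfl⟩ := h
      simp [rank, Fml.rank, child]
  · simp [ins] at h

/-- The valuation given by a function on the natural numbers. -/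
def toVal (n : ℕ) (v : ℕ → ℕ) : Val w C n :=
  fun i => ⟨v i % 2 ^ varBits C n, Nat.mod_lt _ (by positivity)⟩

def root (β : Fin l) : Node ρ := ⟨ρ β, β, (ρ β).self_mem_subs⟩

def outs (n : ℕ) : List (Gate C ρ n) :=
  (vals (2 ^ varBits C n) w).flatMap fun v => List.ofFn fun β => .inl (root ρ β, toVal C n v)

noncomputable def circuit (n : ℕ) : BoolCircuit n where
  Gate := Gate C ρ n
  gateFintype := Fintype.ofFinite _
  kind := kind C g ρ n
  ins := ins C ρ n
  outs := outs C ρ n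
  input_lt := by
    rintro (⟨⟨φ, hφ⟩, val⟩ | j) i h
    · cases φ <;> simp only [kind, nodeKind] at h <;> try cases h
      split at h <;> cases h
    · simp only [kind, GateKind.input.injEq] at h
      exact h ▸ j.2
  input_ins := by
    rintro (⟨⟨φ, hφ⟩, val⟩ | j) i h
    · cases φ <;> simp only [kind, nodeKind] at h <;> try cases h
      rfl
    · rfl
  not_ins := by
    rintro (⟨⟨φ, hφ⟩, val⟩ | j) h
    · cases φ <;> simp only [kind, nodeKind] at h <;> try cases h
      · split at h <;> cases h
      · rfl
    · simp [kind] at h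
  acyclic := Subrelation.wf (fun h => rank_lt C ρ h) (measure (rank C ρ n)).wf

/-- The value of a gate. -/
noncomputable def evalGate (n : ℕ) (x : List Bool) (u : Gate C ρ n) : Bool :=
  (circuit C g ρ n).eval x u

theorem evalGate_eq (n : ℕ) (x : List Bool) (u : Gate C ρ n) :
    evalGate C g ρ n x u =
      (kind C g ρ n u).apply x ((ins C ρ n u).map (evalGate C g ρ n x)) :=
  (circuit C g ρ n).eval_eq x u

theorem eval_inr (n : ℕ) (x : List Bool) (i : Fin n) :
    evalGate C g ρ n x (.inr i) = x.getD i false := by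
  rw [evalGate_eq]
  rfl

theorem eval_inl (n : ℕ) (x : List Bool) (hx : x.length = n) (φ : Fml w)
    (h : ∃ β, φ ∈ (ρ β).subs) (val : Val w C n) :
    evalGate C g ρ n x (.inl (⟨φ, h⟩, val)) = true ↔
      φ.Holds g (2 ^ varBits C n) n x fun v => val v := by
  induction φ generalizing val with
  | num P =>
    rw [evalGate_eq]
    simp only [kind, nodeKind, ins, Fml.Holds]
    split <;> simp [GateKind.apply, *]
  | inp v =>
    rw [evalGate_eq]
    simp only [kind, nodeKind, ins, Fml.Holds]
    split
    · have := eval_inr C g ρ n x ⟨(val v).1, ‹_›⟩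
      simp [GateKind.apply, this]
    · rename_i h1
      have : x.length ≤ (val v).1 := by omega
      simp [GateKind.apply, this]
  | not φ ih =>
    rw [evalGate_eq]
    have := ih (child ρ h (List.mem_cons_of_mem _ φ.self_mem_subs)).2 val
    simp only [kind, nodeKind, ins, Fml.Holds] at this ⊢
    rw [← this]
    simp [GateKind.apply, child]
  | and φ ψ ih ih' =>
    rw [evalGate_eq]
    have h1 := ih (child ρ h
      (List.mem_cons_of_mem _ (List.mem_append_left _ φ.self_mem_subs))).2 val
    have h2 := ih' (child ρ h
      (List.mem_cons_of_mem _ (List.mem_append_right _ ψ.self_mem_subs))).2 val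
    simp only [kind, nodeKind, ins, Fml.Holds] at h1 h2 ⊢
    rw [← h1, ← h2]
    simp [GateKind.apply, child]
  | ex v φ ih =>
    rw [evalGate_eq]
    have h1 := fun i => ih (child ρ h (List.mem_cons_of_mem _ φ.self_mem_subs)).2
      (Function.update val v i)
    simp only [kind, nodeKind, ins, Fml.Holds] at h1 ⊢
    have e : ∀ i : Fin (2 ^ varBits C n), (fun u => ((Function.update val v i) u : ℕ)) =
        Function.update (fun u => (val u : ℕ)) v i := by
      intro i
      funext u
      by_cases hu : u = v
      · subst hu; simp
      · simp [hu]
    simp only [e] at h1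
    constructor
    · intro h2
      simp only [GateKind.apply, List.any_eq_true, List.mem_map, List.mem_ofFn] at h2
      obtain ⟨_, ⟨_, ⟨i, rfl⟩, rfl⟩, h3⟩ := h2
      exact ⟨i, i.2, (h1 i).1 h3⟩
    · rintro ⟨i, hi, h3⟩
      simp only [GateKind.apply, List.any_eq_true, List.mem_map, List.mem_ofFn]
      exact ⟨_, ⟨_, ⟨⟨i, hi⟩, rfl⟩, rfl⟩, (h1 ⟨i, hi⟩).2 h3⟩

open scoped Classical in
theorem output_eq (x : List Bool) :
    (circuit C g ρ x.length).output x =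
      (vals (2 ^ varBits C x.length) w).flatMap fun v => List.ofFn fun β =>
        decide ((ρ β).Holds g (2 ^ varBits C x.length) x.length x fun i => v i) := by
  have h0 : (circuit C g ρ x.length).output x =
      (outs C ρ x.length).map (evalGate C g ρ x.length x) := rfl
  rw [h0, outs, List.map_flatMap]
  refine List.flatMap_congr fun v hv => ?_
  obtain ⟨Y, hY⟩ := List.mem_iff_getElem?.1 hv
  have hv := (getElem?_vals (by positivity) _ _ _).1 hY
  rw [List.map_ofFn]
  congr 1
  funext β
  have := eval_inl C g ρ x.length x rfl (ρ β) (root ρ β).2 (toVal C x.length v)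
  have e : (fun i => ((toVal C x.length v : Val w C x.length) i : ℕ)) = fun i : Fin w => v i := by
    funext i
    exact Nat.mod_eq_of_lt (hv.1 i i.2)
  rw [e] at this
  rw [Bool.eq_iff_iff, decide_eq_true_iff, ← this]
  rfl

theorem depthAtMost : ∃ d, ∀ n, (circuit C g ρ n).DepthAtMost d := by
  have := Fintype.ofFinite (Node ρ)
  refine ⟨Finset.univ.sup fun φ : Node ρ => φ.1.rank, fun n p hp => ?_⟩
  have key : ∀ (p : List (Gate C ρ n)) (u : Gate C ρ n),
      (u :: p).IsChain (fun g u => g ∈ ins C ρ n u) →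
        rank C ρ n u + (u :: p).length ≤
          (Finset.univ.sup fun φ : Node ρ => φ.1.rank) + 1 := by
    intro p
    induction p with
    | nil =>
      intro u _
      refine Nat.add_le_add_right ?_ 1
      rcases u with ⟨φ, val⟩ | i
      · exact Finset.le_sup (f := fun φ : Node ρ => φ.1.rank) (Finset.mem_univ φ)
      · simp [rank]
    | cons v p ih =>
      intro u h
      rw [List.isChain_cons_cons] at h
      have h1 := ih v h.2
      have h2 := rank_lt C ρ h.1
      simp only [List.length_cons] at *
      omega
  cases p with
  | nil => simp
  | cons u p => exact (Nat.le_add_left _ _).trans (key p u hp)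

theorem length_ins_le (n : ℕ) (u : Gate C ρ n) : (ins C ρ n u).length ≤ 2 + 2 ^ varBits C n := by
  rcases u with ⟨⟨φ, h⟩, val⟩ | i
  · cases φ with
    | inp v => simp only [ins]; split <;> simp <;> omega
    | _ => simp [ins] <;> exact le_add_right (by norm_num)
  · simp [ins]

theorem size_le : ∃ p : Polynomial ℕ, ∀ n, (circuit C g ρ n).size ≤ p.eval n := by
  let X : Polynomial ℕ := (4 * Polynomial.X + 2) ^ C
  refine ⟨(Polynomial.C (Nat.card (Node ρ)) * X ^ w + Polynomial.X) * (3 + X) +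
    X ^ w * Polynomial.C l, fun n => ?_⟩
  have hX : 2 ^ varBits C n ≤ X.eval n := by
    refine (two_pow_varBits_le C n).trans (le_of_eq ?_)
    simp [X]
  generalize X = X at *
  simp only [Polynomial.eval_add, Polynomial.eval_mul, Polynomial.eval_pow, Polynomial.eval_C,
    Polynomial.eval_X, Polynomial.eval_ofNat]
  have h0 : (circuit C g ρ n).size =
      (letI := Fintype.ofFinite (Gate C ρ n); ∑ u : Gate C ρ n, (1 + (ins C ρ n u).length)) +
        (outs C ρ n).length := rfl
  have hcard : Nat.card (Gate C ρ n) = Nat.card (Node ρ) * (2 ^ varBits C n) ^ w + n := by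
    rw [Nat.card_sum, Nat.card_prod]
    simp
  rw [h0]
  refine Nat.add_le_add ?_ ?_
  · let := Fintype.ofFinite (Gate C ρ n)
    calc ∑ u : Gate C ρ n, (1 + (ins C ρ n u).length)
        ≤ ∑ _u : Gate C ρ n, (3 + 2 ^ varBits C n) := Finset.sum_le_sum fun u _ => by
          have := length_ins_le C ρ n u
          omega
      _ = Nat.card (Gate C ρ n) * (3 + 2 ^ varBits C n) := by
          rw [Finset.sum_const, Finset.card_univ, smul_eq_mul, Nat.card_eq_fintype_card]
      _ ≤ _ := by rw [hcard]; gcongr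
  · have : (outs C ρ n).length = (2 ^ varBits C n) ^ w * l := by
      simp [outs, List.length_flatMap, length_vals]
    rw [this]
    gcongr

end FmlCircuit

/-! ## Uniformity of the circuits for formulas -/

namespace Recog

variable {ι : Type}

theorem linear (L : List (ℤ × ι)) (D : ℤ) :
    Recog fun T : ι → List Bool => (L.map fun p => p.1 * (bitsNum (T p.2) : ℤ)).sum ≤ D := by
  refine ((linear_le (fun j : Fin L.length => (L.get j).1) D).comap
    fun j => (L.get j).2).congr fun T => ?_
  rw [← Fin.sum_univ_fun_getElem]
  rfl

theorem num_eq (i j : ι) : Recog fun T : ι → List Bool => bitsNum (T i) = bitsNum (T j) := by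
  refine ((linear [(1, i), (-1, j)] 0).and (linear [(-1, i), (1, j)] 0)).congr fun T => ?_
  simp
  omega

theorem num_lt (i j : ι) : Recog fun T : ι → List Bool => bitsNum (T i) < bitsNum (T j) := by
  refine (linear [(1, i), (-1, j)] (-1)).congr fun T => ?_
  simp
  omega

theorem num_eq_const (i : ι) (m : ℕ) : Recog fun T : ι → List Bool => bitsNum (T i) = m := by
  refine ((linear [(1, i)] m).and (linear [(-1, i)] (-m))).congr fun T => ?_
  simp
  omega

theorem num_eq_mul_add (i j : ι) (l b : ℕ) :
    Recog fun T : ι → List Bool => bitsNum (T i) = l * bitsNum (T j) + b := by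
  refine ((linear [(1, i), (-l, j)] b).and (linear [(-1, i), (l, j)] (-b))).congr fun T => ?_
  simp
  zify
  generalize (l : ℤ) * (bitsNum (T j) : ℤ) = z
  omega

end Recog

theorem bitsNum_bits (m : ℕ) : bitsNum m.bits = m := by
  induction m using Nat.binaryRec' with
  | zero => simp
  | bit b m h ih =>
    rw [Nat.bits_append_bit _ _ h, bitsNum_cons, ih, Nat.bit_val]
    ring

namespace Recog

variable {ι : Type}

theorem eq_bits (i : ι) (m : ℕ) : Recog fun T : ι → List Bool => T i = m.bits := by
  refine ((canonical i).and (num_eq_const i m)).congr fun T => ?_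
  rw [eq_iff_iff]
  constructor
  · rintro ⟨h1, h2⟩
    rw [← h1, h2]
  · intro h
    rw [h, bitsNum_bits]
    simp

theorem eq_nil (i : ι) : Recog fun T : ι → List Bool => T i = [] := by
  simpa using eq_bits i 0

end Recog

/-- The binary representation with `L` digits. -/
def padBits : ℕ → ℕ → List Bool
  | 0, _ => []
  | L + 1, m => decide (m % 2 = 1) :: padBits L (m / 2)

@[simp] theorem length_padBits (L m : ℕ) : (padBits L m).length = L := by
  induction L generalizing m with
  | zero => rfl
  | succ L ih => simp [padBits, ih]

theorem bitsNum_padBits {L m : ℕ} (h : m < 2 ^ L) : bitsNum (padBits L m) = m := by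
  induction L generalizing m with
  | zero => simp at h; simp [padBits, h]
  | succ L ih =>
    rw [pow_succ] at h
    rw [padBits, bitsNum_cons, ih (by omega)]
    rcases Nat.mod_two_eq_zero_or_one m with h1 | h1 <;> simp [h1] <;> omega

theorem bitsNum_lt (l : List Bool) : bitsNum l < 2 ^ l.length := by
  induction l with
  | nil => simp
  | cons b l ih => cases b <;> simp [pow_succ] <;> omega

theorem padBits_bitsNum (l : List Bool) : padBits l.length (bitsNum l) = l := by
  induction l with
  | nil => rfl
  | cons b l ih =>
    have h : bitsNum (b :: l) / 2 = bitsNum l := by cases b <;> simp <;> omega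
    rw [List.length_cons, padBits, h, ih]
    cases b <;> simp

theorem count_true_eq_popcount (l : List Bool) : l.count true = popcount (bitsNum l) := by
  induction l with
  | nil => simp [popcount]
  | cons b l ih =>
    have h1 : bitsNum (b :: l) = Nat.bit b (bitsNum l) := by
      cases b <;> simp [Nat.bit_val] <;> ring
    rw [h1, popcount]
    by_cases h : bitsNum l = 0 → b = true
    · rw [Nat.bits_append_bit _ _ h, List.count_cons, List.count_cons, ih, popcount]
    · push Not at h
      obtain ⟨h2, rfl⟩ := (by simpa using h : bitsNum l = 0 ∧ b = false)
      rw [List.count_cons, ih, h2]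
      simp [popcount]

/-! ### Names of the gates. -/

namespace FmlCircuit

variable {w l : ℕ} (C : ℕ) (g : Fin w) (ρ : Fin l → Fml w)

/-- A numbering of the finitely many subformulas. Names contain the number plus one, whose binary
representation is non-empty, so that an empty last block can mark the input gates. -/
noncomputable def idx (ψ : Node ρ) : ℕ := Finite.equivFin (Node ρ) ψ

theorem idx_injective : Function.Injective (idx ρ) := fun _ _ h =>
  (Finite.equivFin (Node ρ)).injective (Fin.ext h)

/-- The blocks of the name of a gate. -/
noncomputable def desc (n : ℕ) : Gate C ρ n → ℕ → List Bool
  | .inl (ψ, val), i => if h : i < w then padBits (varBits C n) (val ⟨i, h⟩) else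
      if i = w then [] else (idx ρ ψ + 1).bits
  | .inr j, i => if i = w then j.1.bits else []

noncomputable def name (n : ℕ) (u : Gate C ρ n) : List Bool := packFrom 0 (w + 2) (desc C ρ n u)

/-- The blocks name a gate for a given subformula. -/
def NodeOK (L : ℕ) (ψ : Node ρ) (D : ℕ → List Bool) : Prop :=
  (∀ i : Fin w, (D i).length = L) ∧ D w = [] ∧ D (w + 1) = (idx ρ ψ + 1).bits

/-- The blocks name an input gate. -/
def InpOK (w n : ℕ) (D : ℕ → List Bool) : Prop :=
  (∀ i : Fin w, D i = []) ∧ ((bitsNum (D w)).bits = D w ∧ bitsNum (D w) < n) ∧ D (w + 1) = []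

-- This lemma and the next three show that `NodeOK` and `InpOK` describe exactly the block sequences
-- of names. These predicates replace quantification over gates by conditions on strings.
variable {C ρ} in
theorem nodeOK_desc {n : ℕ} {ψ : Node ρ} {val : Val w C n} {D : ℕ → List Bool}
    (h : ∀ i < w + 2, D i = desc C ρ n (.inl (ψ, val)) i) :
    NodeOK ρ (varBits C n) ψ D ∧ (fun i : Fin w => bitsNum (D i)) = fun i => (val i : ℕ) := by
  refine ⟨⟨fun i => ?_, ?_, ?_⟩, funext fun i => ?_⟩
  · rw [h i (by omega)]
    simp [desc]
  · rw [h w (by omega)]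
    simp [desc]
  · rw [h (w + 1) (by omega)]
    simp [desc]
  · rw [h i (by omega)]
    simp only [desc, i.2, dite_true]
    exact bitsNum_padBits (val i).2

variable {C ρ} in
theorem desc_of_nodeOK {n : ℕ} {ψ : Node ρ} {D : ℕ → List Bool}
    (h : NodeOK ρ (varBits C n) ψ D) :
    ∃ val : Val w C n, ∀ i < w + 2, D i = desc C ρ n (.inl (ψ, val)) i := by
  obtain ⟨h1, h2, h3⟩ := h
  refine ⟨fun i => ⟨bitsNum (D i), h1 i ▸ bitsNum_lt _⟩, fun i hi => ?_⟩
  by_cases hw : i < w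
  · simp only [desc, hw, dite_true]
    rw [← h1 ⟨i, hw⟩, padBits_bitsNum]
  · by_cases hw' : i = w
    · subst hw'; simp [desc, h2]
    · have : i = w + 1 := by omega
      subst this; simp [desc, h3]

variable {C ρ} in
theorem inpOK_desc {n : ℕ} {j : Fin n} {D : ℕ → List Bool}
    (h : ∀ i < w + 2, D i = desc C ρ n (.inr j) i) : InpOK w n D ∧ bitsNum (D w) = j := by
  have h1 : D w = j.1.bits := by
    rw [h w (by omega)]
    simp [desc]
  refine ⟨⟨fun i => ?_, ?_, ?_⟩, ?_⟩
  · rw [h i (by omega)]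
    simp [desc, i.2.ne]
  · rw [h1, bitsNum_bits]
    exact ⟨rfl, j.2⟩
  · rw [h (w + 1) (by omega)]
    simp [desc]
  · rw [h1, bitsNum_bits]

variable {C ρ} in
theorem desc_of_inpOK {n : ℕ} {D : ℕ → List Bool} (h : InpOK w n D) :
    ∃ j : Fin n, ∀ i < w + 2, D i = desc C ρ n (.inr j) i := by
  obtain ⟨h1, ⟨h2, h2'⟩, h3⟩ := h
  refine ⟨⟨bitsNum (D w), h2'⟩, fun i hi => ?_⟩
  by_cases hw : i < w
  · simp [desc, hw.ne, h1 ⟨i, hw⟩]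
  · by_cases hw' : i = w
    · subst hw'; simp [desc, h2]
    · have : i = w + 1 := by omega
      subst this; simp [desc, h3]

theorem packFrom_eq_name_iff (a n : ℕ) (T : ℕ → List Bool) (u : Gate C ρ n) :
    packFrom a (w + 2) T = name C ρ n u ↔ ∀ i < w + 2, T (a + i) = desc C ρ n u i := by
  rw [packFrom_shift, name]
  constructor
  · intro h i hi
    simpa using packFrom_inj h i hi
  · intro h
    exact packFrom_congr fun i hi => by simpa using h i hi

theorem name_injective (n : ℕ) : Function.Injective (name C ρ n) := by
  intro u v h
  have h := (packFrom_eq_name_iff C ρ 0 n (desc C ρ n u) v).1 h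
  simp only [zero_add] at h
  rcases u with ⟨ψ, val⟩ | j <;> rcases v with ⟨ψ', val'⟩ | j'
  · obtain ⟨⟨-, -, h1⟩, h2⟩ := nodeOK_desc h
    obtain ⟨⟨-, -, h1'⟩, h2'⟩ := nodeOK_desc (ψ := ψ) (val := val) fun i _ => rfl
    have e : idx ρ ψ + 1 = idx ρ ψ' + 1 := by
      rw [← bitsNum_bits (idx ρ ψ + 1), ← h1', h1, bitsNum_bits]
    have e1 : ψ = ψ' := idx_injective ρ (by omega)
    have e2 : val = val' := by
      funext i
      exact Fin.ext (congrFun (h2'.symm.trans h2) i)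
    rw [e1, e2]
  · have h1 := h (w + 1) (by omega)
    simp [desc] at h1
    have := congrArg bitsNum h1
    rw [bitsNum_bits] at this
    simp at this
  · have h1 := h (w + 1) (by omega)
    simp [desc] at h1
    have := congrArg bitsNum h1
    rw [bitsNum_bits] at this
    simp at this
  · have h1 := (inpOK_desc h).2
    have h2 := (inpOK_desc (C := C) (ρ := ρ) (j := j) fun i _ => rfl).2
    rw [Fin.ext (h2.symm.trans h1)]

theorem length_name_le : ∃ c, ∀ n u, (name C ρ n u).length ≤ c * (Nat.size n + 1) := by
  refine ⟨(w + 2) * (2 * (C + 1 + Nat.size (Nat.card (Node ρ) + 1)) + 2), fun n u => ?_⟩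
  have : ∀ i < w + 2, (desc C ρ n u (0 + i)).length ≤
      (C + 1 + Nat.size (Nat.card (Node ρ) + 1)) * (Nat.size n + 1) := by
    intro i _
    rw [zero_add]
    generalize hK : Nat.size (Nat.card (Node ρ) + 1) = K
    have e : (C + 1 + K) * (Nat.size n + 1) =
      C * (Nat.size n + 1) + (Nat.size n + 1) + K * (Nat.size n + 1) := by ring
    have e' : K ≤ K * (Nat.size n + 1) := Nat.le_mul_of_pos_right _ (Nat.succ_pos _)
    rw [e]
    rcases u with ⟨ψ, val⟩ | j
    · simp only [desc]
      split
      · rw [length_padBits, varBits]; omega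
      · split
        · simp
        · rw [Nat.size_eq_bits_len]
          have : Nat.size (idx ρ ψ + 1) ≤ K := by
            rw [← hK]
            refine Nat.size_le_size ?_
            have := (Finite.equivFin (Node ρ) ψ).2
            unfold idx
            omega
          omega
    · simp only [desc]
      split
      · rw [Nat.size_eq_bits_len]
        have := Nat.size_le_size j.2.le
        omega
      · simp
  refine (length_packFrom_le this).trans ?_
  rw [mul_assoc]
  refine Nat.mul_le_mul_left _ ?_
  ring_nf
  have := Nat.zero_le (Nat.size n)
  omega

section

variable {ι : Type}

/-- The required width of the value blocks is not a constant; it is read off a further track `e` of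
that length, with which the blocks are compared. -/
theorem recog_nodeOK (ψ : Node ρ) (f : ℕ → ι) (e : ι) :
    Recog fun T : ι → List Bool => NodeOK ρ (T e).length ψ fun i => T (f i) :=
  (Recog.all fun _ => Recog.length_eq _ _).and ((Recog.eq_nil _).and (Recog.eq_bits _ _))

theorem recog_inpOK (w : ℕ) (f : ℕ → ι) (e : ι) :
    Recog fun T : ι → List Bool => InpOK w (bitsNum (T e)) fun i => T (f i) :=
  (Recog.all fun _ => Recog.eq_nil _).and
    (((Recog.canonical _).and (Recog.num_lt _ _)).and (Recog.eq_nil _))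

end

end FmlCircuit

namespace FmlCircuit

open PieceState

variable {w l : ℕ} (C : ℕ) (g : Fin w) (ρ : Fin l → Fml w)

variable {ρ} in
theorem nodeOK_congr {L : ℕ} {ψ : Node ρ} {D D' : ℕ → List Bool} (h : ∀ i < w + 2, D i = D' i) :
    NodeOK ρ L ψ D ↔ NodeOK ρ L ψ D' := by
  unfold NodeOK
  rw [h w (by omega), h (w + 1) (by omega), forall_congr' fun i : Fin w => by rw [h i (by omega)]]

theorem inpOK_congr {n : ℕ} {D D' : ℕ → List Bool} (h : ∀ i < w + 2, D i = D' i) :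
    InpOK w n D ↔ InpOK w n D' := by
  unfold InpOK
  rw [h w (by omega), h (w + 1) (by omega), forall_congr' fun i : Fin w => by rw [h i (by omega)]]

/-- The track of a piece. -/
def blk (P i : ℕ) : Option (Fin P ⊕ Bool) := if h : i < P then some (.inl ⟨i, h⟩) else none

theorem split_blk {P C g : ℕ} {wh : ℕ → Bool} {T : ℕ → List Bool} {i : ℕ} (h : i < P) :
    split P C g wh T (blk P i) = T i := by
  simp [blk, h, split]

/-- The first piece contributes its digits and one separator, hence `Nat.size n + 1` letters, each
of which emits `C` ones. -/
theorem length_split {P C g : ℕ} {wh : ℕ → Bool} {T : ℕ → List Bool} {n : ℕ}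
    (h : T (P - 1) = n.bits) : (split P C g wh T (some (.inr true))).length = varBits C n := by
  simp [split, h, Nat.size_eq_bits_len, varBits]

/-- A relation on tuples of a fixed shape is decidable in linear time if it is recognised by a
finite automaton on the strings that are extracted from the tuple. -/
theorem linearTimeDecidable_of_pieces (sh : ℕ → PieceKind) (P C g : ℕ) (wh : ℕ → Bool)
    (hP : 0 < P) (hg : g < P) (hraw : sh (P - 1) = .raw)
    (Q : (Option (Fin P ⊕ Bool) → List Bool) → Prop) (hQ : Recog Q)
    (enc : (ℕ → List Bool) → List (List Bool))
    (henc : ∀ T, encodeTuple (enc T) = renderPieces sh P T) (Rel : List (List Bool) → Prop)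
    (hR : ∀ T, (∀ i, sh i = .closing → T i = []) → (Rel (enc T) ↔ Q (split P C g wh T)))
    (hRel : ∀ t, Rel t → ∃ T, (∀ i, sh i = .closing → T i = []) ∧ t = enc T) :
    LinearTimeDecidable Rel := by
  classical
  refine ⟨fun t => [decide (Rel t)], ?_, fun t => by simp +contextual⟩
  refine linearTimeComputable_of_pieces sh P C g wh hP hg hraw (fun T => ([decide (Q T)], false))
    (hQ.map fun q => ([decide q], false)) ⟨0, hP⟩ enc henc _ [false] (fun T hT => ?_)
    fun t ht => ?_
  · simp [hR T hT]
  · have : ¬ Rel t := fun h => ht (hRel t h)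
    simp [this]

theorem bits_inj {m n : ℕ} (h : m.bits = n.bits) : m = n := by
  rw [← bitsNum_bits m, h, bitsNum_bits]

/-! ### Types of gates -/

-- The kind of a node as a function of finite data: the subformula and the truth value of its atom.
open scoped Classical in
noncomputable def kindOf : Fml w → Prop → GateKind
  | .num _, r => if r then .and else .or
  | .inp _, _ => .or
  | .not _, _ => .not
  | .and _ _, _ => .and
  | .ex _ _, _ => .or

def atom (env : Src w → ℕ) : Fml w → Prop
  | .num P => P env
  | _ => True

theorem kindOf_atom (n : ℕ) (val : Fin w → ℕ) (ψ : Fml w) :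
    kindOf ψ (atom (Fml.env g n val) ψ) = nodeKind g n val ψ := by
  cases ψ <;> rfl

-- The code of an input gate contains its index, which is unbounded; the flag `true` requests that a
-- block of the name be appended to the output. All other codes are constants.
open scoped Classical in
noncomputable def kindCode (p : Prop) (q r : Node ρ → Prop) : List Bool × Bool :=
  if p then ([false], true) else
    if h : ∃ ψ, q ψ then (GateKind.code (some (kindOf h.choose.1 (r h.choose))), false)
    else ([], false)

theorem kindCode_of_unique (p : Prop) (q r : Node ρ → Prop) (ψ : Node ρ) (hp : ¬ p) (h : q ψ)
    (hq : ∀ φ, q φ → φ = ψ) :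
    kindCode ρ p q r = (GateKind.code (some (kindOf ψ.1 (r ψ))), false) := by
  have h' : ∃ φ, q φ := ⟨ψ, h⟩
  rw [kindCode, if_neg hp, dif_pos h', hq _ h'.choose_spec]

variable {ρ} in
theorem nodeOK_unique {L : ℕ} {ψ φ : Node ρ} {D : ℕ → List Bool} (h : NodeOK ρ L ψ D)
    (h' : NodeOK ρ L φ D) : φ = ψ := by
  have := bits_inj (h.2.2.symm.trans h'.2.2)
  exact idx_injective ρ (by omega)

open scoped Classical in
/-- The type of a gate, computed from its name. -/
noncomputable def kindOfTuple (t : List (List Bool)) : Option GateKind :=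
  if h : ∃ p : Σ n, Gate C ρ n, t = [p.1.bits, name C ρ p.1 p.2] then
    some (kind C g ρ h.choose.1 h.choose.2) else none

theorem kindOfTuple_name (n : ℕ) (u : Gate C ρ n) :
    kindOfTuple C g ρ [n.bits, name C ρ n u] = some (kind C g ρ n u) := by
  have h : ∃ p : Σ n, Gate C ρ n, [n.bits, name C ρ n u] = [p.1.bits, name C ρ p.1 p.2] :=
    ⟨⟨n, u⟩, rfl⟩
  rw [kindOfTuple, dif_pos h]
  have := h.choose_spec
  generalize h.choose = p at *
  obtain ⟨n', u'⟩ := p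
  simp only [List.cons.injEq, and_true] at this
  obtain ⟨h1, h2⟩ := this
  obtain rfl := bits_inj h1
  rw [name_injective C ρ n h2]

theorem kindOfTuple_eq_none {t : List (List Bool)}
    (h : ∀ n u, t ≠ [n.bits, name C ρ n u]) : kindOfTuple C g ρ t = none := by
  rw [kindOfTuple, dif_neg]
  rintro ⟨⟨n, u⟩, hp⟩
  exact h n u hp

/-- A finite automaton finds the subformula that is named and evaluates its atom on the digits of
$n$, of the variables, and of the number of ones of variable `g`. That last number is not automatic,
but it is supplied by the counter of the splitter, applied to piece `1 + g`. -/
theorem kind_linear (hρ : ∀ β, (ρ β).Auto) :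
    LinearTimeComputable fun t => GateKind.code (kindOfTuple C g ρ t) := by
  have hauto : ∀ ψ : Node ρ, ψ.1.Auto := fun ψ => by
    obtain ⟨β, hβ⟩ := ψ.2
    exact Fml.auto_of_mem_subs hβ (hρ β)
  let P := w + 4
  let raw : Option (Fin P ⊕ Bool) := blk P (w + 3)
  let D : ℕ → Option (Fin P ⊕ Bool) := fun i => blk P (1 + i)
  let src : Src w → Option (Fin P ⊕ Bool) := fun s => match s with
    | .n => raw
    | .pop => none
    | .var v => D v
  let canon : (Option (Fin P ⊕ Bool) → List Bool) → Prop := fun T =>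
    (bitsNum (T raw)).bits = T raw
  let p : (Option (Fin P ⊕ Bool) → List Bool) → Prop := fun T =>
    canon T ∧ InpOK w (bitsNum (T raw)) fun i => T (D i)
  let q : Node ρ → (Option (Fin P ⊕ Bool) → List Bool) → Prop := fun ψ T =>
    canon T ∧ NodeOK ρ (T (some (.inr true))).length ψ fun i => T (D i)
  let r : Node ρ → (Option (Fin P ⊕ Bool) → List Bool) → Prop := fun ψ T =>
    atom (fun s => bitsNum (T (src s))) ψ.1
  have hp : Recog p := (Recog.canonical _).and (recog_inpOK w D raw)
  have hq : ∀ ψ, Recog (q ψ) := fun ψ => (Recog.canonical _).and (recog_nodeOK ρ ψ D _)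
  have hr : ∀ ψ, Recog (r ψ) := by
    rintro ⟨ψ, hψ⟩
    have h := hauto ⟨ψ, hψ⟩
    cases ψ with
    | num P => exact Recog.comap h src
    | _ => exact Recog.const True
  -- The pieces, from the end of the tuple: the closing mark of the name, its `w + 2` blocks from
  -- index 1 on, and `n` itself.
  let sh : ℕ → PieceKind := fun i => if i = 0 then .closing else if i = w + 3 then .raw else .inner
  refine linearTimeComputable_of_pieces sh P C (1 + g) (fun _ => false) (by simp [P])
    (by simp only [P]; omega) (by simp [P, sh])
    (fun T => kindCode ρ (p T) (fun ψ => q ψ T) fun ψ => r ψ T)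
    (Recog.map (fun z : Prop × (Node ρ → Prop) × (Node ρ → Prop) => kindCode ρ z.1 z.2.1 z.2.2)
      (Recog.map₂ Prod.mk hp (Recog.map₂ Prod.mk (Recog.pi hq) (Recog.pi hr))))
    ⟨1 + w, by simp only [P]; omega⟩ (fun T => [T (w + 3), packFrom 1 (w + 2) T])
    (fun T => ?_) _ [] (fun T hT => ?_) fun t ht => ?_
  · have h1 : renderPieces sh (w + 3) T =
        (packFrom 1 (w + 2) T).map some ++ renderPieces sh 1 T := by
      rw [show w + 3 = 1 + (w + 2) by omega]
      exact renderPieces_name sh 1 (w + 2) T fun i hi => by simp [sh]; omega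
    change _ = (sh (w + 3)).code (T (w + 3)) ++ renderPieces sh (w + 3) T
    rw [h1]
    simp [encodeTuple_cons, encodeTuple_nil, renderPieces, sh, PieceKind.code]
  · have hraw : split P C (1 + g) (fun _ => false) T raw = T (w + 3) := split_blk (by simp [P])
    have hD : ∀ i < w + 2, split P C (1 + g) (fun _ => false) T (D i) = T (1 + i) := fun i hi =>
      split_blk (by simp only [P]; omega)
    have hname := fun n u => packFrom_eq_name_iff C ρ 1 n T u
    by_cases hc : canon (split P C (1 + g) (fun _ => false) T)
    · have hc' : (bitsNum (T (w + 3))).bits = T (w + 3) := by simpa only [canon, hraw] using hc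
      generalize hn : bitsNum (T (w + 3)) = n at hc'
      have hlen : (split P C (1 + g) (fun _ => false) T (some (.inr true))).length =
          varBits C n := length_split hc'.symm
      by_cases hi : InpOK w n fun i => T (1 + i)
      · obtain ⟨j, hj⟩ := desc_of_inpOK (C := C) (ρ := ρ) hi
        have hj' := (hname n _).2 hj
        have hp' : p (split P C (1 + g) (fun _ => false) T) := by
          refine ⟨hc, ?_⟩
          rw [hraw, hn]
          exact (inpOK_congr hD).2 hi
        dsimp only
        rw [hj', ← hc', kindOfTuple_name, kindCode, if_pos hp']
        simp [kind, GateKind.code, hj w (by omega), desc]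
      · have hp' : ¬ p (split P C (1 + g) (fun _ => false) T) := fun h => by
          have := h.2
          rw [hraw, hn] at this
          exact hi ((inpOK_congr hD).1 this)
        by_cases hψ : ∃ ψ, NodeOK ρ (varBits C n) ψ fun i => T (1 + i)
        · obtain ⟨ψ, hψ⟩ := hψ
          obtain ⟨val, hv⟩ := desc_of_nodeOK hψ
          have hq' : ∀ φ, q φ (split P C (1 + g) (fun _ => false) T) ↔
              NodeOK ρ (varBits C n) φ fun i => T (1 + i) := fun φ => by
            simp only [q, hc, true_and, hlen]
            exact nodeOK_congr hD
          dsimp only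
          rw [(hname n _).2 hv, ← hc', kindOfTuple_name, kindCode_of_unique ρ _ _ _ ψ hp'
            ((hq' _).2 hψ) fun φ hφ => nodeOK_unique hψ ((hq' _).1 hφ)]
          have hval := (nodeOK_desc hv).2
          have e : (fun s => bitsNum (split P C (1 + g) (fun _ => false) T (src s))) =
              Fml.env g n fun v => val v := by
            funext s
            cases s with
            | n => exact (congrArg bitsNum hraw).trans hn
            | pop =>
              simp only [src, split, Fml.env, bitsNum_bits]
              rw [count_true_eq_popcount, congrFun hval g]
            | var v => simp only [src, hD v (by omega), Fml.env, ← congrFun hval v]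
          simp only [r, e, kindOf_atom]
          simp [kind]
        · have : kindOfTuple C g ρ [T (w + 3), packFrom 1 (w + 2) T] = none := by
            refine kindOfTuple_eq_none C g ρ fun n' u h => ?_
            simp only [List.cons.injEq, and_true] at h
            obtain ⟨h1, h2⟩ := h
            obtain rfl : n = n' := bits_inj (hc'.trans h1)
            have h3 := (hname n u).1 h2
            rcases u with ⟨φ, val⟩ | j
            · exact hψ ⟨φ, (nodeOK_desc h3).1⟩
            · exact hi (inpOK_desc h3).1
          rw [this, kindCode, if_neg hp', dif_neg]
          · rfl
          · rintro ⟨ψ, hψ'⟩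
            have := hψ'.2
            rw [hlen] at this
            exact hψ ⟨ψ, (nodeOK_congr hD).1 this⟩
    · have : kindOfTuple C g ρ [T (w + 3), packFrom 1 (w + 2) T] = none := by
        refine kindOfTuple_eq_none C g ρ fun n' u h => hc ?_
        simp only [List.cons.injEq] at h
        simp only [canon, hraw, h.1, bitsNum_bits]
      rw [this, kindCode, if_neg fun h => hc h.1, dif_neg]
      · rfl
      · rintro ⟨ψ, hψ⟩
        exact hc hψ.1
  · have : kindOfTuple C g ρ t = none := by
      refine kindOfTuple_eq_none C g ρ fun n u h => ht
        ⟨fun k => if k = 0 then [] else if k = w + 3 then n.bits else desc C ρ n u (k - 1),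
          fun i hi => ?_, ?_⟩
      · simp only [sh] at hi
        split at hi
        · simp [*]
        · split at hi <;> cases hi
      · rw [h, (packFrom_eq_name_iff C ρ 1 n _ u).2]
        · simp
        · intro i hi
          simp
          omega
    rw [this]
    rfl

/-! ### Output gates -/

/-- The extension of a valuation of finitely many variables. -/
def ext {n : ℕ} (val : Val w C n) (i : ℕ) : ℕ := if h : i < w then val ⟨i, h⟩ else 0

/-- Each valuation owns `l` consecutive outputs, so quotient and remainder modulo `l` recover the
valuation and the root formula. -/
theorem getElem?_outs (n i : ℕ) (u : Gate C ρ n) : (outs C ρ n)[i]? = some u ↔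
    ∃ (β : Fin l) (val : Val w C n), u = .inl (root ρ β, val) ∧
      i = l * valIndex (2 ^ varBits C n) w (ext C val) + β := by
  rcases Nat.eq_zero_or_pos l with rfl | hl
  · simp [outs]
  rw [outs, getElem?_flatMap_const hl _ (by simp), Option.bind_eq_some_iff]
  have hm := Nat.mod_lt i hl
  have hB : 0 < 2 ^ varBits C n := by positivity
  constructor
  · rintro ⟨v, hv, hu⟩
    obtain ⟨h1, h2, h3⟩ := (getElem?_vals hB _ _ _).1 hv
    refine ⟨⟨i % l, hm⟩, toVal C n v, ?_, ?_⟩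
    · simp [hm] at hu
      exact hu.symm
    · rw [valIndex_congr (v' := v), h3, Nat.div_add_mod]
      intro j hj
      simp only [ext, hj, dite_true, toVal]
      exact Nat.mod_eq_of_lt (h1 j hj)
  · rintro ⟨β, val, rfl, rfl⟩
    rw [Nat.mul_add_div hl, Nat.div_eq_of_lt β.2, add_zero, Nat.mul_add_mod,
      Nat.mod_eq_of_lt β.2]
    refine ⟨ext C val, (getElem?_vals hB _ _ _).2 ⟨fun j hj => ?_, fun j hj => ?_, rfl⟩, ?_⟩
    · simp [ext, hj]
    · simp [ext, not_lt.2 hj]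
    · have : toVal C n (ext C val) = val := by
        funext j
        apply Fin.ext
        simp only [toVal, ext, j.2, dite_true]
        exact Nat.mod_eq_of_lt (val j).2
      simp [this]

theorem bitsNum_append (a b : List Bool) :
    bitsNum (a ++ b) = bitsNum a + 2 ^ a.length * bitsNum b := by
  simp [bitsNum, Nat.ofDigits_append]

/-- Blocks of equal length `L` are digits in base $2^L$, so their concatenation already is the
binary representation of the valuation index. No multiplication of variables has to be computed. -/
theorem bitsNum_selected (T : ℕ → List Bool) (L r : ℕ) (hr : r ≤ w)
    (hT : ∀ i < w, (T (2 + i)).length = L) :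
    bitsNum (selected (fun i => decide (2 ≤ i ∧ i < 2 + w)) (2 + r) T) =
      valIndex (2 ^ L) r fun i => bitsNum (T (2 + i)) := by
  induction r with
  | zero => rfl
  | succ r ih =>
    have : 2 ≤ 2 + r ∧ 2 + r < 2 + w := by omega
    rw [← add_assoc, selected, bitsNum_append, ih (by omega)]
    simp [this, valIndex, hT r (by omega)]

/-- By `bitsNum_selected` the condition on the output index is a linear equation between two tracks,
with the constants `l` and `β`. -/
theorem outs_linear : LinearTimeDecidable fun t => ∃ (n : ℕ) (u : Gate C ρ n) (i : ℕ),
    t = [n.bits, name C ρ n u, i.bits] ∧ (outs C ρ n)[i]? = some u := by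
  let P := w + 5
  let wh : ℕ → Bool := fun i => decide (2 ≤ i ∧ i < 2 + w)
  let raw : Option (Fin P ⊕ Bool) := blk P (w + 4)
  let D : ℕ → Option (Fin P ⊕ Bool) := fun i => blk P (2 + i)
  let num : Option (Fin P ⊕ Bool) := blk P 0
  let Q : (Option (Fin P ⊕ Bool) → List Bool) → Prop := fun T =>
    (bitsNum (T raw)).bits = T raw ∧ (bitsNum (T num)).bits = T num ∧ ∃ β,
      NodeOK ρ (T (some (.inr true))).length (root ρ β) (fun i => T (D i)) ∧
        bitsNum (T num) = l * bitsNum (T (some (.inr false))) + β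
  have hQ : Recog Q := (Recog.canonical _).and ((Recog.canonical _).and
    (Recog.ex fun β => (recog_nodeOK ρ _ D _).and (Recog.num_eq_mul_add _ _ _ _)))
  -- From the end: the output index, the closing mark and the `w + 2` blocks of the name, then `n`.
  let sh : ℕ → PieceKind := fun i =>
    if i = 1 then .closing else if i = 0 ∨ i = w + 4 then .raw else .inner
  refine linearTimeDecidable_of_pieces sh P C 0 wh (by simp [P]) (by simp [P])
    (by simp [P, sh]) Q hQ (fun T => [T (w + 4), packFrom 2 (w + 2) T, T 0]) (fun T => ?_) _
    (fun T hT => ?_) fun t ht => ?_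
  · have h1 : renderPieces sh (w + 4) T =
        (packFrom 2 (w + 2) T).map some ++ renderPieces sh 2 T := by
      rw [show w + 4 = 2 + (w + 2) by omega]
      refine renderPieces_name sh 2 (w + 2) T fun i hi => ?_
      have e1 : ¬ (2 + i = 1) := by omega
      have e2 : ¬ (2 + i = 0 ∨ 2 + i = w + 4) := by omega
      simp only [sh, if_neg e1, if_neg e2]
    change _ = (sh (w + 4)).code (T (w + 4)) ++ renderPieces sh (w + 4) T
    rw [h1]
    simp [encodeTuple_cons, encodeTuple_nil, renderPieces, sh, PieceKind.code]
  · have hraw : split P C 0 wh T raw = T (w + 4) := split_blk (by simp [P])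
    have hnum : split P C 0 wh T num = T 0 := split_blk (by simp [P])
    have hD : ∀ i < w + 2, split P C 0 wh T (D i) = T (2 + i) := fun i hi =>
      split_blk (by simp only [P]; omega)
    have hname := fun n u => packFrom_eq_name_iff C ρ 2 n T u
    have hsel : ∀ L, (∀ i : Fin w, (T (2 + i)).length = L) →
        bitsNum (split P C 0 wh T (some (.inr false))) =
          valIndex (2 ^ L) w fun i => bitsNum (T (2 + i)) := by
      intro L hL
      rw [← bitsNum_selected T L w le_rfl fun i hi => hL ⟨i, hi⟩]
      have e : selected wh (w + 5) T = selected wh (2 + w) T := by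
        rw [show w + 5 = 2 + w + 1 + 1 + 1 by omega, selected, selected, selected]
        simp [wh]
      exact congrArg bitsNum e
    simp only [Q, hraw, hnum]
    constructor
    · rintro ⟨n, u, i, h1, h2⟩
      simp only [List.cons.injEq, and_true] at h1
      obtain ⟨h1, h3, h4⟩ := h1
      obtain ⟨β, val, rfl, h5⟩ := (getElem?_outs C ρ n i u).1 h2
      obtain ⟨h6, h7⟩ := nodeOK_desc ((hname _ _).1 h3)
      refine ⟨by rw [h1, bitsNum_bits], by rw [h4, bitsNum_bits], β, ?_, ?_⟩
      · rw [length_split h1]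
        exact (nodeOK_congr hD).2 h6
      · rw [hsel _ h6.1, h4, bitsNum_bits, h5]
        congr 2
        refine valIndex_congr fun i hi => ?_
        rw [ext, dif_pos hi]
        exact (congrFun h7 ⟨i, hi⟩).symm
    · rintro ⟨h1, h2, β, h3, h4⟩
      generalize bitsNum (T (w + 4)) = n at h1
      rw [length_split h1.symm] at h3
      have h3 := (nodeOK_congr hD).1 h3
      obtain ⟨val, hv⟩ := desc_of_nodeOK h3
      refine ⟨n, .inl (root ρ β, val), bitsNum (T 0), ?_, (getElem?_outs C ρ n _ _).2
        ⟨β, val, rfl, ?_⟩⟩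
      · rw [(hname _ _).2 hv, h1, h2]
      · rw [h4, hsel _ h3.1]
        congr 2
        refine valIndex_congr fun i hi => ?_
        rw [ext, dif_pos hi]
        exact congrFun (nodeOK_desc hv).2 ⟨i, hi⟩
  · obtain ⟨n, u, i, rfl, -⟩ := ht
    refine ⟨fun k => if k = 1 then [] else if k = 0 then i.bits else
      if k = w + 4 then n.bits else desc C ρ n u (k - 2), fun i hi => ?_, ?_⟩
    · simp only [sh] at hi
      split at hi
      · simp [*]
      · split at hi <;> cases hi
    · rw [(packFrom_eq_name_iff C ρ 2 n _ u).2]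
      · simp
      · intro i hi
        have e1 : ¬ (2 + i = 1) := by omega
        have e2 : ¬ (2 + i = w + 4) := by omega
        simp [e1, e2]

end FmlCircuit

namespace FmlCircuit

open PieceState

variable {w l : ℕ} (C : ℕ) (g : Fin w) (ρ : Fin l → Fml w)

/-! ### Wires -/

/-- Whether a node is the `i`-th input of a node. -/
def nodeWire : Fml w → Fml w → (Fin w → ℕ) → (Fin w → ℕ) → ℕ → Prop
  | .not φ, χ, a, b, i => χ = φ ∧ (∀ j, b j = a j) ∧ i = 0
  | .and φ ψ, χ, a, b, i => (∀ j, b j = a j) ∧ (χ = φ ∧ i = 0 ∨ χ = ψ ∧ i = 1)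
  | .ex v φ, χ, a, b, i => χ = φ ∧ (∀ j, j ≠ v → b j = a j) ∧ b v = i
  | _, _, _, _, _ => False

/-- Whether an input gate is the `i`-th input of a node. -/
def inpWire : Fml w → ℕ → (Fin w → ℕ) → ℕ → Prop
  | .inp v, m, a, i => m = a v ∧ i = 0
  | _, _, _, _ => False

theorem getElem?_ins_inl (n i : ℕ) (ψ χ : Node ρ) (a b : Val w C n) :
    (ins C ρ n (.inl (ψ, a)))[i]? = some (.inl (χ, b)) ↔
      nodeWire ψ.1 χ.1 (fun j => a j) (fun j => b j) i := by
  have hval : ∀ a b : Val w C n, a = b ↔ ∀ j, (b j : ℕ) = a j := fun a b => by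
    rw [funext_iff]
    exact forall_congr' fun j => by rw [Fin.ext_iff, eq_comm]
  obtain ⟨χ, hχ⟩ := χ
  obtain ⟨ψ, hψ⟩ := ψ
  cases ψ with
  | num P => simp [ins, nodeWire]
  | inp v =>
    simp only [ins, nodeWire, iff_false]
    split <;> rcases i with _ | i <;> simp
  | not φ =>
    rcases i with _ | i
    · simp [ins, nodeWire, child, hval a b, eq_comm (a := χ)]
    · simp [ins, nodeWire]
  | and φ φ' =>
    rcases i with _ | _ | i
    · simp [ins, nodeWire, child, hval a b, eq_comm (a := χ), and_comm]
    · simp [ins, nodeWire, child, hval a b, eq_comm (a := χ), and_comm]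
    · simp [ins, nodeWire]
  | ex v φ =>
    simp only [ins, nodeWire, List.getElem?_ofFn]
    split
    · rename_i h
      simp only [Option.some.injEq, Sum.inl.injEq, Prod.mk.injEq, child, Subtype.mk.injEq,
        eq_comm (a := χ), hval]
      refine and_congr_right fun _ => ⟨fun h' => ⟨fun j hj => ?_, ?_⟩, fun h' j => ?_⟩
      · simpa [hj] using h' j
      · simpa using h' v
      · by_cases hj : j = v
        · subst hj; simpa using h'.2
        · simpa [hj] using h'.1 j hj
    · rename_i h
      simp only [reduceCtorEq, false_iff]
      rintro ⟨-, -, rfl⟩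
      exact h (b v).2

theorem getElem?_ins_inr (n i : ℕ) (ψ : Node ρ) (a : Val w C n) (m : Fin n) :
    (ins C ρ n (.inl (ψ, a)))[i]? = some (.inr m) ↔ inpWire ψ.1 m (fun j => a j) i := by
  obtain ⟨ψ, hψ⟩ := ψ
  cases ψ with
  | num P => simp [ins, inpWire]
  | inp v =>
    simp only [ins, inpWire]
    split
    · rcases i with _ | i
      · simp [Fin.ext_iff, eq_comm]
      · simp
    · rename_i h
      simp only [List.getElem?_nil, reduceCtorEq, false_iff]
      rintro ⟨h1, -⟩
      exact h (h1 ▸ m.2)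
  | not φ => rcases i with _ | i <;> simp [ins, inpWire]
  | and φ φ' => rcases i with _ | _ | i <;> simp [ins, inpWire]
  | ex v φ =>
    simp only [ins, inpWire, List.getElem?_ofFn]
    split <;> simp

theorem recog_nodeWire {ι : Type} (ψ χ : Fml w) (f f' : ℕ → ι) (e : ι) :
    Recog fun T : ι → List Bool => nodeWire ψ χ (fun j => bitsNum (T (f j)))
      (fun j => bitsNum (T (f' j))) (bitsNum (T e)) := by
  cases ψ with
  | num P => exact Recog.const _
  | inp v => exact Recog.const _
  | not φ =>
    exact (Recog.const _).and ((Recog.all fun _ => Recog.num_eq _ _).and (Recog.num_eq_const _ _))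
  | and φ φ' =>
    exact (Recog.all fun _ => Recog.num_eq _ _).and
      (((Recog.const _).and (Recog.num_eq_const _ _)).or
        ((Recog.const _).and (Recog.num_eq_const _ _)))
  | ex v φ =>
    exact (Recog.const _).and ((Recog.all fun j => (Recog.const (j ≠ v)).imp
      (Recog.num_eq _ _)).and (Recog.num_eq _ _))

theorem recog_inpWire {ι : Type} (ψ : Fml w) (f : ℕ → ι) (m e : ι) :
    Recog fun T : ι → List Bool => inpWire ψ (bitsNum (T m)) (fun j => bitsNum (T (f j)))
      (bitsNum (T e)) := by
  cases ψ with
  | inp v => exact (Recog.num_eq _ _).and (Recog.num_eq_const _ _)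
  | _ => exact Recog.const _

/-- Only finitely many pairs of subformulas occur. For each pair, a wire is a conjunction of
equalities between value blocks and the wire index, and these are automatic. -/
theorem ins_linear : LinearTimeDecidable fun t => ∃ (n : ℕ) (u v : Gate C ρ n) (i : ℕ),
    t = [n.bits, name C ρ n u, name C ρ n v, i.bits] ∧ (ins C ρ n v)[i]? = some u := by
  let P := 2 * w + 8
  let raw : Option (Fin P ⊕ Bool) := blk P (2 * w + 7)
  let D : ℕ → Option (Fin P ⊕ Bool) := fun i => blk P (2 + i)
  let D' : ℕ → Option (Fin P ⊕ Bool) := fun i => blk P (w + 5 + i)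
  let num : Option (Fin P ⊕ Bool) := blk P 0
  let len : Option (Fin P ⊕ Bool) := some (.inr true)
  let Q : (Option (Fin P ⊕ Bool) → List Bool) → Prop := fun T =>
    (bitsNum (T raw)).bits = T raw ∧ (bitsNum (T num)).bits = T num ∧ ∃ ψ : Node ρ,
      NodeOK ρ (T len).length ψ (fun i => T (D i)) ∧
        ((∃ χ, NodeOK ρ (T len).length χ (fun i => T (D' i)) ∧
          nodeWire ψ.1 χ.1 (fun j => bitsNum (T (D j))) (fun j => bitsNum (T (D' j)))
            (bitsNum (T num))) ∨
        InpOK w (bitsNum (T raw)) (fun i => T (D' i)) ∧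
          inpWire ψ.1 (bitsNum (T (D' w))) (fun j => bitsNum (T (D j))) (bitsNum (T num)))
  have hQ : Recog Q := (Recog.canonical _).and ((Recog.canonical _).and
    (Recog.ex fun ψ => (recog_nodeOK ρ _ D _).and
      ((Recog.ex fun χ => (recog_nodeOK ρ _ D' _).and (recog_nodeWire _ _ D D' num)).or
        ((recog_inpOK w D' raw).and (recog_inpWire _ D _ num)))))
  -- From the end: the wire index, the closing mark and blocks of the target gate, the closing mark
  -- and blocks of the source gate, then `n`.
  let sh : ℕ → PieceKind := fun i =>
    if i = 1 ∨ i = w + 4 then .closing else if i = 0 ∨ i = 2 * w + 7 then .raw else .inner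
  refine linearTimeDecidable_of_pieces sh P C 0 (fun _ => false) (by simp [P]) (by simp [P])
    ?_ Q hQ (fun T => [T (2 * w + 7), packFrom (w + 5) (w + 2) T, packFrom 2 (w + 2) T, T 0])
    (fun T => ?_) _ (fun T hT => ?_) fun t ht => ?_
  · have : ¬ (2 * w + 7 = w + 4) := by omega
    simp [P, sh, this]
  · have h1 : renderPieces sh (2 * w + 7) T =
        (packFrom (w + 5) (w + 2) T).map some ++ renderPieces sh (w + 5) T := by
      rw [show 2 * w + 7 = w + 5 + (w + 2) by omega]
      refine renderPieces_name sh (w + 5) (w + 2) T fun i hi => ?_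
      have e1 : ¬ (w + 5 + i = 1 ∨ w + 5 + i = w + 4) := by omega
      have e2 : ¬ (w + 5 + i = 0 ∨ w + 5 + i = 2 * w + 7) := by omega
      simp only [sh, if_neg e1, if_neg e2]
    have h2 : renderPieces sh (w + 4) T =
        (packFrom 2 (w + 2) T).map some ++ renderPieces sh 2 T := by
      rw [show w + 4 = 2 + (w + 2) by omega]
      refine renderPieces_name sh 2 (w + 2) T fun i hi => ?_
      have e1 : ¬ (2 + i = 1 ∨ 2 + i = w + 4) := by omega
      have e2 : ¬ (2 + i = 0 ∨ 2 + i = 2 * w + 7) := by omega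
      simp only [sh, if_neg e1, if_neg e2]
    have e : ¬ (2 * w + 7 = w + 4) := by omega
    change _ = (sh (2 * w + 7)).code (T (2 * w + 7)) ++ renderPieces sh (2 * w + 7) T
    rw [h1]
    change _ = _ ++ (_ ++ ((sh (w + 4)).code (T (w + 4)) ++ renderPieces sh (w + 4) T))
    rw [h2]
    simp [encodeTuple_cons, encodeTuple_nil, renderPieces, sh, PieceKind.code, e]
  · have hraw : split P C 0 (fun _ => false) T raw = T (2 * w + 7) := split_blk (by simp [P])
    have hnum : split P C 0 (fun _ => false) T num = T 0 := split_blk (by simp [P])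
    have hD : ∀ i < w + 2, split P C 0 (fun _ => false) T (D i) = T (2 + i) := fun i hi =>
      split_blk (by simp only [P]; omega)
    have hD' : ∀ i < w + 2, split P C 0 (fun _ => false) T (D' i) = T (w + 5 + i) := fun i hi =>
      split_blk (by simp only [P]; omega)
    have hname := fun n u => packFrom_eq_name_iff C ρ 2 n T u
    have hname' := fun n u => packFrom_eq_name_iff C ρ (w + 5) n T u
    have f : (fun j : Fin w => bitsNum (split P C 0 (fun _ => false) T (D j))) =
        fun j : Fin w => bitsNum (T (2 + j)) := funext fun j => by rw [hD j (by omega)]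
    have f' : (fun j : Fin w => bitsNum (split P C 0 (fun _ => false) T (D' j))) =
        fun j : Fin w => bitsNum (T (w + 5 + j)) := funext fun j => by rw [hD' j (by omega)]
    simp only [Q, hraw, hnum, f, f', hD' w (by omega)]
    constructor
    · rintro ⟨n, u, v, i, h1, h2⟩
      simp only [List.cons.injEq, and_true] at h1
      obtain ⟨h1, h3, h4, h5⟩ := h1
      rw [length_split h1, h1, h5, bitsNum_bits, bitsNum_bits]
      refine ⟨rfl, rfl, ?_⟩
      rcases v with ⟨ψ, a⟩ | m
      · have k := nodeOK_desc ((hname _ _).1 h4)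
        refine ⟨ψ, (nodeOK_congr hD).2 k.1, ?_⟩
        rw [k.2]
        rcases u with ⟨χ, b⟩ | m
        · have k' := nodeOK_desc ((hname' _ _).1 h3)
          refine .inl ⟨χ, (nodeOK_congr hD').2 k'.1, ?_⟩
          rw [k'.2]
          exact (getElem?_ins_inl C ρ n i ψ χ a b).1 h2
        · have k' := inpOK_desc ((hname' _ _).1 h3)
          refine .inr ⟨(inpOK_congr hD').2 k'.1, ?_⟩
          rw [k'.2]
          exact (getElem?_ins_inr C ρ n i ψ a m).1 h2
      · simp [ins] at h2
    · rintro ⟨h1, h2, ψ, h3, h4⟩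
      generalize bitsNum (T (2 * w + 7)) = n at *
      rw [length_split h1.symm] at h3 h4
      obtain ⟨a, ha⟩ := desc_of_nodeOK ((nodeOK_congr hD).1 h3)
      rw [(nodeOK_desc ha).2] at h4
      rcases h4 with ⟨χ, h4, h5⟩ | ⟨h4, h5⟩
      · obtain ⟨b, hb⟩ := desc_of_nodeOK ((nodeOK_congr hD').1 h4)
        rw [(nodeOK_desc hb).2] at h5
        refine ⟨n, .inl (χ, b), .inl (ψ, a), bitsNum (T 0), ?_,
          (getElem?_ins_inl C ρ n _ ψ χ a b).2 h5⟩
        rw [(hname _ _).2 ha, (hname' _ _).2 hb, h1, h2]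
      · obtain ⟨m, hm⟩ := desc_of_inpOK (C := C) (ρ := ρ) ((inpOK_congr hD').1 h4)
        rw [(inpOK_desc hm).2] at h5
        refine ⟨n, .inr m, .inl (ψ, a), bitsNum (T 0), ?_,
          (getElem?_ins_inr C ρ n _ ψ a m).2 h5⟩
        rw [(hname _ _).2 ha, (hname' _ _).2 hm, h1, h2]
  · obtain ⟨n, u, v, i, rfl, -⟩ := ht
    refine ⟨fun k => if k = 1 ∨ k = w + 4 then [] else if k = 0 then i.bits else
      if k = 2 * w + 7 then n.bits else if k < w + 4 then desc C ρ n v (k - 2)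
        else desc C ρ n u (k - (w + 5)), fun i hi => ?_, ?_⟩
    · simp only [sh] at hi
      split at hi
      · simp [*]
      · split at hi <;> cases hi
    · rw [(packFrom_eq_name_iff C ρ 2 n _ v).2, (packFrom_eq_name_iff C ρ (w + 5) n _ u).2]
      · have e1 : ¬ (2 * w + 7 = w + 4) := by omega
        simp [e1]
      · intro i hi
        have e1 : ¬ (w + 5 + i = 1 ∨ w + 5 + i = w + 4) := by omega
        have e2 : ¬ (w + 5 + i = 0) := by omega
        have e3 : ¬ (w + 5 + i = 2 * w + 7) := by omega
        have e4 : ¬ (w + 5 + i < w + 4) := by omega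
        simp only [if_neg e1, if_neg e2, if_neg e3, if_neg e4, Nat.add_sub_cancel_left]
      · intro i hi
        have e1 : ¬ (2 + i = 1 ∨ 2 + i = w + 4) := by omega
        have e2 : ¬ (2 + i = 0) := by omega
        have e3 : ¬ (2 + i = 2 * w + 7) := by omega
        have e4 : 2 + i < w + 4 := by omega
        simp only [if_neg e1, if_neg e2, if_neg e3, if_pos e4, Nat.add_sub_cancel_left]

end FmlCircuit

open FmlCircuit in
open scoped Classical in
/-- The function that lists the truth values of formulas for all valuations is computable in
uniform AC⁰. -/
theorem Fml.uniformAC0Computable {w l : ℕ} (C : ℕ) (g : Fin w) (ρ : Fin l → Fml w)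
    (hρ : ∀ β, (ρ β).Auto) :
    UniformAC0Computable fun x => (vals (2 ^ varBits C x.length) w).flatMap fun v =>
      List.ofFn fun β =>
        decide ((ρ β).Holds g (2 ^ varBits C x.length) x.length x fun i => v i) :=
  ⟨circuit C g ρ, ⟨name C ρ, name_injective C ρ, length_name_le C ρ,
    ⟨kindOfTuple C g ρ, kind_linear C g ρ hρ, kindOfTuple_name C g ρ, fun n u hu =>
      kindOfTuple_eq_none C g ρ fun n' u' h => by
        simp only [List.cons.injEq, and_true] at h
        obtain rfl := bits_inj h.1
        exact hu ⟨u', h.2.symm⟩⟩,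
    ins_linear C ρ, outs_linear C ρ⟩, size_le C g ρ, depthAtMost C g ρ, output_eq C g ρ⟩

/-! ## Definable relations -/

/-- The relation of the input and of a valuation is defined by a formula, with quantifiers over
the numbers that have as many bits as the variables. -/
def Definable {w : ℕ} (C : ℕ) (g : Fin w) (R : List Bool → (Fin w → ℕ) → Prop) : Prop :=
  ∃ φ : Fml w, φ.Auto ∧
    ∀ x val, φ.Holds g (2 ^ varBits C x.length) x.length x val ↔ R x val

namespace Definable

variable {w C : ℕ} {g : Fin w} {R R' : List Bool → (Fin w → ℕ) → Prop}

theorem congr (h : Definable C g R) (e : ∀ x val, R x val ↔ R' x val) : Definable C g R' := by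
  obtain ⟨φ, h1, h2⟩ := h
  exact ⟨φ, h1, fun x val => (h2 x val).trans (e x val)⟩

theorem not (h : Definable C g R) : Definable C g fun x val => ¬ R x val := by
  obtain ⟨φ, h1, h2⟩ := h
  exact ⟨.not φ, h1, fun x val => not_congr (h2 x val)⟩

theorem and (h : Definable C g R) (h' : Definable C g R') :
    Definable C g fun x val => R x val ∧ R' x val := by
  obtain ⟨φ, h1, h2⟩ := h
  obtain ⟨φ', h1', h2'⟩ := h'
  exact ⟨.and φ φ', ⟨h1, h1'⟩, fun x val => and_congr (h2 x val) (h2' x val)⟩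

theorem or (h : Definable C g R) (h' : Definable C g R') :
    Definable C g fun x val => R x val ∨ R' x val :=
  (h.not.and h'.not).not.congr fun x val => by tauto

theorem imp (h : Definable C g R) (h' : Definable C g R') :
    Definable C g fun x val => R x val → R' x val :=
  (h.and h'.not).not.congr fun x val => by tauto

theorem ex (v : Fin w) (h : Definable C g R) : Definable C g fun x val =>
    ∃ i < 2 ^ varBits C x.length, R x (Function.update val v i) := by
  obtain ⟨φ, h1, h2⟩ := h
  exact ⟨.ex v φ, h1, fun x val => exists_congr fun i => and_congr_right fun _ => h2 x _⟩

theorem all (v : Fin w) (h : Definable C g R) : Definable C g fun x val =>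
    ∀ i < 2 ^ varBits C x.length, R x (Function.update val v i) :=
  (h.not.ex v).not.congr fun x val => by simp

theorem inp (v : Fin w) : Definable C g fun x val => x.getD (val v) false = true :=
  ⟨.inp v, trivial, fun _ _ => Iff.rfl⟩

theorem num (P : (Src w → ℕ) → Prop) (h : Recog fun T : Src w → List Bool => P fun s =>
    bitsNum (T s)) : Definable C g fun x val => P (Fml.env g x.length val) :=
  ⟨.num P, h, fun _ _ => Iff.rfl⟩

theorem const (p : Prop) : Definable C g fun _ _ => p := num (fun _ => p) (Recog.const p)

theorem linear (L : List (ℤ × Src w)) (D : ℤ) : Definable C g fun x val =>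
    (L.map fun p => p.1 * (Fml.env g x.length val p.2 : ℤ)).sum ≤ D :=
  num (fun env => (L.map fun p => p.1 * (env p.2 : ℤ)).sum ≤ D) (Recog.linear L D)

theorem exists_finite {α : Type*} [Finite α] {R : α → List Bool → (Fin w → ℕ) → Prop}
    (h : ∀ a, Definable C g (R a)) : Definable C g fun x val => ∃ a, R a x val := by
  have := Fintype.ofFinite α
  have key : ∀ L : List α, Definable C g fun x val => ∃ a ∈ L, R a x val := by
    intro L
    induction L with
    | nil => exact (const False).congr fun x val => by simp
    | cons a L ih => exact ((h a).or ih).congr fun x val => by simp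
  exact (key Finset.univ.toList).congr fun x val => by simp

theorem forall_finite {α : Type*} [Finite α] {R : α → List Bool → (Fin w → ℕ) → Prop}
    (h : ∀ a, Definable C g (R a)) : Definable C g fun x val => ∀ a, R a x val :=
  (exists_finite fun a => (h a).not).not.congr fun x val => by simp

end Definable

/-! ## Symbols of the input -/

section Symbols

variable {S : Type*} {k : ℕ}

instance [Finite S] : Finite (PowerSymbol S) := by
  have : Function.Surjective fun z : S ⊕ Bool ⊕ Bool => match z with
      | .inl s => PowerSymbol.letter s
      | .inr (.inl b) => .sign b
      | .inr (.inr b) => .digit b := by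
    rintro (s | b | b)
    exacts [⟨.inl s, rfl⟩, ⟨.inr (.inl b), rfl⟩, ⟨.inr (.inr b), rfl⟩]
  exact Finite.of_surjective _ this

variable (penc : PowerSymbol S → Fin k → Bool)

/-- The `p`-th block of the input is the code of `σ`. -/
def SymAt (x : List Bool) (p : ℕ) (σ : PowerSymbol S) : Prop :=
  k * p + k ≤ x.length ∧ ∀ β : Fin k, x.getD (k * p + β) false = penc σ β

def LetterAt (x : List Bool) (p : ℕ) : Prop := ∃ s, SymAt penc x p (.letter s)

def DigitAt (x : List Bool) (p : ℕ) : Prop := ∃ b, SymAt penc x p (.digit b)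

/-- The input is the code of a power word. -/
def ValidInput (x : List Bool) : Prop :=
  ∀ p, k * p < x.length → (∃ σ, SymAt penc x p σ) ∧ (p = 0 → ¬ DigitAt penc x p) ∧
    (LetterAt penc x p → k * (p + 1) < x.length ∧ ¬ DigitAt penc x (p + 1))

/-- There is a digit `1` at position `p`, and only digits between the positions `s` and `p`. -/
def OneAt (x : List Bool) (s p : ℕ) : Prop :=
  s < p ∧ SymAt penc x p (.digit true) ∧ ∀ q, s < q → q < p → DigitAt penc x q

/-- The digit of index `t` of the exponent whose sign has the position `s`, where a negative
exponent is represented in two's complement. -/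
def BitAt (x : List Bool) (s t : ℕ) : Prop :=
  (SymAt penc x s (.sign false) ∧ OneAt penc x s (s + 1 + t)) ∨
    (SymAt penc x s (.sign true) ∧
      ¬ (OneAt penc x s (s + 1 + t) ↔ ∃ p < s + 1 + t, OneAt penc x s p))

/-- The number `t` is less than `c * (Nat.size m + 1)`, where `m` is the maximal length of a
sequence of consecutive letters. -/
def BelowKappa (c : ℕ) (x : List Bool) (t : ℕ) : Prop :=
  t < c ∨ ∃ i a, t < c * (i + 2) ∧ ∀ q, a ≤ q → q < a + 2 ^ i → LetterAt penc x q

/-- The letter `σ` at the position `j` of the base word before the sign at the position `s` is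
copied. -/
def Copied (c : ℕ) (x : List Bool) (s t r j : ℕ) (σ : S) : Prop :=
  BitAt penc x s t ∧ BelowKappa penc c x t ∧ r < 2 ^ t ∧ SymAt penc x j (.letter σ) ∧ j < s ∧
    ∀ q, j ≤ q → q < s → LetterAt penc x q

end Symbols

/-! ## Definability of the reduction -/

theorem popcount_of_add_one_eq_two_pow {m t : ℕ} (h : m + 1 = 2 ^ t) : popcount m = t := by
  induction t generalizing m with
  | zero =>
    simp at h
    simp [h, popcount]
  | succ t ih =>
    have h1 : 0 < 2 ^ t := by positivity
    rw [pow_succ] at h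
    have h2 : m = Nat.bit true (m / 2) := by rw [Nat.bit_val]; simp; omega
    rw [h2, popcount, Nat.bits_append_bit _ _ (by simp), List.count_cons_self,
      ← ih (m := m / 2) (by omega), popcount]

/-- No automaton obtains $2^t$ from the digits of $t$. Instead $m=2^t-1$ is guessed: that its digits
are all ones is recognisable, and its number of ones is $t$. -/
theorem exists_ones_iff {B t r : ℕ} (ht : 2 ^ t ≤ B) :
    r < 2 ^ t ↔ ∃ m < B, (∃ t, m + 1 = 2 ^ t) ∧ popcount m = t ∧ r ≤ m := by
  have h1 : 0 < 2 ^ t := by positivity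
  constructor
  · intro h
    have h2 : 2 ^ t - 1 + 1 = 2 ^ t := by omega
    exact ⟨2 ^ t - 1, by omega, ⟨t, h2⟩, popcount_of_add_one_eq_two_pow h2, by omega⟩
  · rintro ⟨m, -, ⟨t', ht'⟩, h2, h3⟩
    rw [popcount_of_add_one_eq_two_pow ht'] at h2
    subst h2
    omega

/-- Quantifiers reach every position of the input. -/
theorem lt_two_pow_varBits {C : ℕ} (hC : 0 < C) (n : ℕ) : n < 2 ^ varBits C n :=
  (Nat.lt_size_self n).trans_le (Nat.pow_le_pow_right (by norm_num)
    ((Nat.le_succ _).trans (Nat.le_mul_of_pos_left _ hC)))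

section Reduction

variable {S : Type*} {k C : ℕ} (penc : PowerSymbol S → Fin k → Bool)

/-- Definability with eight variables, of which the variable 4 is used for powers of two. -/
abbrev Definable₈ (C : ℕ) (R : List Bool → (Fin 8 → ℕ) → Prop) : Prop := Definable C 4 R

/-- Input atoms take a variable, not a term, so variable 7 is reserved to hold the bit position
$kv+\beta$. -/
theorem definable_symAt (hC : 0 < C) (v : Fin 8) (hv : v ≠ 7) (σ : PowerSymbol S) :
    Definable₈ C fun x val => SymAt penc x (val v) σ := by
  have h1 : Definable₈ C fun x val => k * val v + k ≤ x.length :=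
    (Definable.linear [(k, .var v), (-1, .n)] (-k)).congr fun x val => by
      simp [Fml.env]
      zify
      generalize (k : ℤ) * (val v : ℤ) = z
      omega
  have h2 : ∀ β : Fin k, Definable₈ C fun x val => k * val v + k ≤ x.length →
      x.getD (k * val v + β) false = penc σ β := fun β => by
    have h3 : Definable₈ C fun x val => val 7 = k * val v + β :=
      ((Definable.linear [(1, .var 7), (-k, .var v)] β).and
        (Definable.linear [(-1, .var 7), (k, .var v)] (-β))).congr fun x val => by
        simp [Fml.env]
        zify
        generalize (k : ℤ) * (val v : ℤ) = z
        omega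
    refine (h1.imp ((h3.and (((Definable.inp 7).and (.const (penc σ β = true))).or
      ((Definable.inp 7).not.and (.const (penc σ β = false))))).ex 7)).congr
      fun x val => forall_congr' fun hx => ?_
    have hB := lt_two_pow_varBits hC x.length
    simp only [Function.update_self, Function.update_of_ne hv]
    constructor
    · rintro ⟨i, -, rfl, h⟩
      rcases h with ⟨h, h'⟩ | ⟨h, h'⟩
      · rw [h, h']
      · rw [h', ← Bool.not_eq_true]; exact h
    · intro h
      refine ⟨_, ?_, rfl, ?_⟩
      · have := β.2
        omega
      · rw [h]
        cases penc σ β <;> simp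
  exact (h1.and (Definable.forall_finite h2)).congr fun x val =>
    and_congr_right fun h => by simp [h]

theorem definable_letterAt [Finite S] (hC : 0 < C) (v : Fin 8) (hv : v ≠ 7) :
    Definable₈ C fun x val => LetterAt penc x (val v) :=
  Definable.exists_finite fun _ => definable_symAt penc hC v hv _

theorem definable_digitAt [Finite S] (hC : 0 < C) (v : Fin 8) (hv : v ≠ 7) :
    Definable₈ C fun x val => DigitAt penc x (val v) :=
  Definable.exists_finite fun _ => definable_symAt penc hC v hv _

variable {penc} in
theorem SymAt.lt {x : List Bool} {p : ℕ} {σ : PowerSymbol S} (hk : 0 < k)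
    (h : SymAt penc x p σ) : p < x.length := by
  have h1 := h.1
  have h2 : p ≤ k * p := Nat.le_mul_of_pos_left _ hk
  omega

theorem definable_lt (u v : Fin 8) (D : ℕ) : Definable₈ C fun _ val => val u < val v + D :=
  (Definable.linear [(1, .var u), (-1, .var v)] (D - 1)).congr fun x val => by
    simp [Fml.env]
    omega

theorem definable_le (u v : Fin 8) : Definable₈ C fun _ val => val u ≤ val v :=
  (definable_lt u v 1).congr fun x val => by omega

/-- The bound on the quantified variable is harmless, because the position of the digit, and all
positions before it, lie inside the input. -/
theorem definable_oneAt [Finite S] (hk : 0 < k) (hC : 0 < C) :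
    Definable₈ C fun x val => OneAt penc x (val 0) (val 5) := by
  refine ((definable_lt 0 5 0).and ((definable_symAt penc hC 5 (by decide) (.digit true)).and
    (((definable_lt 0 6 0).imp ((definable_lt 6 5 0).imp
      (definable_digitAt penc hC 6 (by decide)))).all 6))).congr fun x val => ?_
  have hB := lt_two_pow_varBits hC x.length
  simp only [OneAt, Function.update_self, add_zero]
  refine and_congr_right fun h1 => and_congr_right fun h2 => ?_
  have := h2.lt hk
  constructor
  · intro h q h3 h4
    exact h q (by omega) h3 h4
  · intro h q _ h3 h4
    exact h q h3 h4

theorem definable_bitAt [Finite S] (hk : 0 < k) (hC : 0 < C) :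
    Definable₈ C fun x val => BitAt penc x (val 0) (val 1) := by
  have h1 : Definable₈ C fun x val => OneAt penc x (val 0) (val 0 + 1 + val 1) := by
    refine ((((Definable.linear [(1, .var 5), (-1, .var 0), (-1, .var 1)] 1).and
      (Definable.linear [(-1, .var 5), (1, .var 0), (1, .var 1)] (-1))).and
      (definable_oneAt penc hk hC)).ex 5).congr fun x val => ?_
    have hB := lt_two_pow_varBits hC x.length
    simp [Fml.env]
    constructor
    · rintro ⟨i, hi, ⟨h1, h2⟩, h3⟩
      have : i = val 0 + 1 + val 1 := by omega
      exact this ▸ h3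
    · intro h
      exact ⟨_, (h.2.1.lt hk).trans hB, by push_cast; omega, h⟩
  have h2 : Definable₈ C fun x val => ∃ p < val 0 + 1 + val 1, OneAt penc x (val 0) p := by
    refine (((Definable.linear [(1, .var 5), (-1, .var 0), (-1, .var 1)] 0).and
      (definable_oneAt penc hk hC)).ex 5).congr fun x val => ?_
    have hB := lt_two_pow_varBits hC x.length
    simp [Fml.env]
    constructor
    · rintro ⟨i, hi, h1, h3⟩
      exact ⟨i, by omega, h3⟩
    · rintro ⟨i, h1, h⟩
      exact ⟨i, (h.2.1.lt hk).trans hB, by omega, h⟩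
  exact ((definable_symAt penc hC 0 (by decide) _).and h1).or
    ((definable_symAt penc hC 0 (by decide) _).and
      (((h1.imp h2).and (h2.imp h1)).congr fun _ _ => iff_def.symm).not)

/-- Variable 4 holds $2^i-1$, so its number of ones is $i$. Variable 5 holds the start of a run of
$2^i$ letters, and variable 6 ranges over the run. -/
theorem definable_belowKappa [Finite S] (c : ℕ) (hk : 0 < k) (hC : 0 < C) :
    Definable₈ C fun x val => BelowKappa penc c x (val 1) := by
  have h0 : Definable₈ C fun _ val => val 1 < c :=
    (Definable.linear [(1, .var 1)] (c - 1)).congr fun x val => by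
      simp [Fml.env]
  have h1 : Definable₈ C fun _ val => ∃ t, val 4 + 1 = 2 ^ t :=
    Definable.num (fun env => ∃ t, env (.var 4) + 1 = 2 ^ t) (Recog.isOnes _)
  have h2 : Definable₈ C fun _ val => val 1 < c * (popcount (val 4) + 2) :=
    (Definable.linear [(1, .var 1), (-c, .pop)] (2 * c - 1)).congr fun x val => by
      simp [Fml.env]
      zify
      rw [mul_add]
      generalize (c : ℤ) * (popcount (val 4) : ℤ) = z
      omega
  have h3 : Definable₈ C fun _ val => val 6 ≤ val 5 + val 4 :=
    (Definable.linear [(1, .var 6), (-1, .var 5), (-1, .var 4)] 0).congr fun x val => by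
      simp [Fml.env]
      omega
  refine h0.or (((h1.and (h2.and (((definable_le 5 6).imp (h3.imp
    (definable_letterAt penc hC 6 (by decide)))).all 6))).ex 5).ex 4) |>.congr fun x val => ?_
  refine or_congr Iff.rfl ?_
  have hB := lt_two_pow_varBits hC x.length
  simp
  constructor
  · rintro ⟨m, hm, a, ha, ⟨i, hi⟩, h1, h2⟩
    rw [popcount_of_add_one_eq_two_pow hi] at h1
    refine ⟨i, h1, a, fun q h3 h4 => ?_⟩
    by_cases hq : q < 2 ^ varBits C x.length
    · exact h2 q hq h3 (by omega)
    -- Otherwise the run would contain the largest value of a variable, and this position is already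
    -- outside the input.
    · exfalso
      have := (h2 (2 ^ varBits C x.length - 1) (by omega) (by omega) (by omega))
      obtain ⟨s, hs⟩ := this
      have := hs.lt hk
      omega
  · rintro ⟨i, h1, a, h2⟩
    have hp : 0 < 2 ^ i := by positivity
    obtain ⟨s, hs⟩ := h2 (a + 2 ^ i - 1) (by omega) (by omega)
    have := hs.lt hk
    have hi : 2 ^ i - 1 + 1 = 2 ^ i := by omega
    refine ⟨2 ^ i - 1, by omega, a, by omega, ⟨i, hi⟩, ?_, fun q _ h3 h4 => h2 q h3 (by omega)⟩
    rwa [popcount_of_add_one_eq_two_pow hi]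

theorem belowKappa_lt {c : ℕ} {x : List Bool} {t : ℕ} (hk : 0 < k)
    (h : BelowKappa penc c x t) : t < c * (Nat.size x.length + 1) := by
  rcases h with h | ⟨i, a, h1, h2⟩
  · exact h.trans_le (Nat.le_mul_of_pos_right _ (Nat.succ_pos _))
  · have hp : 0 < 2 ^ i := by positivity
    obtain ⟨s, hs⟩ := h2 (a + 2 ^ i - 1) (by omega) (by omega)
    have := hs.lt hk
    have h3 : i < Nat.size x.length := Nat.lt_size.2 (by omega)
    exact h1.trans_le (Nat.mul_le_mul_left _ (by omega))

/-- Variables 0 to 3 are the sign position, digit index, copy and letter position. The condition `c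
< C` leaves room for $2^t$ among the values of variable 4 whenever $t$ is below the bound of
`belowKappa_lt`. -/
theorem definable_copied [Finite S] (c : ℕ) (hk : 0 < k) (hC : c < C) (σ : S) : Definable₈ C fun x val =>
    Copied penc c x (val 0) (val 1) (val 2) (val 3) σ := by
  have hC0 : 0 < C := by omega
  have h1 : Definable₈ C fun _ val => ∃ t, val 4 + 1 = 2 ^ t :=
    Definable.num (fun env => ∃ t, env (.var 4) + 1 = 2 ^ t) (Recog.isOnes _)
  have h2 : Definable₈ C fun _ val => popcount (val 4) = val 1 :=
    ((Definable.linear [(1, .var 1), (-1, .pop)] 0).and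
      (Definable.linear [(-1, .var 1), (1, .pop)] 0)).congr fun x val => by
      simp [Fml.env]
      omega
  refine ((definable_bitAt penc hk hC0).and ((definable_belowKappa penc c hk hC0).and
    (((h1.and (h2.and (definable_le 2 4))).ex 4).and ((definable_symAt penc hC0 3 (by decide) (.letter σ)).and
      ((definable_lt 3 0 0).and (((definable_le 3 6).imp ((definable_lt 6 0 0).imp
        (definable_letterAt penc hC0 6 (by decide)))).all 6)))))).congr fun x val => ?_
  refine and_congr_right fun h3 => and_congr_right fun h4 => and_congr ?_ <|
    and_congr_right fun _ => and_congr_right fun _ => ?_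
  · have h5 : 2 ^ val 1 ≤ 2 ^ varBits C x.length := by
      refine Nat.pow_le_pow_right (by norm_num) ((belowKappa_lt penc hk h4).le.trans ?_)
      exact Nat.mul_le_mul_right _ hC.le
    rw [exists_ones_iff h5]
    simp
  · have hB := lt_two_pow_varBits hC0 x.length
    have h5 : val 0 < x.length := by
      rcases h3 with h3 | h3 <;> exact h3.1.lt hk
    simp
    constructor
    · intro h q h6 h7
      exact h q (by omega) h6 h7
    · intro h q _ h6 h7
      exact h q h6 h7

theorem definable_validInput [Finite S] (hk : 0 < k) (hC : 0 < C) :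
    Definable₈ C fun x _ => ValidInput penc x := by
  have h1 : ∀ v : Fin 8, Definable₈ C fun x val => k * val v < x.length := fun v =>
    (Definable.linear [(k, .var v), (-1, .n)] (-1)).congr fun x val => by
      simp [Fml.env]
      zify
      generalize (k : ℤ) * (val v : ℤ) = z
      omega
  have h2 : Definable₈ C fun x val => ∃ σ, SymAt penc x (val 5) σ :=
    Definable.exists_finite fun σ => definable_symAt penc hC 5 (by decide) σ
  have h3 : Definable₈ C fun _ val => val 5 = 0 :=
    (Definable.linear [(1, .var 5)] 0).congr fun x val => by
      simp [Fml.env]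
  have h4 : Definable₈ C fun _ val => val 6 = val 5 + 1 :=
    ((definable_lt 6 5 2).and (definable_lt 5 6 0)).congr fun x val => by omega
  refine (((h1 5).imp (h2.and ((h3.imp (definable_digitAt penc hC 5 (by decide)).not).and
    ((definable_letterAt penc hC 5 (by decide)).imp ((h4.and ((h1 6).and
      (definable_digitAt penc hC 6 (by decide)).not)).ex 6))))).all 5).congr fun x val => ?_
  have hB := lt_two_pow_varBits hC x.length
  have hlt : ∀ p, k * p < x.length → p < x.length := fun p hp =>
    (Nat.le_mul_of_pos_left _ hk).trans_lt hp
  simp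
  constructor
  · intro h p hp
    obtain ⟨h5, h6, h7⟩ := h p ((hlt p hp).trans hB) hp
    exact ⟨h5, h6, fun h8 => (h7 h8).2⟩
  · intro h p _ hp
    obtain ⟨h5, h6, h7⟩ := h p hp
    exact ⟨h5, h6, fun h8 => ⟨(hlt _ (h7 h8).1).trans hB, h7 h8⟩⟩

end Reduction

/-! ## Codes of power words -/

section Encoding

variable {A : Type*} {l : ℕ} {enc : A → Fin l → Bool}

theorem encodeWord_cons (s : A) (y : List A) :
    encodeWord enc (s :: y) = List.ofFn (enc s) ++ encodeWord enc y := rfl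

theorem length_encodeWord (y : List A) : (encodeWord enc y).length = l * y.length := by
  induction y with
  | nil => rfl
  | cons s y ih => rw [encodeWord_cons, List.length_append, ih]; simp; ring

theorem getD_encodeWord {y : List A} {p : ℕ} {σ : A} (h : y[p]? = some σ) (β : Fin l) :
    (encodeWord enc y).getD (l * p + β) false = enc σ β := by
  induction y generalizing p with
  | nil => simp at h
  | cons s y ih =>
    rw [encodeWord_cons]
    cases p with
    | zero =>
      obtain rfl : s = σ := by simpa using h
      rw [List.getD_append _ _ _ _ (by simp)]
      simp
    | succ p =>
      rw [List.getD_append_right _ _ _ _ (by simp [mul_add]; omega)]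
      rw [← ih (by simpa using h)]
      congr 1
      simp [mul_add]
      omega

theorem encodeWord_injective (hl : 0 < l) (henc : Function.Injective enc) :
    Function.Injective (encodeWord enc) := by
  intro y y' h
  have hlen : y.length = y'.length := by
    have := congrArg List.length h
    rw [length_encodeWord, length_encodeWord] at this
    exact Nat.eq_of_mul_eq_mul_left hl this
  refine List.ext_getElem hlen fun i h1 h2 => henc (funext fun β => ?_)
  rw [← getD_encodeWord (enc := enc) (List.getElem?_eq_getElem h1) β,
    ← getD_encodeWord (enc := enc) (List.getElem?_eq_getElem h2) β, h]

end Encoding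

/-! ### Syntactic description of the codes of power words. -/

section PowerWords

variable {S : Type*} {k : ℕ} {penc : PowerSymbol S → Fin k → Bool}

theorem symAt_encodeWord (hk : 0 < k) (hp : Function.Injective penc) (y : List (PowerSymbol S))
    (p : ℕ) (σ : PowerSymbol S) : SymAt penc (encodeWord penc y) p σ ↔ y[p]? = some σ := by
  constructor
  · rintro ⟨h1, h2⟩
    rw [length_encodeWord, ← Nat.mul_succ] at h1
    have h3 := List.getElem?_eq_getElem (Nat.le_of_mul_le_mul_left h1 hk)
    rw [h3]
    congr 1
    refine hp (funext fun β => ?_)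
    rw [← getD_encodeWord (enc := penc) h3 β, h2]
  · intro h
    refine ⟨?_, fun β => getD_encodeWord h β⟩
    rw [length_encodeWord, ← Nat.mul_succ]
    exact Nat.mul_le_mul_left _ (List.getElem?_eq_some_iff.1 h).1

theorem exists_eq_encodeWord (hk : 0 < k) (x : List Bool)
    (h : ∀ p, k * p < x.length → ∃ σ, SymAt penc x p σ) : ∃ y, x = encodeWord penc y := by
  induction hn : x.length using Nat.strong_induction_on generalizing x with
  | _ n ih =>
    subst hn
    rcases Nat.eq_zero_or_pos x.length with h0 | h0
    · exact ⟨[], by rw [List.length_eq_zero_iff.1 h0]; rfl⟩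
    · obtain ⟨σ, h1, h2⟩ := h 0 (by simpa using h0)
      simp only [mul_zero, zero_add] at h1 h2
      obtain ⟨y, hy⟩ := ih (x.drop k).length (by simp; omega) (x.drop k) (fun p hp => by
        obtain ⟨σ', h3, h4⟩ := h (p + 1) (by simp [mul_add] at hp ⊢; omega)
        refine ⟨σ', by simp [mul_add] at h3 ⊢; omega, fun β => ?_⟩
        rw [← h4 β]
        simp only [List.getD_eq_getElem?_getD, List.getElem?_drop]
        congr 2
        ring) rfl
      refine ⟨σ :: y, ?_⟩
      rw [encodeWord_cons, ← hy]
      conv_lhs => rw [← List.take_append_drop k x]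
      congr 1
      refine List.ext_getElem (by simp; omega) fun i hi hi' => ?_
      have hi2 : i < k := by simpa using hi'
      have := h2 ⟨i, hi2⟩
      simp only [List.getD_eq_getElem?_getD] at this
      rw [List.getElem?_eq_getElem (by omega)] at this
      simpa using this

theorem powerWordSymbols_cons (q : PowerFactor S) (P : List (PowerFactor S)) :
    powerWordSymbols (q :: P) = q.symbols ++ powerWordSymbols P := rfl

theorem powerWordSymbols_append (P P' : List (PowerFactor S)) :
    powerWordSymbols (P ++ P') = powerWordSymbols P ++ powerWordSymbols P' :=
  List.flatMap_append

theorem PowerFactor.length_symbols (q : PowerFactor S) :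
    q.symbols.length = q.base.length + 1 + q.digits.length := by
  simp [PowerFactor.symbols]
  omega

/-- Every letter is followed by a letter or a sign. -/
def LettersFollowed (y : List (PowerSymbol S)) : Prop :=
  ∀ p s, y[p]? = some (.letter s) → ∃ σ, y[p + 1]? = some σ ∧ ∀ b, σ ≠ .digit b

/-- Parsing from the right, with pending digits in front of a power word. A digit joins the pending
ones, a sign closes them to a factor with empty base, and a letter, whose successor is neither a
digit nor missing, extends the base of the first factor. -/
theorem exists_digits_append (y : List (PowerSymbol S)) (h : LettersFollowed y) :
    ∃ (ds : List Bool) (P : List (PowerFactor S)),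
      y = ds.map .digit ++ powerWordSymbols P := by
  induction y with
  | nil => exact ⟨[], [], rfl⟩
  | cons σ y ih =>
    obtain ⟨ds, P, rfl⟩ := ih fun p s hp => h (p + 1) s hp
    rcases σ with s | b | b
    · obtain ⟨τ, h1, h2⟩ := h 0 s rfl
      rcases ds with _ | ⟨b, ds⟩
      · rcases P with _ | ⟨q, P⟩
        · simp [powerWordSymbols] at h1
        · exact ⟨[], ⟨s :: q.base, q.neg, q.digits⟩ :: P, by
            simp [powerWordSymbols_cons, PowerFactor.symbols]⟩
      · simp at h1
        exact absurd h1.symm (h2 b)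
    · exact ⟨[], ⟨[], b, ds⟩ :: P, by simp [powerWordSymbols_cons, PowerFactor.symbols]⟩
    · exact ⟨b :: ds, P, rfl⟩

theorem exists_eq_powerWordSymbols (y : List (PowerSymbol S)) (h : LettersFollowed y)
    (h0 : ∀ b, y[0]? ≠ some (.digit b)) : ∃ P, y = powerWordSymbols P := by
  obtain ⟨ds, P, rfl⟩ := exists_digits_append y h
  rcases ds with _ | ⟨b, ds⟩
  · exact ⟨P, rfl⟩
  · exact absurd rfl (h0 b)

theorem powerWordSymbols_head (P : List (PowerFactor S)) (b : Bool) :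
    (powerWordSymbols P)[0]? ≠ some (.digit b) := by
  rcases P with _ | ⟨q, P⟩
  · simp [powerWordSymbols]
  · rcases h : q.base <;> simp [powerWordSymbols_cons, PowerFactor.symbols, h]

theorem lettersFollowed_powerWordSymbols (P : List (PowerFactor S)) :
    LettersFollowed (powerWordSymbols P) := by
  induction P with
  | nil => intro p s h; simp [powerWordSymbols] at h
  | cons q P ih =>
    intro p s h
    rw [powerWordSymbols_cons] at h ⊢
    have hlen := q.length_symbols
    by_cases hp : p < q.symbols.length
    · rw [List.getElem?_append_left hp] at h
      have h1 : p < q.base.length := by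
        by_contra h1
        rw [PowerFactor.symbols, List.getElem?_append_right (by simpa using h1)] at h
        generalize p - (q.base.map PowerSymbol.letter).length = i at h
        rcases i with _ | i <;> simp at h
      rw [List.getElem?_append_left (by omega), PowerFactor.symbols]
      by_cases h2 : p + 1 < q.base.length
      · exact ⟨.letter q.base[p + 1], by simp [List.getElem?_append_left, h2], by simp⟩
      · have h3 : p + 1 = q.base.length := by omega
        exact ⟨.sign q.neg, by simp [h3], by simp⟩
    · push Not at hp
      rw [List.getElem?_append_right hp] at h
      rw [List.getElem?_append_right (by omega), Nat.sub_add_comm hp]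
      exact ih _ s h

theorem validInput_iff (hk : 0 < k) (hp : Function.Injective penc) (x : List Bool) :
    ValidInput penc x ↔ ∃ P, x = encodeWord penc (powerWordSymbols P) := by
  constructor
  · intro h
    obtain ⟨y, rfl⟩ := exists_eq_encodeWord hk x fun p hp => (h p hp).1
    simp only [ValidInput, LetterAt, DigitAt, symAt_encodeWord hk hp, length_encodeWord,
      Nat.mul_lt_mul_left hk] at h
    obtain ⟨P, rfl⟩ := exists_eq_powerWordSymbols y (fun p s hs => by
        obtain ⟨h1, h2, h3⟩ := h p (List.getElem?_eq_some_iff.1 hs).1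
        obtain ⟨h4, h5⟩ := h3 ⟨s, hs⟩
        exact ⟨y[p + 1], List.getElem?_eq_getElem h4, fun b hb =>
          h5 ⟨b, by rw [List.getElem?_eq_getElem h4, hb]⟩⟩) fun b hb =>
      (h 0 (List.getElem?_eq_some_iff.1 hb).1).2.1 rfl ⟨b, hb⟩
    exact ⟨P, rfl⟩
  · rintro ⟨P, rfl⟩
    simp only [ValidInput, LetterAt, DigitAt, symAt_encodeWord hk hp, length_encodeWord,
      Nat.mul_lt_mul_left hk]
    refine fun p hp => ⟨⟨_, List.getElem?_eq_getElem hp⟩, ?_, ?_⟩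
    · rintro rfl ⟨b, hb⟩
      exact powerWordSymbols_head P b hb
    · rintro ⟨s, hs⟩
      obtain ⟨σ, h1, h2⟩ := lettersFollowed_powerWordSymbols P p s hs
      exact ⟨(List.getElem?_eq_some_iff.1 h1).1, fun ⟨b, hb⟩ =>
        h2 b (Option.some.inj (h1.symm.trans hb))⟩

end PowerWords

/-! ## Binary digits of exponents -/

theorem testBit_bitsNum (l : List Bool) (t : ℕ) :
    (bitsNum l).testBit t = true ↔ l[t]? = some true := by
  induction l generalizing t with
  | nil => simp
  | cons b l ih =>
    have h1 : bitsNum (b :: l) = Nat.bit b (bitsNum l) := by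
      cases b <;> simp [Nat.bit_val] <;> ring
    rw [h1]
    cases t with
    | zero => simp
    | succ t => rw [Nat.testBit_bit_succ, ih]; simp

theorem sum_two_pow_testBit (R N : ℕ) :
    ∑ t ∈ Finset.range N, (if R.testBit t then 2 ^ t else 0) = R % 2 ^ N := by
  induction N with
  | zero => simp [Nat.mod_one]
  | succ N ih =>
    rw [Finset.sum_range_succ, ih, pow_succ, Nat.mod_mul, Nat.testBit_eq_decide_div_mod_eq]
    rcases Nat.mod_two_eq_zero_or_one (R / 2 ^ N) with h | h <;> simp [h]

theorem mod_two_pow_eq_zero_iff (X t : ℕ) : X % 2 ^ t = 0 ↔ ∀ i < t, X.testBit i = false := by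
  constructor
  · intro h i hi
    have := Nat.testBit_mod_two_pow X t i
    rw [h] at this
    simpa [hi] using this
  · intro h
    refine Nat.eq_of_testBit_eq fun i => ?_
    rw [Nat.testBit_mod_two_pow]
    by_cases hi : i < t <;> simp [hi, h]

theorem testBit_emod_two_pow {t κ : ℕ} (h : t < κ) (z : ℤ) :
    (z % 2 ^ κ).toNat.testBit t = true ↔ z / 2 ^ t % 2 = 1 := by
  obtain ⟨d, rfl⟩ := Nat.exists_eq_add_of_lt h
  have hz := Int.emod_add_mul_ediv z (2 ^ (t + d + 1))
  have h0 := Int.emod_nonneg z (b := 2 ^ (t + d + 1)) (by positivity)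
  generalize z / 2 ^ (t + d + 1) = m at hz
  lift z % 2 ^ (t + d + 1) to ℕ using h0 with r
  rw [Int.toNat_natCast, Nat.testBit_eq_decide_div_mod_eq, decide_eq_true_iff, ← hz]
  have e : (r : ℤ) + 2 ^ (t + d + 1) * m = r + 2 ^ t * (2 * (2 ^ d * m)) := by ring
  rw [e, Int.add_mul_ediv_left _ _ (by positivity)]
  have e' : (r : ℤ) / 2 ^ t = ((r / 2 ^ t : ℕ) : ℤ) := by push_cast; rfl
  rw [e']
  omega

/-- Division rounds downwards, so a nonzero remainder lowers the quotient by one. This is the borrow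
in two's complement. -/
theorem neg_ediv_two_pow (X t : ℕ) :
    (-(X : ℤ)) / 2 ^ t = if X % 2 ^ t = 0 then -((X / 2 ^ t : ℕ) : ℤ)
      else -((X / 2 ^ t : ℕ) : ℤ) - 1 := by
  have h := Nat.div_add_mod X (2 ^ t)
  have h1 : X % 2 ^ t < 2 ^ t := Nat.mod_lt _ (by positivity)
  generalize X / 2 ^ t = q, X % 2 ^ t = r at *
  subst h
  have hp : (0 : ℤ) < 2 ^ t := by positivity
  have h1' : (r : ℤ) < 2 ^ t := by exact_mod_cast h1
  push_cast
  split
  · subst r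
    rw [show -((2 : ℤ) ^ t * q + (0 : ℕ)) = 0 + 2 ^ t * (-q) by push_cast; ring,
      Int.add_mul_ediv_left _ _ hp.ne']
    simp
  · have hr : (0 : ℤ) < r := by omega
    rw [show -((2 : ℤ) ^ t * q + r) = (2 ^ t - r) + 2 ^ t * (-q - 1) by ring,
      Int.add_mul_ediv_left _ _ hp.ne', Int.ediv_eq_zero_of_lt (by omega) (by omega)]
    simp

/-- In $-X$ the lowest digit one and the zeros below it are kept, and all higher digits are
complemented. The formula expresses this without computing a carry. -/
theorem PowerFactor.testBit_exponent {S : Type*} (q : PowerFactor S) {t κ : ℕ} (h : t < κ) :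
    (q.exponent % ((2 ^ κ : ℕ) : ℤ)).toNat.testBit t = true ↔
      if q.neg then ¬ (q.digits[t]? = some true ↔ ∃ i < t, q.digits[i]? = some true)
      else q.digits[t]? = some true := by
  have hX : q.absExponent = bitsNum q.digits := rfl
  push_cast
  rw [testBit_emod_two_pow h, exponent, hX]
  simp only [← testBit_bitsNum]
  generalize bitsNum q.digits = X
  have h1 : X.testBit t = true ↔ X / 2 ^ t % 2 = 1 := by
    rw [Nat.testBit_eq_decide_div_mod_eq, decide_eq_true_iff]
  split
  · have h2 : (∃ i < t, X.testBit i = true) ↔ ¬ X % 2 ^ t = 0 := by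
      rw [mod_two_pow_eq_zero_iff]
      simp
    rw [h1, h2, neg_ediv_two_pow]
    generalize X / 2 ^ t = Y
    split <;> simp [*] <;> omega
  · rw [h1]
    have : (X : ℤ) / 2 ^ t = ((X / 2 ^ t : ℕ) : ℤ) := by push_cast; rfl
    rw [this]
    omega

/-! ## The copied letters -/

theorem flatMap_range_segment {α : Type*} (F : ℕ → List α) {B a m : ℕ} (h : a + m ≤ B)
    (h0 : ∀ i < B, i < a ∨ a + m ≤ i → F i = []) :
    (List.range B).flatMap F = (List.range m).flatMap fun i => F (a + i) := by
  obtain ⟨r, rfl⟩ := Nat.exists_eq_add_of_le h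
  have h1 : (List.range a).flatMap F = [] :=
    List.flatMap_eq_nil_iff.2 fun i hi => by
      have := List.mem_range.1 hi
      exact h0 i (by omega) (.inl this)
  have h2 : (List.range r).flatMap (fun i => F (a + m + i)) = [] :=
    List.flatMap_eq_nil_iff.2 fun i hi => by
      have := List.mem_range.1 hi
      exact h0 _ (by omega) (.inr (by omega))
  rw [List.range_add, List.range_add, List.flatMap_append, List.flatMap_append, h1,
    List.flatMap_map, List.flatMap_map, h2]
  simp

theorem flatMap_range_getElem? {α : Type*} (u : List α) :
    (List.range u.length).flatMap (fun i => u[i]?.toList) = u := by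
  induction u with
  | nil => rfl
  | cons s u ih =>
    rw [List.length_cons, List.range_succ_eq_map, List.flatMap_cons, List.flatMap_map]
    simpa using ih

theorem flatMap_range_const {α : Type*} (u : List α) (K : ℕ) :
    (List.range K).flatMap (fun _ => u) = (List.replicate K u).flatten := by
  simp [List.flatMap_def, List.map_const']

theorem flatMap_range_replicate {α : Type*} (u : List α) (f : ℕ → ℕ) (K : ℕ) :
    (List.range K).flatMap (fun t => (List.replicate (f t) u).flatten) =
      (List.replicate (∑ t ∈ Finset.range K, f t) u).flatten := by
  induction K with
  | zero => rfl
  | succ K ih =>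
    rw [List.range_succ, List.flatMap_append, ih, Finset.sum_range_succ, List.replicate_add,
      List.flatten_append]
    simp

section

variable {S : Type*} {k : ℕ} {penc : PowerSymbol S → Fin k → Bool}

theorem maxBaseLength_cons (q : PowerFactor S) (P : List (PowerFactor S)) :
    maxBaseLength (q :: P) = max q.base.length (maxBaseLength P) := rfl

theorem length_le_maxBaseLength {q : PowerFactor S} {P : List (PowerFactor S)} (h : q ∈ P) :
    q.base.length ≤ maxBaseLength P := by
  induction P with
  | nil => simp at h
  | cons q' P ih =>
    rw [maxBaseLength_cons]
    rcases List.mem_cons.1 h with rfl | h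
    · exact le_max_left _ _
    · exact (ih h).trans (le_max_right _ _)

namespace PowerFactor

variable (q : PowerFactor S) (Y₁ Y₂ : List (PowerSymbol S))

theorem getElem?_base {i : ℕ} (h : i < q.base.length) :
    (Y₁ ++ (q.symbols ++ Y₂))[Y₁.length + i]? = some (.letter q.base[i]) := by
  rw [List.getElem?_append_right (by omega), List.getElem?_append_left
    (by rw [q.length_symbols]; omega), PowerFactor.symbols, List.getElem?_append_left
    (by simp; omega)]
  simp [h]

theorem getElem?_sign :
    (Y₁ ++ (q.symbols ++ Y₂))[Y₁.length + q.base.length]? = some (.sign q.neg) := by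
  rw [List.getElem?_append_right (by omega), List.getElem?_append_left
    (by rw [q.length_symbols]; omega), PowerFactor.symbols, List.getElem?_append_right
    (by simp)]
  simp

theorem getElem?_digit {t : ℕ} (h : t < q.digits.length) :
    (Y₁ ++ (q.symbols ++ Y₂))[Y₁.length + q.base.length + 1 + t]? =
      some (.digit q.digits[t]) := by
  rw [List.getElem?_append_right (by omega), List.getElem?_append_left
    (by rw [q.length_symbols]; omega), PowerFactor.symbols, List.getElem?_append_right
    (by simp; omega)]
  have : Y₁.length + q.base.length + 1 + t - Y₁.length - (q.base.map PowerSymbol.letter).length =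
      t + 1 := by simp; omega
  rw [this, List.getElem?_cons_succ]
  simp [h]

theorem getElem?_after :
    (Y₁ ++ (q.symbols ++ Y₂))[Y₁.length + q.base.length + 1 + q.digits.length]? = Y₂[0]? := by
  rw [List.getElem?_append_right (by omega), List.getElem?_append_right
    (by rw [q.length_symbols]; omega)]
  congr 1
  rw [q.length_symbols]
  omega

theorem oneAt_iff (hk : 0 < k) (hp : Function.Injective penc) (h2 : ∀ b, Y₂[0]? ≠ some (.digit b))
    (t : ℕ) : OneAt penc (encodeWord penc (Y₁ ++ (q.symbols ++ Y₂)))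
      (Y₁.length + q.base.length) (Y₁.length + q.base.length + 1 + t) ↔
        q.digits[t]? = some true := by
  simp only [OneAt, DigitAt, symAt_encodeWord hk hp]
  constructor
  · rintro ⟨-, h3, h4⟩
    rcases lt_trichotomy t q.digits.length with h | h | h
    · rw [q.getElem?_digit Y₁ Y₂ h] at h3
      simpa [h] using h3
    · subst h
      rw [q.getElem?_after] at h3
      exact absurd h3 (h2 _)
    · obtain ⟨b, hb⟩ := h4 (Y₁.length + q.base.length + 1 + q.digits.length) (by omega) (by omega)
      rw [q.getElem?_after] at hb
      exact absurd hb (h2 _)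
  · intro h
    obtain ⟨h3, h4⟩ := List.getElem?_eq_some_iff.1 h
    refine ⟨by omega, by rw [q.getElem?_digit Y₁ Y₂ h3, h4], fun p h5 h6 => ?_⟩
    obtain ⟨i, rfl⟩ : ∃ i, p = Y₁.length + q.base.length + 1 + i :=
      ⟨p - (Y₁.length + q.base.length + 1), by omega⟩
    exact ⟨_, q.getElem?_digit Y₁ Y₂ (by omega)⟩

theorem bitAt_iff (hk : 0 < k) (hp : Function.Injective penc) (h2 : ∀ b, Y₂[0]? ≠ some (.digit b))
    {t κ : ℕ} (ht : t < κ) : BitAt penc (encodeWord penc (Y₁ ++ (q.symbols ++ Y₂)))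
      (Y₁.length + q.base.length) t ↔
        (q.exponent % ((2 ^ κ : ℕ) : ℤ)).toNat.testBit t = true := by
  have h3 := q.oneAt_iff Y₁ Y₂ hk hp h2
  have h4 : (∃ p < Y₁.length + q.base.length + 1 + t,
      OneAt penc (encodeWord penc (Y₁ ++ (q.symbols ++ Y₂))) (Y₁.length + q.base.length) p) ↔
        ∃ i < t, q.digits[i]? = some true := by
    constructor
    · rintro ⟨p, h5, h6⟩
      obtain ⟨i, rfl⟩ : ∃ i, p = Y₁.length + q.base.length + 1 + i :=
        ⟨p - (Y₁.length + q.base.length + 1), by have := h6.1; omega⟩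
      exact ⟨i, by omega, (h3 i).1 h6⟩
    · rintro ⟨i, h5, h6⟩
      exact ⟨_, by omega, (h3 i).2 h6⟩
  rw [q.testBit_exponent ht, BitAt, symAt_encodeWord hk hp, symAt_encodeWord hk hp,
    q.getElem?_sign, h3, h4]
  cases q.neg <;> simp

end PowerFactor

theorem powerWordSymbols_getLast (P : List (PowerFactor S)) (s : S) :
    (powerWordSymbols P).getLast? ≠ some (.letter s) := by
  rcases List.eq_nil_or_concat P with rfl | ⟨P, q, rfl⟩
  · simp [powerWordSymbols]
  · have : powerWordSymbols (P ++ [q]) =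
        powerWordSymbols P ++ (q.base.map .letter ++ .sign q.neg :: q.digits.map .digit) := by
      rw [powerWordSymbols_append]
      simp [powerWordSymbols, PowerFactor.symbols]
    rw [List.concat_eq_append, this]
    rcases List.eq_nil_or_concat q.digits with h | ⟨ds, b, h⟩ <;> rw [h] <;> simp [List.getLast?_cons]

/-- Every factor contains a sign, so a run of letters cannot extend over two bases. -/
theorem run_le_maxBaseLength (P : List (PowerFactor S)) {a L : ℕ}
    (h : ∀ i, a ≤ i → i < a + L → ∃ s, (powerWordSymbols P)[i]? = some (.letter s)) :
    L ≤ maxBaseLength P := by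
  induction P generalizing a with
  | nil =>
    by_contra hL
    rw [maxBaseLength] at hL
    obtain ⟨s, hs⟩ := h a le_rfl (by simp at hL; omega)
    simp [powerWordSymbols] at hs
  | cons q P ih =>
    rw [maxBaseLength_cons, powerWordSymbols_cons] at *
    rcases Nat.eq_zero_or_pos L with rfl | hL
    · exact Nat.zero_le _
    have hlen := q.length_symbols
    have hb := fun {i} => q.getElem?_base [] (powerWordSymbols P) (i := i)
    have hs := q.getElem?_sign [] (powerWordSymbols P)
    have hd := fun {t} => q.getElem?_digit [] (powerWordSymbols P) (t := t)
    simp only [List.nil_append, List.length_nil, zero_add] at hb hs hd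
    rcases lt_trichotomy a q.base.length with h1 | h1 | h1
    · refine le_trans ?_ (le_max_left _ _)
      by_contra h2
      obtain ⟨s, h3⟩ := h q.base.length (by omega) (by omega)
      rw [hs] at h3
      simp at h3
    · obtain ⟨s, h3⟩ := h a le_rfl (by omega)
      rw [h1, hs] at h3
      simp at h3
    · by_cases h2 : a < q.symbols.length
      · obtain ⟨s, h3⟩ := h a le_rfl (by omega)
        obtain ⟨t, rfl⟩ : ∃ t, a = q.base.length + 1 + t := ⟨a - (q.base.length + 1), by omega⟩
        rw [hd (by omega)] at h3
        simp at h3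
      · refine le_trans (ih (a := a - q.symbols.length) fun i h3 h4 => ?_) (le_max_right _ _)
        obtain ⟨s, h5⟩ := h (i + q.symbols.length) (by omega) (by omega)
        rw [List.getElem?_append_right (by omega), Nat.add_sub_cancel] at h5
        exact ⟨s, h5⟩

theorem exists_run (P : List (PowerFactor S)) : ∃ a, ∀ i, a ≤ i → i < a + maxBaseLength P →
    ∃ s, (powerWordSymbols P)[i]? = some (.letter s) := by
  induction P with
  | nil => exact ⟨0, fun i _ h => by simp [maxBaseLength] at h⟩
  | cons q P ih =>
    rw [maxBaseLength_cons, powerWordSymbols_cons]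
    rcases le_total (maxBaseLength P) q.base.length with h | h
    · rw [max_eq_left h]
      refine ⟨0, fun i _ hi => ⟨q.base[i]'(by omega), ?_⟩⟩
      have := q.getElem?_base [] (powerWordSymbols P) (i := i) (by omega)
      simpa using this
    · rw [max_eq_right h]
      obtain ⟨a, ha⟩ := ih
      refine ⟨q.symbols.length + a, fun i h1 h2 => ?_⟩
      obtain ⟨s, hs⟩ := ha (i - q.symbols.length) (by omega) (by omega)
      exact ⟨s, by rwa [List.getElem?_append_right (by omega)]⟩

/-- The inequality $2^i\le m$ means $i<\mathrm{size}(m)$, and it is visible as a run of $2^i$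
letters. The best such $i$ is $\mathrm{size}(m)-1$, whence `i + 2` in the definition; the
alternative `t < c` covers $m=0$. -/
theorem belowKappa_iff (hk : 0 < k) (hp : Function.Injective penc) (c : ℕ)
    (P : List (PowerFactor S)) (t : ℕ) :
    BelowKappa penc c (encodeWord penc (powerWordSymbols P)) t ↔
      t < c * (Nat.size (maxBaseLength P) + 1) := by
  simp only [BelowKappa, LetterAt, symAt_encodeWord hk hp]
  constructor
  · rintro (h | ⟨i, a, h1, h2⟩)
    · exact h.trans_le (Nat.le_mul_of_pos_right _ (Nat.succ_pos _))
    · have h3 := Nat.lt_size.2 (run_le_maxBaseLength P h2)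
      exact h1.trans_le (Nat.mul_le_mul_left _ (by omega))
  · intro h
    rcases hs : Nat.size (maxBaseLength P) with _ | i
    · left
      simpa [hs] using h
    · right
      have h1 : 2 ^ i ≤ maxBaseLength P := Nat.lt_size.1 (by omega)
      obtain ⟨a, ha⟩ := exists_run P
      refine ⟨i, a, by rwa [hs] at h, fun q h2 h3 => ha q h2 (by omega)⟩

theorem copied_iff (hk : 0 < k) (hp : Function.Injective penc) (c : ℕ)
    (P₁ P₂ : List (PowerFactor S)) (q : PowerFactor S) (t r j : ℕ) (σ : S) {κ : ℕ}
    (hκ : κ = c * (Nat.size (maxBaseLength (P₁ ++ q :: P₂)) + 1)) :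
    Copied penc c (encodeWord penc (powerWordSymbols (P₁ ++ q :: P₂)))
      ((powerWordSymbols P₁).length + q.base.length) t r j σ ↔
    (t < κ ∧ (q.exponent % ((2 ^ κ : ℕ) : ℤ)).toNat.testBit t = true) ∧ r < 2 ^ t ∧
      (powerWordSymbols P₁).length ≤ j ∧
        q.base[j - (powerWordSymbols P₁).length]? = some σ := by
  rw [Copied, belowKappa_iff hk hp, ← hκ]
  have e : powerWordSymbols (P₁ ++ q :: P₂) =
      powerWordSymbols P₁ ++ (q.symbols ++ powerWordSymbols P₂) := powerWordSymbols_append _ _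
  have hlast := powerWordSymbols_getLast P₁
  generalize hY : powerWordSymbols P₁ = Y₁ at *
  rw [e]
  have hbit := fun ht : t < κ => q.bitAt_iff Y₁ (powerWordSymbols P₂) hk hp
    (powerWordSymbols_head P₂) ht
  have hb := fun i => q.getElem?_base Y₁ (powerWordSymbols P₂) (i := i)
  constructor
  · rintro ⟨h1, h2, h3, h4, h5, h6⟩
    refine ⟨⟨h2, (hbit h2).1 h1⟩, h3, ?_⟩
    -- The preceding factor ends with a sign or a digit, so an uninterrupted run of letters up to
    -- the sign starts inside the base of `q`.
    have h7 : Y₁.length ≤ j := by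
      by_contra h7
      obtain ⟨s, hs⟩ := h6 (Y₁.length - 1) (by omega) (by omega)
      rw [symAt_encodeWord hk hp, List.getElem?_append_left (by omega),
        ← List.getLast?_eq_getElem?] at hs
      exact hlast s hs
    obtain ⟨i, rfl⟩ := Nat.exists_eq_add_of_le h7
    have h8 : i < q.base.length := by omega
    rw [symAt_encodeWord hk hp, hb i h8] at h4
    refine ⟨h7, ?_⟩
    simpa [h8] using h4
  · rintro ⟨⟨h2, h1⟩, h3, h4, h5⟩
    obtain ⟨i, rfl⟩ := Nat.exists_eq_add_of_le h4
    rw [Nat.add_sub_cancel_left] at h5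
    obtain ⟨h6, h7⟩ := List.getElem?_eq_some_iff.1 h5
    refine ⟨(hbit h2).2 h1, h2, h3, ?_, by omega, fun p h8 h9 => ?_⟩
    · rw [symAt_encodeWord hk hp, hb i h6, h7]
    · obtain ⟨d, rfl⟩ := Nat.exists_eq_add_of_le (h4.trans h8)
      exact ⟨_, (symAt_encodeWord hk hp _ _ _).2 (hb d (by omega))⟩

/-- The copied letters of one factor form a power of its base word. -/
theorem flatMap_copied (hk : 0 < k) (hp : Function.Injective penc) (c B : ℕ)
    (P₁ P₂ : List (PowerFactor S)) (q : PowerFactor S) {κ : ℕ}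
    (hκ : κ = c * (Nat.size (maxBaseLength (P₁ ++ q :: P₂)) + 1)) (hB : 2 ^ κ ≤ B)
    (hB' : (powerWordSymbols (P₁ ++ q :: P₂)).length ≤ B)
    (o : ℕ → ℕ → ℕ → ℕ → Option S)
    (ho : ∀ s t r j σ, o s t r j = some σ ↔
      Copied penc c (encodeWord penc (powerWordSymbols (P₁ ++ q :: P₂))) s t r j σ) :
    ((List.range B).flatMap fun t => (List.range B).flatMap fun r => (List.range B).flatMap fun j =>
      (o ((powerWordSymbols P₁).length + q.base.length) t r j).toList) =
    (List.replicate (q.exponent % ((2 ^ κ : ℕ) : ℤ)).toNat q.base).flatten := by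
  have hlen : (powerWordSymbols P₁).length + q.base.length ≤ B := by
    rw [powerWordSymbols_append, powerWordSymbols_cons] at hB'
    simp only [List.length_append, q.length_symbols] at hB'
    omega
  have hc := fun t r j σ => (ho _ t r j σ).trans (copied_iff hk hp c P₁ P₂ q t r j σ hκ)
  generalize hR : (q.exponent % ((2 ^ κ : ℕ) : ℤ)).toNat = R at hc ⊢
  have hRlt : R < 2 ^ κ := by
    have h1 := Int.emod_lt_of_pos q.exponent (b := ((2 ^ κ : ℕ) : ℤ)) (by positivity)
    have h2 := Int.emod_nonneg q.exponent (b := ((2 ^ κ : ℕ) : ℤ)) (by positivity)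
    omega
  generalize (powerWordSymbols P₁).length = a at *
  have hκB : κ ≤ B := (Nat.lt_two_pow_self (n := κ)).le.trans hB
  have h1 : ∀ t r, ((List.range B).flatMap fun j => (o (a + q.base.length) t r j).toList) =
      if (t < κ ∧ R.testBit t = true) ∧ r < 2 ^ t then q.base else [] := by
    intro t r
    split
    · rename_i h
      rw [flatMap_range_segment _ hlen fun j _ hj => ?_]
      · conv_rhs => rw [← flatMap_range_getElem? q.base]
        refine List.flatMap_congr fun j _ => ?_
        congr 1
        refine Option.ext fun σ => ?_
        simp [hc, h.1, h.2]
      · rw [Option.toList_eq_nil_iff, Option.eq_none_iff_forall_ne_some]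
        intro σ hσ
        obtain ⟨-, -, h3, h4⟩ := (hc _ _ _ _).1 hσ
        have := (List.getElem?_eq_some_iff.1 h4).1
        omega
    · rename_i h
      rw [List.flatMap_eq_nil_iff]
      intro j _
      rw [Option.toList_eq_nil_iff, Option.eq_none_iff_forall_ne_some]
      intro σ hσ
      obtain ⟨h3, h4, -, -⟩ := (hc _ _ _ _).1 hσ
      exact h ⟨h3, h4⟩
  have h2 : ∀ t, ((List.range B).flatMap fun r => (List.range B).flatMap fun j =>
      (o (a + q.base.length) t r j).toList) =
      (List.replicate (if R.testBit t then 2 ^ t else 0) q.base).flatten := by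
    intro t
    simp only [h1]
    by_cases h : R.testBit t = true
    · have ht : t < κ := by
        by_contra ht
        rw [Nat.testBit_lt_two_pow (hRlt.trans_le
          (Nat.pow_le_pow_right (by norm_num) (by omega)))] at h
        cases h
      have h3 : 2 ^ t ≤ B := (Nat.pow_le_pow_right (by norm_num) ht.le).trans hB
      rw [flatMap_range_segment (a := 0) (m := 2 ^ t) _ (by omega) fun r _ hr => ?_]
      · rw [if_pos h, ← flatMap_range_const]
        refine List.flatMap_congr fun r hr => ?_
        rw [if_pos ⟨⟨ht, h⟩, by simpa using hr⟩]
      · rw [if_neg]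
        omega
    · simp [h]
  simp only [h2]
  -- Digit `t` contributes $2^t$ copies, and the contributions add up to the residue.
  rw [flatMap_range_replicate, sum_two_pow_testBit, Nat.mod_eq_of_lt]
  exact hRlt.trans_le ((Nat.pow_le_pow_right (by norm_num) hκB))

/-- The copied letters form the reduced word. -/
theorem flatMap_copied_eq_reducedWord (hk : 0 < k) (hp : Function.Injective penc) (c B : ℕ)
    (P : List (PowerFactor S)) {κ : ℕ} (hκ : κ = c * (Nat.size (maxBaseLength P) + 1))
    (hB : 2 ^ κ ≤ B) (hB' : (powerWordSymbols P).length ≤ B)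
    (o : ℕ → ℕ → ℕ → ℕ → Option S)
    (ho : ∀ s t r j σ, o s t r j = some σ ↔
      Copied penc c (encodeWord penc (powerWordSymbols P)) s t r j σ) :
    ((List.range B).flatMap fun s => (List.range B).flatMap fun t => (List.range B).flatMap fun r =>
      (List.range B).flatMap fun j => (o s t r j).toList) = reducedWord (2 ^ κ) P := by
  set G : ℕ → List S := fun s => (List.range B).flatMap fun t => (List.range B).flatMap fun r =>
      (List.range B).flatMap fun j => (o s t r j).toList with hG
  have hsign : ∀ s, (∀ b, (powerWordSymbols P)[s]? ≠ some (.sign b)) → G s = [] := by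
    intro s hs
    simp only [hG, List.flatMap_eq_nil_iff, Option.toList_eq_nil_iff,
      Option.eq_none_iff_forall_ne_some]
    intro t _ r _ j _ σ hσ
    obtain ⟨h, -⟩ := (ho _ _ _ _ _).1 hσ
    rw [BitAt, symAt_encodeWord hk hp, symAt_encodeWord hk hp] at h
    rcases h with h | h
    · exact hs _ h.1
    · exact hs _ h.1
  -- Induction along initial segments of the power word: the interval of a new factor contains
  -- exactly one sign position, and only there is anything copied.
  have key : ∀ P₁ P₂, P = P₁ ++ P₂ →
      (List.range (powerWordSymbols P₁).length).flatMap G = reducedWord (2 ^ κ) P₁ := by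
    intro P₁
    induction P₁ using List.reverseRecOn with
    | nil => intro P₂ _; rfl
    | append_singleton P₁ q ih =>
      intro P₂ h
      rw [List.append_assoc, List.singleton_append] at h
      have e : powerWordSymbols P =
          powerWordSymbols P₁ ++ (q.symbols ++ powerWordSymbols P₂) := by
        rw [h, powerWordSymbols_append, powerWordSymbols_cons]
      have e' : powerWordSymbols (P₁ ++ [q]) = powerWordSymbols P₁ ++ q.symbols := by
        rw [powerWordSymbols_append]
        simp [powerWordSymbols]
      rw [e', List.length_append, List.range_add, List.flatMap_append, ih _ h, List.flatMap_map,
        flatMap_range_segment (a := q.base.length) (m := 1) _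
          (by rw [q.length_symbols]; omega) fun i hi' hi => ?_]
      · rw [reducedWord, reducedWord, List.flatMap_append]
        congr 1
        subst h
        simpa using flatMap_copied hk hp c B P₁ P₂ q hκ hB hB' o ho
      · refine hsign _ fun b hb => ?_
        rw [e] at hb
        rcases hi with hi | hi
        · rw [q.getElem?_base _ _ hi] at hb
          simp at hb
        · obtain ⟨t, rfl⟩ := Nat.exists_eq_add_of_le hi
          rw [q.length_symbols] at hi'
          rw [← add_assoc, ← add_assoc, q.getElem?_digit _ _ (by omega)] at hb
          simp at hb
  rw [flatMap_range_segment (a := 0) (m := (powerWordSymbols P).length) _ (by omega) fun i _ hi => ?_]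
  · simpa using key P [] (by simp)
  · refine hsign i fun b hb => ?_
    have := (List.getElem?_eq_some_iff.1 hb).1
    omega

end

/-! ## The reduction to the word problem -/

section

variable {S G : Type*} [Group G]

theorem IsPadding.prod_eq {e : S} {val : S → G} (he : val e = 1) {v w : List S}
    (h : IsPadding e v w) : (w.map val).prod = (v.map val).prod := by
  induction h with
  | nil => rfl
  | cons s _ ih => simp [ih]
  | pad _ ih => simp [ih, he]

theorem isPadding_map_getD {α : Type*} (e : S) (o : α → Option S) (L : List α) :
    IsPadding e (L.flatMap fun a => (o a).toList) (L.map fun a => (o a).getD e) := by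
  induction L with
  | nil => exact .nil
  | cons a L ih =>
    rw [List.flatMap_cons, List.map_cons]
    rcases o a with _ | s
    · exact .pad ih
    · exact .cons s ih

theorem prod_reducedWord (val : S → G) (M : ℕ) (hM : 0 < M)
    (P : List (PowerFactor S)) (h : ∀ q ∈ P, (q.base.map val).prod ^ M = 1) :
    ((reducedWord M P).map val).prod = powerWordValue val P := by
  induction P with
  | nil => rfl
  | cons q P ih =>
    have e1 : reducedWord M (q :: P) =
        (List.replicate (q.exponent % (M : ℤ)).toNat q.base).flatten ++ reducedWord M P := rfl
    have e2 : powerWordValue val (q :: P) =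
        (q.base.map val).prod ^ q.exponent * powerWordValue val P := by simp [powerWordValue]
    rw [e1, e2, List.map_append, List.prod_append, ih fun q' hq' => h q' (List.mem_cons_of_mem _ hq')]
    congr 1
    have h1 := h q List.mem_cons_self
    rw [List.map_flatten, List.prod_flatten, List.map_replicate, List.map_replicate,
      List.prod_replicate]
    generalize (q.base.map val).prod = u at *
    have h2 : (((q.exponent % (M : ℤ)).toNat : ℕ) : ℤ) = q.exponent % M :=
      Int.toNat_of_nonneg (Int.emod_nonneg _ (by omega))
    rw [← zpow_natCast, h2]
    conv_rhs => rw [← Int.emod_add_mul_ediv q.exponent M, zpow_add, zpow_mul, zpow_natCast, h1,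
      one_zpow, mul_one]

end

theorem coe_prod_flatMap {S : Type*} {val : S → grigorchukGroup} {ws : S → List GrigGen}
    (hws : ∀ s, (val s : BinaryTreeAut) = ((ws s).map GrigGen.toAut).prod) (u : List S) :
    (((u.map val).prod : grigorchukGroup) : BinaryTreeAut) =
      ((u.flatMap ws).map GrigGen.toAut).prod := by
  induction u with
  | nil => rfl
  | cons s u ih =>
    rw [List.map_cons, List.prod_cons, Subgroup.coe_mul, ih, hws, List.flatMap_cons,
      List.map_append, List.prod_append]

theorem length_flatMap_le {S A : Type*} {ws : S → List A} {K : ℕ} (hK : ∀ s, (ws s).length ≤ K)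
    (u : List S) : (u.flatMap ws).length ≤ K * u.length := by
  induction u with
  | nil => simp
  | cons s u ih =>
    have := hK s
    rw [List.flatMap_cons, List.length_append, List.length_cons, mul_add]
    omega

/-- Words for the values of the letters, of bounded length. -/
theorem exists_words {S : Type*} [Finite S] (val : S → grigorchukGroup) :
    ∃ (ws : S → List GrigGen) (K : ℕ),
      (∀ s, (val s : BinaryTreeAut) = ((ws s).map GrigGen.toAut).prod) ∧
        ∀ s, (ws s).length ≤ K := by
  have := Fintype.ofFinite S
  choose ws hws using fun s => Grig.exists_word (val s)
  exact ⟨ws, Finset.univ.sup fun s => (ws s).length, hws, fun s =>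
    Finset.le_sup (f := fun s => (ws s).length) (Finset.mem_univ s)⟩

/-- The orders of the elements of the Grigorchuk group divide powers of two that are polynomial in
the word length. -/
theorem exists_pow_eq_one {S : Type*} [Finite S] (val : S → grigorchukGroup) :
    ∃ c, ∀ (u : List S) (m : ℕ), u.length ≤ m → (u.map val).prod ^ 2 ^ varBits c m = 1 := by
  obtain ⟨ws, K, hws, hK⟩ := exists_words val
  -- With words of length at most `K` for the letters, the exponent
  -- $4(\mathrm{size}(K)+\mathrm{size}(m))+1$ suffices, and it is at most
  -- $(4\,\mathrm{size}(K)+5)(\mathrm{size}(m)+1)$.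
  refine ⟨4 * Nat.size K + 5, fun u m hu => ?_⟩
  have h1 := coe_prod_flatMap hws u
  have h2 := (length_flatMap_le hK u).trans (Nat.mul_le_mul_left K hu)
  have h3 : (u.flatMap ws).length < 2 ^ (Nat.size K + Nat.size m) := by
    refine h2.trans_lt ?_
    rw [pow_add]
    exact Nat.mul_lt_mul'' (Nat.lt_size_self K) (Nat.lt_size_self m)
  have h4 := Grig.wordPerm_pow_eq_one _ _ h3
  have h5 : (u.map val).prod ^ 2 ^ (4 * (Nat.size K + Nat.size m) + 1) = 1 := by
    apply Subtype.ext
    rw [Subgroup.coe_pow, h1, Subgroup.coe_one]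
    have h6 : ∀ (w : List GrigGen) (N : ℕ), (w.map GrigGen.toAut).prod ^ N =
        ((List.replicate N w).flatten.map GrigGen.toAut).prod := by
      intro w N
      simp [List.map_flatten, List.prod_flatten]
    have h7 : ∀ (w : List GrigGen) (N : ℕ), Grig.wordPerm w ^ N =
        Grig.wordPerm (List.replicate N w).flatten := by
      intro w N
      simp [Grig.wordPerm, List.map_flatten, List.prod_flatten]
    rw [h6]
    refine (Grig.prod_toAut_eq_iff _ []).2 ?_
    rw [← h7, h4, Grig.wordPerm_nil]
  have h6 : 4 * (Nat.size K + Nat.size m) + 1 ≤ varBits (4 * Nat.size K + 5) m := by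
    rw [varBits]
    ring_nf
    have := Nat.zero_le (Nat.size K * Nat.size m)
    omega
  obtain ⟨d, hd⟩ := pow_dvd_pow 2 h6
  rw [hd, pow_mul, h5, one_pow]

theorem flatMap_vals_succ {α : Type*} (B r : ℕ) (F : (ℕ → ℕ) → List α) :
    (vals B (r + 1)).flatMap F =
      (vals B r).flatMap fun v => (List.range B).flatMap fun d => F (Function.update v r d) := by
  rw [vals, List.flatMap_assoc]
  simp [List.flatMap_map]

theorem flatMap_range_if_zero {α : Type*} {B : ℕ} (hB : 0 < B) (L : List α) :
    (List.range B).flatMap (fun d => if d = 0 then L else []) = L := by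
  rw [flatMap_range_segment (a := 0) (m := 1) _ (by omega) fun i _ hi => if_neg (by omega)]
  simp

/-- Variables 4 to 7 serve only for quantification. Demanding that they vanish leaves one slot for
each quadruple, in lexicographic order. -/
theorem flatMap_vals_eight {α : Type*} {B : ℕ} (hB : 0 < B) (o : ℕ → ℕ → ℕ → ℕ → List α) :
    (vals B 8).flatMap (fun v => if v 4 = 0 ∧ v 5 = 0 ∧ v 6 = 0 ∧ v 7 = 0 then
      o (v 0) (v 1) (v 2) (v 3) else []) =
    (List.range B).flatMap fun s => (List.range B).flatMap fun t => (List.range B).flatMap fun r =>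
      (List.range B).flatMap fun j => o s t r j := by
  have h : ∀ (p : Prop) [Decidable p] (L : List α) , (List.range B).flatMap
      (fun d => if p ∧ d = 0 then L else []) = if p then L else [] := by
    intro p _ L
    by_cases hp : p
    · simp [hp, flatMap_range_if_zero hB]
    · simp [hp]
  rw [flatMap_vals_succ B 7, flatMap_vals_succ B 6, flatMap_vals_succ B 5, flatMap_vals_succ B 4,
    flatMap_vals_succ B 3, flatMap_vals_succ B 2, flatMap_vals_succ B 1, flatMap_vals_succ B 0, vals]
  simp [← and_assoc, h, flatMap_range_if_zero hB]

open scoped Classical in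
/-- The power word problem reduces to the word problem, if there is a neutral letter. -/
theorem exists_reduction {S : Type*} [Finite S] (val : S → grigorchukGroup) {l k : ℕ}
    (hl : 0 < l) (hk : 0 < k)
    (enc : S → Fin l → Bool) (henc : Function.Injective enc)
    (penc : PowerSymbol S → Fin k → Bool) (hpenc : Function.Injective penc) (z : S) (hz : val z ≠ 1)
    (e : S) (he : val e = 1) :
    ∃ f : List Bool → List Bool,
      IsUniformAC0Reduction f (PowerWordProblem val penc) (WordProblem val enc) ∧
      ∃ (κ : ℕ → ℕ) (p : Polynomial ℕ), (∀ m, 2 ^ κ m ≤ p.eval m) ∧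
        ∀ P : List (PowerFactor S), ∃ w : List S,
          f (encodeWord penc (powerWordSymbols P)) = encodeWord enc w ∧
          IsPadding e (reducedWord (2 ^ κ (maxBaseLength P)) P) w := by
  obtain ⟨c, hc⟩ := exists_pow_eq_one val
  have hC0 : 0 < c + 1 := by omega
  -- An input that encodes no power word has to be mapped outside the word problem; its output
  -- contains the single non-neutral letter `z`.
  let E : List Bool → ℕ → ℕ → ℕ → ℕ → S → Prop := fun x s t r j σ =>
    (ValidInput penc x ∧ Copied penc c x s t r j σ) ∨
      (¬ ValidInput penc x ∧ σ = z ∧ s = 0 ∧ t = 0 ∧ r = 0 ∧ j = 0)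
  have hE : ∀ x s t r j σ σ', E x s t r j σ → E x s t r j σ' → σ = σ' := by
    rintro x s t r j σ σ' (⟨h1, h2⟩ | ⟨h1, rfl, -⟩) (⟨h3, h4⟩ | ⟨h3, rfl, -⟩)
    · have e1 : penc (.letter σ) = penc (.letter σ') := funext fun β =>
        (h2.2.2.2.1.2 β).symm.trans (h4.2.2.2.1.2 β)
      simpa using hpenc e1
    · exact absurd h1 h3
    · exact absurd h3 h1
    · rfl
  let o' : List Bool → ℕ → ℕ → ℕ → ℕ → Option S := fun x s t r j =>
    if h : ∃ σ, E x s t r j σ then some h.choose else none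
  have ho' : ∀ x s t r j σ, o' x s t r j = some σ ↔ E x s t r j σ := by
    intro x s t r j σ
    simp only [o']
    split
    · rename_i h
      rw [Option.some.injEq]
      exact ⟨fun h' => h' ▸ h.choose_spec, fun h' => hE _ _ _ _ _ _ _ h.choose_spec h'⟩
    · rename_i h
      simp only [reduceCtorEq, false_iff]
      exact fun h' => h ⟨σ, h'⟩
  let Z : (Fin 8 → ℕ) → Prop := fun v => v 4 = 0 ∧ v 5 = 0 ∧ v 6 = 0 ∧ v 7 = 0
  let o : List Bool → (Fin 8 → ℕ) → Option S := fun x v =>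
    if Z v then o' x (v 0) (v 1) (v 2) (v 3) else none
  have ho : ∀ x v σ, o x v = some σ ↔ Z v ∧ E x (v 0) (v 1) (v 2) (v 3) σ := by
    intro x v σ
    simp only [o]
    split <;> simp [*]
  have hzero : ∀ i : Fin 8, Definable₈ (c + 1) fun _ v => v i = 0 := fun i =>
    (Definable.linear [(1, .var i)] 0).congr fun x v => by simp [Fml.env]
  have hdef : ∀ σ, Definable₈ (c + 1) fun x v => o x v = some σ := fun σ => by
    refine Definable.congr ?_ fun x v => (ho x v σ).symm
    refine ((hzero 4).and ((hzero 5).and ((hzero 6).and (hzero 7)))).and ?_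
    refine ((definable_validInput penc hk hC0).and
      (definable_copied penc c hk (Nat.lt_succ_self c) σ)).or ?_
    exact (definable_validInput penc hk hC0).not.and ((Definable.const (σ = z)).and
      ((hzero 0).and ((hzero 1).and ((hzero 2).and (hzero 3)))))
  have hbit : ∀ β, Definable₈ (c + 1) fun x v => enc ((o x v).getD e) β = true := fun β => by
    have h1 : Definable₈ (c + 1) fun x v => ∃ σ, o x v = some σ ∧ enc σ β = true :=
      Definable.exists_finite fun σ => (hdef σ).and (.const _)
    have h2 : Definable₈ (c + 1) fun x v => ∀ σ, ¬ o x v = some σ :=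
      Definable.forall_finite fun σ => (hdef σ).not
    refine (h1.or (h2.and (.const (enc e β = true)))).congr fun x v => ?_
    rcases h : o x v with _ | σ <;> simp
  choose ρ hρ hρ' using hbit
  -- `W` is the output, with `e` in the unused slots, and `V` is the word of the used slots.
  let W : List Bool → List S := fun x => (vals (2 ^ varBits (c + 1) x.length) 8).map fun v =>
    (o x fun i => v i).getD e
  let V : List Bool → List S := fun x => (vals (2 ^ varBits (c + 1) x.length) 8).flatMap fun v =>
    (o x fun i => v i).toList
  have hWV : ∀ x, IsPadding e (V x) (W x) := fun x => isPadding_map_getD e _ _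
  have hV : ∀ x, V x = (List.range (2 ^ varBits (c + 1) x.length)).flatMap fun s =>
      (List.range (2 ^ varBits (c + 1) x.length)).flatMap fun t =>
      (List.range (2 ^ varBits (c + 1) x.length)).flatMap fun r =>
      (List.range (2 ^ varBits (c + 1) x.length)).flatMap fun j => (o' x s t r j).toList := by
    intro x
    rw [← flatMap_vals_eight (by positivity)]
    refine List.flatMap_congr fun v _ => ?_
    simp only [o, Z]
    split <;> rename_i h
    · exact (if_pos h).symm
    · exact (if_neg h).symm
  have hpad : ∀ P : List (PowerFactor S), V (encodeWord penc (powerWordSymbols P)) =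
      reducedWord (2 ^ varBits c (maxBaseLength P)) P := by
    intro P
    have hval := (validInput_iff hk hpenc _).2 ⟨P, rfl⟩
    have h1 : maxBaseLength P ≤ (powerWordSymbols P).length := by
      obtain ⟨a, ha⟩ := exists_run P
      rcases Nat.eq_zero_or_pos (maxBaseLength P) with h0 | h0
      · omega
      · obtain ⟨s, hs⟩ := ha (a + maxBaseLength P - 1) (by omega) (by omega)
        have := (List.getElem?_eq_some_iff.1 hs).1
        omega
    have h2 : (powerWordSymbols P).length ≤ (encodeWord penc (powerWordSymbols P)).length := by
      rw [length_encodeWord]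
      exact Nat.le_mul_of_pos_left _ hk
    rw [hV]
    refine flatMap_copied_eq_reducedWord hk hpenc c _ P rfl ?_ ?_ _ fun s t r j σ => ?_
    · refine Nat.pow_le_pow_right (by norm_num) (Nat.mul_le_mul (by omega) ?_)
      have := Nat.size_le_size (h1.trans h2)
      omega
    · exact h2.trans (lt_two_pow_varBits hC0 _).le
    · rw [ho']
      simp only [E, hval, true_and, not_true_eq_false, false_and, or_false]
  have hinv : ∀ x, ¬ ValidInput penc x → V x = [z] := by
    intro x hx
    have hB : 0 < 2 ^ varBits (c + 1) x.length := by positivity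
    have h1 : ∀ s t r j, (o' x s t r j).toList =
        if j = 0 then if r = 0 then if t = 0 then if s = 0 then [z] else [] else [] else []
          else [] := by
      intro s t r j
      by_cases h : s = 0 ∧ t = 0 ∧ r = 0 ∧ j = 0
      · rw [(ho' _ _ _ _ _ z).2 (.inr ⟨hx, rfl, h⟩)]
        simp [h]
      · have h2 : o' x s t r j = none := Option.eq_none_iff_forall_ne_some.2 fun σ hσ => by
          rcases (ho' _ _ _ _ _ σ).1 hσ with h3 | h3
          · exact hx h3.1
          · exact h h3.2.2
        rw [h2]
        split_ifs <;> simp_all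
    rw [hV]
    simp only [h1, flatMap_range_if_zero hB]
  refine ⟨fun x => encodeWord enc (W x), ⟨?_, fun x => ?_⟩, varBits c,
    (4 * Polynomial.X + 2) ^ c, fun m => ?_, fun P => ⟨_, rfl, ?_⟩⟩
  · have hf : (fun x => encodeWord enc (W x)) = fun x =>
        (vals (2 ^ varBits (c + 1) x.length) 8).flatMap fun v => List.ofFn fun β =>
          decide ((ρ β).Holds 4 (2 ^ varBits (c + 1) x.length) x.length x fun i => v i) := by
      funext x
      simp only [W, encodeWord, List.flatMap_map]
      refine List.flatMap_congr fun v _ => congrArg List.ofFn (funext fun β => ?_)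
      rw [Bool.eq_iff_iff, decide_eq_true_iff, hρ']
    rw [hf]
    exact Fml.uniformAC0Computable (c + 1) 4 ρ hρ
  · clear_value V W
    have hval : ∀ P, x = encodeWord penc (powerWordSymbols P) →
        ((W x).map val).prod = powerWordValue val P := by
      rintro P rfl
      rw [(hWV _).prod_eq he, hpad P, prod_reducedWord _ _ (by positivity)]
      exact fun q hq => hc _ _ (length_le_maxBaseLength hq)
    constructor
    · rintro ⟨P, hP, h1⟩
      exact ⟨W x, rfl, by rw [hval P hP, h1]⟩
    · rintro ⟨w, h1, h2⟩
      have h3 : w = W x := (encodeWord_injective hl henc h1).symm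
      rw [h3] at h2
      by_cases hx : ValidInput penc x
      · obtain ⟨P, hP⟩ := (validInput_iff hk hpenc x).1 hx
        exact ⟨P, hP, by rw [← hval P hP, h2]⟩
      · rw [(hWV _).prod_eq he, hinv x hx] at h2
        simp [hz] at h2
  · refine (two_pow_varBits_le c m).trans (le_of_eq ?_)
    simp
  · rw [← hpad P]
    exact hWV _

/-! ## Sweeping machines -/

/-- The computation from `c` ends with the answer `b`, and all its configurations are good. -/
inductive HaltsWithin {C : Type*} (step : C → Bool ⊕ C) (good : C → Prop) (b : Bool) : C → Prop
  | halt {c : C} : good c → step c = .inl b → HaltsWithin step good b c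
  | next {c c' : C} : good c → step c = .inr c' → HaltsWithin step good b c' →
      HaltsWithin step good b c

/-- The computation from `c` leads to `c'`, and all configurations before `c'` are good. -/
inductive LeadsTo {C : Type*} (step : C → Bool ⊕ C) (good : C → Prop) : C → C → Prop
  | refl (c : C) : LeadsTo step good c c
  | head {c c' c'' : C} : good c → step c = .inr c' → LeadsTo step good c' c'' →
      LeadsTo step good c c''

namespace LeadsTo

variable {C : Type*} {step : C → Bool ⊕ C} {good : C → Prop} {c c' c'' : C}

theorem single (h : good c) (h' : step c = .inr c') : LeadsTo step good c c' :=
  .head h h' (.refl _)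

theorem trans (h : LeadsTo step good c c') (h' : LeadsTo step good c' c'') :
    LeadsTo step good c c'' := by
  induction h with
  | refl => exact h'
  | head h1 h2 _ ih => exact .head h1 h2 (ih h')

theorem haltsWithin {b : Bool} (h : LeadsTo step good c c') (h' : HaltsWithin step good b c') :
    HaltsWithin step good b c := by
  induction h with
  | refl => exact h'
  | head h1 h2 _ ih => exact .next h1 h2 (ih h')

end LeadsTo

/-- Machines with a list of cells as work space. In one step the machine reads an input symbol,
transforms the cells by a transducer that sweeps over them, and then halts, or moves the input
head and possibly appends one cell. -/
structure SweepMachine (I : Type*) where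
  Ctl : Type
  Work : Type
  Cell : Type
  [ctlFinite : Finite Ctl]
  [workFinite : Finite Work]
  [cellFinite : Finite Cell]
  init : Ctl
  start : Ctl → I → Work
  tr : Work → Cell → Work × Cell
  finish : Work → Bool ⊕ (Ctl × HeadMove × Option Cell)

namespace SweepMachine

variable {I : Type*} (M : SweepMachine I)

/-- Configurations. -/
structure Cfg where
  ctl : M.Ctl
  pos : ℕ
  cells : List M.Cell

/-- The transducer. -/
def sweep : M.Work → List M.Cell → M.Work × List M.Cell
  | m, [] => (m, [])
  | m, c :: L => ((sweep (M.tr m c).1 L).1, (M.tr m c).2 :: (sweep (M.tr m c).1 L).2)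

theorem length_sweep (m : M.Work) (L : List M.Cell) : (M.sweep m L).2.length = L.length := by
  induction L generalizing m with
  | nil => rfl
  | cons c L ih => simp [sweep, ih]

/-- One step, where `rd` describes the input tape and `mv` the moves of the head. -/
def step (rd : ℕ → I) (mv : ℕ → HeadMove → ℕ) (c : M.Cfg) : Bool ⊕ M.Cfg :=
  match M.finish (M.sweep (M.start c.ctl (rd c.pos)) c.cells).1 with
  | .inl b => .inl b
  | .inr (q, h, a) => .inr
      ⟨q, mv c.pos h, (M.sweep (M.start c.ctl (rd c.pos)) c.cells).2 ++ a.toList⟩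

theorem step_inl {rd : ℕ → I} {mv : ℕ → HeadMove → ℕ} {c : M.Cfg} {b : Bool} :
    M.step rd mv c = .inl b ↔
      M.finish (M.sweep (M.start c.ctl (rd c.pos)) c.cells).1 = .inl b := by
  unfold step
  split <;> simp [*]

theorem step_inr {rd : ℕ → I} {mv : ℕ → HeadMove → ℕ} {c c' : M.Cfg} :
    M.step rd mv c = .inr c' ↔ ∃ q h a,
      M.finish (M.sweep (M.start c.ctl (rd c.pos)) c.cells).1 = .inr (q, h, a) ∧
        c' = ⟨q, mv c.pos h, (M.sweep (M.start c.ctl (rd c.pos)) c.cells).2 ++ a.toList⟩ := by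
  unfold step
  split
  · simp [*]
  · rename_i q h a heq
    simp only [heq, Sum.inr.injEq, Prod.mk.injEq]
    constructor
    · rintro rfl
      exact ⟨_, _, _, ⟨rfl, rfl, rfl⟩, rfl⟩
    · rintro ⟨_, _, _, ⟨rfl, rfl, rfl⟩, rfl⟩
      rfl

end SweepMachine

/-! ### Simulation by off-line Turing machines -/

namespace SweepTM

variable (M : SweepMachine InputSymbol)

inductive State where
  | park (q : M.Ctl)
  | sweep (m : M.Work)
  | ret (q : M.Ctl)

instance : Finite (State M) := by
  have := M.ctlFinite
  have := M.workFinite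
  have : Function.Surjective fun z : M.Ctl ⊕ M.Work ⊕ M.Ctl => match z with
      | .inl q => State.park q
      | .inr (.inl m) => .sweep m
      | .inr (.inr q) => .ret q := by
    rintro (q | m | q)
    exacts [⟨.inl q, rfl⟩, ⟨.inr (.inl m), rfl⟩, ⟨.inr (.inr q), rfl⟩]
  exact Finite.of_surjective _ this

/-- One step of the sweeping machine is a round trip: rightwards from the blank at position 0 over
the cells, decision and possible extension at the first blank after them, and back to position 0. -/
def trans : State M → InputSymbol → Option M.Cell →
    Bool ⊕ (State M × HeadMove × (Option M.Cell × HeadMove))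
  | .park q, i, s => .inr (.sweep (M.start q i), .stay, s, .right)
  | .sweep m, _, some c => .inr (.sweep (M.tr m c).1, .stay, some (M.tr m c).2, .right)
  | .sweep m, _, none => match M.finish m with
    | .inl b => .inl b
    | .inr (q, h, a) => .inr (.ret q, h, a, .left)
  | .ret q, _, some c => .inr (.ret q, .stay, some c, .left)
  | .ret q, _, none => .inr (.park q, .stay, none, .stay)

def machine : OfflineTM where
  State := State M
  Tape := Unit
  Symb := Option M.Cell
  symbFinite := by
    have := M.cellFinite
    infer_instance
  start := .park M.init
  blank := none
  trans q i s := match trans M q i (s ()) with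
    | .inl b => .inl b
    | .inr (q', h, a) => .inr (q', h, fun _ => a)

/-- The tape that contains the cells at the positions `1, 2, …`. -/
def tape (L : List M.Cell) (z : ℤ) : Option M.Cell := if 1 ≤ z then L[(z - 1).toNat]? else none

theorem tape_length (A : List M.Cell) : tape M A (A.length + 1) = none := by
  simp [tape]

theorem tape_append (A B : List M.Cell) (c : M.Cell) :
    tape M (A ++ c :: B) (A.length + 1) = some c := by
  simp [tape]

theorem update_tape (A B : List M.Cell) (c c' : M.Cell) :
    Function.update (tape M (A ++ c :: B)) (A.length + 1) (some c') = tape M (A ++ c' :: B) := by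
  funext z
  by_cases h : z = A.length + 1
  · subst h
    rw [Function.update_self, tape_append]
  · rw [Function.update_of_ne h]
    unfold tape
    split
    · rcases lt_or_ge (z - 1).toNat A.length with h1 | h1
      · rw [List.getElem?_append_left h1, List.getElem?_append_left h1]
      · rw [List.getElem?_append_right h1, List.getElem?_append_right h1]
        obtain ⟨i, hi⟩ : ∃ i, (z - 1).toNat - A.length = i + 1 :=
          ⟨(z - 1).toNat - A.length - 1, by omega⟩
        rw [hi]
        rfl
    · rfl

theorem update_tape_length (A : List M.Cell) (a : Option M.Cell) :
    Function.update (tape M A) (A.length + 1) a = tape M (A ++ a.toList) := by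
  funext z
  by_cases h : z = A.length + 1
  · subst h
    rw [Function.update_self]
    rcases a with _ | c
    · simp [tape]
    · exact (tape_append M A [] c).symm
  · rw [Function.update_of_ne h]
    unfold tape
    split
    · rcases lt_or_ge (z - 1).toNat A.length with h1 | h1
      · rw [List.getElem?_append_left h1]
      · rw [List.getElem?_eq_none h1, List.getElem?_eq_none]
        rcases a with _ | c <;> simp <;> omega
    · rfl

theorem update_tape_self (L : List M.Cell) (z : ℤ) :
    Function.update (tape M L) z (tape M L z) = tape M L := Function.update_eq_self _ _

/-- A configuration of the machine. -/
def cfg (q : State M) (p : ℕ) (L : List M.Cell) (z : ℤ) : (machine M).Cfg where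
  state := q
  inputPos := p
  work := fun _ => tape M L
  head := fun _ => z

theorem step_cfg_inl {x : List Bool} {q : State M} {p : ℕ} {L : List M.Cell} {z : ℤ} {b : Bool}
    (h : trans M q (OfflineTM.readInput x p) (tape M L z) = .inl b) :
    (machine M).step x (cfg M q p L z) = .inl b := by
  simp only [OfflineTM.step, machine, cfg, h]

theorem step_cfg_inr {x : List Bool} {q q' : State M} {p : ℕ} {L L' : List M.Cell} {z : ℤ}
    {h h' : HeadMove} {a : Option M.Cell}
    (e : trans M q (OfflineTM.readInput x p) (tape M L z) = .inr (q', h, a, h'))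
    (e' : Function.update (tape M L) z a = tape M L') :
    (machine M).step x (cfg M q p L z) =
      .inr (cfg M q' (OfflineTM.moveInput x p h) L' (OfflineTM.moveWork z h')) := by
  simp only [OfflineTM.step, machine, cfg, e, e']

/-- The head stays close to the cells. -/
def Good (s : ℕ) (c : (machine M).Cfg) : Prop := ∀ k, |c.head k| ≤ (s : ℤ)

theorem good_cfg {s : ℕ} {q : State M} {p : ℕ} {L : List M.Cell} {j : ℕ} (h : j ≤ s) :
    Good M s (cfg M q p L j) := fun _ => by
  simp only [cfg, Nat.abs_cast]
  exact_mod_cast h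

theorem leadsTo_sweep {x : List Bool} {p s : ℕ} (m : M.Work) (A B : List M.Cell)
    (h : (A ++ B).length ≤ s) :
    LeadsTo ((machine M).step x) (Good M (s + 1)) (cfg M (.sweep m) p (A ++ B) (A.length + 1 : ℕ))
      (cfg M (.sweep (M.sweep m B).1) p (A ++ (M.sweep m B).2)
        ((A ++ (M.sweep m B).2).length + 1 : ℕ)) := by
  induction B generalizing m A with
  | nil => simpa [SweepMachine.sweep] using LeadsTo.refl _
  | cons c B ih =>
    simp only [List.length_append, List.length_cons] at h
    refine .head (good_cfg M (by omega)) (step_cfg_inr M (L' := A ++ (M.tr m c).2 :: B)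
      (h := .stay) (h' := .right) (q' := .sweep (M.tr m c).1) (a := some (M.tr m c).2) ?_ ?_) ?_
    · push_cast
      rw [tape_append]
      rfl
    · push_cast
      rw [update_tape]
    · have := ih (M.tr m c).1 (A ++ [(M.tr m c).2]) (by simp; omega)
      simpa [SweepMachine.sweep, OfflineTM.moveWork, OfflineTM.moveInput] using this

theorem leadsTo_ret {x : List Bool} {p s : ℕ} (q : M.Ctl) (L : List M.Cell) (j : ℕ)
    (hj : j ≤ L.length) (h : L.length ≤ s) :
    LeadsTo ((machine M).step x) (Good M (s + 1)) (cfg M (.ret q) p L j)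
      (cfg M (.park q) p L 0) := by
  induction j with
  | zero =>
    refine .single (good_cfg M (Nat.zero_le _)) (step_cfg_inr M (L' := L) (h := .stay)
      (h' := .stay) (a := none) ?_ ?_)
    · simp [tape, trans]
    · exact update_tape_self M L 0
  | succ j ih =>
    have e : tape M L (j + 1 : ℕ) = some (L[j]'(by omega)) := by
      simp [tape]
    refine .head (good_cfg M (by omega)) (step_cfg_inr M (L' := L) (h := .stay)
      (h' := .left) (a := some (L[j]'(by omega))) (q' := .ret q) ?_ ?_) ?_
    · rw [e]
      rfl
    · rw [← e]
      exact update_tape_self M L _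
    · have := ih (by omega)
      simpa [OfflineTM.moveWork, OfflineTM.moveInput] using this

theorem leadsTo_start {x : List Bool} {p s : ℕ} (q : M.Ctl) (L : List M.Cell) (h : L.length ≤ s) :
    LeadsTo ((machine M).step x) (Good M (s + 1)) (cfg M (.park q) p L 0)
      (cfg M (.sweep (M.sweep (M.start q (OfflineTM.readInput x p)) L).1) p
        (M.sweep (M.start q (OfflineTM.readInput x p)) L).2
        ((M.sweep (M.start q (OfflineTM.readInput x p)) L).2.length + 1 : ℕ)) := by
  refine .head (good_cfg M (Nat.zero_le _)) (step_cfg_inr M (L' := L) (h := .stay)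
      (h' := .right) (q' := .sweep (M.start q (OfflineTM.readInput x p))) (a := tape M L 0)
      rfl (update_tape_self M L 0)) ?_
  have := leadsTo_sweep M (x := x) (p := p) (M.start q (OfflineTM.readInput x p)) [] L h
  simpa [OfflineTM.moveWork, OfflineTM.moveInput] using this

theorem haltsWithin {x : List Bool} {s : ℕ} {b : Bool} {c : M.Cfg}
    (h : HaltsWithin (M.step (OfflineTM.readInput x) (OfflineTM.moveInput x))
      (fun c => c.cells.length ≤ s) b c) :
    HaltsWithin ((machine M).step x) (Good M (s + 1)) b (cfg M (.park c.ctl) c.pos c.cells 0) := by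
  induction h with
  | halt h1 h2 =>
    rw [SweepMachine.step_inl] at h2
    refine (leadsTo_start M _ _ h1).haltsWithin (.halt (good_cfg M ?_) (step_cfg_inl M ?_))
    · rw [SweepMachine.length_sweep]
      omega
    · push_cast
      rw [tape_length]
      simp only [trans, h2]
  | @next c c' h1 h2 h3 ih =>
    obtain ⟨q, h, a, h4, rfl⟩ := (M.step_inr).1 h2
    refine (leadsTo_start M _ _ h1).haltsWithin (.next (good_cfg M ?_) (step_cfg_inr M
      (L' := (M.sweep (M.start c.ctl (OfflineTM.readInput x c.pos)) c.cells).2 ++ a.toList)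
      (q' := .ret q) (h := h) (a := a) (h' := .left) ?_ ?_) ?_)
    · rw [SweepMachine.length_sweep]
      omega
    · push_cast
      rw [tape_length]
      simp only [trans, h4]
    · push_cast
      rw [update_tape_length]
    · have h5 : OfflineTM.moveWork
          (((M.sweep (M.start c.ctl (OfflineTM.readInput x c.pos)) c.cells).2.length + 1 : ℕ) : ℤ)
          .left = ((M.sweep (M.start c.ctl (OfflineTM.readInput x c.pos)) c.cells).2.length : ℕ) := by
        simp [OfflineTM.moveWork]
      rw [h5]
      refine (leadsTo_ret M q _ _ (by simp) ?_).haltsWithin ih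
      cases h3 <;> assumption

end SweepTM

/-- By determinism every reachable configuration lies on the halting run, so the space bound along
that run holds for all of them. -/
theorem HaltsWithin.of_reflTransGen {C : Type*} {step : C → Bool ⊕ C} {good : C → Prop} {b : Bool}
    {c c' : C} (h : HaltsWithin step good b c)
    (h' : Relation.ReflTransGen (fun c₁ c₂ => step c₁ = .inr c₂) c c') :
    HaltsWithin step good b c' := by
  induction h' with
  | refl => exact h
  | tail _ h1 ih =>
    cases ih with
    | halt h2 h3 => rw [h1] at h3; cases h3
    | next h2 h3 h4 =>
      rw [h1] at h3
      cases h3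
      exact h4

theorem HaltsWithin.exists_reflTransGen {C : Type*} {step : C → Bool ⊕ C} {good : C → Prop}
    {b : Bool} {c : C} (h : HaltsWithin step good b c) :
    ∃ c', Relation.ReflTransGen (fun c₁ c₂ => step c₁ = .inr c₂) c c' ∧ step c' = .inl b := by
  induction h with
  | halt _ h => exact ⟨_, .refl, h⟩
  | next _ h1 _ ih =>
    obtain ⟨c', h2, h3⟩ := ih
    exact ⟨c', .head h1 h2, h3⟩

/-- A sweeping machine with few cells decides a language in logarithmic space. -/
theorem SweepMachine.inLogspace (M : SweepMachine InputSymbol) (L : Set (List Bool)) (C : ℕ)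
    (h : ∀ x, ∃ b, (b = true ↔ x ∈ L) ∧
      HaltsWithin (M.step (OfflineTM.readInput x) (OfflineTM.moveInput x))
        (fun c => c.cells.length ≤ C * (Nat.size x.length + 1)) b ⟨M.init, 0, []⟩) :
    InLogspace L := by
  have key : ∀ x, ∃ b, (b = true ↔ x ∈ L) ∧ HaltsWithin ((SweepTM.machine M).step x)
      (SweepTM.Good M (C * (Nat.size x.length + 1) + 1)) b (SweepTM.machine M).initial := by
    intro x
    obtain ⟨b, h1, h2⟩ := h x
    refine ⟨b, h1, ?_⟩
    have h3 := SweepTM.haltsWithin M h2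
    have e : SweepTM.cfg M (.park M.init) 0 [] 0 = (SweepTM.machine M).initial := by
      simp [SweepTM.cfg, OfflineTM.initial, SweepTM.machine, funext_iff, SweepTM.tape]
    rwa [← e]
  refine ⟨SweepTM.machine M, ⟨C + 1, fun x c hc k => ?_⟩, fun x => ?_⟩
  · obtain ⟨b, -, h2⟩ := key x
    have h3 : SweepTM.Good M (C * (Nat.size x.length + 1) + 1) c := by
      cases h2.of_reflTransGen hc <;> assumption
    refine (h3 k).trans ?_
    have : C * (Nat.size x.length + 1) + 1 ≤ (C + 1) * (Nat.size x.length + 1) := by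
      rw [Nat.succ_mul]
      omega
    exact_mod_cast this
  · obtain ⟨b, h1, h2⟩ := key x
    obtain ⟨c, h3, h4⟩ := h2.exists_reflTransGen
    constructor
    · intro hx
      rw [h1.2 hx] at h4
      exact ⟨c, h3, h4⟩
    · intro hx
      have : b = false := by
        rw [← Bool.not_eq_true]
        exact fun hb => hx (h1.1 hb)
      rw [this] at h4
      exact ⟨c, h3, h4⟩

/-! ### Reading blocks of bits -/

/-- What a machine sees that reads the input block by block. -/
inductive BlockSymbol (A : Type*) where
  | leftEnd
  | rightEnd
  | bad
  | sym (a : A)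

section Blocks

variable {S : Type*} {k : ℕ} (penc : PowerSymbol S → Fin k → Bool)

open scoped Classical in
noncomputable def decodeBlock (l : List Bool) : BlockSymbol (PowerSymbol S) :=
  if h : ∃ σ, List.ofFn (penc σ) = l then .sym h.choose else .bad

/-- The symbols of the input, between the end markers. -/
noncomputable def readBlock (x : List Bool) : ℕ → BlockSymbol (PowerSymbol S)
  | 0 => .leftEnd
  | p + 1 => if k * p = x.length then .rightEnd else
      if k * p + k ≤ x.length then decodeBlock penc ((x.drop (k * p)).take k) else .bad

open scoped Classical in
noncomputable def moveBlock (x : List Bool) (p : ℕ) : HeadMove → ℕ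
  | .left => p - 1
  | .stay => p
  | .right => if readBlock penc x p = .rightEnd then p else p + 1

theorem decodeBlock_ofFn (hp : Function.Injective penc) (σ : PowerSymbol S) :
    decodeBlock penc (List.ofFn (penc σ)) = .sym σ := by
  have h : ∃ τ, List.ofFn (penc τ) = List.ofFn (penc σ) := ⟨σ, rfl⟩
  rw [decodeBlock, dif_pos h]
  congr 1
  exact hp (List.ofFn_injective h.choose_spec)

theorem symAt_iff (x : List Bool) (p : ℕ) (σ : PowerSymbol S) :
    SymAt penc x p σ ↔
      k * p + k ≤ x.length ∧ List.ofFn (penc σ) = (x.drop (k * p)).take k := by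
  refine and_congr_right fun h => ?_
  constructor
  · intro h1
    refine List.ext_getElem (by simp; omega) fun i hi hi' => ?_
    have hi2 : i < k := by simpa using hi
    have := h1 ⟨i, hi2⟩
    rw [List.getD_eq_getElem?_getD, List.getElem?_eq_getElem (by simp; omega)] at this
    simpa using this.symm
  · intro h1 β
    have : ((x.drop (k * p)).take k)[β.1]? = some (penc σ β) := by rw [← h1]; simp
    rw [List.getElem?_take, if_pos β.2, List.getElem?_drop] at this
    rw [List.getD_eq_getElem?_getD, this]
    rfl

variable {penc}

theorem readBlock_eq_sym_iff (hk : 0 < k) (hp : Function.Injective penc) (x : List Bool) (p : ℕ)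
    (σ : PowerSymbol S) : readBlock penc x (p + 1) = .sym σ ↔ SymAt penc x p σ := by
  rw [symAt_iff, readBlock]
  constructor
  · intro h
    split at h
    · cases h
    · split at h
      · refine ⟨by assumption, ?_⟩
        rw [decodeBlock] at h
        split at h
        · rename_i h1
          cases h
          exact h1.choose_spec
        · cases h
      · cases h
  · rintro ⟨h1, h2⟩
    rw [if_neg (by omega), if_pos h1, ← h2, decodeBlock_ofFn penc hp]

theorem readBlock_eq_rightEnd_iff (x : List Bool) (p : ℕ) :
    readBlock penc x (p + 1) = .rightEnd ↔ k * p = x.length := by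
  rw [readBlock]
  split
  · simp [*]
  · split
    · rw [decodeBlock]
      split <;> simp [*]
    · simp [*]

namespace BlockSim

variable (M : SweepMachine (BlockSymbol (PowerSymbol S)))

/-- `rd` collects the bits of the current block; `back n` moves the head `n` positions to the left.
-/
inductive Ctl (k : ℕ) where
  | rd (q : M.Ctl) (buf : {l : List Bool // l.length ≤ k})
  | back (n : Fin (2 * k + 1)) (q : M.Ctl)

inductive Class where
  | left | right | sym

inductive Work (k : ℕ) where
  | pass (c : Ctl M k) (right : Option Bool)
  | run (m : M.Work) (cl : Class)

instance : Finite (Ctl M k) := by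
  have := M.ctlFinite
  have : Finite {l : List Bool // l.length ≤ k} := List.finite_length_le Bool k
  have : Function.Surjective fun z : (M.Ctl × {l : List Bool // l.length ≤ k}) ⊕
      (Fin (2 * k + 1) × M.Ctl) => match z with
      | .inl (q, l) => Ctl.rd q l
      | .inr (n, q) => .back n q := by
    rintro (⟨q, l⟩ | ⟨n, q⟩)
    exacts [⟨.inl (q, l), rfl⟩, ⟨.inr (n, q), rfl⟩]
  exact Finite.of_surjective _ this

instance : Finite (Work M k) := by
  have := M.workFinite
  have : Function.Surjective fun z : (Ctl M k × Option Bool) ⊕ (M.Work × Fin 3) => match z with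
      | .inl (q, l) => Work.pass q l
      | .inr (m, 0) => .run m .left
      | .inr (m, 1) => .run m .right
      | .inr (m, 2) => .run m .sym := by
    rintro (⟨q, l⟩ | ⟨m, _ | _ | _⟩)
    exacts [⟨.inl (q, l), rfl⟩, ⟨.inr (m, 0), rfl⟩, ⟨.inr (m, 1), rfl⟩, ⟨.inr (m, 2), rfl⟩]
  exact Finite.of_surjective _ this

def emptyBuf (k : ℕ) : {l : List Bool // l.length ≤ k} := ⟨[], Nat.zero_le k⟩

def toMove : Option Bool → HeadMove
  | none => .stay
  | some false => .left
  | some true => .right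

variable (penc)

noncomputable def start : Ctl M k → InputSymbol → Work M k
  | .back ⟨0, _⟩ q, _ => .pass (.rd q (emptyBuf k)) none
  | .back ⟨n + 1, h⟩ q, _ => .pass (.back ⟨n, by omega⟩ q) (some false)
  | .rd q _, .leftEnd => .run (M.start q .leftEnd) .left
  | .rd q buf, .rightEnd => .run (M.start q (if buf.1 = [] then .rightEnd else .bad)) .right
  | .rd q buf, .bit b => if h : buf.1.length + 1 < k then
      .pass (.rd q ⟨buf.1 ++ [b], by simp; omega⟩) (some true)
      else .run (M.start q (decodeBlock penc (buf.1 ++ [b]))) .sym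

/-- After a block has been read, the head is on its last bit: the block itself starts `k - 1`
positions to the left, the previous one `2 * k - 1`. From the right end marker the previous block
starts `k` positions to the left. -/
def after (q : M.Ctl) : Class → HeadMove → Ctl M k × HeadMove
  | .left, .right => (.rd q (emptyBuf k), .right)
  | .left, _ => (.rd q (emptyBuf k), .stay)
  | .right, .left => (.back ⟨k, by omega⟩ q, .stay)
  | .right, _ => (.rd q (emptyBuf k), .stay)
  | .sym, .right => (.rd q (emptyBuf k), .right)
  | .sym, .stay => (.back ⟨k - 1, by omega⟩ q, .stay)
  | .sym, .left => (.back ⟨2 * k - 1, by omega⟩ q, .stay)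

noncomputable def machine : SweepMachine InputSymbol where
  Ctl := Ctl M k
  Work := Work M k
  Cell := M.Cell
  cellFinite := M.cellFinite
  init := .rd M.init (emptyBuf k)
  start := start penc M
  tr
    | .pass c r, s => (.pass c r, s)
    | .run m cl, s => (.run (M.tr m s).1 cl, (M.tr m s).2)
  finish
    | .pass c r => .inr (c, toMove r, none)
    | .run m cl => match M.finish m with
      | .inl b => .inl b
      | .inr (q, h, a) => .inr ((after M q cl h).1, (after M (k := k) q cl h).2, a)

theorem sweep_pass (c : Ctl M k) (r : Option Bool) (L : List M.Cell) :
    (machine penc M).sweep (Work.pass c r : Work M k) L = (Work.pass c r, L) := by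
  induction L with
  | nil => rfl
  | cons s L ih => simp only [SweepMachine.sweep, machine] at *; rw [ih]

theorem sweep_run (m : M.Work) (cl : Class) (L : List M.Cell) :
    (machine penc M).sweep (Work.run m cl : Work M k) L =
      (Work.run (M.sweep m L).1 cl, (M.sweep m L).2) := by
  induction L generalizing m with
  | nil => rfl
  | cons s L ih =>
    have := ih (M.tr m s).1
    simp only [SweepMachine.sweep, machine] at *
    rw [this]

/-- The steps on bits. -/
noncomputable abbrev bitStep (x : List Bool) :=
  (machine penc M).step (OfflineTM.readInput x) (OfflineTM.moveInput x)

def Good (s : ℕ) (c : (machine penc M).Cfg) : Prop := c.cells.length ≤ s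

def mk (c : Ctl M k) (p : ℕ) (L : List M.Cell) : (machine penc M).Cfg := ⟨c, p, L⟩

theorem step_pass {x : List Bool} {c c' : Ctl M k} {p : ℕ} {L : List M.Cell} {r : Option Bool}
    (h : start penc M c (OfflineTM.readInput x p) = .pass c' r) :
    bitStep penc M x (mk penc M c p L) =
      .inr (mk penc M c' (OfflineTM.moveInput x p (toMove r)) L) := by
  have e : (machine penc M).sweep ((machine penc M).start c (OfflineTM.readInput x p)) L =
      (Work.pass c' r, L) :=
    (congrArg (fun m => (machine penc M).sweep m L) h).trans (sweep_pass penc M c' r L)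
  refine ((machine penc M).step_inr).2 ⟨c', toMove r, none, ?_, ?_⟩
  · exact congrArg (fun z => (machine penc M).finish z.1) e
  · have := congrArg Prod.snd e
    exact congrArg (fun z : List M.Cell => mk penc M c' (OfflineTM.moveInput x p (toMove r)) z)
      ((List.append_nil _).trans this).symm

theorem leadsTo_back {x : List Bool} {s n p : ℕ} (hn : n < 2 * k + 1) (q : M.Ctl)
    {L : List M.Cell} (hL : L.length ≤ s) :
    LeadsTo (bitStep penc M x) (Good penc M s) (mk penc M (.back ⟨n, hn⟩ q) p L)
      (mk penc M (.rd q (emptyBuf k)) (p - n) L) := by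
  induction n generalizing p with
  | zero => exact .single hL (step_pass penc M (r := none) rfl)
  | succ n ih =>
    refine .head hL (step_pass penc M (r := some false) rfl) ?_
    have := ih (p := p - 1) (by omega)
    rwa [show p - 1 - n = p - (n + 1) by omega] at this

theorem readInput_bit {x : List Bool} {i : ℕ} (h : i < x.length) :
    OfflineTM.readInput x (i + 1) = .bit x[i] := by
  simp [OfflineTM.readInput, h]

theorem readInput_rightEnd {x : List Bool} {i : ℕ} (h : x.length ≤ i) :
    OfflineTM.readInput x (i + 1) = .rightEnd := by
  simp [OfflineTM.readInput, h]

theorem leadsTo_rd {x : List Bool} {s p i : ℕ} (q : M.Ctl) {L : List M.Cell} (hL : L.length ≤ s)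
    (hi : i < k) (hx : k * p + i ≤ x.length) :
    ∃ h : ((x.drop (k * p)).take i).length ≤ k,
    LeadsTo (bitStep penc M x) (Good penc M s) (mk penc M (.rd q (emptyBuf k)) (k * p + 1) L)
      (mk penc M (.rd q ⟨(x.drop (k * p)).take i, h⟩) (k * p + i + 1) L) := by
  induction i with
  | zero => exact ⟨by simp, by simpa [emptyBuf] using LeadsTo.refl _⟩
  | succ i ih =>
    obtain ⟨h, h1⟩ := ih (by omega) (by omega)
    have hlen : ((x.drop (k * p)).take i).length = i := by simp; omega
    have e : (x.drop (k * p)).take (i + 1) =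
        (x.drop (k * p)).take i ++ [x[k * p + i]'(by omega)] := by
      rw [List.take_add_one, List.getElem?_drop, List.getElem?_eq_getElem (by omega)]
      rfl
    refine ⟨by simp; omega, h1.trans (.single hL ?_)⟩
    have h2 : start penc M (.rd q ⟨(x.drop (k * p)).take i, h⟩)
        (OfflineTM.readInput x (k * p + i + 1)) =
          .pass (.rd q ⟨(x.drop (k * p)).take (i + 1), by simp; omega⟩) (some true) := by
      rw [readInput_bit (by omega), start, dif_pos (by dsimp only; rw [hlen]; exact hi)]
      simp only [e]
    have h3 : OfflineTM.moveInput x (k * p + i + 1) (toMove (some true)) = k * p + (i + 1) + 1 := by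
      simp only [toMove, OfflineTM.moveInput]
      omega
    rw [step_pass penc M h2, h3]

/-- The position of the first bit of a block. -/
def bitPos (k : ℕ) : ℕ → ℕ
  | 0 => 0
  | p + 1 => k * p + 1

theorem exists_read (hk : 0 < k) {x : List Bool} {s p : ℕ} (q : M.Ctl) {L : List M.Cell}
    (hL : L.length ≤ s) (hp : k * (p - 1) ≤ x.length) :
    ∃ (c : Ctl M k) (i : ℕ) (cl : Class),
      LeadsTo (bitStep penc M x) (Good penc M s) (mk penc M (.rd q (emptyBuf k)) (bitPos k p) L)
        (mk penc M c i L) ∧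
      start penc M c (OfflineTM.readInput x i) = .run (M.start q (readBlock penc x p)) cl ∧
      (readBlock penc x p = .bad ∨ ∀ (q' : M.Ctl) (h : HeadMove) (L' : List M.Cell),
        L'.length ≤ s → k * (moveBlock penc x p h - 1) ≤ x.length ∧
          LeadsTo (bitStep penc M x) (Good penc M s)
            (mk penc M (after M q' cl h).1 (OfflineTM.moveInput x i (after M (k := k) q' cl h).2) L')
            (mk penc M (.rd q' (emptyBuf k)) (bitPos k (moveBlock penc x p h)) L')) := by
  cases p with
  | zero =>
    refine ⟨_, _, .left, .refl _, rfl, .inr fun q' h L' hL' => ?_⟩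
    have e : moveBlock penc x 0 .right = 1 := by simp [moveBlock, readBlock]
    cases h
    · exact ⟨by simp [moveBlock], .refl _⟩
    · exact ⟨by simp [moveBlock], .refl _⟩
    · rw [e]
      refine ⟨by simp, ?_⟩
      simpa [after, bitPos, OfflineTM.moveInput] using LeadsTo.refl _
  | succ p =>
    rw [Nat.add_sub_cancel] at hp
    by_cases h1 : k * p = x.length
    · have e := (readBlock_eq_rightEnd_iff (penc := penc) x p).2 h1
      refine ⟨_, _, .right, .refl _, ?_, .inr fun q' h L' hL' => ?_⟩
      · rw [e, bitPos, readInput_rightEnd h1.ge]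
        rfl
      · cases h
        · refine ⟨(Nat.mul_le_mul_left k (by simp [moveBlock])).trans hp, ?_⟩
          have := leadsTo_back penc M (x := x) (s := s) (n := k) (p := k * p + 1) (by omega) q' hL'
          have e' : k * p + 1 - k = bitPos k p := by
            cases p with
            | zero => simp [bitPos]; omega
            | succ p => simp only [bitPos, mul_add]; omega
          rwa [e'] at this
        · exact ⟨by simpa [moveBlock] using hp, .refl _⟩
        · rw [moveBlock, if_pos e]
          exact ⟨by simpa using hp, .refl _⟩
    · by_cases h2 : k * p + k ≤ x.length
      · obtain ⟨h, h3⟩ := leadsTo_rd penc M (x := x) (p := p) (i := k - 1) q hL (by omega)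
          (by omega)
        have hlen : ((x.drop (k * p)).take (k - 1)).length = k - 1 := by simp; omega
        have e : (x.drop (k * p)).take k =
            (x.drop (k * p)).take (k - 1) ++ [x[k * p + (k - 1)]'(by omega)] := by
          have := List.take_add_one (l := x.drop (k * p)) (i := k - 1)
          rw [show k - 1 + 1 = k by omega, List.getElem?_drop,
            List.getElem?_eq_getElem (by omega)] at this
          exact this
        refine ⟨_, _, .sym, h3, ?_, .inr fun q' h L' hL' => ?_⟩
        · rw [readInput_bit (by omega), start, dif_neg (by dsimp only; rw [hlen]; omega),
            readBlock, if_neg h1, if_pos h2, e]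
        · have e2 : moveBlock penc x (p + 1) .right = p + 2 := by
            rw [moveBlock, if_neg]
            rw [readBlock_eq_rightEnd_iff]
            exact h1
          cases h
          · refine ⟨(Nat.mul_le_mul_left k (by simp [moveBlock])).trans hp, ?_⟩
            have := leadsTo_back penc M (x := x) (s := s) (n := 2 * k - 1)
              (p := k * p + (k - 1) + 1) (by omega) q' hL'
            have e' : k * p + (k - 1) + 1 - (2 * k - 1) = bitPos k p := by
              cases p with
              | zero => simp [bitPos]; omega
              | succ p => simp only [bitPos, mul_add]; omega
            rwa [e'] at this
          · refine ⟨by simpa [moveBlock] using hp, ?_⟩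
            have := leadsTo_back penc M (x := x) (s := s) (n := k - 1)
              (p := k * p + (k - 1) + 1) (by omega) q' hL'
            have e' : k * p + (k - 1) + 1 - (k - 1) = bitPos k (p + 1) := by
              simp only [bitPos]; omega
            rwa [e'] at this
          · rw [e2]
            refine ⟨by simpa [mul_add] using h2, ?_⟩
            have e' : OfflineTM.moveInput x (k * p + (k - 1) + 1) .right = bitPos k (p + 2) := by
              simp only [OfflineTM.moveInput, bitPos, mul_add]
              omega
            simp only [after]
            rw [e']
            exact .refl _
      · obtain ⟨h, h3⟩ := leadsTo_rd penc M (x := x) (p := p) (i := x.length - k * p) q hL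
          (by omega) (by omega)
        have e : readBlock penc x (p + 1) = .bad := by
          rw [readBlock, if_neg h1, if_neg h2]
        refine ⟨_, _, .right, h3, ?_, .inl e⟩
        have hlen : ((x.drop (k * p)).take (x.length - k * p)).length = x.length - k * p := by simp
        have hne : (x.drop (k * p)).take (x.length - k * p) ≠ [] := by
          intro h0
          rw [h0] at hlen
          simp at hlen
          omega
        rw [readInput_rightEnd (by omega), e, start, if_neg hne]

/-- After an incomplete last block the head no longer stands at the distance that `after`
presupposes. The hypothesis `hbad` excludes this case, because the simulated machine then stops at
once. -/
theorem haltsWithin (hk : 0 < k) {x : List Bool} {s : ℕ} {b : Bool} {c : M.Cfg}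
    (hbad : ∀ q L, ∃ b, M.finish (M.sweep (M.start q .bad) L).1 = .inl b)
    (hc : k * (c.pos - 1) ≤ x.length)
    (h : HaltsWithin (M.step (readBlock penc x) (moveBlock penc x))
      (fun c => c.cells.length ≤ s) b c) :
    HaltsWithin (bitStep penc M x) (Good penc M s) b
      (mk penc M (.rd c.ctl (emptyBuf k)) (bitPos k c.pos) c.cells) := by
  induction h with
  | @halt c h1 h2 =>
    rw [SweepMachine.step_inl] at h2
    obtain ⟨c', i, cl, h3, h4, -⟩ := exists_read penc M hk c.ctl h1 hc
    refine h3.haltsWithin (.halt h1 (((machine penc M).step_inl).2 ?_))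
    have h5 : (machine penc M).start c' (OfflineTM.readInput x i) = _ := h4
    simp only [mk]
    rw [h5, sweep_run]
    simp only [machine, h2]
  | @next c c' h1 h2 h3 ih =>
    obtain ⟨q, h, a, h4, rfl⟩ := (M.step_inr).1 h2
    obtain ⟨c', i, cl, h5, h6, h7⟩ := exists_read penc M hk c.ctl h1 hc
    rcases h7 with h7 | h7
    · obtain ⟨b', hb'⟩ := hbad c.ctl c.cells
      rw [h7] at h4
      rw [h4] at hb'
      cases hb'
    · have h8 := h7 q h ((M.sweep (M.start c.ctl (readBlock penc x c.pos)) c.cells).2 ++ a.toList)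
        (by cases h3 <;> assumption)
      refine h5.haltsWithin (.next h1 (((machine penc M).step_inr).2
        ⟨(after M q cl h).1, (after M (k := k) q cl h).2, a, ?_, rfl⟩) ?_)
      · have h9 : (machine penc M).start c' (OfflineTM.readInput x i) = _ := h6
        simp only [mk]
        rw [h9, sweep_run]
        simp only [machine, h4]
      · have h9 : (machine penc M).start c' (OfflineTM.readInput x i) = _ := h6
        have := h8.2.haltsWithin (ih h8.1)
        simp only [mk] at *
        rw [h9, sweep_run]
        exact this

end BlockSim

/-- A sweeping machine that reads symbols decides a language in logarithmic space, if it uses few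
cells. -/
theorem SweepMachine.inLogspace_of_blocks (hk : 0 < k)
    (M : SweepMachine (BlockSymbol (PowerSymbol S)))
    (hbad : ∀ q L, ∃ b, M.finish (M.sweep (M.start q .bad) L).1 = .inl b)
    (L : Set (List Bool)) (C : ℕ)
    (h : ∀ x, ∃ b, (b = true ↔ x ∈ L) ∧
      HaltsWithin (M.step (readBlock penc x) (moveBlock penc x))
        (fun c => c.cells.length ≤ C * (Nat.size x.length + 1)) b ⟨M.init, 0, []⟩) :
    InLogspace L := by
  refine (BlockSim.machine penc M).inLogspace L C fun x => ?_
  obtain ⟨b, h1, h2⟩ := h x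
  exact ⟨b, h1, BlockSim.haltsWithin penc M hk hbad (by simp) h2⟩

end Blocks

/-! ## A program for the power word problem -/

namespace Grig

instance : Finite GrigGen := by
  have : Function.Surjective (![.a, .b, .c, .d] : Fin 4 → GrigGen) := by
    rintro (_ | _ | _ | _)
    exacts [⟨0, rfl⟩, ⟨1, rfl⟩, ⟨2, rfl⟩, ⟨3, rfl⟩]
  exact Finite.of_surjective _ this

def genStep : GrigGen → Bool → List GrigGen × Bool
  | .a, x => ([], !x)
  | .b, false => ([.a], false)
  | .b, true => ([.c], true)
  | .c, false => ([.a], false)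
  | .c, true => ([.d], true)
  | .d, false => ([], false)
  | .d, true => ([.b], true)

/-- The action of a word on the first coordinate, and its section there. -/
def stepWord : List GrigGen → Bool → List GrigGen × Bool
  | [], x => ([], x)
  | g :: w, x => ((genStep g (stepWord w x).2).1 ++ (stepWord w x).1,
      (genStep g (stepWord w x).2).2)

theorem act_cons (g : GrigGen) (x : Bool) (v : List Bool) :
    g.act (x :: v) = (genStep g x).2 :: wordPerm (genStep g x).1 v := by
  cases g <;> cases x <;> simp [GrigGen.act, genStep, genPerm_apply]

theorem wordPerm_apply_cons (w : List GrigGen) (x : Bool) (v : List Bool) :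
    wordPerm w (x :: v) = (stepWord w x).2 :: wordPerm (stepWord w x).1 v := by
  induction w with
  | nil => rfl
  | cons g w ih =>
    rw [wordPerm_cons, Equiv.Perm.mul_apply, ih, genPerm_apply, act_cons]
    simp [stepWord, wordPerm_append]

/-- Sections are never longer than the word, so words of length at most `K` are the states of a
finite transducer that computes the action on vertices. -/
theorem length_stepWord (w : List GrigGen) (x : Bool) : (stepWord w x).1.length ≤ w.length := by
  induction w with
  | nil => rfl
  | cons g w ih =>
    have : ∀ y, (genStep g y).1.length ≤ 1 := by
      intro y
      cases g <;> cases y <;> simp [genStep]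
    have := this (stepWord w x).2
    simp only [stepWord, List.length_append, List.length_cons]
    omega

end Grig

namespace PowProg

/-- Short words. -/
abbrev Short (K : ℕ) := {w : List GrigGen // w.length ≤ K}

instance (K : ℕ) : Finite (Short K) := List.finite_length_le GrigGen K

/-- A work cell: `act` and `cnt` belong to the counter that determines the number of cells,
`v0` to the vertex from which a round starts, `v` to the current vertex, and `x` to the number
of remaining iterations. -/
structure Cell where
  act : Bool
  cnt : Bool
  v0 : Bool
  v : Bool
  x : Bool

instance : Finite Cell := by
  have : Function.Injective fun c : Cell => (c.act, c.cnt, c.v0, c.v, c.x) := by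
    rintro ⟨⟩ ⟨⟩ h
    simpa using h
  exact Finite.of_injective _ this

/-- `scan` checks the syntax, remembering whether the last symbol was a letter, and counts symbols;
`grow` appends cells. A round starts with `begin`, which rewinds. Then `seek` finds the next sign
and `toEnd` the end of its digits. In `work`, digits are absorbed leftwards, the counter is tested
at the sign, and letters are applied rightwards; `back` returns to the start of the base. -/
inductive Ctl (C : ℕ) where
  | scan (p : Option Bool)
  | grow (i : Fin C) (isLetter : Bool)
  | init
  | begin
  | seek
  | toEnd
  | work
  | back

instance (C : ℕ) : Finite (Ctl C) := by
  have : Function.Surjective fun z : Option Bool ⊕ (Fin C × Bool) ⊕ Fin 6 => match z with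
      | .inl p => (Ctl.scan p : Ctl C)
      | .inr (.inl (i, l)) => .grow i l
      | .inr (.inr 0) => .init
      | .inr (.inr 1) => .begin
      | .inr (.inr 2) => .seek
      | .inr (.inr 3) => .toEnd
      | .inr (.inr 4) => .work
      | .inr (.inr 5) => .back := by
    rintro (p | ⟨i, l⟩ | _ | _ | _ | _ | _ | _)
    exacts [⟨.inl p, rfl⟩, ⟨.inr (.inl (i, l)), rfl⟩, ⟨.inr (.inr 0), rfl⟩, ⟨.inr (.inr 1), rfl⟩,
      ⟨.inr (.inr 2), rfl⟩, ⟨.inr (.inr 3), rfl⟩, ⟨.inr (.inr 4), rfl⟩, ⟨.inr (.inr 5), rfl⟩]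
  exact Finite.of_surjective _ this

instance : Finite HeadMove := by
  have : Function.Surjective (![.left, .stay, .right] : Fin 3 → HeadMove) := by
    rintro (_ | _ | _)
    exacts [⟨0, rfl⟩, ⟨1, rfl⟩, ⟨2, rfl⟩]
  exact Finite.of_surjective _ this

abbrev Result (C : ℕ) := Bool ⊕ (Ctl C × HeadMove × Option Cell)

inductive Work (C K : ℕ) where
  | pass (r : Result C)
  | inc (carry isLetter : Bool)
  | copy
  | cmp (eq carry : Bool)
  | reset
  | shift (d : Bool)
  | dec (neg borrow nz : Bool)
  | app (w : Short K)

instance (C K : ℕ) : Finite (Work C K) := by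
  have : Function.Surjective fun z : Result C ⊕ (Bool × Bool) ⊕ (Bool × Bool) ⊕ Bool ⊕
      (Bool × Bool × Bool) ⊕ Short K ⊕ Bool => match z with
      | .inl r => (Work.pass r : Work C K)
      | .inr (.inl (c, l)) => .inc c l
      | .inr (.inr (.inl (e, c))) => .cmp e c
      | .inr (.inr (.inr (.inl d))) => .shift d
      | .inr (.inr (.inr (.inr (.inl (s, b, z))))) => .dec s b z
      | .inr (.inr (.inr (.inr (.inr (.inl w))))) => .app w
      | .inr (.inr (.inr (.inr (.inr (.inr false))))) => .copy
      | .inr (.inr (.inr (.inr (.inr (.inr true))))) => .reset := by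
    rintro (r | ⟨c, l⟩ | _ | ⟨e, c⟩ | _ | d | ⟨s, b, z⟩ | w)
    exacts [⟨.inl r, rfl⟩, ⟨.inr (.inl (c, l)), rfl⟩,
      ⟨.inr (.inr (.inr (.inr (.inr (.inr false))))), rfl⟩, ⟨.inr (.inr (.inl (e, c))), rfl⟩,
      ⟨.inr (.inr (.inr (.inr (.inr (.inr true))))), rfl⟩, ⟨.inr (.inr (.inr (.inl d))), rfl⟩,
      ⟨.inr (.inr (.inr (.inr (.inl (s, b, z))))), rfl⟩,
      ⟨.inr (.inr (.inr (.inr (.inr (.inl w))))), rfl⟩]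
  exact Finite.of_surjective _ this

variable {S : Type*} {C K : ℕ}

def goto (q : Ctl C) (h : HeadMove) : Work C K := .pass (.inr (q, h, none))

def fail : Work C K := .pass (.inl false)

def freshCell (act : Bool) : Cell := ⟨act, act, false, false, false⟩

def start (ws : S → Short K) : Ctl C → BlockSymbol (PowerSymbol S) → Work C K
  | _, .bad => fail
  | .init, _ => goto (.scan none) .right
  | .scan p, .rightEnd => if p = some true then fail else goto .begin .stay
  | .scan _, .sym (.letter _) => .inc true true
  | .scan _, .sym (.sign _) => .inc true false
  | .scan p, .sym (.digit _) => if p = some false then .inc true false else fail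
  | .grow ⟨0, _⟩ l, _ => goto (.scan (some l)) .right
  | .grow ⟨i + 1, h⟩ l, _ => .pass (.inr (.grow ⟨i, by omega⟩ l, .stay, some (freshCell false)))
  | .begin, .leftEnd => .copy
  | .begin, _ => goto .begin .left
  | .seek, .rightEnd => .cmp true true
  | .seek, .sym (.sign _) => .reset
  | .seek, _ => goto .seek .right
  | .toEnd, .sym (.digit _) => goto .toEnd .right
  | .toEnd, _ => goto .work .left
  | .work, .sym (.digit d) => .shift d
  | .work, .sym (.sign b) => .dec b true false
  | .work, .sym (.letter s) => .app (ws s)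
  | .back, .sym (.letter _) => goto .back .left
  | .back, _ => goto .work .right
  | _, _ => fail

/-- Numbers stand in the cells with the least significant digit first, so carries travel with the
sweep. `cmp` compares the vertices and at the same time advances `v0` to the next one; `dec` moves
the counter `x` towards zero, upwards modulo a power of two if the exponent is negative. -/
def tr : Work C K → Cell → Work C K × Cell
  | .inc carry l, ⟨true, cnt, v0, v, x⟩ => (.inc (carry && cnt) l, ⟨true, cnt ^^ carry, v0, v, x⟩)
  | .copy, ⟨act, cnt, v0, _, x⟩ => (.copy, ⟨act, cnt, v0, v0, x⟩)
  | .cmp eq carry, ⟨act, cnt, v0, v, x⟩ =>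
      (.cmp (eq && v == v0) (carry && v0), ⟨act, cnt, v0 ^^ carry, v, x⟩)
  | .reset, ⟨act, cnt, v0, v, _⟩ => (.reset, ⟨act, cnt, v0, v, false⟩)
  | .shift d, ⟨act, cnt, v0, v, x⟩ => (.shift x, ⟨act, cnt, v0, v, d⟩)
  | .dec neg borrow nz, ⟨act, cnt, v0, v, x⟩ =>
      (.dec neg (borrow && x == neg) (nz || x), ⟨act, cnt, v0, v, x ^^ borrow⟩)
  | .app w, ⟨act, cnt, v0, v, x⟩ =>
      (.app ⟨(Grig.stepWord w.1 v).1, (Grig.length_stepWord w.1 v).trans w.2⟩,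
        ⟨act, cnt, v0, (Grig.stepWord w.1 v).2, x⟩)
  | w, c => (w, c)

/-- For every new bit of the counter `C` cells are appended. -/
def finish (hC : 0 < C) : Work C K → Result C
  | .pass r => r
  | .inc true l => .inr (.grow ⟨C - 1, by omega⟩ l, .stay, some (freshCell true))
  | .inc false l => .inr (.scan (some l), .right, none)
  | .copy => .inr (.seek, .right, none)
  | .cmp false _ => .inl false
  | .cmp true true => .inl true
  | .cmp true false => .inr (.begin, .stay, none)
  | .reset => .inr (.toEnd, .right, none)
  | .shift _ => .inr (.work, .left, none)
  | .dec _ _ true => .inr (.back, .left, none)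
  | .dec _ _ false => .inr (.seek, .right, none)
  | .app _ => .inr (.work, .right, none)

variable (hC : 0 < C) (ws : S → Short K)

def machine : SweepMachine (BlockSymbol (PowerSymbol S)) where
  Ctl := Ctl C
  Work := Work C K
  Cell := Cell
  init := .init
  start := start ws
  tr := tr
  finish := finish hC

/-- The transducer. -/
def sweep : Work C K → List Cell → Work C K × List Cell
  | m, [] => (m, [])
  | m, c :: L => ((sweep (tr m c).1 L).1, (tr m c).2 :: (sweep (tr m c).1 L).2)

theorem machine_sweep (m : Work C K) (L : List Cell) : (machine hC ws).sweep m L = sweep m L := by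
  induction L generalizing m with
  | nil => rfl
  | cons c L ih =>
    have := ih (tr m c).1
    simp only [SweepMachine.sweep, sweep]
    exact congrArg₂ Prod.mk (congrArg Prod.fst this)
      (congrArg (List.cons (tr m c).2) (congrArg Prod.snd this))

/-- A configuration of the machine. -/
def mk (q : Ctl C) (p : ℕ) (L : List Cell) : (machine hC ws).Cfg := ⟨q, p, L⟩

variable {hC ws} {k : ℕ} {penc : PowerSymbol S → Fin k → Bool} {x : List Bool}

theorem step_inl {q : Ctl C} {p : ℕ} {L : List Cell} {b : Bool}
    (h : finish hC (sweep (start ws q (readBlock penc x p)) L).1 = .inl b) :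
    (machine hC ws).step (readBlock penc x) (moveBlock penc x) (mk hC ws q p L) = .inl b :=
  ((machine hC ws).step_inl).2 <|
    (congrArg (fun z : Work C K × List Cell => finish hC z.1)
      (machine_sweep hC ws (start ws q (readBlock penc x p)) L)).trans h

theorem step_inr {q q' : Ctl C} {p : ℕ} {L L' : List Cell} {w' : Work C K} {h : HeadMove}
    {a : Option Cell} (h1 : sweep (start ws q (readBlock penc x p)) L = (w', L'))
    (h2 : finish hC w' = .inr (q', h, a)) :
    (machine hC ws).step (readBlock penc x) (moveBlock penc x) (mk hC ws q p L) =
      .inr (mk hC ws q' (moveBlock penc x p h) (L' ++ a.toList)) := by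
  have h3 := (machine_sweep hC ws (start ws q (readBlock penc x p)) L).trans h1
  exact ((machine hC ws).step_inr).2 ⟨q', h, a,
    (congrArg (fun z : Work C K × List Cell => finish hC z.1) h3).trans h2,
    congrArg (mk hC ws q' (moveBlock penc x p h))
      (congrArg (fun z : Work C K × List Cell => z.2 ++ a.toList) h3.symm)⟩

theorem sweep_pass (r : Result C) (L : List Cell) :
    sweep (.pass r : Work C K) L = (.pass r, L) := by
  induction L with
  | nil => rfl
  | cons c L ih => simp [sweep, tr, ih]

theorem step_pass {q q' : Ctl C} {p : ℕ} {h : HeadMove} {a : Option Cell} (L : List Cell)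
    (h1 : start ws q (readBlock penc x p) = .pass (.inr (q', h, a))) :
    (machine hC ws).step (readBlock penc x) (moveBlock penc x) (mk hC ws q p L) =
      .inr (mk hC ws q' (moveBlock penc x p h) (L ++ a.toList)) :=
  step_inr (by rw [h1, sweep_pass]) rfl

end PowProg

/-! ### Effect of the sweeps on the cells. -/

namespace PowProg

variable {C K : ℕ}

theorem sweep_copy (L : List Cell) : ∃ L', sweep (.copy : Work C K) L = (.copy, L') ∧
    L'.map Cell.v0 = L.map Cell.v0 ∧ L'.map Cell.v = L.map Cell.v0 ∧
    L'.map Cell.x = L.map Cell.x := by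
  induction L with
  | nil => exact ⟨[], rfl, rfl, rfl, rfl⟩
  | cons c L ih =>
    obtain ⟨L', h, h0, h1, h2⟩ := ih
    exact ⟨_ :: L', by simp only [sweep, tr, h]; rfl, by simp [h0], by simp [h1], by simp [h2]⟩

theorem sweep_reset (L : List Cell) : ∃ L', sweep (.reset : Work C K) L = (.reset, L') ∧
    L'.map Cell.v0 = L.map Cell.v0 ∧ L'.map Cell.v = L.map Cell.v ∧
    L'.map Cell.x = List.replicate L.length false := by
  induction L with
  | nil => exact ⟨[], rfl, rfl, rfl, rfl⟩
  | cons c L ih =>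
    obtain ⟨L', h, h0, h1, h2⟩ := ih
    exact ⟨_ :: L', by simp only [sweep, tr, h]; rfl, by simp [h0], by simp [h1],
      by simp [h2, List.replicate_succ]⟩

theorem sweep_shift (d : Bool) (L : List Cell) :
    ∃ d' L', sweep (.shift d : Work C K) L = (.shift d', L') ∧
    L'.map Cell.v0 = L.map Cell.v0 ∧ L'.map Cell.v = L.map Cell.v ∧
    bitsNum (L'.map Cell.x) + 2 ^ L.length * d'.toNat = d.toNat + 2 * bitsNum (L.map Cell.x) := by
  induction L generalizing d with
  | nil => exact ⟨d, [], rfl, rfl, rfl, by simp⟩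
  | cons c L ih =>
    obtain ⟨d', L', h, h0, h1, h2⟩ := ih c.x
    refine ⟨d', _ :: L', by simp only [sweep, tr, h]; rfl, by simp [h0], by simp [h1], ?_⟩
    simp only [List.map_cons, bitsNum_cons, List.length_cons, pow_succ]
    linarith

/-- The borrow passes a digit 0 when subtracting and, as a carry, a digit 1 when adding. The third
flag reports whether the number was nonzero before the change. -/
theorem sweep_dec (neg b z : Bool) (L : List Cell) :
    ∃ b' L', sweep (.dec neg b z : Work C K) L =
      (.dec neg b' (z || decide (bitsNum (L.map Cell.x) ≠ 0)), L') ∧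
    L'.map Cell.v0 = L.map Cell.v0 ∧ L'.map Cell.v = L.map Cell.v ∧
    (neg = false → bitsNum (L'.map Cell.x) + b.toNat =
      bitsNum (L.map Cell.x) + 2 ^ L.length * b'.toNat) ∧
    (neg = true → bitsNum (L'.map Cell.x) + 2 ^ L.length * b'.toNat =
      bitsNum (L.map Cell.x) + b.toNat) := by
  induction L generalizing b z with
  | nil => exact ⟨b, [], by simp [sweep], rfl, rfl, by simp, by simp⟩
  | cons c L ih =>
    obtain ⟨b', L', h, h0, h1, h2, h3⟩ := ih (b && c.x == neg) (z || c.x)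
    refine ⟨b', ⟨c.act, c.cnt, c.v0, c.v, c.x ^^ b⟩ :: L', ?_, ?_, ?_, fun hn => ?_, fun hn => ?_⟩
    · simp only [sweep, tr, h]
      refine congrArg₂ Prod.mk (congrArg _ ?_) rfl
      cases hx : c.x <;> simp [hx]
    · simp [h0]
    · simp [h1]
    · subst hn
      have := h2 rfl
      simp only [List.map_cons, bitsNum_cons, List.length_cons, pow_succ]
      cases hx : c.x <;> cases b <;> simp [hx] at this ⊢ <;> linarith
    · subst hn
      have := h3 rfl
      simp only [List.map_cons, bitsNum_cons, List.length_cons, pow_succ]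
      cases hx : c.x <;> cases b <;> simp [hx] at this ⊢ <;> linarith

theorem sweep_app (w : Short K) (L : List Cell) :
    ∃ w' L', sweep (.app w : Work C K) L = (.app w', L') ∧
    L'.map Cell.v0 = L.map Cell.v0 ∧ L'.map Cell.v = Grig.wordPerm w.1 (L.map Cell.v) ∧
    L'.map Cell.x = L.map Cell.x := by
  induction L generalizing w with
  | nil => exact ⟨w, [], rfl, rfl, (Grig.wordPerm_apply_nil _).symm, rfl⟩
  | cons c L ih =>
    obtain ⟨w', L', h, h0, h1, h2⟩ := ih ⟨(Grig.stepWord w.1 c.v).1,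
      (Grig.length_stepWord w.1 c.v).trans w.2⟩
    refine ⟨w', _ :: L', by simp only [sweep, tr, h]; rfl, by simp [h0], ?_, by simp [h2]⟩
    simp [Grig.wordPerm_apply_cons, h1]

theorem sweep_cmp (e b : Bool) (L : List Cell) :
    ∃ b' L', sweep (.cmp e b : Work C K) L =
      (.cmp (e && decide (L.map Cell.v = L.map Cell.v0)) b', L') ∧
    bitsNum (L'.map Cell.v0) + 2 ^ L.length * b'.toNat = bitsNum (L.map Cell.v0) + b.toNat := by
  induction L generalizing e b with
  | nil => exact ⟨b, [], by simp [sweep], by simp⟩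
  | cons c L ih =>
    obtain ⟨b', L', h, h1⟩ := ih (e && c.v == c.v0) (b && c.v0)
    refine ⟨b', ⟨c.act, c.cnt, c.v0 ^^ b, c.v, c.x⟩ :: L', ?_, ?_⟩
    · simp only [sweep, tr, h]
      refine congrArg₂ Prod.mk (congrArg (fun z => Work.cmp z b') ?_) rfl
      by_cases hv : c.v = c.v0 <;> simp [hv]
    · simp only [List.map_cons, bitsNum_cons, List.length_cons, pow_succ]
      cases hx : c.v0 <;> cases b <;> simp [hx] at h1 ⊢ <;> linarith

variable {S : Type*} {hC : 0 < C} {ws : S → Short K} {k : ℕ} {penc : PowerSymbol S → Fin k → Bool}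

theorem start_bad (q : Ctl C) : start ws q .bad = fail := by
  rcases q with _ | ⟨⟨_ | _, _⟩, _⟩ | _ | _ | _ | _ | _ | _ <;> rfl

/-- The part of a configuration that matters after the preparation of the cells. -/
structure View (C : ℕ) where
  ctl : Ctl C
  pos : ℕ
  v0 : List Bool
  v : List Bool
  x : List Bool

/-- The machine goes from one view to another one on the input `z` with at most `B` cells. -/
def Arrow (hC : 0 < C) (ws : S → Short K) (penc : PowerSymbol S → Fin k → Bool)
    (z : List Bool) (B : ℕ) (a b : View C) : Prop :=
  ∀ L : List Cell, L.length ≤ B → L.map Cell.v0 = a.v0 → L.map Cell.v = a.v →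
    L.map Cell.x = a.x → ∃ L', L'.map Cell.v0 = b.v0 ∧ L'.map Cell.v = b.v ∧
      L'.map Cell.x = b.x ∧
      LeadsTo ((machine hC ws).step (readBlock penc z) (moveBlock penc z))
        (fun c => c.cells.length ≤ B) (mk hC ws a.ctl a.pos L) (mk hC ws b.ctl b.pos L')

variable {z : List Bool} {B : ℕ}

theorem Arrow.refl (a : View C) : Arrow hC ws penc z B a a :=
  fun L _ h0 h1 h2 => ⟨L, h0, h1, h2, .refl _⟩

theorem length_eq_of_map {L L' : List Cell} (h : L'.map Cell.v0 = L.map Cell.v0) :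
    L'.length = L.length := by
  simpa using congrArg List.length h

theorem Arrow.trans {a b c : View C} (h : Arrow hC ws penc z B a b)
    (h' : Arrow hC ws penc z B b c) (hl : b.v0.length = a.v0.length) :
    Arrow hC ws penc z B a c := by
  intro L hL h0 h1 h2
  obtain ⟨L', h0', h1', h2', h3⟩ := h L hL h0 h1 h2
  have : L'.length = L.length := by
    rw [← List.length_map Cell.v0, h0', hl, ← h0, List.length_map]
  obtain ⟨L'', h0'', h1'', h2'', h4⟩ := h' L' (by omega) h0' h1' h2'
  exact ⟨L'', h0'', h1'', h2'', h3.trans h4⟩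

theorem Arrow.of_step {q q' : Ctl C} {p : ℕ} {v0 v x v0' v' x' : List Bool} {h : HeadMove}
    (h' : ∀ L : List Cell, L.map Cell.v0 = v0 → L.map Cell.v = v → L.map Cell.x = x →
      ∃ w' L', sweep (start ws q (readBlock penc z p)) L = (w', L') ∧
        finish hC w' = .inr (q', h, none) ∧ L'.map Cell.v0 = v0' ∧ L'.map Cell.v = v' ∧
        L'.map Cell.x = x') :
    Arrow hC ws penc z B ⟨q, p, v0, v, x⟩ ⟨q', moveBlock penc z p h, v0', v', x'⟩ := by
  intro L hL h0 h1 h2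
  obtain ⟨w', L', h3, h4, h5, h6, h7⟩ := h' L h0 h1 h2
  refine ⟨L', h5, h6, h7, .single hL ?_⟩
  have := step_inr (penc := penc) (x := z) h3 h4
  simpa using this

theorem Arrow.goto {q q' : Ctl C} {p : ℕ} {h : HeadMove} (v0 v x : List Bool)
    (h' : start ws q (readBlock penc z p) = goto q' h) :
    Arrow hC ws penc z B ⟨q, p, v0, v, x⟩ ⟨q', moveBlock penc z p h, v0, v, x⟩ :=
  .of_step fun L h0 h1 h2 => ⟨_, L, by rw [h', PowProg.goto, sweep_pass], rfl, h0, h1, h2⟩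

theorem Arrow.copy {q : Ctl C} {p : ℕ} (v0 v x : List Bool)
    (h' : start ws q (readBlock penc z p) = .copy) :
    Arrow hC ws penc z B ⟨q, p, v0, v, x⟩ ⟨.seek, moveBlock penc z p .right, v0, v0, x⟩ :=
  .of_step fun L h0 h1 h2 => by
    obtain ⟨L', h3, h4, h5, h6⟩ := sweep_copy (C := C) (K := K) L
    exact ⟨_, L', by rw [h', h3], rfl, h4.trans h0, h5.trans h0, h6.trans h2⟩

theorem Arrow.reset {q : Ctl C} {p : ℕ} (v0 v x : List Bool)
    (h' : start ws q (readBlock penc z p) = .reset) :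
    Arrow hC ws penc z B ⟨q, p, v0, v, x⟩
      ⟨.toEnd, moveBlock penc z p .right, v0, v, List.replicate v0.length false⟩ :=
  .of_step fun L h0 h1 h2 => by
    obtain ⟨L', h3, h4, h5, h6⟩ := sweep_reset (C := C) (K := K) L
    exact ⟨_, L', by rw [h', h3], rfl, h4.trans h0, h5.trans h1, by simp [h6, ← h0]⟩

theorem Arrow.app {q : Ctl C} {p : ℕ} {w : Short K} (v0 v x : List Bool)
    (h' : start ws q (readBlock penc z p) = .app w) :
    Arrow hC ws penc z B ⟨q, p, v0, v, x⟩
      ⟨.work, moveBlock penc z p .right, v0, Grig.wordPerm w.1 v, x⟩ :=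
  .of_step fun L h0 h1 h2 => by
    obtain ⟨w', L', h3, h4, h5, h6⟩ := sweep_app (C := C) w L
    exact ⟨_, L', by rw [h', h3], rfl, h4.trans h0, by rw [h5, h1], h6.trans h2⟩

theorem map_x_eq_padBits (L : List Cell) (n : ℕ) (h : bitsNum (L.map Cell.x) = n) :
    L.map Cell.x = padBits L.length n := by
  rw [← h]
  simpa using (padBits_bitsNum (L.map Cell.x)).symm

theorem map_x_mod {L : List Cell} {n m d : ℕ} (h : bitsNum (L.map Cell.x) + 2 ^ n * d = m)
    (hn : L.length = n) : L.map Cell.x = padBits n (m % 2 ^ n) := by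
  subst hn
  apply map_x_eq_padBits
  have := bitsNum_lt (L.map Cell.x)
  rw [List.length_map] at this
  rw [← h, Nat.add_mul_mod_self_left, Nat.mod_eq_of_lt this]

theorem Arrow.shift {q : Ctl C} {p : ℕ} {d : Bool} (v0 v : List Bool) (n : ℕ)
    (hn : n < 2 ^ v0.length) (h' : start ws q (readBlock penc z p) = .shift d) :
    Arrow hC ws penc z B ⟨q, p, v0, v, padBits v0.length n⟩
      ⟨.work, moveBlock penc z p .left, v0, v,
        padBits v0.length ((d.toNat + 2 * n) % 2 ^ v0.length)⟩ :=
  .of_step fun L h0 h1 h2 => by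
    obtain ⟨d', L', h3, h4, h5, h6⟩ := sweep_shift (C := C) (K := K) d L
    have h7 : L.length = v0.length := by simp [← h0]
    refine ⟨_, L', by rw [h', h3], rfl, h4.trans h0, h5.trans h1, ?_⟩
    rw [h2, bitsNum_padBits hn, h7] at h6
    exact map_x_mod h6 ((length_eq_of_map h4).trans h7)

/-- The successor or the predecessor of a number, in `D` bits. -/
def nextNum (neg : Bool) (D n : ℕ) : ℕ := (if neg then n + 1 else n + 2 ^ D - 1) % 2 ^ D

theorem Arrow.dec {q : Ctl C} {p : ℕ} {neg : Bool} (v0 v : List Bool) (n : ℕ)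
    (hn : n < 2 ^ v0.length) (h' : start ws q (readBlock penc z p) = .dec neg true false) :
    Arrow hC ws penc z B ⟨q, p, v0, v, padBits v0.length n⟩
      ⟨if n = 0 then .seek else .back, moveBlock penc z p (if n = 0 then .right else .left), v0, v,
        padBits v0.length (nextNum neg v0.length n)⟩ :=
  .of_step fun L h0 h1 h2 => by
    obtain ⟨b', L', h3, h4, h5, h6, h6'⟩ := sweep_dec (C := C) (K := K) neg true false L
    have h7 : L.length = v0.length := by simp [← h0]
    have h8 : bitsNum (L.map Cell.x) = n := by rw [h2, bitsNum_padBits hn]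
    have h9 := (length_eq_of_map h4).trans h7
    refine ⟨_, L', by rw [h', h3], ?_, h4.trans h0, h5.trans h1, ?_⟩
    · rw [h8]
      by_cases hn0 : n = 0 <;> simp [hn0, finish]
    rw [h8, h7] at h6 h6'
    cases neg with
    | true => exact map_x_mod (h6' rfl) h9
    | false =>
      have h10 := h6 rfl
      have h11 : n + 2 ^ v0.length - 1 = bitsNum (L'.map Cell.x) + 2 ^ v0.length * (!b').toNat := by
        cases b' <;> simp at h10 ⊢ <;> omega
      exact map_x_mod h11.symm h9

end PowProg

/-! ### Evaluation of a power word at a vertex. -/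

namespace PowProg

variable {C K : ℕ} {S : Type*} {hC : 0 < C} {ws : S → Short K} {k : ℕ}
  {penc : PowerSymbol S → Fin k → Bool} {z : List Bool} {B : ℕ}

/-- The machine sees the symbols of `Y` on the input `z`. -/
structure Shows (penc : PowerSymbol S → Fin k → Bool) (z : List Bool) (Y : List (PowerSymbol S)) :
    Prop where
  sym : ∀ {p σ}, Y[p]? = some σ → readBlock penc z (p + 1) = .sym σ
  right : ∀ {p}, readBlock penc z (p + 1) = .rightEnd ↔ p = Y.length

theorem shows_encodeWord (hk : 0 < k) (hp : Function.Injective penc) (Y : List (PowerSymbol S)) :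
    Shows penc (encodeWord penc Y) Y where
  sym h := (readBlock_eq_sym_iff hk hp _ _ _).2 ((symAt_encodeWord hk hp _ _ _).2 h)
  right := by
    intro p
    rw [readBlock_eq_rightEnd_iff, length_encodeWord]
    exact ⟨fun h => Nat.eq_of_mul_eq_mul_left hk h, fun h => by rw [h]⟩

variable {Y : List (PowerSymbol S)}

theorem Shows.move_right (R : Shows penc z Y) {p : ℕ} (h : p ≤ Y.length) :
    moveBlock penc z p .right = p + 1 := by
  rw [moveBlock, if_neg]
  rcases p with _ | p
  · simp [readBlock]
  · rw [R.right]
    omega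

theorem Arrow.pass_right (R : Shows penc z Y) {q : Ctl C} {a m : ℕ} (v0 v x : List Bool)
    (hm : a + m ≤ Y.length)
    (h : ∀ i < m, start ws q (readBlock penc z (a + i + 1)) = PowProg.goto q .right) :
    Arrow hC ws penc z B ⟨q, a + 1, v0, v, x⟩ ⟨q, a + m + 1, v0, v, x⟩ := by
  induction m with
  | zero => exact .refl _
  | succ m ih =>
    have h1 := Arrow.goto (hC := hC) (B := B) v0 v x (h m (Nat.lt_succ_self _))
    rw [R.move_right (by omega)] at h1
    exact (ih (by omega) fun i hi => h i (by omega)).trans h1 rfl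

theorem Arrow.pass_left {q : Ctl C} {a m : ℕ} (v0 v x : List Bool)
    (h : ∀ i < m, start ws q (readBlock penc z (a + i + 1)) = PowProg.goto q .left) :
    Arrow hC ws penc z B ⟨q, a + m, v0, v, x⟩ ⟨q, a, v0, v, x⟩ := by
  induction m with
  | zero => exact .refl _
  | succ m ih =>
    have h1 := Arrow.goto (hC := hC) (B := B) v0 v x (h m (Nat.lt_succ_self _))
    exact h1.trans (ih fun i hi => h i (by omega)) rfl

variable {φ : S → Equiv.Perm (List Bool)}

/-- Reading from left to right applies the first letter first, whereas in a product the last factor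
acts first. The program therefore works with inverse letters and computes the inverse of the
product. -/
theorem Arrow.app_word (hφ : ∀ s, Grig.wordPerm (ws s).1 = (φ s)⁻¹) (R : Shows penc z Y) (u : List S)
    {a : ℕ} (v0 v x : List Bool)
    (h : ∀ (i : ℕ) (hi : i < u.length), Y[a + i]? = some (.letter u[i])) :
    Arrow hC ws penc z B ⟨.work, a + 1, v0, v, x⟩
      ⟨.work, a + u.length + 1, v0, ((u.map φ).prod)⁻¹ v, x⟩ := by
  induction u generalizing a v with
  | nil => exact .refl _
  | cons s u ih =>
    have h0 : Y[a]? = some (.letter s) := h 0 (by simp)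
    have h1 : start ws (.work : Ctl C) (readBlock penc z (a + 1)) = .app (ws s) := by
      rw [R.sym h0]
      rfl
    have h2 := Arrow.app (hC := hC) (B := B) v0 v x h1
    have h3 := ih (a := a + 1) (Grig.wordPerm (ws s).1 v) fun i hi => by
      have := h (i + 1) (by simpa using hi)
      rw [show a + 1 + i = a + (i + 1) by omega]
      exact this
    obtain ⟨h4, -⟩ := List.getElem?_eq_some_iff.1 h0
    rw [R.move_right (by omega)] at h2
    have h5 := h2.trans h3 rfl
    have e : a + 1 + u.length + 1 = a + (s :: u).length + 1 := by simp; omega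
    rw [e, hφ, ← Equiv.Perm.mul_apply, ← mul_inv_rev] at h5
    exact h5

/-- The factor `q` is written at the position `a`. -/
structure FactorAt (Y : List (PowerSymbol S)) (a : ℕ) (q : PowerFactor S) : Prop where
  base : ∀ (i : ℕ) (hi : i < q.base.length), Y[a + i]? = some (.letter q.base[i])
  sign : Y[a + q.base.length]? = some (.sign q.neg)
  digit : ∀ (i : ℕ) (hi : i < q.digits.length),
    Y[a + q.base.length + 1 + i]? = some (.digit q.digits[i])
  after : ∀ b, Y[a + q.base.length + 1 + q.digits.length]? ≠ some (.digit b)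
  before : a = 0 ∨ ∃ a', a = a' + 1 ∧ ∃ σ, Y[a']? = some σ ∧ ∀ s, σ ≠ .letter s
  le : a + q.base.length + 1 + q.digits.length ≤ Y.length

variable {a : ℕ} {q : PowerFactor S}

theorem nextNum_lt (neg : Bool) (D n : ℕ) : nextNum neg D n < 2 ^ D :=
  Nat.mod_lt _ (by positivity)

theorem Arrow.iteration (hφ : ∀ s, Grig.wordPerm (ws s).1 = (φ s)⁻¹) (R : Shows penc z Y)
    (F : FactorAt Y a q) (v0 v : List Bool) (n : ℕ) (hn : n < 2 ^ v0.length) (h0 : n ≠ 0) :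
    Arrow hC ws penc z B ⟨.work, a + q.base.length + 1, v0, v, padBits v0.length n⟩
      ⟨.work, a + q.base.length + 1, v0, ((q.base.map φ).prod)⁻¹ v,
        padBits v0.length (nextNum q.neg v0.length n)⟩ := by
  have h1 : start ws (.work : Ctl C) (readBlock penc z (a + q.base.length + 1)) =
      .dec q.neg true false := by
    rw [R.sym F.sign]
    rfl
  have h2 := Arrow.dec (hC := hC) (B := B) v0 v n hn h1
  rw [if_neg h0, if_neg h0] at h2
  have h3 := Arrow.pass_left (hC := hC) (ws := ws) (penc := penc) (z := z) (B := B) (q := .back)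
    (a := a) (m := q.base.length) v0 v (padBits v0.length (nextNum q.neg v0.length n))
    fun i hi => by
      rw [R.sym (F.base i hi)]
      rfl
  have h4 : start ws (.back : Ctl C) (readBlock penc z a) = PowProg.goto .work .right := by
    rcases F.before with rfl | ⟨a', rfl, σ, h5, h6⟩
    · rfl
    · rw [R.sym h5]
      rcases σ with s | b | d
      · exact absurd rfl (h6 s)
      · rfl
      · rfl
  have h5 := Arrow.goto (hC := hC) (B := B) v0 v (padBits v0.length (nextNum q.neg v0.length n)) h4
  have := F.le
  rw [R.move_right (by omega)] at h5
  exact ((h2.trans h3 rfl).trans h5 rfl).trans (.app_word hφ R q.base _ _ _ F.base) rfl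

/-- The number of iterations that remain. -/
def remaining (neg : Bool) (D n : ℕ) : ℕ := if neg then (2 ^ D - n) % 2 ^ D else n

theorem remaining_nextNum (neg : Bool) {D n : ℕ} (hn : n < 2 ^ D) (h0 : n ≠ 0) :
    remaining neg D n = remaining neg D (nextNum neg D n) + 1 := by
  cases neg
  · simp only [remaining, nextNum]
    have : n + 2 ^ D - 1 = n - 1 + 2 ^ D := by omega
    simp [this, Nat.mod_eq_of_lt (show n - 1 < 2 ^ D by omega)]
    omega
  · simp only [remaining, nextNum, if_true]
    rcases Nat.lt_or_ge (n + 1) (2 ^ D) with h | h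
    · rw [Nat.mod_eq_of_lt h, Nat.mod_eq_of_lt (by omega), Nat.mod_eq_of_lt (by omega)]
      omega
    · obtain h : n + 1 = 2 ^ D := by omega
      rw [h, Nat.mod_self, Nat.sub_zero, Nat.mod_self, Nat.mod_eq_of_lt (by omega)]
      omega

/-- Induction on the number of iterations left. The test precedes each passage over the base, so the
base is applied exactly `remaining` times. -/
theorem Arrow.loop (hφ : ∀ s, Grig.wordPerm (ws s).1 = (φ s)⁻¹) (R : Shows penc z Y)
    (F : FactorAt Y a q) (v0 v : List Bool) (n : ℕ) (hn : n < 2 ^ v0.length) :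
    ∃ x, Arrow hC ws penc z B ⟨.work, a + q.base.length + 1, v0, v, padBits v0.length n⟩
      ⟨.seek, a + q.base.length + 1 + 1, v0,
        (((q.base.map φ).prod)⁻¹ ^ remaining q.neg v0.length n) v, x⟩ := by
  induction hr : remaining q.neg v0.length n generalizing n v with
  | zero =>
    have h0 : n = 0 := by
      by_contra h0
      rw [remaining_nextNum _ hn h0] at hr
      omega
    subst h0
    have h1 : start ws (.work : Ctl C) (readBlock penc z (a + q.base.length + 1)) =
        .dec q.neg true false := by
      rw [R.sym F.sign]
      rfl
    have h2 := Arrow.dec (hC := hC) (B := B) v0 v 0 hn h1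
    have := F.le
    rw [if_pos rfl, if_pos rfl, R.move_right (by omega)] at h2
    exact ⟨_, h2⟩
  | succ r ih =>
    have h0 : n ≠ 0 := by
      rintro rfl
      simp [remaining] at hr
    have h1 := Arrow.iteration (hC := hC) (B := B) hφ R F v0 v n hn h0
    obtain ⟨x, h2⟩ := ih (((q.base.map φ).prod)⁻¹ v) (nextNum q.neg v0.length n)
      (nextNum_lt _ _ _) (by rw [remaining_nextNum _ hn h0] at hr; omega)
    refine ⟨x, ?_⟩
    rw [pow_succ, Equiv.Perm.mul_apply]
    exact h1.trans h2 rfl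

/-- The least significant digit comes first, so walking leftwards over the digits is Horner's rule.
Overflow is dropped, which amounts to computing modulo $2^D$. -/
theorem Arrow.horner (R : Shows penc z Y) (F : FactorAt Y a q) (v0 v : List Bool) (i : ℕ)
    (hi : i ≤ q.digits.length) :
    Arrow hC ws penc z B
      ⟨.work, a + q.base.length + 1 + i, v0, v,
        padBits v0.length (bitsNum (q.digits.drop i) % 2 ^ v0.length)⟩
      ⟨.work, a + q.base.length + 1, v0, v,
        padBits v0.length (q.absExponent % 2 ^ v0.length)⟩ := by
  induction i with
  | zero => exact .refl _
  | succ i ih =>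
    have h1 : start ws (.work : Ctl C) (readBlock penc z (a + q.base.length + 1 + i + 1)) =
        .shift q.digits[i] := by
      rw [R.sym (F.digit i hi)]
      rfl
    have h2 := Arrow.shift (hC := hC) (B := B) v0 v
      (bitsNum (q.digits.drop (i + 1)) % 2 ^ v0.length) (Nat.mod_lt _ (by positivity)) h1
    have e : (q.digits[i].toNat + 2 * (bitsNum (q.digits.drop (i + 1)) % 2 ^ v0.length)) %
        2 ^ v0.length = bitsNum (q.digits.drop i) % 2 ^ v0.length := by
      rw [List.drop_eq_getElem_cons (show i < q.digits.length by omega), bitsNum_cons]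
      exact (Nat.ModEq.add_left _ ((Nat.mod_modEq _ _).mul_left 2))
    rw [e] at h2
    exact h2.trans (ih (by omega)) rfl

/-- For a negative exponent the counter runs from $n$ up to $2^D$, that is through $2^D-n$
iterations, and $g^{-(2^D-n)}=g^n$ because $g^{2^D}=1$. No inverse words for the bases are needed.
-/
theorem zpow_inv_eq {G : Type*} [Group G] (g : G) (D : ℕ) (q : PowerFactor S)
    (hg : g ^ 2 ^ D = 1) :
    g⁻¹ ^ remaining q.neg D (q.absExponent % 2 ^ D) = (g ^ q.exponent)⁻¹ := by
  have h1 : g ^ q.absExponent = g ^ (q.absExponent % 2 ^ D) := pow_eq_pow_mod _ hg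
  rw [PowerFactor.exponent, remaining]
  cases q.neg
  · simp [h1]
  · have h2 := pow_eq_pow_mod (2 ^ D - q.absExponent % 2 ^ D) hg
    simp only [if_true, zpow_neg, inv_inv, zpow_natCast, inv_pow, ← h2, h1]
    rw [inv_eq_iff_mul_eq_one, ← pow_add, ← hg]
    congr 1
    have : q.absExponent % 2 ^ D < 2 ^ D := Nat.mod_lt _ (by positivity)
    omega

theorem Arrow.factor (hφ : ∀ s, Grig.wordPerm (ws s).1 = (φ s)⁻¹) (R : Shows penc z Y)
    (F : FactorAt Y a q) (v0 v x : List Bool)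
    (hg : ((q.base.map φ).prod) ^ 2 ^ v0.length = 1) :
    ∃ x', Arrow hC ws penc z B ⟨.seek, a + 1, v0, v, x⟩
      ⟨.seek, a + q.base.length + 1 + q.digits.length + 1, v0,
        (((q.base.map φ).prod) ^ q.exponent)⁻¹ v, x'⟩ := by
  have hle := F.le
  have h1 : Arrow hC ws penc z B ⟨.seek, a + 1, v0, v, x⟩ ⟨.seek, a + q.base.length + 1, v0, v, x⟩ :=
    .pass_right R _ _ _ (by omega) fun i hi => by
      rw [R.sym (F.base i hi)]
      rfl
  have h2 : start ws (.seek : Ctl C) (readBlock penc z (a + q.base.length + 1)) = .reset := by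
    rw [R.sym F.sign]
    rfl
  have h3 := Arrow.reset (hC := hC) (B := B) v0 v x h2
  rw [R.move_right (by omega)] at h3
  have h4 : Arrow hC ws penc z B
      ⟨.toEnd, a + q.base.length + 1 + 1, v0, v, List.replicate v0.length false⟩
      ⟨.toEnd, a + q.base.length + 1 + q.digits.length + 1, v0, v,
        List.replicate v0.length false⟩ :=
    .pass_right R _ _ _ F.le fun i hi => by
      rw [R.sym (F.digit i hi)]
      rfl
  have h5 : start ws (.toEnd : Ctl C) (readBlock penc z
      (a + q.base.length + 1 + q.digits.length + 1)) = PowProg.goto .work .left := by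
    rcases hσ : Y[a + q.base.length + 1 + q.digits.length]? with _ | σ
    · rw [R.right.2 (le_antisymm hle (by simpa using hσ))]
      rfl
    · rw [R.sym hσ]
      rcases σ with s | b | d
      · rfl
      · rfl
      · exact absurd hσ (F.after d)
  have h6 := Arrow.goto (hC := hC) (B := B) v0 v (List.replicate v0.length false) h5
  have h7 := Arrow.horner (hC := hC) (ws := ws) (B := B) R F v0 v _ le_rfl
  have e : padBits v0.length (bitsNum (q.digits.drop q.digits.length) % 2 ^ v0.length) =
      List.replicate v0.length false := by
    have h0 : ∀ n, bitsNum (List.replicate n false) = 0 := by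
      intro n
      induction n with
      | zero => rfl
      | succ n ih => simp [List.replicate_succ, ih]
    have := padBits_bitsNum (List.replicate v0.length false)
    rw [h0, List.length_replicate] at this
    simpa using this
  rw [e] at h7
  obtain ⟨x1, h8⟩ := Arrow.loop (hC := hC) (B := B) hφ R F v0 v
    (q.absExponent % 2 ^ v0.length) (Nat.mod_lt _ (by positivity))
  rw [zpow_inv_eq _ _ _ hg] at h8
  refine ⟨x1, ?_⟩
  refine ((((((h1.trans h3 rfl).trans h4 rfl).trans h6 rfl).trans h7 rfl).trans h8 rfl).trans ?_ rfl)
  exact .pass_right R _ _ _ hle fun i hi => by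
    rw [R.sym (F.digit i hi)]
    rfl

theorem factorAt (P₁ P₂ : List (PowerFactor S)) (q : PowerFactor S) :
    FactorAt (powerWordSymbols (P₁ ++ q :: P₂)) (powerWordSymbols P₁).length q := by
  rw [powerWordSymbols_append, powerWordSymbols_cons]
  refine ⟨fun i hi => q.getElem?_base _ _ hi, q.getElem?_sign _ _,
    fun i hi => q.getElem?_digit _ _ hi, fun b => ?_, ?_, ?_⟩
  · rw [q.getElem?_after]
    exact powerWordSymbols_head P₂ b
  · rcases h : powerWordSymbols P₁ with _ | ⟨σ, Y⟩
    · exact .inl rfl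
    · refine .inr ⟨Y.length, rfl, (σ :: Y)[Y.length], ?_, fun s hs => ?_⟩
      · rw [List.getElem?_append_left (by simp)]
        simp
      · refine powerWordSymbols_getLast P₁ s ?_
        rw [h, List.getLast?_eq_getElem?, ← hs]
        simp
  · simp only [List.length_append, q.length_symbols]
    omega

theorem Arrow.factors (hφ : ∀ s, Grig.wordPerm (ws s).1 = (φ s)⁻¹) (P₁ P₂ : List (PowerFactor S))
    (R : Shows penc z (powerWordSymbols (P₁ ++ P₂))) (v0 v x : List Bool)
    (hg : ∀ q ∈ P₂, ((q.base.map φ).prod) ^ 2 ^ v0.length = 1) :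
    ∃ x', Arrow hC ws penc z B ⟨.seek, (powerWordSymbols P₁).length + 1, v0, v, x⟩
      ⟨.seek, (powerWordSymbols (P₁ ++ P₂)).length + 1, v0, (powerWordValue φ P₂)⁻¹ v, x'⟩ := by
  induction P₂ generalizing P₁ v x with
  | nil => exact ⟨x, by simpa [powerWordValue] using Arrow.refl _⟩
  | cons q P ih =>
    obtain ⟨x1, h1⟩ := Arrow.factor (hC := hC) (B := B) hφ R (factorAt P₁ P q) v0 v x
      (hg q (by simp))
    have e : P₁ ++ q :: P = (P₁ ++ [q]) ++ P := by simp
    obtain ⟨x2, h2⟩ := ih (P₁ ++ [q]) (by rwa [← e]) ((((q.base.map φ).prod) ^ q.exponent)⁻¹ v) x1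
      fun q' hq' => hg q' (by simp [hq'])
    rw [← e] at h2
    refine ⟨x2, ?_⟩
    have e2 : (powerWordSymbols (P₁ ++ [q])).length + 1 =
        (powerWordSymbols P₁).length + q.base.length + 1 + q.digits.length + 1 := by
      rw [powerWordSymbols_append, powerWordSymbols_cons, List.length_append, List.length_append,
        q.length_symbols]
      simp [powerWordSymbols]
      omega
    rw [e2] at h2
    have e3 : (powerWordValue φ (q :: P))⁻¹ v =
        (powerWordValue φ P)⁻¹ ((((q.base.map φ).prod) ^ q.exponent)⁻¹ v) := by
      simp [powerWordValue, mul_inv_rev, Equiv.Perm.mul_apply]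
    rw [e3]
    exact h1.trans h2 rfl

end PowProg

namespace PowProg

variable {C K : ℕ} {S : Type*} {hC : 0 < C} {ws : S → Short K} {k : ℕ}
  {penc : PowerSymbol S → Fin k → Bool} {z : List Bool} {B : ℕ}

/-- The run of the machine on the input `z` that starts with `c` ends with `b` and never has more
than `B` cells. -/
abbrev Halts (hC : 0 < C) (ws : S → Short K) (penc : PowerSymbol S → Fin k → Bool)
    (z : List Bool) (B : ℕ) (b : Bool) (c : (machine hC ws).Cfg) : Prop :=
  HaltsWithin ((machine hC ws).step (readBlock penc z) (moveBlock penc z))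
    (fun c => c.cells.length ≤ B) b c

/-! ### The rounds -/

theorem bitsNum_injective {V W : List Bool} (hl : V.length = W.length)
    (h : bitsNum V = bitsNum W) : V = W := by
  rw [← padBits_bitsNum V, ← padBits_bitsNum W, hl, h]

/-- Induction on the number of vertices that have not been tested. The answer is determined by the
vertices with number at least that of `v0`. -/
theorem halts_begin {φ : S → Equiv.Perm (List Bool)}
    (hφ : ∀ s, Grig.wordPerm (ws s).1 = (φ s)⁻¹) (P : List (PowerFactor S))
    (R : Shows penc z (powerWordSymbols P)) {D : ℕ} (hD : D ≤ B)
    (hg : ∀ q ∈ P, ((q.base.map φ).prod) ^ 2 ^ D = 1) (L : List Cell) (hL : L.length = D) (p : ℕ)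
    (hp : p ≤ (powerWordSymbols P).length + 1) (b : Bool)
    (hb : b = true ↔ ∀ W : List Bool, W.length = D → bitsNum (L.map Cell.v0) ≤ bitsNum W →
      (powerWordValue φ P)⁻¹ W = W) :
    Halts hC ws penc z B b (mk hC ws .begin p L) := by
  induction hm : 2 ^ D - bitsNum (L.map Cell.v0) using Nat.strong_induction_on
    generalizing L p with
  | _ m ih =>
    subst hm
    have hlen : (L.map Cell.v0).length = D := by simp [hL]
    have h1 : Arrow hC ws penc z B ⟨.begin, 0 + p, L.map Cell.v0, L.map Cell.v, L.map Cell.x⟩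
        ⟨.begin, 0, L.map Cell.v0, L.map Cell.v, L.map Cell.x⟩ :=
      .pass_left _ _ _ fun i hi => by
        rcases hσ : (powerWordSymbols P)[0 + i]? with _ | σ
        · have : (powerWordSymbols P).length ≤ 0 + i := by simpa using hσ
          rw [R.right.2 (by omega)]
          rfl
        · rw [R.sym hσ]
          rfl
    rw [zero_add] at h1
    have h2 : Arrow hC ws penc z B ⟨.begin, 0, L.map Cell.v0, L.map Cell.v, L.map Cell.x⟩ _ :=
      .copy _ _ _ rfl
    rw [R.move_right (Nat.zero_le _)] at h2
    obtain ⟨x', h3⟩ := Arrow.factors (hC := hC) (B := B) hφ [] P R (L.map Cell.v0)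
      (L.map Cell.v0) (L.map Cell.x) (by rwa [hlen])
    obtain ⟨L', h4, h5, -, h6⟩ := ((h1.trans h2 rfl).trans h3 rfl) L (by omega) rfl rfl rfl
    refine h6.haltsWithin ?_
    simp only [List.nil_append] at h4 h5 ⊢
    have hL' : L'.length = D := (length_eq_of_map h4).trans hL
    have h7 : start ws (.seek : Ctl C) (readBlock penc z ((powerWordSymbols P).length + 1)) =
        .cmp true true := by
      rw [R.right.2 rfl]
      rfl
    obtain ⟨c', L'', h8, h9⟩ := sweep_cmp (C := C) (K := K) true true L'
    rw [h4, h5, Bool.true_and] at h8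
    rw [h4, hL'] at h9
    rw [← h7] at h8
    have hL'' : L''.length = D := by
      have := (machine hC ws).length_sweep (start ws (.seek : Ctl C)
        (readBlock penc z ((powerWordSymbols P).length + 1))) L'
      have e := (machine_sweep hC ws (start ws (.seek : Ctl C)
        (readBlock penc z ((powerWordSymbols P).length + 1))) L').trans h8
      exact (congrArg (fun w : Work C K × List Cell => w.2.length) e).symm.trans
        (this.trans hL')
    have h10 := bitsNum_lt (L.map Cell.v0)
    have h11 := bitsNum_lt (L''.map Cell.v0)
    rw [List.length_map] at h10 h11
    rw [hL] at h10
    rw [hL''] at h11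
    by_cases hfix : (powerWordValue φ P)⁻¹ (L.map Cell.v0) = L.map Cell.v0
    · rw [decide_eq_true hfix] at h8
      cases c' with
      -- The increment overflows, so `v0` was the last vertex of the level.
      | true =>
        simp only [Bool.toNat_true, mul_one] at h9
        have : b = true := hb.2 fun W hW hW' => by
          have h12 := bitsNum_lt W
          rw [hW] at h12
          have : W = L.map Cell.v0 := bitsNum_injective (by simp [hW, hL]) (by omega)
          rw [this, hfix]
        subst this
        exact .halt (hL'.trans_le hD) (step_inl (by rw [h8]; rfl))
      | false =>
        simp only [Bool.toNat_false, mul_zero, add_zero, Bool.toNat_true] at h9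
        refine .next (hL'.trans_le hD) (step_inr (h := .stay) (a := none) h8 rfl) ?_
        have h12 := ih _ (by omega) L'' hL'' ((powerWordSymbols P).length + 1) le_rfl
          (hb.trans ⟨fun h W hW hW' => h W hW (by omega), fun h W hW hW' => ?_⟩) rfl
        · rw [Option.toList_none, List.append_nil]
          exact h12
        · rcases Nat.lt_or_ge (bitsNum (L.map Cell.v0)) (bitsNum W) with h13 | h13
          · exact h W hW (by omega)
          · have : W = L.map Cell.v0 := bitsNum_injective (by simp [hW, hL]) (by omega)
            rw [this, hfix]
    · have : b = false := by
        rw [← Bool.not_eq_true, hb]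
        exact fun h => hfix (h _ hlen le_rfl)
      subst this
      rw [decide_eq_false hfix] at h8
      exact .halt (hL'.trans_le hD) (step_inl (by rw [h8]; rfl))

/-! ### The preparation of the cells -/

/-- The digits of the counter. -/
def counter (L : List Cell) : List Bool := (L.filter Cell.act).map Cell.cnt

theorem sweep_inc (b l : Bool) (L : List Cell) :
    ∃ b' L', sweep (.inc b l : Work C K) L = (.inc b' l, L') ∧
      L'.map Cell.v0 = L.map Cell.v0 ∧ (counter L').length = (counter L).length ∧
      bitsNum (counter L') + 2 ^ (counter L).length * b'.toNat =
        bitsNum (counter L) + b.toNat := by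
  induction L generalizing b with
  | nil => exact ⟨b, [], rfl, rfl, rfl, by simp [counter]⟩
  | cons c L ih =>
    obtain ⟨act, cnt, v0, v, x⟩ := c
    cases act with
    | false =>
      obtain ⟨b', L', h, h0, h1, h2⟩ := ih b
      exact ⟨b', ⟨false, cnt, v0, v, x⟩ :: L', by simp only [sweep, tr, h], by simp [h0],
        by simpa [counter] using h1, by simpa [counter] using h2⟩
    | true =>
      obtain ⟨b', L', h, h0, h1, h2⟩ := ih (b && cnt)
      refine ⟨b', ⟨true, cnt ^^ b, v0, v, x⟩ :: L', by simp only [sweep, tr, h], by simp [h0],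
        by simpa [counter] using h1, ?_⟩
      simp only [counter, List.filter_cons, if_true, List.map_cons, bitsNum_cons,
        List.length_cons, pow_succ] at h2 ⊢
      cases cnt <;> cases b <;> simp at h2 ⊢ <;> linarith

/-- The cells after `i` symbols have been read. -/
structure Counts (C i : ℕ) (L : List Cell) : Prop where
  num : bitsNum (counter L) = i
  len : (counter L).length = Nat.size i
  card : L.length = C * Nat.size i
  v0 : ∀ b ∈ L.map Cell.v0, b = false

theorem leadsTo_grow {p : ℕ} (hp : readBlock penc z p ≠ .bad) (i : ℕ) (hi : i < C) (l : Bool)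
    (L : List Cell) (hL : L.length + i ≤ B) :
    LeadsTo ((machine hC ws).step (readBlock penc z) (moveBlock penc z))
      (fun c => c.cells.length ≤ B) (mk hC ws (.grow ⟨i, hi⟩ l) p L)
      (mk hC ws (.scan (some l)) (moveBlock penc z p .right)
        (L ++ List.replicate i (freshCell false))) := by
  induction i generalizing L with
  | zero =>
    refine .single hL ?_
    have h1 : start ws (.grow ⟨0, hi⟩ l) (readBlock penc z p) =
        PowProg.goto (.scan (some l)) .right := by
      cases h : readBlock penc z p <;> first | rfl | exact absurd h hp
    simpa using step_pass (hC := hC) L h1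
  | succ i ih =>
    have h1 : start ws (.grow ⟨i + 1, hi⟩ l) (readBlock penc z p) =
        .pass (.inr (.grow ⟨i, by omega⟩ l, .stay, some (freshCell false))) := by
      cases h : readBlock penc z p <;> first | rfl | exact absurd h hp
    refine .head ((Nat.le_add_right _ _).trans hL) (step_pass (hC := hC) L h1) ?_
    have := ih (by omega) (L ++ [freshCell false]) (by simp; omega)
    rw [List.append_assoc, List.singleton_append, ← List.replicate_succ] at this
    exact this

theorem counter_append (L L' : List Cell) : counter (L ++ L') = counter L ++ counter L' := by
  simp [counter]

/-- When the increment overflows, the counter gets a new leading digit 1. Its active cell is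
accompanied by `C - 1` inactive ones, which keeps the number of cells at `C` times the length of the
counter. -/
theorem leadsTo_scan {i : ℕ} {p : Option Bool} {l : Bool} {σ : PowerSymbol S}
    (hr : readBlock penc z (i + 1) = .sym σ)
    (hs : start ws (.scan p : Ctl C) (.sym σ) = .inc true l) {L : List Cell} (hL : Counts C i L)
    (hB : C * Nat.size (i + 1) ≤ B) :
    ∃ L', Counts C (i + 1) L' ∧
      LeadsTo ((machine hC ws).step (readBlock penc z) (moveBlock penc z))
        (fun c => c.cells.length ≤ B) (mk hC ws (.scan p) (i + 1) L)
        (mk hC ws (.scan (some l)) (i + 2) L') := by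
  obtain ⟨b', L', h, h0, h1, h2⟩ := sweep_inc (C := C) (K := K) true l L
  have hlen := length_eq_of_map h0
  rw [← hs, ← hr] at h
  rw [hL.num, hL.len] at h2
  have hsize : Nat.size i ≤ Nat.size (i + 1) := Nat.size_le_size (Nat.le_succ i)
  have hle : L.length ≤ B := by
    rw [hL.card]
    exact (Nat.mul_le_mul_left C hsize).trans hB
  have hmv : moveBlock penc z (i + 1) .right = i + 2 := by
    rw [moveBlock, hr, if_neg (by simp)]
  have hlt := bitsNum_lt (counter L')
  rw [h1, hL.len] at hlt
  cases b' with
  | false =>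
    simp only [Bool.toNat_false, mul_zero, add_zero, Bool.toNat_true] at h2
    have e : Nat.size (i + 1) = Nat.size i :=
      le_antisymm (Nat.size_le.2 (h2 ▸ hlt)) hsize
    refine ⟨L', ⟨h2, by rw [h1, hL.len, e], by rw [hlen, hL.card, e], by rw [h0]; exact hL.v0⟩,
      .single hle ?_⟩
    have := step_inr (hC := hC) (ws := ws) (penc := penc) (x := z) (h := .right) (a := none)
      (q' := .scan (some l)) h rfl
    simpa [hmv] using this
  | true =>
    simp only [mul_one, Bool.toNat_true] at h2
    have h3 : i < 2 ^ Nat.size i := Nat.lt_size_self i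
    have h4 : i + 1 = 2 ^ Nat.size i := by omega
    have e : Nat.size (i + 1) = Nat.size i + 1 := by
      conv_lhs => rw [h4]
      exact Nat.size_pow
    have e3 : counter (List.replicate (C - 1) (freshCell false)) = [] := by
      simp [counter, freshCell]
    have e4 : counter [freshCell true] = [true] := rfl
    have h5 : L.length + 1 + (C - 1) = C * Nat.size (i + 1) := by
      rw [e, hL.card, Nat.mul_succ]
      omega
    refine ⟨L' ++ [freshCell true] ++ List.replicate (C - 1) (freshCell false), ⟨?_, ?_, ?_, ?_⟩,
      .head hle (step_inr (a := some (freshCell true)) h rfl) ?_⟩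
    · rw [counter_append, counter_append, e3, e4, List.append_nil, FmlCircuit.bitsNum_append, h1, hL.len]
      simp
      omega
    · rw [counter_append, counter_append, e3, e4, e]
      simp [h1, hL.len]
    · simp
      omega
    · intro b hb
      simp only [List.map_append, List.mem_append, List.map_replicate, List.map_cons,
        List.map_nil] at hb
      rcases hb with (hb | hb) | hb
      · exact hL.v0 b (h0 ▸ hb)
      · simpa [freshCell] using hb
      · exact (List.mem_replicate.1 hb).2
    · have := leadsTo_grow (hC := hC) (ws := ws) (penc := penc) (z := z) (B := B) (p := i + 1)
        (by rw [hr]; simp) (C - 1) (by omega) l (L' ++ [freshCell true]) (by simp; omega)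
      rw [hmv] at this
      exact this

/-- The first `i` symbols can be the beginning of a power word, and `p` tells whether the last
one of them is a letter. -/
structure Scanned (penc : PowerSymbol S → Fin k → Bool) (z : List Bool) (i : ℕ)
    (p : Option Bool) : Prop where
  sym : ∀ j < i, ∃ σ, SymAt penc z j σ
  zero : 0 < i → ¬ DigitAt penc z 0
  next : ∀ j, j + 1 < i → LetterAt penc z j → ¬ DigitAt penc z (j + 1)
  none : i = 0 → p = none
  last : ∀ j, i = j + 1 → (LetterAt penc z j ∧ p = some true) ∨ (¬ LetterAt penc z j ∧ p = some false)

theorem symAt_unique (hk : 0 < k) (hp : Function.Injective penc) {j : ℕ} {σ τ : PowerSymbol S}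
    (h : SymAt penc z j σ) (h' : SymAt penc z j τ) : σ = τ := by
  rw [← readBlock_eq_sym_iff hk hp] at h h'
  simpa [h] using h'

theorem Scanned.succ (hk : 0 < k) (hp : Function.Injective penc) {i : ℕ} {p : Option Bool}
    (h : Scanned penc z i p) {σ : PowerSymbol S} (hσ : SymAt penc z i σ) {l : Bool}
    (hs : start ws (.scan p : Ctl C) (.sym σ) = .inc true l) : Scanned penc z (i + 1) (some l) := by
  have hd : DigitAt penc z i → p = some false := by
    rintro ⟨b, hb⟩
    rw [symAt_unique hk hp hσ hb] at hs
    by_contra hne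
    simp [start, hne, fail] at hs
  have hl : (LetterAt penc z i ∧ l = true) ∨ (¬ LetterAt penc z i ∧ l = false) := by
    rcases σ with s | b | b
    · refine .inl ⟨⟨s, hσ⟩, ?_⟩
      simpa [start] using hs.symm
    · refine .inr ⟨?_, by simpa [start] using hs.symm⟩
      rintro ⟨s, hs'⟩
      cases symAt_unique hk hp hσ hs'
    · refine .inr ⟨?_, ?_⟩
      · rintro ⟨s, hs'⟩
        cases symAt_unique hk hp hσ hs'
      · rw [hd ⟨b, hσ⟩] at hs
        simpa [start] using hs.symm
  refine ⟨fun j hj => ?_, fun _ h0 => ?_, fun j hj hj' hj'' => ?_, by simp, fun j hj => ?_⟩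
  · rcases Nat.lt_succ_iff_lt_or_eq.1 hj with hj | rfl
    · exact h.sym j hj
    · exact ⟨σ, hσ⟩
  · rcases Nat.eq_zero_or_pos i with rfl | hi
    · have := hd h0
      rw [h.none rfl] at this
      cases this
    · exact h.zero hi h0
  · rcases Nat.lt_succ_iff_lt_or_eq.1 hj with hj | rfl
    · exact h.next j hj hj' hj''
    · rcases h.last j rfl with ⟨-, h1⟩ | ⟨h1, -⟩
      · have := hd hj''
        rw [h1] at this
        cases this
      · exact h1 hj'
  · cases hj
    simpa using hl

/-- Each failure of the scan witnesses a violated clause of `ValidInput`, and a complete scan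
establishes all of them. -/
theorem halts_scan (hk : 0 < k) (hp : Function.Injective penc) {b : Bool}
    (hB : ∀ i, k * i ≤ z.length → C * Nat.size i ≤ B) (hb : b = true → ValidInput penc z)
    (H : ValidInput penc z → ∀ L N, k * N = z.length → Counts C N L →
      Halts hC ws penc z B b (mk hC ws .begin (N + 1) L))
    (i : ℕ) (hi : k * i ≤ z.length) (p : Option Bool) (hs : Scanned penc z i p) (L : List Cell)
    (hL : Counts C i L) : Halts hC ws penc z B b (mk hC ws (.scan p) (i + 1) L) := by
  induction hm : z.length - k * i using Nat.strong_induction_on generalizing i p L with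
  | _ m ih =>
    subst hm
    have hle : L.length ≤ B := by
      rw [hL.card]
      exact hB i hi
    have hfail (h1 : start ws (.scan p : Ctl C) (readBlock penc z (i + 1)) = fail)
        (h2 : ¬ ValidInput penc z) : Halts hC ws penc z B b (mk hC ws (.scan p) (i + 1) L) := by
      have : b = false := by
        rw [← Bool.not_eq_true]
        exact fun h => h2 (hb h)
      subst this
      refine .halt hle (step_inl ?_)
      rw [h1, fail, sweep_pass]
      rfl
    rcases h : readBlock penc z (i + 1) with _ | _ | _ | σ
    · exfalso
      rw [readBlock] at h
      split at h
      · cases h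
      · split at h
        · rw [decodeBlock] at h
          split at h <;> cases h
        · cases h
    · have h1 := (readBlock_eq_rightEnd_iff (penc := penc) z i).1 h
      by_cases hp' : p = some true
      · refine hfail (by rw [h, hp']; rfl) fun hv => ?_
        rcases i with _ | j
        · rw [hs.none rfl] at hp'
          cases hp'
        · rcases hs.last j rfl with ⟨h2, -⟩ | ⟨-, h2⟩
          · have := ((hv j (by rw [← h1]; exact Nat.mul_lt_mul_of_pos_left (Nat.lt_succ_self j) hk)).2.2 h2).1
            omega
          · rw [h2] at hp'
            cases hp'
      · have hv : ValidInput penc z := by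
          intro j hj
          rw [← h1, Nat.mul_lt_mul_left hk] at hj
          refine ⟨hs.sym j hj, ?_, fun h2 => ?_⟩
          · rintro rfl
            exact hs.zero hj
          · have h3 : j + 1 < i := by
              by_contra h3
              obtain rfl : i = j + 1 := by omega
              rcases hs.last j rfl with ⟨-, h4⟩ | ⟨h4, -⟩
              · exact hp' h4
              · exact h4 h2
            refine ⟨?_, hs.next j h3 h2⟩
            rw [← h1]
            exact Nat.mul_lt_mul_of_pos_left h3 hk
        have h2 : start ws (.scan p : Ctl C) (readBlock penc z (i + 1)) =
            PowProg.goto .begin .stay := by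
          rw [h]
          exact if_neg hp'
        refine .next hle (step_pass L h2) ?_
        rw [Option.toList_none, List.append_nil]
        exact H hv L i h1 hL
    · refine hfail (by rw [h, start_bad]) fun hv => ?_
      have h1 : k * i ≠ z.length := fun h1 => by
        rw [(readBlock_eq_rightEnd_iff (penc := penc) z i).2 h1] at h
        cases h
      obtain ⟨σ, hσ⟩ := (hv i (by omega)).1
      rw [(readBlock_eq_sym_iff hk hp z i σ).2 hσ] at h
      cases h
    · have hσ := (readBlock_eq_sym_iff hk hp z i σ).1 h
      have hi' : k * (i + 1) ≤ z.length := hσ.1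
      have step {l : Bool} (h1 : start ws (.scan p : Ctl C) (.sym σ) = .inc true l) :
          Halts hC ws penc z B b (mk hC ws (.scan p) (i + 1) L) := by
        obtain ⟨L', h2, h3⟩ := leadsTo_scan (hC := hC) h h1 hL (hB _ hi')
        refine h3.haltsWithin (ih _ ?_ (i + 1) hi' _ (hs.succ hk hp hσ h1) L' h2 rfl)
        rw [Nat.mul_succ] at hi' ⊢
        omega
      rcases σ with s | d | d
      · exact step (l := true) rfl
      · exact step (l := false) rfl
      · by_cases hp' : p = some false
        · exact step (l := false) (if_pos hp')
        · refine hfail (by rw [h]; exact if_neg hp') fun hv => ?_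
          have h1 := hv i (by rw [Nat.mul_succ] at hi'; omega)
          rcases i with _ | j
          · exact h1.2.1 rfl ⟨d, hσ⟩
          · rcases hs.last j rfl with ⟨h2, -⟩ | ⟨-, h2⟩
            · refine ((hv j ?_).2.2 h2).2 ⟨d, hσ⟩
              rw [Nat.mul_succ] at hi
              omega
            · exact hp' h2

theorem halts_init (hk : 0 < k) (hp : Function.Injective penc) {b : Bool}
    (hB : ∀ i, k * i ≤ z.length → C * Nat.size i ≤ B) (hb : b = true → ValidInput penc z)
    (H : ValidInput penc z → ∀ L N, k * N = z.length → Counts C N L →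
      Halts hC ws penc z B b (mk hC ws .begin (N + 1) L)) :
    Halts hC ws penc z B b (mk hC ws .init 0 []) := by
  have h1 : start ws (.init : Ctl C) (readBlock penc z 0) = PowProg.goto (.scan none) .right := rfl
  refine .next (Nat.zero_le _) (step_pass [] h1) ?_
  have h2 : moveBlock penc z 0 .right = 0 + 1 := by
    rw [moveBlock, if_neg (by simp [readBlock])]
  rw [h2]
  refine halts_scan hk hp hB hb H 0 (Nat.zero_le _) none ⟨?_, ?_, ?_, ?_, ?_⟩ [] ⟨?_, ?_, ?_, ?_⟩ <;>
    simp [counter]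

end PowProg

namespace PowProg

/-! ### The power word problem in logarithmic space -/

/-- The action of the Grigorchuk group on the vertices of the tree. -/
def permHom : grigorchukGroup →* Equiv.Perm (List Bool) :=
  MonoidHom.mk' (fun g => (g : BinaryTreeAut).toEquiv) fun _ _ => rfl

theorem permHom_apply (g : grigorchukGroup) (v : List Bool) :
    permHom g v = (g : BinaryTreeAut) v := rfl

theorem permHom_eq {g : grigorchukGroup} {w : List GrigGen}
    (h : (g : BinaryTreeAut) = (w.map GrigGen.toAut).prod) : permHom g = Grig.wordPerm w := by
  ext1 v
  rw [permHom_apply, h, Grig.coe_prod_toAut]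

theorem permHom_prefix (g : grigorchukGroup) {u v : List Bool} (h : u <+: v) :
    permHom g u <+: permHom g v :=
  (g : BinaryTreeAut).map_rel_iff.2 h

theorem powerWordValue_map {S G H : Type*} [Group G] [Group H] (f : G →* H) (val : S → G)
    (P : List (PowerFactor S)) :
    powerWordValue (fun s => f (val s)) P = f (powerWordValue val P) := by
  have h (u : List S) : (u.map fun s => f (val s)).prod = f (u.map val).prod := by
    rw [map_list_prod, List.map_map]
    rfl
  simp only [powerWordValue, map_list_prod, List.map_map, h]
  congr 2
  funext q
  exact (congrArg (· ^ q.exponent) (h q.base)).trans (map_zpow f _ _).symm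

theorem length_reducedWord_le {S : Type*} (M : ℕ) (hM : 0 < M) (P : List (PowerFactor S)) :
    (reducedWord M P).length ≤ (powerWordSymbols P).length * M := by
  induction P with
  | nil => simp [reducedWord]
  | cons q P ih =>
    have h1 : q.exponent % (M : ℤ) < M := Int.emod_lt_of_pos _ (by exact_mod_cast hM)
    have h2 : (q.exponent % (M : ℤ)).toNat ≤ M := by omega
    rw [powerWordSymbols_cons, List.length_append, add_mul, q.length_symbols]
    have h3 : (reducedWord M (q :: P)).length =
        (q.exponent % (M : ℤ)).toNat * q.base.length + (reducedWord M P).length := by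
      simp [reducedWord]
    rw [h3]
    refine Nat.add_le_add ?_ ih
    rw [mul_comm]
    exact Nat.mul_le_mul (by omega) h2

theorem length_base_le {S : Type*} {P : List (PowerFactor S)} {q : PowerFactor S} (h : q ∈ P) :
    q.base.length ≤ (powerWordSymbols P).length := by
  obtain ⟨P₁, P₂, rfl⟩ := List.append_of_mem h
  rw [powerWordSymbols_append, powerWordSymbols_cons, List.length_append, List.length_append,
    q.length_symbols]
  omega

/-- An element that fixes a level of the tree whose number is logarithmic is trivial. -/
theorem value_eq_one {S : Type*} {val : S → grigorchukGroup} {ws : S → List GrigGen} {c K : ℕ}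
    (hws : ∀ s, (val s : BinaryTreeAut) = ((ws s).map GrigGen.toAut).prod)
    (hK : ∀ s, (ws s).length ≤ K)
    (hc : ∀ (u : List S) (m : ℕ), u.length ≤ m → (u.map val).prod ^ 2 ^ varBits c m = 1)
    {P : List (PowerFactor S)} {D : ℕ}
    (hD : 3 + (Nat.size K + Nat.size (powerWordSymbols P).length +
      varBits c (powerWordSymbols P).length) ≤ D)
    (h : ∀ W : List Bool, W.length = D → permHom (powerWordValue val P) W = W) :
    powerWordValue val P = 1 := by
  set N := (powerWordSymbols P).length
  set M := 2 ^ varBits c N with hM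
  have hM0 : 0 < M := by positivity
  have h1 := prod_reducedWord val M hM0 P fun q hq => hc q.base N (length_base_le hq)
  have h2 := coe_prod_flatMap hws (reducedWord M P)
  rw [h1] at h2
  have h3 := permHom_eq h2
  have h4 : Grig.countA ((reducedWord M P).flatMap ws) <
      2 ^ (Nat.size K + Nat.size N + varBits c N) := by
    refine (Grig.countA_le _).trans_lt ((length_flatMap_le hK _).trans_lt ?_)
    refine (Nat.mul_le_mul_left K (length_reducedWord_le M hM0 P)).trans_lt ?_
    rw [pow_add, pow_add, ← hM, ← mul_assoc]
    exact Nat.mul_lt_mul_of_pos_right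
      (Nat.mul_lt_mul'' (Nat.lt_size_self K) (Nat.lt_size_self N)) hM0
  have h5 := Grig.eq_one_of_level _ _ h4 fun v hv => by
    rw [← h3]
    -- A vertex on a smaller level is fixed because one of its descendants on level `D` is.
    have h6 := permHom_prefix (powerWordValue val P)
      (List.prefix_append v (List.replicate (D - v.length) false))
    rw [h (v ++ List.replicate (D - v.length) false) (by simp; omega)] at h6
    refine (List.prefix_of_prefix_length_le h6 (List.prefix_append _ _) ?_).eq_of_length ?_
    · rw [h3, Grig.length_wordPerm]
    · rw [h3, Grig.length_wordPerm]
  apply Subtype.ext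
  rw [h2]
  exact (Grig.prod_toAut_eq_iff _ []).2 h5

theorem inLogspace {S : Type*} [Finite S] (val : S → grigorchukGroup) {k : ℕ} (hk : 0 < k)
    (penc : PowerSymbol S → Fin k → Bool) (hp : Function.Injective penc) :
    InLogspace (PowerWordProblem val penc) := by
  classical
  obtain ⟨c, hc⟩ := exists_pow_eq_one val
  obtain ⟨ws, K, hws, hK⟩ := exists_words val
  let inv : S → Short K := fun s => ⟨(ws s).reverse, by simpa using hK s⟩
  let φ : S → Equiv.Perm (List Bool) := fun s => permHom (val s)
  have hφ : ∀ s, Grig.wordPerm (inv s).1 = (φ s)⁻¹ := fun s => by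
    rw [Grig.wordPerm_reverse, ← permHom_eq (hws s)]
  -- The constant makes $C\,\mathrm{size}(N)$, for $N\ge1$, at least the depth required by
  -- `value_eq_one`; in particular $2^D$ annihilates the bases.
  have hC : 0 < 2 * c + Nat.size K + 4 := by omega
  set C := 2 * c + Nat.size K + 4 with hCdef
  refine (machine hC inv).inLogspace_of_blocks (penc := penc) hk (fun q L => ⟨false, ?_⟩) _ C
    fun x => ⟨decide (x ∈ PowerWordProblem val penc), decide_eq_true_iff, ?_⟩
  · have h1 := (machine_sweep hC inv (start inv q .bad) L).trans
      ((congrArg (sweep · L) (start_bad q)).trans (sweep_pass (K := K) (.inl false) L))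
    exact congrArg (fun w : Work C K × List Cell => finish hC w.1) h1
  refine halts_init (hC := hC) (ws := inv) (z := x) (B := C * (Nat.size x.length + 1)) hk hp
    (fun i hi => ?_) (fun h => ?_) fun hv L N hN hL => ?_
  · refine Nat.mul_le_mul_left C (le_trans (Nat.size_le_size ?_) (Nat.le_succ _))
    exact (Nat.le_mul_of_pos_left i hk).trans hi
  · obtain ⟨P, hP, -⟩ := of_decide_eq_true h
    exact (validInput_iff hk hp x).2 ⟨P, hP⟩
  · obtain ⟨P, rfl, hP⟩ : ∃ P, x = encodeWord penc (powerWordSymbols P) ∧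
        (x ∈ PowerWordProblem val penc ↔ powerWordValue val P = 1) := by
      by_cases h : x ∈ PowerWordProblem val penc
      · obtain ⟨P, h1, h2⟩ := h
        exact ⟨P, h1, fun _ => h2, fun _ => ⟨P, h1, h2⟩⟩
      · obtain ⟨P, h1⟩ := (validInput_iff hk hp x).1 hv
        exact ⟨P, h1, fun h2 => absurd h2 h, fun h2 => ⟨P, h1, h2⟩⟩
    rw [length_encodeWord] at hN
    obtain rfl := Nat.eq_of_mul_eq_mul_left hk hN
    set N := (powerWordSymbols P).length with hNdef
    have hbits (hN0 : 0 < N) : 3 + (Nat.size K + Nat.size N + varBits c N) ≤ C * Nat.size N := by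
      have h1 : 1 ≤ Nat.size N := Nat.size_pos.2 hN0
      rw [varBits, hCdef]
      nlinarith [Nat.zero_le c, Nat.zero_le (Nat.size K)]
    refine halts_begin (φ := φ) hφ P (shows_encodeWord hk hp _) (D := C * Nat.size N) ?_ ?_ L
      hL.card (N + 1) le_rfl _ ?_
    · refine Nat.mul_le_mul_left C (le_trans (Nat.size_le_size ?_) (Nat.le_succ _))
      rw [length_encodeWord]
      exact Nat.le_mul_of_pos_left N hk
    · intro q hq
      have h1 : 0 < N := by
        obtain ⟨P₁, P₂, rfl⟩ := List.append_of_mem hq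
        rw [hNdef, powerWordSymbols_append, powerWordSymbols_cons, List.length_append,
          List.length_append, q.length_symbols]
        omega
      have h2 : (q.base.map φ).prod = permHom (q.base.map val).prod := by
        rw [map_list_prod, List.map_map]
        rfl
      have h3 : varBits c N ≤ C * Nat.size N := by
        have := hbits h1
        omega
      obtain ⟨d, hd⟩ := pow_dvd_pow 2 h3
      rw [h2, ← map_pow, hd, pow_mul, hc _ _ (length_base_le hq), one_pow, map_one]
    · rw [decide_eq_true_iff, hP, powerWordValue_map permHom val P]
      constructor
      · intro h W _ _
        rw [h, map_one, inv_one]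
        rfl
      · intro h
        -- Without symbols there are no cells, but then the power word is empty and its value is 1.
        rcases Nat.eq_zero_or_pos N with h0 | h0
        · rcases P with _ | ⟨q, P⟩
          · rfl
          · rw [hNdef, powerWordSymbols_cons, List.length_append, q.length_symbols] at h0
            omega
        · refine value_eq_one hws hK hc (hbits h0) fun W hW => ?_
          have h1 : bitsNum (L.map Cell.v0) = 0 := by
            have := hL.v0
            generalize L.map Cell.v0 = V at this
            induction V with
            | nil => rfl
            | cons b V ih =>
              rw [bitsNum_cons, this b (by simp), ih fun b' hb' => this b' (by simp [hb'])]
              rfl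
          have h2 := h W hW (by omega)
          rw [Equiv.Perm.inv_eq_iff_eq] at h2
          exact h2.symm

end PowProg

/-- The group is nontrivial, since `a` moves a vertex. The letter found here marks invalid inputs in
the reduction. -/
theorem exists_val_ne_one {S : Type*} (val : S → grigorchukGroup)
    (hgen : Subgroup.closure (Set.range val) = ⊤) : ∃ z, val z ≠ 1 := by
  by_contra! h
  have h1 : Subgroup.closure (Set.range val) = ⊥ := by
    rw [Subgroup.closure_eq_bot_iff]
    rintro _ ⟨s, rfl⟩
    exact h s
  have h2 : (⟨GrigGen.a.toAut, Subgroup.subset_closure ⟨_, rfl⟩⟩ : grigorchukGroup) ∈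
      (⊥ : Subgroup grigorchukGroup) := by
    rw [← h1, hgen]
    trivial
  have h3 := congrArg (fun g : grigorchukGroup => (g : BinaryTreeAut) [false])
    (Subgroup.mem_bot.1 h2)
  cases h3

theorem mainTheorem8 {S : Type*} [Finite S] (val : S → grigorchukGroup)
    (hgen : Subgroup.closure (Set.range val) = ⊤)
    (hsymm : ∀ s, ∃ t, val t = (val s)⁻¹)
    {l k : ℕ} (enc : S → Fin l → Bool) (henc : Function.Injective enc)
    (penc : PowerSymbol S → Fin k → Bool) (hpenc : Function.Injective penc) :
    (∀ e : S, val e = 1 →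
      ∃ f : List Bool → List Bool,
        IsUniformAC0Reduction f (PowerWordProblem val penc) (WordProblem val enc) ∧
        ∃ (κ : ℕ → ℕ) (p : Polynomial ℕ), (∀ m, 2 ^ κ m ≤ p.eval m) ∧
          ∀ P : List (PowerFactor S), ∃ w : List S,
            f (encodeWord penc (powerWordSymbols P)) = encodeWord enc w ∧
            IsPadding e (reducedWord (2 ^ κ (maxBaseLength P)) P) w) ∧
    InLogspace (PowerWordProblem val penc) := by
  have hk : 0 < k := by
    by_contra hk
    obtain rfl : k = 0 := by omega
    cases hpenc (Subsingleton.elim (penc (.digit true)) (penc (.digit false)))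
  refine ⟨fun e he => ?_, PowProg.inLogspace val hk penc hpenc⟩
  obtain ⟨z, hz⟩ := exists_val_ne_one val hgen
  -- The letters `z` and `e` are distinct and need distinct codes.
  have hl : 0 < l := by
    by_contra hl
    obtain rfl : l = 0 := by omega
    obtain rfl := henc (Subsingleton.elim (enc z) (enc e))
    exact hz he
  exact exists_reduction val hl hk enc henc penc hpenc z hz e he
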